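/- Let $\mathcal{G}\rightrightarrows M$ be a (finite-dimensional, smooth) Lie groupoid over a Hausdorff second countable manifold $M$, with source $s$, target $t$, units $1_x$, and with source fibres of constant dimension; products $gh$ are defined when $s(g)=t(h)$. Let $A$ be its Lie algebroid: $A_x=\ker (ds)_{1_x}$, with anchor $\rho=dt$ and with the bracket of right-invariant vector fields. For a real vector space $V$ of dimension $r$ let $\mathcal{D}_V$ be the space of functions $\xi$ on the frames of $V$ with $\xi(e\cdot P)=|\det P|\,\xi(e)$ for $P\in GL_r$, and let $\mathcal{D}^{\mathrm{tr}}_A=\mathcal{D}_{A^*}\otimes\mathcal{D}_{TM}$. The groupoid acts on $\mathcal{D}^{\mathrm{tr}}_A$: for $g:x\to y$ the exact sequence $0\to A_y\to T_g\mathcal{G}\xrightarrow{ds}T_xM\to 0$ (given by right translation), the similar one at $g^{-1}$, and the differential of the inversion give $\mathcal{D}_{A_y}\otimes\mathcal{D}_{T_xM}\cong\mathcal{D}_{T_g\mathcal{G}}\cong \mathcal{D}_{T_{g^{-1}}\mathcal{G}}\cong\mathcal{D}_{A_x}\otimes\mathcal{D}_{T_yM}$, hence $g_*:\mathcal{D}^{\mathrm{tr}}_{A,x}\to\mathcal{D}^{\mathrm{tr}}_{A,y}$.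 Any Lie algebroid $A$ acts on $\mathcal{D}^{\mathrm{tr}}_A$ by $\nabla_\alpha=L_\alpha\otimes 1+1\otimes L_{\rho(\alpha)}$ (Lie derivatives). Let $H^1_{\mathrm{diff}}(\mathcal{G})$ be the space of smooth $c:\mathcal{G}\to\mathbb{R}$ with $c(gh)=c(g)+c(h)$ modulo the functions $g\mapsto f(s(g))-f(t(g))$ with $f\in C^\infty(M)$, and let $H^1(A)$ be the space of closed $A$-forms of degree one modulo the forms $\alpha\mapsto\rho(\alpha)f$. The Van Est map $VE:H^1_{\mathrm{diff}}(\mathcal{G})\to H^1(A)$ sends $[c]$ to the class of $\alpha_x\mapsto (dc)_{1_x}(\alpha_x)$. The modular class $\mathrm{mod}(\mathcal{G})\in H^1_{\mathrm{diff}}(\mathcal{G})$ is the class of $c_\sigma(g)=\ln\big(\sigma(y)/g_*\sigma(x)\big)$, $g:x\to y$, for any strictly positive smooth section $\sigma$ of $\mathcal{D}^{\mathrm{tr}}_A$. The modular class $\mathrm{mod}(A)\in H^1(A)$ of a Lie algebroid is the characteristic class of $\mathcal{D}^{\mathrm{tr}}_A$: the class of the form $c_\sigma$ with $\nabla_\alpha\sigma=c_\sigma(\alpha)\,\sigma$,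 for any nowhere vanishing smooth section $\sigma$ of $\mathcal{D}^{\mathrm{tr}}_A$. $\mathcal{G}$ is unimodular if $\mathrm{mod}(\mathcal{G})=0$, and proper if it is Hausdorff and $(s,t):\mathcal{G}\to M\times M$ is a proper map. Then $VE$, $\mathrm{mod}(\mathcal{G})$ and $\mathrm{mod}(A)$ are well defined, and $$VE(\mathrm{mod}(\mathcal{G}))=\mathrm{mod}(A).$$ In particular, if a Lie algebroid is integrable by a unimodular Lie groupoid (that is, if it is isomorphic to the Lie algebroid of one), then its modular class vanishes. Moreover, proper Lie groupoids are unimodular, so this applies to every Lie algebroid that is integrable by a proper Lie groupoid. -/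

import Mathlib

open scoped Manifold ContDiff TensorProduct Topology
open Module VectorField

/-! ## Densities on vector spaces -/

noncomputable section Densities

/-- The space `𝒟_V` of densities of a real vector space `V`, whose frames are indexed by the finite
type `ι`: the functions `ξ` on the frames of `V` such that `ξ (e · P) = |det P| ξ e`. Here
`e.det e'` is the determinant of the matrix `P` for which `e' = e · P`. -/
def Density (ι : Type*) [Fintype ι] [DecidableEq ι] (V : Type*) [AddCommGroup V] [Module ℝ V] :
    Submodule ℝ (Basis ι ℝ V → ℝ) where
  carrier := {ξ | ∀ e e' : Basis ι ℝ V, ξ e' = |e.det e'| * ξ e}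
  zero_mem' := by intro e e'; simp
  add_mem' := by
    intro ξ η hξ hη e e'
    simp only [Pi.add_apply, hξ e e', hη e e']
    ring
  smul_mem' := by
    intro c ξ hξ e e'
    simp only [Pi.smul_apply, hξ e e', smul_eq_mul]
    ring

/-- The fibre `𝒟_{A^*} ⊗ 𝒟_T` of the transverse density bundle, where `A` is a vector space of
dimension `r` (a fibre of an algebroid) and `T` one of dimension `n` (a tangent space of the
base). -/
abbrev TransverseDensity (r n : ℕ) (A T : Type*) [AddCommGroup A] [Module ℝ A]
    [AddCommGroup T] [Module ℝ T] : Type _ :=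
  Density (Fin r) (Module.Dual ℝ A) ⊗[ℝ] Density (Fin n) T

namespace TransverseDensity

variable {r n : ℕ} {A T : Type*} [AddCommGroup A] [Module ℝ A] [AddCommGroup T] [Module ℝ T]

/-- The value of a transverse density on a frame `a` of `A` and a frame `e` of `T`:
`(ξ ⊗ η)(a, e) = ξ(a^*) η(e)`, where `a^*` is the dual frame of `a`. -/
def eval (a : Basis (Fin r) ℝ A) (e : Basis (Fin n) ℝ T) : TransverseDensity r n A T →ₗ[ℝ] ℝ :=
  TensorProduct.lift
    (LinearMap.mk₂ ℝ
      (fun (ξ : Density (Fin r) (Module.Dual ℝ A)) (η : Density (Fin n) T) =>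
        ξ.1 a.dualBasis * η.1 e)
      (fun _ _ _ => by simp [add_mul]) (fun _ _ _ => by simp [mul_assoc])
      (fun _ _ _ => by simp [mul_add]) (fun _ _ _ => by simp [mul_left_comm]))

@[simp] theorem eval_tmul (a : Basis (Fin r) ℝ A) (e : Basis (Fin n) ℝ T)
    (ξ : Density (Fin r) (Module.Dual ℝ A)) (η : Density (Fin n) T) :
    eval a e (ξ ⊗ₜ[ℝ] η) = ξ.1 a.dualBasis * η.1 e := rfl

open Classical in
/-- The value of a transverse density on two tuples of vectors: as above if both of them are frames,
and zero otherwise. -/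
def evalTuple (a : Fin r → A) (e : Fin n → T) (τ : TransverseDensity r n A T) : ℝ :=
  if h : (∃ b : Basis (Fin r) ℝ A, ⇑b = a) ∧ ∃ c : Basis (Fin n) ℝ T, ⇑c = e then
    eval h.1.choose h.2.choose τ
  else 0

/-- A transverse density is strictly positive if its value on all frames is. -/
def IsPositive (τ : TransverseDensity r n A T) : Prop :=
  ∀ (a : Basis (Fin r) ℝ A) (e : Basis (Fin n) ℝ T), 0 < eval a e τ

end TransverseDensity

end Densities

/-! ## Lie algebroids: forms, cohomology in degree one and the modular class -/

noncomputable section Algebroids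

universe u v w

variable (E : Type u) [NormedAddCommGroup E] [NormedSpace ℝ E]
  (M : Type v) [TopologicalSpace M] [ChartedSpace E M] [IsManifold 𝓘(ℝ, E) ∞ M]

/-- The smooth real functions on a manifold. -/
abbrev IsSmoothFun {E : Type*} [NormedAddCommGroup E] [NormedSpace ℝ E] {M : Type*}
    [TopologicalSpace M] [ChartedSpace E M] (f : M → ℝ) : Prop :=
  ContMDiff 𝓘(ℝ, E) 𝓘(ℝ, ℝ) ∞ f

/-- The smooth vector fields on a manifold. -/
abbrev IsSmoothVectorField {E : Type*} [NormedAddCommGroup E] [NormedSpace ℝ E] {M : Type*}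
    [TopologicalSpace M] [ChartedSpace E M] [IsManifold 𝓘(ℝ, E) ∞ M]
    (X : Π x : M, TangentSpace 𝓘(ℝ, E) x) : Prop :=
  ContMDiff 𝓘(ℝ, E) (𝓘(ℝ, E).prod 𝓘(ℝ, E)) ∞ fun x => (⟨x, X x⟩ : TangentBundle 𝓘(ℝ, E) M)

/-- The data that underlie a Lie algebroid over `M`: the fibres, the smooth sections, the anchor and
the bracket of smooth sections. It carries no laws and serves only to write the constructions below
once; they are applied to `LieAlgebroid.toData` (a Lie algebroid with all its laws) and to
`LieGroupoid.lieAlgebroid` (the Lie algebroid that is constructed from a Lie groupoid). -/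
structure AlgebroidData where
  /-- the rank of the underlying vector bundle -/
  rank : ℕ
  Fiber : M → Type w
  [addCommGroup : ∀ x, AddCommGroup (Fiber x)]
  [module : ∀ x, Module ℝ (Fiber x)]
  IsSmooth : (Π x, Fiber x) → Prop
  anchor : ∀ x, Fiber x →ₗ[ℝ] TangentSpace 𝓘(ℝ, E) x
  bracket : {α // IsSmooth α} → {α // IsSmooth α} → Π x, Fiber x

attribute [instance] AlgebroidData.addCommGroup AlgebroidData.module

/-- A Lie algebroid structure on a smooth vector bundle `A → M` with typical fibre `F'`. -/
structure LieAlgebroid (F' : Type*) [NormedAddCommGroup F']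
    [NormedSpace ℝ F'] (A : M → Type w) [TopologicalSpace (Bundle.TotalSpace F' A)]
    [∀ x, TopologicalSpace (A x)] [∀ x, AddCommGroup (A x)] [∀ x, Module ℝ (A x)]
    [FiberBundle F' A] [VectorBundle ℝ F' A] [ContMDiffVectorBundle ∞ F' A 𝓘(ℝ, E)] where
  anchor : ∀ x, A x →ₗ[ℝ] TangentSpace 𝓘(ℝ, E) x
  /-- the anchor is a smooth map of vector bundles -/
  smooth_anchor : ∀ α : Cₛ^∞⟮𝓘(ℝ, E); F', A⟯, IsSmoothVectorField fun x => anchor x (α x)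
  bracket : Cₛ^∞⟮𝓘(ℝ, E); F', A⟯ → Cₛ^∞⟮𝓘(ℝ, E); F', A⟯ → Cₛ^∞⟮𝓘(ℝ, E); F', A⟯
  bracket_add : ∀ α β γ, bracket α (β + γ) = bracket α β + bracket α γ
  bracket_smul : ∀ (k : ℝ) α β, bracket α (k • β) = k • bracket α β
  bracket_skew : ∀ α β, bracket α β = -bracket β α
  jacobi : ∀ α β γ,
    bracket α (bracket β γ) = bracket (bracket α β) γ + bracket β (bracket α γ)
  /-- the Leibniz rule `[α, f β] = f [α, β] + (ρ(α) f) β` -/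
  leibniz : ∀ (f : M → ℝ), IsSmoothFun (E := E) f → ∀ α β γ : Cₛ^∞⟮𝓘(ℝ, E); F', A⟯,
    (∀ x, γ x = f x • β x) → ∀ x, bracket α γ x =
      f x • bracket α β x + mvfderiv 𝓘(ℝ, E) f x (anchor x (α x)) • β x

/-- The data that underlie a Lie algebroid. -/
def LieAlgebroid.toData {E M} [NormedAddCommGroup E] [NormedSpace ℝ E] [TopologicalSpace M]
    [ChartedSpace E M] [IsManifold 𝓘(ℝ, E) ∞ M] {F' : Type*}
    [NormedAddCommGroup F'] [NormedSpace ℝ F'] {A : M → Type w}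
    [TopologicalSpace (Bundle.TotalSpace F' A)]
    [∀ x, TopologicalSpace (A x)] [∀ x, AddCommGroup (A x)] [∀ x, Module ℝ (A x)]
    [FiberBundle F' A] [VectorBundle ℝ F' A] [ContMDiffVectorBundle ∞ F' A 𝓘(ℝ, E)]
    (L : LieAlgebroid E M F' A) : AlgebroidData.{u, v, w} E M where
  rank := finrank ℝ F'
  Fiber := A
  IsSmooth α := ContMDiff 𝓘(ℝ, E) (𝓘(ℝ, E).prod 𝓘(ℝ, F')) ∞
    fun x => (⟨x, α x⟩ : Bundle.TotalSpace F' A)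
  anchor := L.anchor
  bracket α β := L.bracket ⟨α.1, α.2⟩ ⟨β.1, β.2⟩

namespace AlgebroidData

variable {E M}

/-- An isomorphism of Lie algebroids over `M`: an isomorphism of smooth vector bundles that is
compatible with the anchors and with the brackets. -/
structure Iso (D D' : AlgebroidData E M) where
  toEquiv : ∀ x, D.Fiber x ≃ₗ[ℝ] D'.Fiber x
  smooth_iff : ∀ α : Π x, D.Fiber x, D.IsSmooth α ↔ D'.IsSmooth fun x => toEquiv x (α x)
  anchor_eq : ∀ x (a : D.Fiber x), D'.anchor x (toEquiv x a) = D.anchor x a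
  bracket_eq : ∀ (α β : {α // D.IsSmooth α}) (x : M), toEquiv x (D.bracket α β x) =
    D'.bracket ⟨fun x => toEquiv x (α.1 x), (smooth_iff α.1).1 α.2⟩
      ⟨fun x => toEquiv x (β.1 x), (smooth_iff β.1).1 β.2⟩ x

variable (D : AlgebroidData E M)

/-- The (not necessarily smooth) sections of the dual bundle `A^*`. -/
def DualSection : Type _ := Π x, D.Fiber x →ₗ[ℝ] ℝ

instance : AddCommGroup D.DualSection := inferInstanceAs (AddCommGroup (Π x, D.Fiber x →ₗ[ℝ] ℝ))

instance : Module ℝ D.DualSection := inferInstanceAs (Module ℝ (Π x, D.Fiber x →ₗ[ℝ] ℝ))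

theorem mvfderiv_const_smul_aux {E : Type*} [NormedAddCommGroup E] [NormedSpace ℝ E] {M : Type*}
    [TopologicalSpace M] [ChartedSpace E M] {f : M → ℝ} {x : M}
    (hf : MDifferentiableAt 𝓘(ℝ, E) 𝓘(ℝ, ℝ) f x) (k : ℝ) :
    mvfderiv 𝓘(ℝ, E) (k • f) x = k • mvfderiv 𝓘(ℝ, E) f x := by
  simp only [mvfderiv, const_smul_mfderiv hf]
  rfl

/-- The `A`-forms of degree one: the smooth sections of the dual bundle `A^*`. -/
def IsSmoothForm (θ : D.DualSection) : Prop :=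
  ∀ α, D.IsSmooth α → IsSmoothFun (E := E) fun x => θ x (α x)

/-- The closed `A`-forms of degree one: `θ([α, β]) = ρ(α)(θ(β)) - ρ(β)(θ(α))`. -/
def Z1 : Submodule ℝ D.DualSection where
  carrier := {θ | D.IsSmoothForm θ ∧ ∀ (α β : {α // D.IsSmooth α}) (x : M),
    θ x (D.bracket α β x) =
      mvfderiv 𝓘(ℝ, E) (fun y => θ y (β.1 y)) x (D.anchor x (α.1 x)) -
      mvfderiv 𝓘(ℝ, E) (fun y => θ y (α.1 y)) x (D.anchor x (β.1 x))}
  zero_mem' := by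
    have h0 : ∀ γ : Π x, D.Fiber x,
        (fun y => (0 : D.DualSection) y (γ y)) = fun _ => (0 : ℝ) := fun _ => rfl
    refine ⟨fun α _ => contMDiff_const, fun α β x => ?_⟩
    simp only [h0, mvfderiv_const]
    exact (sub_zero (0 : ℝ)).symm
  add_mem' := by
    rintro θ η ⟨hθ, hθ'⟩ ⟨hη, hη'⟩
    refine ⟨fun α hα => (hθ α hα).add (hη α hα), fun α β x => ?_⟩
    have key : ∀ γ : {γ // D.IsSmooth γ}, mvfderiv 𝓘(ℝ, E) (fun y => (θ + η) y (γ.1 y)) x =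
        mvfderiv 𝓘(ℝ, E) (fun y => θ y (γ.1 y)) x +
        mvfderiv 𝓘(ℝ, E) (fun y => η y (γ.1 y)) x := fun γ =>
      mvfderiv_add ((hθ γ.1 γ.2).mdifferentiable (by simp) x)
        ((hη γ.1 γ.2).mdifferentiable (by simp) x)
    have key' : (θ + η) x (D.bracket α β x) = θ x (D.bracket α β x) + η x (D.bracket α β x) := rfl
    rw [key, key, key', hθ', hη', _root_.add_apply, _root_.add_apply]
    ring
  smul_mem' := by
    rintro k θ ⟨hθ, hθ'⟩
    refine ⟨fun α hα => contMDiff_const.mul (hθ α hα), fun α β x => ?_⟩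
    have key : ∀ γ : {γ // D.IsSmooth γ}, mvfderiv 𝓘(ℝ, E) (fun y => (k • θ) y (γ.1 y)) x =
        k • mvfderiv 𝓘(ℝ, E) (fun y => θ y (γ.1 y)) x := fun γ =>
      mvfderiv_const_smul_aux ((hθ γ.1 γ.2).mdifferentiable (by simp) x) k
    have key' : (k • θ) x (D.bracket α β x) = k * θ x (D.bracket α β x) := rfl
    rw [key, key, key', hθ', _root_.smul_apply, _root_.smul_apply, smul_eq_mul, smul_eq_mul]
    ring

/-- The exact `A`-forms of degree one: the forms `α ↦ ρ(α) f` for a smooth function `f`. -/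
def B1 : Submodule ℝ D.DualSection where
  carrier := {θ | ∃ f : M → ℝ, IsSmoothFun (E := E) f ∧
    ∀ x a, θ x a = mvfderiv 𝓘(ℝ, E) f x (D.anchor x a)}
  zero_mem' := ⟨fun _ => 0, contMDiff_const, fun x a => by simp only [mvfderiv_const]; rfl⟩
  add_mem' := by
    rintro θ η ⟨f, hf, hθ⟩ ⟨g, hg, hη⟩
    refine ⟨f + g, hf.add hg, fun x a => ?_⟩
    rw [mvfderiv_add (hf.mdifferentiable (by simp) x) (hg.mdifferentiable (by simp) x),
      _root_.add_apply, ← hθ, ← hη]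
    rfl
  smul_mem' := by
    rintro k θ ⟨f, hf, hθ⟩
    refine ⟨k • f, contMDiff_const.mul hf, fun x a => ?_⟩
    rw [mvfderiv_const_smul_aux (hf.mdifferentiable (by simp) x), _root_.smul_apply, ← hθ]
    rfl

/-- The Lie algebroid cohomology `H^1(A)`. -/
abbrev H1 : Type _ := ↥D.Z1 ⧸ D.B1.submoduleOf D.Z1

/-- The cohomology class of a closed `A`-form of degree one. -/
def mkH1 : D.Z1 →ₗ[ℝ] D.H1 := (D.B1.submoduleOf D.Z1).mkQ

/-- The fibre at `x` of the transverse density bundle `𝒟_A^tr = 𝒟_{A^*} ⊗ 𝒟_{TM}`. -/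
abbrev Dtr (x : M) : Type _ :=
  TransverseDensity D.rank (finrank ℝ E) (D.Fiber x) (TangentSpace 𝓘(ℝ, E) x)

/-- The smooth sections of `𝒟_A^tr`: their values on smooth local frames are smooth. -/
def IsSmoothDtr (σ : Π x, D.Dtr x) : Prop :=
  ∀ (a : Fin D.rank → {α // D.IsSmooth α})
    (e : Fin (finrank ℝ E) → {X : Π x : M, TangentSpace 𝓘(ℝ, E) x // IsSmoothVectorField X})
    (x : M) (b : Basis (Fin D.rank) ℝ (D.Fiber x))
    (c : Basis (Fin (finrank ℝ E)) ℝ (TangentSpace 𝓘(ℝ, E) x)),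
    (∀ i, b i = (a i).1 x) → (∀ j, c j = (e j).1 x) →
    ContMDiffAt 𝓘(ℝ, E) 𝓘(ℝ, ℝ) ∞
      (fun y => (σ y).evalTuple (fun i => (a i).1 y) (fun j => (e j).1 y)) x

/-- `D.IsNabla α σ σ'` says that `σ' = ∇_α σ`, where `∇` is the canonical action of the Lie algebroid
on `𝒟_A^tr`: the action by Lie derivatives `L_α` on the factor `𝒟_{A^*}` and `L_{ρ(α)}` on the
factor `𝒟_{TM}`. On a local frame `a` of `A` and a local frame `e` of `TM` this reads
`(∇_α σ)(a, e) = ρ(α)(σ(a, e)) + (∑ i, a_i^*([α, a_i]) - ∑ j, e_j^*([ρ(α), e_j])) σ(a, e)`. -/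
def IsNabla (α : {α // D.IsSmooth α}) (σ σ' : Π x, D.Dtr x) : Prop :=
  ∀ (a : Fin D.rank → {α // D.IsSmooth α})
    (e : Fin (finrank ℝ E) → {X : Π x : M, TangentSpace 𝓘(ℝ, E) x // IsSmoothVectorField X})
    (x : M) (b : Basis (Fin D.rank) ℝ (D.Fiber x))
    (c : Basis (Fin (finrank ℝ E)) ℝ (TangentSpace 𝓘(ℝ, E) x)),
    (∀ i, b i = (a i).1 x) → (∀ j, c j = (e j).1 x) →
    TransverseDensity.eval b c (σ' x) =
      mvfderiv 𝓘(ℝ, E)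
        (fun y => (σ y).evalTuple (fun i => (a i).1 y) (fun j => (e j).1 y)) x
        (D.anchor x (α.1 x)) +
      ((∑ i, b.coord i (D.bracket α (a i) x)) -
        ∑ j, c.coord j (mlieBracket 𝓘(ℝ, E) (fun y => D.anchor y (α.1 y)) (e j).1 x)) *
        TransverseDensity.eval b c (σ x)

/-- `m ∈ H^1(A)` is the characteristic class of the representation `𝒟_A^tr` of `A`: there are
nowhere vanishing smooth sections `σ` of `𝒟_A^tr`, and for each of them `∇_α σ = c_σ(α) σ` for a
closed `A`-form `c_σ` of class `m`. -/
def IsModularClass (m : D.H1) : Prop :=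
  (∃ σ, D.IsSmoothDtr σ ∧ ∀ x, σ x ≠ 0) ∧
  ∀ σ, D.IsSmoothDtr σ → (∀ x, σ x ≠ 0) →
    ∃ c : D.Z1, (∀ α, D.IsNabla α σ fun x => c.1 x (α.1 x) • σ x) ∧ D.mkH1 c = m

open Classical in
/-- The modular class `mod(A)`: the characteristic class of `𝒟_A^tr`. -/
def modularClass : D.H1 := if h : ∃ m, D.IsModularClass m then h.choose else 0

end AlgebroidData

end Algebroids

/-! ## Lie groupoids -/

noncomputable section Groupoids

universe u v w z

variable (E : Type u) [NormedAddCommGroup E] [NormedSpace ℝ E]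
  (M : Type v) [TopologicalSpace M] [ChartedSpace E M] [IsManifold 𝓘(ℝ, E) ∞ M]
  (F : Type w) [NormedAddCommGroup F] [NormedSpace ℝ F]
  (𝒢 : Type z) [TopologicalSpace 𝒢] [ChartedSpace F 𝒢] [IsManifold 𝓘(ℝ, F) ∞ 𝒢]

/-- A Lie groupoid over `M` with manifold of arrows `𝒢`, which need be neither Hausdorff nor second
countable. The product `mul g h = gh` is the composition "first `h`, then `g`"; its value matters
only if `src g = tgt h`. -/
structure LieGroupoid where
  src : 𝒢 → M
  tgt : 𝒢 → M
  unit : M → 𝒢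
  inv : 𝒢 → 𝒢
  mul : 𝒢 → 𝒢 → 𝒢
  src_unit : ∀ x, src (unit x) = x
  tgt_unit : ∀ x, tgt (unit x) = x
  src_inv : ∀ g, src (inv g) = tgt g
  tgt_inv : ∀ g, tgt (inv g) = src g
  src_mul : ∀ g h, src g = tgt h → src (mul g h) = src h
  tgt_mul : ∀ g h, src g = tgt h → tgt (mul g h) = tgt g
  unit_mul : ∀ g, mul (unit (tgt g)) g = g
  mul_unit : ∀ g, mul g (unit (src g)) = g
  inv_mul : ∀ g, mul (inv g) g = unit (src g)
  mul_inv : ∀ g, mul g (inv g) = unit (tgt g)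
  mul_assoc : ∀ g h k, src g = tgt h → src h = tgt k → mul (mul g h) k = mul g (mul h k)
  isSubmersion_src : Manifold.IsSubmersion 𝓘(ℝ, F) 𝓘(ℝ, E) ∞ src
  contMDiff_tgt : ContMDiff 𝓘(ℝ, F) 𝓘(ℝ, E) ∞ tgt
  contMDiff_unit : ContMDiff 𝓘(ℝ, E) 𝓘(ℝ, F) ∞ unit
  contMDiff_inv : ContMDiff 𝓘(ℝ, F) 𝓘(ℝ, F) ∞ inv
  /-- the product is smooth on the submanifold of composable pairs -/
  contMDiffOn_mul : ContMDiffOn (𝓘(ℝ, F).prod 𝓘(ℝ, F)) 𝓘(ℝ, F) ∞ (fun p : 𝒢 × 𝒢 => mul p.1 p.2)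
    {p | src p.1 = tgt p.2}
  t2_fiber : ∀ x, T2Space (src ⁻¹' {x})

namespace LieGroupoid

variable {E M F 𝒢} (G : LieGroupoid E M F 𝒢)

/-- A Lie groupoid is proper if it is Hausdorff and `(s, t) : 𝒢 → M × M` is a proper map. -/
def IsProper : Prop := T2Space 𝒢 ∧ IsProperMap fun g => (G.src g, G.tgt g)

/-! ### The Lie algebroid of a Lie groupoid -/

/-- The fibre at `x` of the Lie algebroid: the kernel of `ds` at the unit `1_x`. -/
abbrev lieFiber (x : M) : Submodule ℝ (TangentSpace 𝓘(ℝ, F) (G.unit x)) :=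
  LinearMap.ker (mfderiv 𝓘(ℝ, F) 𝓘(ℝ, E) G.src (G.unit x)).toLinearMap

/-- The right translation `A_y → T_g 𝒢` by an arrow `g` with target `y`: the differential at `1_y`
of the map `h ↦ hg`, which is defined on the source fibre of `y`. -/
def rightTranslation (g : 𝒢) (y : M) (v : G.lieFiber y) : TangentSpace 𝓘(ℝ, F) g :=
  (mfderivWithin 𝓘(ℝ, F) 𝓘(ℝ, F) (fun h => G.mul h g) (G.src ⁻¹' {y}) (G.unit y) v.1 :
    TangentSpace 𝓘(ℝ, F) (G.mul (G.unit y) g))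

/-- The right-invariant vector field on `𝒢` that extends a section of the Lie algebroid. -/
def rightInvariant (α : Π x, G.lieFiber x) (g : 𝒢) : TangentSpace 𝓘(ℝ, F) g :=
  G.rightTranslation g (G.tgt g) (α (G.tgt g))

open Classical in
/-- The Lie algebroid of a Lie groupoid: `A_x` is the kernel of `ds` at `1_x`, the anchor is `dt`,
and the bracket is the one of right-invariant vector fields (for smooth sections `α`, `β` the bracket
of the right-invariant vector fields is tangent to the source fibres, so the second case in the
definition of the bracket does not occur). -/
def lieAlgebroid : AlgebroidData.{u, v, w} E M where
  rank := finrank ℝ F - finrank ℝ E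
  Fiber x := G.lieFiber x
  IsSmooth α := ContMDiff 𝓘(ℝ, E) (𝓘(ℝ, F).prod 𝓘(ℝ, F)) ∞
    fun x => (⟨G.unit x, (α x).1⟩ : TangentBundle 𝓘(ℝ, F) 𝒢)
  anchor x := ((mfderiv 𝓘(ℝ, F) 𝓘(ℝ, E) G.tgt (G.unit x)).toLinearMap ∘ₗ (G.lieFiber x).subtype :
    G.lieFiber x →ₗ[ℝ] TangentSpace 𝓘(ℝ, E) (G.tgt (G.unit x)))
  bracket α β x :=
    if h : mlieBracket 𝓘(ℝ, F) (G.rightInvariant α.1) (G.rightInvariant β.1) (G.unit x)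
        ∈ G.lieFiber x then
      ⟨mlieBracket 𝓘(ℝ, F) (G.rightInvariant α.1) (G.rightInvariant β.1) (G.unit x), h⟩
    else 0

/-- `A` is integrable by `G`: it is isomorphic to the Lie algebroid of `G`. -/
def Integrates (D : AlgebroidData E M) : Prop := Nonempty (D.Iso G.lieAlgebroid)

/-! ### Differentiable cohomology in degree one and the Van Est map -/

/-- The differentiable cocycles of degree one. -/
def Z1 : Submodule ℝ (𝒢 → ℝ) where
  carrier := {c | IsSmoothFun (E := F) c ∧
    ∀ g h, G.src g = G.tgt h → c (G.mul g h) = c g + c h}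
  zero_mem' := ⟨contMDiff_const, by simp⟩
  add_mem' := by
    rintro c d ⟨hc, hc'⟩ ⟨hd, hd'⟩
    refine ⟨hc.add hd, fun g h hgh => ?_⟩
    simp only [Pi.add_apply, hc' g h hgh, hd' g h hgh]
    ring
  smul_mem' := by
    rintro k c ⟨hc, hc'⟩
    refine ⟨contMDiff_const.mul hc, fun g h hgh => ?_⟩
    simp only [Pi.smul_apply, hc' g h hgh, smul_eq_mul]
    ring

/-- The differentiable coboundaries `(δ f)(g) = f(s(g)) - f(t(g))` of degree one. -/
def B1 : Submodule ℝ (𝒢 → ℝ) where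
  carrier := {c | ∃ f : M → ℝ, IsSmoothFun (E := E) f ∧ ∀ g, c g = f (G.src g) - f (G.tgt g)}
  zero_mem' := ⟨fun _ => 0, contMDiff_const, by simp⟩
  add_mem' := by
    rintro c d ⟨f, hf, hc⟩ ⟨f', hf', hd⟩
    refine ⟨f + f', hf.add hf', fun g => ?_⟩
    simp only [Pi.add_apply, hc, hd]
    ring
  smul_mem' := by
    rintro k c ⟨f, hf, hc⟩
    refine ⟨k • f, contMDiff_const.mul hf, fun g => ?_⟩
    simp only [Pi.smul_apply, hc, smul_eq_mul]
    ring

/-- The differentiable cohomology `H^1_diff(G)`. -/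
abbrev H1 : Type _ := ↥G.Z1 ⧸ G.B1.submoduleOf G.Z1

/-- The cohomology class of a differentiable cocycle of degree one. -/
def mkH1 : G.Z1 →ₗ[ℝ] G.H1 := (G.B1.submoduleOf G.Z1).mkQ

/-- The linear map `Φ : H^1_diff(G) → H^1(A)` is the Van Est map in degree one: it sends the class of
a cocycle `c` to the class of the closed `A`-form `α_x ↦ (dc)_{1_x}(α_x)`. -/
def IsVanEst (Φ : G.H1 →ₗ[ℝ] G.lieAlgebroid.H1) : Prop :=
  ∀ c : G.Z1, ∃ θ : G.lieAlgebroid.Z1,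
    (∀ (x : M) (a : G.lieFiber x), θ.1 x a = mvfderiv 𝓘(ℝ, F) c.1 (G.unit x) a.1) ∧
    Φ (G.mkH1 c) = G.lieAlgebroid.mkH1 θ

open Classical in
/-- The Van Est map `H^1_diff(G) → H^1(A)` in degree one. -/
def vanEst : G.H1 →ₗ[ℝ] G.lieAlgebroid.H1 := if h : ∃ Φ, G.IsVanEst Φ then h.choose else 0

/-! ### The action on transverse densities and the modular class -/

/-- A frame `b` of `T_g 𝒢`, where `g : x → y`, is adapted to the exact sequence
`0 → A_y → T_g 𝒢 → T_x M → 0` given by right translation and `ds`, and to frames `a` of `A_y` and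
`e` of `T_x M`: it consists of the images of `a` and of lifts of `e`. The isomorphism
`𝒟(T_g 𝒢) ≅ 𝒟(A_y) ⊗ 𝒟(T_x M)` sends `ζ` to the element with value `ζ(b)` on `(a, e)`. -/
def IsAdapted (g : 𝒢) {x y : M} {r n : ℕ} (a : Fin r → G.lieFiber y)
    (e : Fin n → TangentSpace 𝓘(ℝ, E) x) (b : Fin r ⊕ Fin n → TangentSpace 𝓘(ℝ, F) g) : Prop :=
  (∀ i, b (Sum.inl i) = G.rightTranslation g y (a i)) ∧
  ∀ j, (mfderiv 𝓘(ℝ, F) 𝓘(ℝ, E) G.src g (b (Sum.inr j)) : TangentSpace 𝓘(ℝ, E) (G.src g)) = e j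

/-- `G.ActsTo g τ τ'` says that `g_* τ = τ'`, where `g_* : 𝒟^tr_{A,x} → 𝒟^tr_{A,y}` is the canonical
action of an arrow `g : x → y`. It is induced by the isomorphisms
`𝒟(A_y) ⊗ 𝒟(T_x M) ≅ 𝒟(T_g 𝒢) ≅ 𝒟(T_{g⁻¹} 𝒢) ≅ 𝒟(A_x) ⊗ 𝒟(T_y M)`,
whose middle one is given by the differential of the inversion. Let `a`, `a'`, `e`, `e'` be frames of
`A_x`, `A_y`, `T_x M`, `T_y M`, let `b` be a frame of `T_g 𝒢` adapted to `a'` and `e`, and `b'` one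
whose image in `T_{g⁻¹} 𝒢` is adapted to `a` and `e'`. For a density `ζ` on `T_g 𝒢`, these
isomorphisms match the element of `𝒟(A_y) ⊗ 𝒟(T_x M)` with value `ζ(b)` on `(a', e)` and the one of
`𝒟(A_x) ⊗ 𝒟(T_y M)` with value `ζ(b')` on `(a, e')`. Contraction with `𝒟(A_x^*)` and
`𝒟(A_y^*)` turns this into `(g_* τ)(a', e') ζ(b) = τ(a, e) ζ(b')`. -/
def ActsTo (g : 𝒢) (τ : G.lieAlgebroid.Dtr (G.src g)) (τ' : G.lieAlgebroid.Dtr (G.tgt g)) : Prop :=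
  ∀ (a : Basis (Fin G.lieAlgebroid.rank) ℝ (G.lieAlgebroid.Fiber (G.src g)))
    (a' : Basis (Fin G.lieAlgebroid.rank) ℝ (G.lieAlgebroid.Fiber (G.tgt g)))
    (e : Basis (Fin (finrank ℝ E)) ℝ (TangentSpace 𝓘(ℝ, E) (G.src g)))
    (e' : Basis (Fin (finrank ℝ E)) ℝ (TangentSpace 𝓘(ℝ, E) (G.tgt g)))
    (b b' : Basis (Fin G.lieAlgebroid.rank ⊕ Fin (finrank ℝ E)) ℝ (TangentSpace 𝓘(ℝ, F) g)),
    G.IsAdapted g a' e b →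
    G.IsAdapted (G.inv g) a e' (fun k => mfderiv 𝓘(ℝ, F) 𝓘(ℝ, F) G.inv g (b' k)) →
    ∀ ζ : Density (Fin G.lieAlgebroid.rank ⊕ Fin (finrank ℝ E)) (TangentSpace 𝓘(ℝ, F) g),
      TransverseDensity.eval a' e' τ' * ζ.1 b = TransverseDensity.eval a e τ * ζ.1 b'

/-- `m ∈ H^1_diff(G)` is the modular class of `G`: there are strictly positive smooth sections `σ` of
`𝒟_A^tr`, and for each of them the function `c_σ(g) = ln (σ(y) / g_* σ(x))`, for `g : x → y`, is a
differentiable cocycle of class `m`. The equation for `c_σ` is stated as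
`g_* σ(x) = exp (-c_σ(g)) σ(y)`. -/
def IsModularClass (m : G.H1) : Prop :=
  (∃ σ, G.lieAlgebroid.IsSmoothDtr σ ∧ ∀ x, (σ x).IsPositive) ∧
  ∀ σ, G.lieAlgebroid.IsSmoothDtr σ → (∀ x, (σ x).IsPositive) →
    ∃ c : G.Z1, (∀ g, G.ActsTo g (σ (G.src g)) (Real.exp (-c.1 g) • σ (G.tgt g))) ∧ G.mkH1 c = m

open Classical in
/-- The modular class `mod(G)`. -/
def modularClass : G.H1 := if h : ∃ m, G.IsModularClass m then h.choose else 0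

/-- A Lie groupoid is unimodular if its modular class vanishes. -/
def IsUnimodular : Prop := G.modularClass = 0

end LieGroupoid

end Groupoids

/-!
The proof has four ingredients.

*The modular class of a Lie groupoid.* The action of an arrow on transverse densities is defined by
two frames of the tangent space of `𝒢` at that arrow, one adapted to the source and one to the
target. It is made explicit by a local bisection `β` through the arrow: left translation by `β` gives
an isomorphism of the fibres of the Lie algebroid, the adjoint action `IsBisectionAt.exists_adjoint`,
and `t ∘ β` gives one of the tangent spaces of `M`. The action of the arrow is the transport of
densities along these two isomorphisms (`IsBisectionAt.scales_iff`). This rests on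
`IsBisectionAt.leftTranslation_eq`: the vectors tangent to the target fibre and to the source fibre
that come from the same element `v` of the algebroid add up to the image of the anchor of `v` under
`dβ`. So the two adapted frames, both completed by vectors tangent to the bisection, differ by a
matrix of determinant `± 1`. The adjoint action is multiplicative (`rightTranslation_mul`), hence
`c_σ` is a cocycle. It is smooth, because locally it is a combination of logarithms of values of `σ`
and of a determinant of smooth frames (`contMDiff_of_scales`). A partition of unity provides a positive
density (`exists_positive_density`), and another choice changes `c_σ` by a coboundary, which gives
`isModularClass_modularClass`.

*The Van Est map.* The differential of a cocycle along the source fibres is right-invariant, so its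
restriction to the units determines a form on the Lie algebroid. The form is closed by the formula
`X (Y f) - Y (X f) = [X, Y] f`, applied to right-invariant vector fields
(`mfderiv_mlieBracket`, `vanEstSection_mem`).

*Comparison of the two modular classes.* A section `α` of the Lie algebroid is generated by a family
of local bisections `Θ t`; left translations by `Θ t` generate the right-invariant vector field of
`α`, and the maps `t ∘ Θ t` on `M` generate its anchor. For a family of maps that starts at the identity
with velocity `X`, the difference between the transported field and the field `Y` at the image points
has derivative `-[X, Y]` (`hasDerivAt_flow_sub`). Jacobi's formula turns this into the derivatives of
the determinants by which frames of the Lie algebroid and of `M` are transported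
(`IsFlowAt.exists_lie_det`, `IsFlowAt.exists_tangent_det`): they are the two sums in the definition of
`∇_α`. Differentiating the action of the arrows `Θ t x` at `t = 0` gives `∇_α σ = VE(c_σ)(α) σ`
(`isNabla_of_scales`), from which `vanEst_modularClass` follows. The vanishing of the class is carried
over to isomorphic Lie algebroids by `AlgebroidData.IsModularClass.zero_of_iso`.

*Proper Lie groupoids.* On a proper groupoid every cocycle `c` is a coboundary. A smooth frame of the
Lie algebroid over an open set defines densities on the source fibres that are invariant under right
translations (`SourceChart.integral_ext_eq`). Integrating `exp (c g) χ (t g)` over the source fibres,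
for a cutoff function `χ` supported in that set, yields a nonnegative smooth function `φ` on `M` with
`φ (s h) = exp (c h) φ (t h)` (`ChartPartition.fibreIntegral_src`). A locally finite sum of such
functions is positive everywhere (`exists_isEquivariant_forall_pos`), and then `c` is the coboundary of
`log φ`.
-/

set_option linter.unusedSectionVars false

/-! ### Frames, determinants and densities -/

section LinearAlgebra

theorem Module.Basis.det_eq_det_mul_det {ι V : Type*} [Fintype ι] [DecidableEq ι] [AddCommGroup V]
    [Module ℝ V] (e e' : Basis ι ℝ V) (v : ι → V) : e.det v = e.det e' * e'.det v := by
  rw [Basis.det_apply, Basis.det_apply, Basis.det_apply, ← Matrix.det_mul,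
    Basis.toMatrix_mul_toMatrix]

theorem Module.Basis.det_ne_zero' {ι V : Type*} [Fintype ι] [DecidableEq ι] [AddCommGroup V]
    [Module ℝ V] (e e' : Basis ι ℝ V) : e.det e' ≠ 0 := by
  intro h
  have := e.det_eq_det_mul_det e' e
  rw [h, e.det_self, zero_mul] at this
  exact one_ne_zero this

theorem Module.Basis.det_dualBasis {ι V : Type*} [Fintype ι] [DecidableEq ι] [AddCommGroup V]
    [Module ℝ V] (a a' : Basis ι ℝ V) : a.dualBasis.det a'.dualBasis = a'.det a := by
  rw [Basis.det_apply, Basis.det_apply, ← Matrix.det_transpose]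
  congr 1
  ext i j
  simp [Basis.toMatrix_apply, Matrix.transpose_apply]

namespace Density

variable {ι : Type*} [Fintype ι] [DecidableEq ι] {V : Type*} [AddCommGroup V] [Module ℝ V]

/-- The density that takes the value `1` on a given frame. -/
noncomputable def ofBasis (e : Basis ι ℝ V) : Density ι V :=
  ⟨fun e' => |e.det e'|, fun e' e'' => by
    rw [← abs_mul, mul_comm, ← Basis.det_eq_det_mul_det]⟩

theorem ofBasis_apply (e e' : Basis ι ℝ V) : (ofBasis e).1 e' = |e.det e'| := rfl

theorem ofBasis_self (e : Basis ι ℝ V) : (ofBasis e).1 e = 1 := by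
  rw [ofBasis_apply, e.det_self, abs_one]

theorem eq_smul_ofBasis (e : Basis ι ℝ V) (ξ : Density ι V) : ξ = ξ.1 e • ofBasis e := by
  apply Subtype.ext
  funext e'
  have h := ξ.2 e e'
  change ξ.1 e' = ξ.1 e * |e.det e'|
  rw [h, mul_comm]

end Density

namespace TransverseDensity

variable {r n : ℕ} {A T : Type*} [AddCommGroup A] [Module ℝ A] [AddCommGroup T] [Module ℝ T]

/-- Under a change of frames, the value of a transverse density is multiplied by
`|det P|⁻¹ |det Q|`, where `P` is the change of frame of `A` and `Q` the one of `T`. -/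
theorem eval_mul_abs_det (a a' : Basis (Fin r) ℝ A) (e e' : Basis (Fin n) ℝ T)
    (τ : TransverseDensity r n A T) :
    eval a' e' τ * |a.det a'| = |e.det e'| * eval a e τ := by
  induction τ using TensorProduct.induction_on with
  | zero => simp
  | add x y hx hy => simp only [map_add, add_mul, mul_add, hx, hy]
  | tmul ξ η =>
    rw [eval_tmul, eval_tmul, ξ.2 a.dualBasis a'.dualBasis, η.2 e e', a.det_dualBasis]
    have h : |a'.det a| * |a.det a'| = 1 := by
      rw [← abs_mul, ← Basis.det_eq_det_mul_det, Basis.det_self, abs_one]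
    linear_combination (ξ.1 a.dualBasis * |e.det e'| * η.1 e) * h

/-- The transverse density that takes the value `1` on given frames. -/
noncomputable def ofFrames (a : Basis (Fin r) ℝ A) (e : Basis (Fin n) ℝ T) :
    TransverseDensity r n A T :=
  Density.ofBasis a.dualBasis ⊗ₜ[ℝ] Density.ofBasis e

theorem eval_ofFrames (a : Basis (Fin r) ℝ A) (e : Basis (Fin n) ℝ T) :
    eval a e (ofFrames a e) = 1 := by
  simp [ofFrames, eval_tmul, Density.ofBasis_self]

theorem eq_smul_ofFrames (a : Basis (Fin r) ℝ A) (e : Basis (Fin n) ℝ T)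
    (τ : TransverseDensity r n A T) : τ = eval a e τ • ofFrames a e := by
  induction τ using TensorProduct.induction_on with
  | zero => simp
  | add x y hx hy => rw [map_add, add_smul, ← hx, ← hy]
  | tmul ξ η =>
    conv_lhs => rw [Density.eq_smul_ofBasis a.dualBasis ξ, Density.eq_smul_ofBasis e η]
    rw [TensorProduct.smul_tmul_smul, eval_tmul, ofFrames]

theorem eval_injective (a : Basis (Fin r) ℝ A) (e : Basis (Fin n) ℝ T) :
    Function.Injective (eval a e) := by
  intro τ τ' h
  rw [eq_smul_ofFrames a e τ, eq_smul_ofFrames a e τ', h]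

theorem eval_ne_zero {a : Basis (Fin r) ℝ A} {e : Basis (Fin n) ℝ T}
    {τ : TransverseDensity r n A T} (h : τ ≠ 0) : eval a e τ ≠ 0 := fun h0 =>
  h (eval_injective a e (by rw [h0, map_zero]))

theorem evalTuple_eq (a : Basis (Fin r) ℝ A) (e : Basis (Fin n) ℝ T)
    {v : Fin r → A} {w : Fin n → T} (hv : ⇑a = v) (hw : ⇑e = w)
    (τ : TransverseDensity r n A T) : evalTuple v w τ = eval a e τ := by
  subst hv hw
  have h : (∃ b : Basis (Fin r) ℝ A, ⇑b = ⇑a) ∧ ∃ c : Basis (Fin n) ℝ T, ⇑c = ⇑e :=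
    ⟨⟨a, rfl⟩, ⟨e, rfl⟩⟩
  rw [evalTuple, dif_pos h]
  have h1 : h.1.choose = a := DFunLike.coe_injective h.1.choose_spec
  have h2 : h.2.choose = e := DFunLike.coe_injective h.2.choose_spec
  rw [h1, h2]

theorem isPositive_of_eval_pos {a : Basis (Fin r) ℝ A} {e : Basis (Fin n) ℝ T}
    {τ : TransverseDensity r n A T} (h : 0 < eval a e τ) : τ.IsPositive := by
  intro a' e'
  have h1 := eval_mul_abs_det a a' e e' τ
  have h2 : 0 < |a.det a'| := abs_pos.2 (a.det_ne_zero' a')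
  have h3 : 0 < |e.det e'| := abs_pos.2 (e.det_ne_zero' e')
  exact pos_of_mul_pos_left (h1 ▸ mul_pos h3 h) h2.le

end TransverseDensity

/-- Two surjective linear maps `p, q : V → W` have a common partial inverse up to isomorphism: `p`
has a section `H` for which `q ∘ H` is bijective. The range of `H` is a common complement of the two
kernels. -/
theorem LinearMap.exists_section_comp_bijective {V W : Type*} [AddCommGroup V] [Module ℝ V]
    [AddCommGroup W] [Module ℝ W] [FiniteDimensional ℝ W] (p q : V →ₗ[ℝ] W)
    (hp : Function.Surjective p) (hq : Function.Surjective q) :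
    ∃ H : W →ₗ[ℝ] V, (∀ w, p (H w) = w) ∧ Function.Bijective (q ∘ₗ H) := by
  obtain ⟨H₀, hH₀⟩ := p.exists_rightInverse_of_surjective (LinearMap.range_eq_top.2 hp)
  have hH₀' : ∀ w, p (H₀ w) = w := fun w => LinearMap.congr_fun hH₀ w
  set B : W →ₗ[ℝ] W := q ∘ₗ H₀ with hB
  -- the kernel of `p` covers the cokernel of `q ∘ H₀`
  let π : LinearMap.ker p →ₗ[ℝ] W ⧸ LinearMap.range B :=
    (LinearMap.range B).mkQ ∘ₗ q ∘ₗ (LinearMap.ker p).subtype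
  have hπ : Function.Surjective π := by
    intro z
    obtain ⟨w, rfl⟩ := Submodule.mkQ_surjective _ z
    obtain ⟨v, rfl⟩ := hq w
    refine ⟨⟨v - H₀ (p v), by simp [hH₀']⟩, ?_⟩
    change (LinearMap.range B).mkQ (q (v - H₀ (p v))) = _
    rw [map_sub, map_sub, sub_eq_self]
    exact (Submodule.Quotient.mk_eq_zero _).2 ⟨p v, rfl⟩
  obtain ⟨ρ, hρ⟩ := π.exists_rightInverse_of_surjective (LinearMap.range_eq_top.2 hπ)
  have hρ' : ∀ w, π (ρ w) = w := fun w => LinearMap.congr_fun hρ w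
  -- `W` is finite-dimensional, so the kernel of `B` and its cokernel are isomorphic, and `k`
  -- maps the first one to lifts of the second one in the kernel of `p`
  have hdim : finrank ℝ (LinearMap.ker B) = finrank ℝ (W ⧸ LinearMap.range B) := by
    have h1 := B.finrank_range_add_finrank_ker
    have h2 := (LinearMap.range B).finrank_quotient_add_finrank
    omega
  let ψ : LinearMap.ker B ≃ₗ[ℝ] W ⧸ LinearMap.range B := LinearEquiv.ofFinrankEq _ _ hdim
  obtain ⟨pr, hpr⟩ := (LinearMap.ker B).subtype.exists_leftInverse_of_injective
    (LinearMap.ker_eq_bot.2 Subtype.val_injective)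
  let k : W →ₗ[ℝ] V := (LinearMap.ker p).subtype ∘ₗ ρ ∘ₗ ψ.toLinearMap ∘ₗ pr
  have hk : ∀ w, p (k w) = 0 := fun w => (ρ (ψ (pr w))).2
  refine ⟨H₀ + k, fun w => by simp [hH₀', hk], ?_⟩
  have hinj : Function.Injective (q ∘ₗ (H₀ + k)) := by
    rw [injective_iff_map_eq_zero]
    intro w hw
    have hw' : B w + q (k w) = 0 := by simpa [hB] using hw
    have h1 : (LinearMap.range B).mkQ (q (k w)) = ψ (pr w) := hρ' (ψ (pr w))
    have h2 : ψ (pr w) = 0 := by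
      rw [← h1, ← neg_eq_of_add_eq_zero_right hw']
      exact (Submodule.Quotient.mk_eq_zero _).2 ⟨-w, by simp⟩
    have h3 : pr w = 0 := by simpa using h2
    have h4 : k w = 0 := by simp [k, h3]
    rw [h4, map_zero, add_zero] at hw'
    have h5 := LinearMap.congr_fun hpr ⟨w, hw'⟩
    have h6 : pr w = ⟨w, hw'⟩ := h5
    rw [h3] at h6
    exact (congrArg Subtype.val h6).symm
  exact ⟨hinj, LinearMap.injective_iff_surjective.1 hinj⟩

theorem Module.Basis.det_update_eq_coord {ι V : Type*} [Fintype ι] [DecidableEq ι] [AddCommGroup V]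
    [Module ℝ V] (e : Basis ι ℝ V) (i : ι) (v : V) :
    e.det (Function.update e i v) = e.coord i v := by
  conv_lhs => rw [← e.sum_repr v]
  rw [AlternatingMap.map_update_sum, Finset.sum_eq_single i]
  · rw [AlternatingMap.map_update_smul, Function.update_eq_self, e.det_self]; simp
  · intro j _ hj
    rw [AlternatingMap.map_update_smul, AlternatingMap.map_update_self _ _ hj.symm, smul_zero]
  · simp

section
variable {ι F : Type*} [Fintype ι] [DecidableEq ι] [NormedAddCommGroup F] [NormedSpace ℝ F]
  [FiniteDimensional ℝ F]

/-- The determinant with respect to a basis, as a continuous multilinear map. -/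
noncomputable def Module.Basis.detCLM (e : Basis ι ℝ F) :
    ContinuousMultilinearMap ℝ (fun _ : ι => F) ℝ :=
  { e.det.toMultilinearMap with
    cont := by
      have : (e.det.toMultilinearMap).toFun = fun v : ι → F => Matrix.det (e.toMatrix v) := by
        funext v; exact Basis.det_apply _ _
      rw [this]
      refine Continuous.matrix_det (continuous_matrix fun i j => ?_)
      exact ((e.coord i).continuous_of_finiteDimensional).comp (continuous_apply j) }

theorem Module.Basis.detCLM_apply (e : Basis ι ℝ F) (v : ι → F) : e.detCLM v = e.det v := rfl

/-- Jacobi's formula at the identity matrix: the derivative of the determinant is the trace. -/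
theorem Module.Basis.hasDerivAt_det (e : Basis ι ℝ F) {v : ι → ℝ → F} {v' : ι → F} {t₀ : ℝ}
    (h0 : ∀ i, v i t₀ = e i) (hv : ∀ i, HasDerivAt (v i) (v' i) t₀) :
    HasDerivAt (fun t => e.det fun i => v i t) (∑ i, e.coord i (v' i)) t₀ := by
  have h1 : HasDerivAt (fun t => fun i => v i t) v' t₀ := hasDerivAt_pi.2 hv
  have h2 := (e.detCLM.hasFDerivAt (fun i => v i t₀)).comp_hasDerivAt t₀ h1
  have h4 : (e.detCLM.linearDeriv fun i => v i t₀) v' = ∑ i, e.coord i (v' i) := by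
    rw [ContinuousMultilinearMap.linearDeriv_apply]
    refine Finset.sum_congr rfl fun i _ => ?_
    have h3 : (fun i => v i t₀) = ⇑e := funext h0
    rw [h3, Basis.detCLM_apply, e.det_update_eq_coord]
  rw [← h4]
  exact h2
end

end LinearAlgebra

/-! ### Smooth families of tangent vectors -/

noncomputable section ManifoldCalculus

variable {F : Type*} [NormedAddCommGroup F] [NormedSpace ℝ F] {P : Type*} [TopologicalSpace P]
  [ChartedSpace F P] [IsManifold 𝓘(ℝ, F) ∞ P]
  {F' : Type*} [NormedAddCommGroup F'] [NormedSpace ℝ F'] {P' : Type*} [TopologicalSpace P']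
  [ChartedSpace F' P'] [IsManifold 𝓘(ℝ, F') ∞ P']
  {E₁ : Type*} [NormedAddCommGroup E₁] [NormedSpace ℝ E₁] {H₁ : Type*} [TopologicalSpace H₁]
  {I : ModelWithCorners ℝ E₁ H₁} {N : Type*} [TopologicalSpace N] [ChartedSpace H₁ N]
  {E₂ : Type*} [NormedAddCommGroup E₂] [NormedSpace ℝ E₂] {H₂ : Type*} [TopologicalSpace H₂]
  {J : ModelWithCorners ℝ E₂ H₂} {Q : Type*} [TopologicalSpace Q] [ChartedSpace H₂ Q]
  {G : Type*} [NormedAddCommGroup G] [NormedSpace ℝ G]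

theorem ContMDiffAt.mdiffAt_of_infty {f : N → Q} {x : N} (h : ContMDiffAt I J ∞ f x) :
    MDifferentiableAt I J f x := h.mdifferentiableAt (by simp)

theorem ContMDiffAt.eventually_one [IsManifold I ∞ N] [IsManifold J ∞ Q] {f : N → Q} {x : N}
    (h : ContMDiffAt I J ∞ f x) :
    ∀ᶠ y in 𝓝 x, ContMDiffAt I J 1 f y := by
  have : IsManifold I 1 N := .of_le (n := ∞) (by simp)
  have : IsManifold J 1 Q := .of_le (n := ∞) (by simp)
  exact (contMDiffAt_iff_contMDiffAt_nhds (by simp)).1 (h.of_le (by simp))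

/-- The derivatives of a smooth family of maps, applied to a smooth family of vectors, form a smooth
family of vectors. -/
theorem ContMDiffAt.mfderiv_apply_family [IsManifold I ∞ N] [IsManifold J ∞ Q] {f : N → Q → P}
    {g : N → Q} {v : Π n, TangentSpace J (g n)} {n₀ : N}
    (hf : ContMDiffAt (I.prod J) 𝓘(ℝ, F) ∞ (Function.uncurry f) (n₀, g n₀))
    (hv : ContMDiffAt I J.tangent ∞ (fun n => (⟨g n, v n⟩ : TangentBundle J Q)) n₀) :
    ContMDiffAt I (𝓘(ℝ, F).prod 𝓘(ℝ, F)) ∞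
      (fun n => (⟨f n (g n), mfderiv J 𝓘(ℝ, F) (f n) (g n) (v n)⟩ : TangentBundle 𝓘(ℝ, F) P))
      n₀ := by
  have : IsManifold J 1 Q := .of_le (n := ∞) (by simp)
  have : IsManifold I 1 N := .of_le (n := ∞) (by simp)
  have : IsManifold 𝓘(ℝ, F) 1 P := .of_le (n := ∞) (by simp)
  have hg : ContMDiffAt I J ∞ g n₀ := (Bundle.contMDiffAt_totalSpace.1 hv).1
  have h1 := ContMDiffAt.mfderiv f g hf hg (m := ∞) (by simp)
  have h2 : ContMDiffAt I 𝓘(ℝ, F) ∞ (fun n => f n (g n)) n₀ :=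
    hf.comp n₀ (contMDiffAt_id.prodMk hg)
  exact ContMDiffAt.clm_apply_of_inCoordinates h1 hv h2

theorem contMDiffAt_vectorSpace_snd {u : N → G} {v : N → G} {n₀ : N}
    (h : ContMDiffAt I (𝓘(ℝ, G).prod 𝓘(ℝ, G)) ∞
      (fun n => (⟨u n, v n⟩ : TangentBundle 𝓘(ℝ, G) G)) n₀) :
    ContMDiffAt I 𝓘(ℝ, G) ∞ v n₀ :=
  (contMDiff_snd_tangentBundle_modelSpace G 𝓘(ℝ, G) (n := ∞)).contMDiffAt.comp n₀ h

theorem contMDiffAt_vectorSpace_mk {u : N → G} {v : N → G} {n₀ : N}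
    (hu : ContMDiffAt I 𝓘(ℝ, G) ∞ u n₀) (hv : ContMDiffAt I 𝓘(ℝ, G) ∞ v n₀) :
    ContMDiffAt I (𝓘(ℝ, G).prod 𝓘(ℝ, G)) ∞
      (fun n => (⟨u n, v n⟩ : TangentBundle 𝓘(ℝ, G) G)) n₀ := by
  rw [Bundle.contMDiffAt_totalSpace]
  refine ⟨hu, ?_⟩
  simpa using! hv

/-! ### Coordinates of tangent vectors -/

variable (F) in
/-- The coordinates in the preferred chart at `p` of a tangent vector at `q`. -/
def tcoord (p q : P) : TangentSpace 𝓘(ℝ, F) q →L[ℝ] F :=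
  mfderiv 𝓘(ℝ, F) 𝓘(ℝ, F) (extChartAt 𝓘(ℝ, F) p) q

theorem tcoord_self (p : P) (v : TangentSpace 𝓘(ℝ, F) p) : tcoord F p p v = v := by
  have : IsManifold 𝓘(ℝ, F) 1 P := .of_le (n := ∞) (by simp)
  rw [tcoord, mfderiv_extChartAt_self]
  rfl

theorem tcoord_isInvertible {p q : P} (hq : q ∈ (chartAt F p).source) :
    (tcoord F p q).IsInvertible := by
  have : IsManifold 𝓘(ℝ, F) 1 P := .of_le (n := ∞) (by simp)
  exact isInvertible_mfderiv_extChartAt (by rwa [extChartAt_source])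

theorem tcoord_bijective {p q : P} (hq : q ∈ (chartAt F p).source) :
    Function.Bijective (tcoord F p q) := by
  obtain ⟨M, hM⟩ := tcoord_isInvertible hq
  rw [← hM]
  exact M.bijective

theorem contMDiffAt_extChartAt_infty {p q : P} (hq : q ∈ (chartAt F p).source) :
    ContMDiffAt 𝓘(ℝ, F) 𝓘(ℝ, F) ∞ (extChartAt 𝓘(ℝ, F) p) q :=
  contMDiffAt_extChartAt' hq

theorem contMDiffAt_mfderiv_vectorSpace [IsManifold I ∞ N] {f : P → G} {u : N → P}
    {v : Π n, TangentSpace 𝓘(ℝ, F) (u n)} {n₀ : N}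
    (hf : ContMDiffAt 𝓘(ℝ, F) 𝓘(ℝ, G) ∞ f (u n₀))
    (hv : ContMDiffAt I (𝓘(ℝ, F).prod 𝓘(ℝ, F)) ∞
      (fun n => (⟨u n, v n⟩ : TangentBundle 𝓘(ℝ, F) P)) n₀) :
    ContMDiffAt I 𝓘(ℝ, G) ∞
      (fun n => (mfderiv 𝓘(ℝ, F) 𝓘(ℝ, G) f (u n) (v n) : G)) n₀ := by
  have hg : ContMDiffAt I 𝓘(ℝ, F) ∞ u n₀ := (Bundle.contMDiffAt_totalSpace.1 hv).1
  refine contMDiffAt_vectorSpace_snd (u := fun n => f (u n)) ?_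
  refine ContMDiffAt.mfderiv_apply_family (f := fun _ => f) ?_ hv
  exact ContMDiffAt.comp (n₀, u n₀) hf contMDiffAt_snd

theorem contMDiffAt_tcoord [IsManifold I ∞ N] {u : N → P} {v : Π n, TangentSpace 𝓘(ℝ, F) (u n)}
    {n₀ : N} {p : P} (hp : u n₀ ∈ (chartAt F p).source)
    (hv : ContMDiffAt I (𝓘(ℝ, F).prod 𝓘(ℝ, F)) ∞
      (fun n => (⟨u n, v n⟩ : TangentBundle 𝓘(ℝ, F) P)) n₀) :
    ContMDiffAt I 𝓘(ℝ, F) ∞ (fun n => tcoord F p (u n) (v n)) n₀ :=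
  contMDiffAt_mfderiv_vectorSpace (contMDiffAt_extChartAt_infty hp) hv

/-- A family of tangent vectors is smooth if its base points and its coordinates in one chart are
smooth. -/
theorem contMDiffAt_of_tcoord {u : N → P} {v : Π n, TangentSpace 𝓘(ℝ, F) (u n)}
    {n₀ : N} (hu : ContMDiffAt I 𝓘(ℝ, F) ∞ u n₀)
    (hv : ContMDiffAt I 𝓘(ℝ, F) ∞ (fun n => tcoord F (u n₀) (u n) (v n)) n₀) :
    ContMDiffAt I (𝓘(ℝ, F).prod 𝓘(ℝ, F)) ∞
      (fun n => (⟨u n, v n⟩ : TangentBundle 𝓘(ℝ, F) P)) n₀ := by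
  have : IsManifold 𝓘(ℝ, F) 1 P := .of_le (n := ∞) (by simp)
  rw [Bundle.contMDiffAt_totalSpace]
  refine ⟨hu, hv.congr_of_eventuallyEq ?_⟩
  have h1 : ∀ᶠ n in 𝓝 n₀, u n ∈ (chartAt F (u n₀)).source :=
    hu.continuousAt.eventually ((chartAt F (u n₀)).open_source.mem_nhds (mem_chart_source F _))
  filter_upwards [h1] with n hn
  have h2 := TangentBundle.continuousLinearMapAt_trivializationAt (I := 𝓘(ℝ, F)) hn
  rw [tcoord, ← h2]
  exact (Bundle.Trivialization.continuousLinearMapAt_apply_of_mem _ (R := ℝ) hn _).symm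

/-! ### Smooth frames -/

section Frames

variable {ι : Type*} [Fintype ι] [DecidableEq ι] [FiniteDimensional ℝ F]

instance (q : P) : FiniteDimensional ℝ (TangentSpace 𝓘(ℝ, F) q) :=
  inferInstanceAs (FiniteDimensional ℝ F)

omit [FiniteDimensional ℝ F] in
theorem Module.Basis.exists_of_det_ne_zero {W : Type*} [AddCommGroup W] [Module ℝ W]
    (f : Basis ι ℝ W) {v : ι → W} (h : f.det v ≠ 0) : ∃ b : Basis ι ℝ W, ⇑b = v := by
  have h1 := (is_basis_iff_det f).2 (isUnit_iff_ne_zero.2 h)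
  exact ⟨Basis.mk h1.1 h1.2.ge, Basis.coe_mk _ _⟩

/-- Near a point at which a smooth family `v` of tuples of tangent vectors is a frame, it is a frame,
and the determinant with respect to it of a smooth family `w` is smooth. -/
theorem exists_contMDiffAt_det [IsManifold I ∞ N] {u : N → P}
    {v w : ι → Π n, TangentSpace 𝓘(ℝ, F) (u n)} {n₀ : N}
    (hv : ∀ i, ContMDiffAt I (𝓘(ℝ, F).prod 𝓘(ℝ, F)) ∞
      (fun n => (⟨u n, v i n⟩ : TangentBundle 𝓘(ℝ, F) P)) n₀)
    (hw : ∀ i, ContMDiffAt I (𝓘(ℝ, F).prod 𝓘(ℝ, F)) ∞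
      (fun n => (⟨u n, w i n⟩ : TangentBundle 𝓘(ℝ, F) P)) n₀)
    (hu : ContMDiffAt I 𝓘(ℝ, F) ∞ u n₀)
    (b₀ : Basis ι ℝ (TangentSpace 𝓘(ℝ, F) (u n₀))) (hb₀ : ∀ i, b₀ i = v i n₀) :
    (∀ᶠ n in 𝓝 n₀, ∃ b : Basis ι ℝ (TangentSpace 𝓘(ℝ, F) (u n)), ⇑b = fun i => v i n) ∧
    ∃ δ : N → ℝ, ContMDiffAt I 𝓘(ℝ, ℝ) ∞ δ n₀ ∧
      ∀ᶠ n in 𝓝 n₀, ∀ b : Basis ι ℝ (TangentSpace 𝓘(ℝ, F) (u n)), (⇑b = fun i => v i n) →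
        b.det (fun i => w i n) = δ n := by
  -- Both families are read in the chart at `u n₀`, where their determinants are taken with respect to
  -- the fixed frame `b₀`; the determinant of `w` with respect to `v` is the quotient.
  let f : Basis ι ℝ F := b₀
  have key : ∀ z : ι → Π n, TangentSpace 𝓘(ℝ, F) (u n),
      (∀ i, ContMDiffAt I (𝓘(ℝ, F).prod 𝓘(ℝ, F)) ∞
        (fun n => (⟨u n, z i n⟩ : TangentBundle 𝓘(ℝ, F) P)) n₀) →
      ContMDiffAt I 𝓘(ℝ, ℝ) ∞ (fun n => f.det fun i => tcoord F (u n₀) (u n) (z i n)) n₀ := by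
    intro z hz
    have h1 : ContMDiffAt I 𝓘(ℝ, ι → F) ∞
        (fun n => fun i => tcoord F (u n₀) (u n) (z i n)) n₀ :=
      contMDiffAt_pi_space.2 fun i => contMDiffAt_tcoord (mem_chart_source F _) (hz i)
    have h2 : ContMDiffAt 𝓘(ℝ, ι → F) 𝓘(ℝ, ℝ) ∞ f.detCLM
        (fun i => tcoord F (u n₀) (u n₀) (z i n₀)) :=
      (f.detCLM.contDiff.contDiffAt).contMDiffAt
    exact h2.comp n₀ h1
  have hsrc : ∀ᶠ n in 𝓝 n₀, u n ∈ (chartAt F (u n₀)).source :=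
    hu.continuousAt.eventually ((chartAt F (u n₀)).open_source.mem_nhds (mem_chart_source F _))
  have hne0 : (f.det fun i => tcoord F (u n₀) (u n₀) (v i n₀)) ≠ 0 := by
    have : (fun i => tcoord F (u n₀) (u n₀) (v i n₀)) = ⇑f := by
      funext i; rw [tcoord_self, ← hb₀ i]; rfl
    rw [this, f.det_self]; exact one_ne_zero
  have hne : ∀ᶠ n in 𝓝 n₀, (f.det fun i => tcoord F (u n₀) (u n) (v i n)) ≠ 0 :=
    (key v hv).continuousAt.eventually_ne hne0
  refine ⟨?_, fun n => (f.det fun i => tcoord F (u n₀) (u n) (w i n)) /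
    (f.det fun i => tcoord F (u n₀) (u n) (v i n)), (key w hw).div₀ (key v hv) hne0, ?_⟩
  · filter_upwards [hsrc, hne] with n hn hne
    let T : TangentSpace 𝓘(ℝ, F) (u n) ≃ₗ[ℝ] F :=
      LinearEquiv.ofBijective (tcoord F (u n₀) (u n)).toLinearMap (tcoord_bijective hn)
    obtain ⟨b, hb⟩ := f.exists_of_det_ne_zero hne
    refine ⟨b.map T.symm, funext fun i => ?_⟩
    rw [Basis.map_apply, hb]
    exact T.symm_apply_apply (v i n)
  · filter_upwards [hsrc, hne] with n hn hne b hb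
    let T : TangentSpace 𝓘(ℝ, F) (u n) ≃ₗ[ℝ] F :=
      LinearEquiv.ofBijective (tcoord F (u n₀) (u n)).toLinearMap (tcoord_bijective hn)
    rw [eq_div_iff hne, mul_comm]
    have h1 := f.det_eq_det_mul_det (b.map T) (fun i => T (w i n))
    have h2 : ⇑(b.map T) = fun i => tcoord F (u n₀) (u n) (v i n) := by
      funext i; rw [Basis.map_apply, hb]; rfl
    have h3 : (b.map T).det (fun i => T (w i n)) = b.det fun i => w i n := by
      rw [Basis.det_map]; congr 1; funext i; exact T.symm_apply_apply (w i n)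
    rw [h2, h3] at h1
    exact h1.symm

end Frames

end ManifoldCalculus

/-! ### Velocities and brackets of vector fields -/

noncomputable section ManifoldBracket

variable {F : Type*} [NormedAddCommGroup F] [NormedSpace ℝ F] {P : Type*} [TopologicalSpace P]
  [ChartedSpace F P] [IsManifold 𝓘(ℝ, F) ∞ P]
  {F' : Type*} [NormedAddCommGroup F'] [NormedSpace ℝ F'] {P' : Type*} [TopologicalSpace P']
  [ChartedSpace F' P'] [IsManifold 𝓘(ℝ, F') ∞ P']
  {G : Type*} [NormedAddCommGroup G] [NormedSpace ℝ G]

/-- The velocity at time `0` of a curve. -/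
def velocity (F : Type*) [NormedAddCommGroup F] [NormedSpace ℝ F] {P : Type*} [TopologicalSpace P]
    [ChartedSpace F P] (γ : ℝ → P) : TangentSpace 𝓘(ℝ, F) (γ 0) :=
  mfderiv 𝓘(ℝ, ℝ) 𝓘(ℝ, F) γ 0 (1 : ℝ)

omit [IsManifold 𝓘(ℝ, F) ∞ P] in
theorem velocity_congr {γ γ' : ℝ → P} (h : γ =ᶠ[𝓝 0] γ') :
    (velocity F γ : F) = velocity F γ' := by
  unfold velocity
  rw [h.mfderiv_eq]
  rfl

omit [IsManifold 𝓘(ℝ, F) ∞ P] [IsManifold 𝓘(ℝ, F') ∞ P'] in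
theorem velocity_comp {γ : ℝ → P} {f : P → P'} {p : P} (hp : γ 0 = p)
    (hγ : MDifferentiableAt 𝓘(ℝ, ℝ) 𝓘(ℝ, F) γ 0)
    (hf : MDifferentiableAt 𝓘(ℝ, F) 𝓘(ℝ, F') f p) :
    (velocity F' (fun t => f (γ t)) : F') =
      mfderiv 𝓘(ℝ, F) 𝓘(ℝ, F') f p (velocity F γ) := by
  subst hp
  exact mfderiv_comp_apply (0 : ℝ) hf hγ (1 : ℝ)

omit [IsManifold 𝓘(ℝ, F) ∞ P] in
theorem velocity_const (p : P) : (velocity F (fun _ => p) : F) = 0 := by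
  unfold velocity
  rw [mfderiv_const]
  rfl

omit [IsManifold 𝓘(ℝ, F) ∞ P] in
theorem hasDerivAt_velocity {γ : ℝ → P} {f : P → G} {p : P} (hp : γ 0 = p)
    (hγ : MDifferentiableAt 𝓘(ℝ, ℝ) 𝓘(ℝ, F) γ 0)
    (hf : MDifferentiableAt 𝓘(ℝ, F) 𝓘(ℝ, G) f p) :
    HasDerivAt (fun t => f (γ t)) (mfderiv 𝓘(ℝ, F) 𝓘(ℝ, G) f p (velocity F γ) : G) 0 := by
  subst hp
  have h1 : MDifferentiableAt 𝓘(ℝ, ℝ) 𝓘(ℝ, G) (f ∘ γ) 0 := hf.comp 0 hγ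
  have h2 : DifferentiableAt ℝ (f ∘ γ) 0 := mdifferentiableAt_iff_differentiableAt.1 h1
  have h3 : deriv (f ∘ γ) 0 = (mfderiv 𝓘(ℝ, F) 𝓘(ℝ, G) f (γ 0) (velocity F γ) : G) := by
    rw [← velocity_comp rfl hγ hf, velocity, mfderiv_eq_fderiv]
    rfl
  rw [← h3]
  exact h2.hasDerivAt

omit [IsManifold 𝓘(ℝ, F) ∞ P] in
/-- The Leibniz rule for the velocity on the diagonal of a two-parameter family. -/
theorem velocity_diag {W : ℝ → ℝ → P}
    (hW : ContMDiffAt (𝓘(ℝ, ℝ).prod 𝓘(ℝ, ℝ)) 𝓘(ℝ, F) ∞ (Function.uncurry W) (0, 0)) :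
    (velocity F (fun t => W t t) : F) = (velocity F (fun t => W t 0) : F) +
      (velocity F (fun t => W 0 t) : F) := by
  have hd : MDifferentiableAt (𝓘(ℝ, ℝ).prod 𝓘(ℝ, ℝ)) 𝓘(ℝ, F) (Function.uncurry W) (0, 0) :=
    hW.mdiffAt_of_infty
  have h1 : MDifferentiableAt 𝓘(ℝ, ℝ) (𝓘(ℝ, ℝ).prod 𝓘(ℝ, ℝ)) (fun t : ℝ => (t, t)) 0 :=
    mdifferentiableAt_id.prodMk mdifferentiableAt_id
  have h2 : (velocity F (fun t => W t t) : F) =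
      mfderiv (𝓘(ℝ, ℝ).prod 𝓘(ℝ, ℝ)) 𝓘(ℝ, F) (Function.uncurry W) (0, 0)
        (mfderiv 𝓘(ℝ, ℝ) (𝓘(ℝ, ℝ).prod 𝓘(ℝ, ℝ)) (fun t : ℝ => (t, t)) 0 (1 : ℝ)) :=
    mfderiv_comp_apply (g := Function.uncurry W) (f := fun t : ℝ => (t, t)) (0 : ℝ) hd h1 (1 : ℝ)
  rw [h2, mfderiv_prod_eq_add_apply hd]
  have h3 : (mfderiv 𝓘(ℝ, ℝ) (𝓘(ℝ, ℝ).prod 𝓘(ℝ, ℝ)) (fun t : ℝ => (t, t)) 0 (1 : ℝ) : ℝ × ℝ) =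
      (1, 1) := by
    have := mfderiv_prodMk (I := 𝓘(ℝ, ℝ)) (x := (0 : ℝ)) (f := fun t : ℝ => t)
      (g := fun t : ℝ => t) (I' := 𝓘(ℝ, ℝ)) (I'' := 𝓘(ℝ, ℝ)) mdifferentiableAt_id
      mdifferentiableAt_id
    rw [this]
    change ((mfderiv 𝓘(ℝ, ℝ) 𝓘(ℝ, ℝ) (id : ℝ → ℝ) 0 (1 : ℝ) : ℝ),
      (mfderiv 𝓘(ℝ, ℝ) 𝓘(ℝ, ℝ) (id : ℝ → ℝ) 0 (1 : ℝ) : ℝ)) = (1, 1)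
    rw [mfderiv_id]
    rfl
  have h4 := congrArg Prod.fst h3
  have h5 := congrArg Prod.snd h3
  exact congrArg₂ (· + ·)
    (congrArg (fun z : ℝ => (mfderiv 𝓘(ℝ, ℝ) 𝓘(ℝ, F) (fun t => W t 0) 0 z : F)) h4)
    (congrArg (fun z : ℝ => (mfderiv 𝓘(ℝ, ℝ) 𝓘(ℝ, F) (fun t => W 0 t) 0 z : F)) h5)

/-! ### Vector fields in coordinates -/

/-- The coordinate expression of a vector field in the preferred chart at `p`. -/
def localVF (p : P) (X : Π q : P, TangentSpace 𝓘(ℝ, F) q) (z : F) : F :=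
  tcoord F p ((extChartAt 𝓘(ℝ, F) p).symm z) (X ((extChartAt 𝓘(ℝ, F) p).symm z))

omit [IsManifold 𝓘(ℝ, F) ∞ P] in
theorem localVF_extChartAt (p : P) (X : Π q : P, TangentSpace 𝓘(ℝ, F) q) {q : P}
    (hq : q ∈ (chartAt F p).source) :
    localVF p X (extChartAt 𝓘(ℝ, F) p q) = tcoord F p q (X q) := by
  unfold localVF
  rw [(extChartAt 𝓘(ℝ, F) p).left_inv (by rwa [extChartAt_source])]

omit [IsManifold 𝓘(ℝ, F) ∞ P] in
theorem eventually_mem_target (p : P) :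
    ∀ᶠ z in 𝓝 (extChartAt 𝓘(ℝ, F) p p), z ∈ (extChartAt 𝓘(ℝ, F) p).target :=
  extChartAt_target_mem_nhds p

theorem contMDiffAt_extChartAt_symm_infty (p : P) :
    ContMDiffAt 𝓘(ℝ, F) 𝓘(ℝ, F) ∞ (extChartAt 𝓘(ℝ, F) p).symm (extChartAt 𝓘(ℝ, F) p p) :=
  (contMDiffOn_extChartAt_symm p).contMDiffAt (extChartAt_target_mem_nhds p)

theorem contDiffAt_localVF {p : P} {X : Π q : P, TangentSpace 𝓘(ℝ, F) q}
    (hX : ContMDiffAt 𝓘(ℝ, F) (𝓘(ℝ, F).prod 𝓘(ℝ, F)) ∞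
      (fun q => (⟨q, X q⟩ : TangentBundle 𝓘(ℝ, F) P)) p) :
    ContDiffAt ℝ ∞ (localVF p X) (extChartAt 𝓘(ℝ, F) p p) := by
  have h1 : ContMDiffAt 𝓘(ℝ, F) 𝓘(ℝ, F) ∞ (fun q => tcoord F p q (X q)) p :=
    contMDiffAt_tcoord (mem_chart_source F p) hX
  have h2 : ContMDiffAt 𝓘(ℝ, F) 𝓘(ℝ, F) ∞ (localVF p X) (extChartAt 𝓘(ℝ, F) p p) :=
    ContMDiffAt.comp_of_eq h1 (contMDiffAt_extChartAt_symm_infty p) (extChartAt_to_inv p)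
  exact h2.contDiffAt

/-- The bracket of vector fields is computed in a chart. -/
theorem mlieBracket_eq_lieBracket_localVF [CompleteSpace F] (p : P)
    (X Y : Π q : P, TangentSpace 𝓘(ℝ, F) q) :
    (mlieBracket 𝓘(ℝ, F) X Y p : F) =
      lieBracket ℝ (localVF p X) (localVF p Y) (extChartAt 𝓘(ℝ, F) p p) := by
  have : IsManifold 𝓘(ℝ, F) 1 P := .of_le (n := ∞) (by simp)
  have key : ∀ X : Π q : P, TangentSpace 𝓘(ℝ, F) q,
      mpullbackWithin 𝓘(ℝ, F) 𝓘(ℝ, F) (extChartAt 𝓘(ℝ, F) p).symm X (Set.range 𝓘(ℝ, F))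
        =ᶠ[𝓝 (extChartAt 𝓘(ℝ, F) p p)] localVF p X := by
    intro X
    filter_upwards [eventually_mem_target p] with z hz
    rw [mpullbackWithin_apply]
    have h1 := mfderiv_extChartAt_comp_mfderivWithin_extChartAt_symm (I := 𝓘(ℝ, F)) hz
    have h2 := isInvertible_mfderivWithin_extChartAt_symm (I := 𝓘(ℝ, F)) hz
    have h3 := mfderivWithin_extChartAt_symm_comp_mfderiv_extChartAt (I := 𝓘(ℝ, F)) hz
    exact h2.inverse_apply_eq.2 (DFunLike.congr_fun h3 (X _)).symm
  have hid : ∀ w : TangentSpace 𝓘(ℝ, F) (extChartAt 𝓘(ℝ, F) p p),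
      (mfderiv 𝓘(ℝ, F) 𝓘(ℝ, F) (extChartAt 𝓘(ℝ, F) p) p).inverse w =
        (show TangentSpace 𝓘(ℝ, F) p from w) := fun w =>
    (isInvertible_mfderiv_extChartAt (mem_extChartAt_source p)).inverse_apply_eq.2
      (tcoord_self (F := F) p _).symm
  refine (hid _).trans ?_
  simp only [Set.preimage_univ, Set.univ_inter, modelWithCornersSelf_coe, Set.range_id]
  have h := (key X).lieBracket_vectorField_eq (𝕜 := ℝ) (key Y)
  simp only [modelWithCornersSelf_coe, Set.range_id] at h
  exact (congrFun (lieBracketWithin_univ (𝕜 := ℝ) (E := F)) _).trans h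

omit [IsManifold 𝓘(ℝ, F) ∞ P] in
theorem Filter.EventuallyEq.mvfderiv_apply {f g : P → G} {p : P} (h : f =ᶠ[𝓝 p] g)
    (v : TangentSpace 𝓘(ℝ, F) p) : mvfderiv 𝓘(ℝ, F) f p v = mvfderiv 𝓘(ℝ, F) g p v :=
  congrArg (fun L : F →L[ℝ] G => L v) h.mfderiv_eq

/-- The derivative of a function along a tangent vector is computed in a chart. -/
theorem mfderiv_eq_fderiv_tcoord {f : P → G} {p q : P} (hq : q ∈ (chartAt F p).source)
    (hf : MDifferentiableAt 𝓘(ℝ, F) 𝓘(ℝ, G) f q) (v : TangentSpace 𝓘(ℝ, F) q) :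
    (mfderiv 𝓘(ℝ, F) 𝓘(ℝ, G) f q v : G) =
      fderiv ℝ (f ∘ (extChartAt 𝓘(ℝ, F) p).symm) (extChartAt 𝓘(ℝ, F) p q) (tcoord F p q v) := by
  have : IsManifold 𝓘(ℝ, F) 1 P := .of_le (n := ∞) (by simp)
  have hq' : q ∈ (extChartAt 𝓘(ℝ, F) p).source := by rwa [extChartAt_source]
  have hz := (extChartAt 𝓘(ℝ, F) p).map_source hq'
  have h1 : MDifferentiableAt 𝓘(ℝ, F) 𝓘(ℝ, F) (extChartAt 𝓘(ℝ, F) p).symm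
      (extChartAt 𝓘(ℝ, F) p q) :=
    ((contMDiffOn_extChartAt_symm (n := 1) p).contMDiffAt
      (extChartAt_target_mem_nhds' hz)).mdifferentiableAt (by simp)
  have hinv := (extChartAt 𝓘(ℝ, F) p).left_inv hq'
  have h2 : MDifferentiableAt 𝓘(ℝ, F) 𝓘(ℝ, G) (f ∘ (extChartAt 𝓘(ℝ, F) p).symm)
      (extChartAt 𝓘(ℝ, F) p q) :=
    MDifferentiableAt.comp (extChartAt 𝓘(ℝ, F) p q) (by rwa [hinv]) h1
  have h3 : f =ᶠ[𝓝 q] (f ∘ (extChartAt 𝓘(ℝ, F) p).symm) ∘ extChartAt 𝓘(ℝ, F) p := by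
    filter_upwards [extChartAt_source_mem_nhds' hq'] with q' hq''
    simp only [Function.comp_apply]
    rw [(extChartAt 𝓘(ℝ, F) p).left_inv hq'']
  rw [h3.mfderiv_eq]
  refine (mfderiv_comp_apply q h2 (mdifferentiableAt_extChartAt hq) v).trans ?_
  rw [mfderiv_eq_fderiv]
  rfl

/-- The bracket of vector fields acts on functions as a commutator. -/
theorem mfderiv_mlieBracket [CompleteSpace F] {f : P → G} {p : P}
    {X Y : Π q : P, TangentSpace 𝓘(ℝ, F) q}
    (hf : ContMDiffAt 𝓘(ℝ, F) 𝓘(ℝ, G) ∞ f p)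
    (hX : ContMDiffAt 𝓘(ℝ, F) (𝓘(ℝ, F).prod 𝓘(ℝ, F)) ∞
      (fun q => (⟨q, X q⟩ : TangentBundle 𝓘(ℝ, F) P)) p)
    (hY : ContMDiffAt 𝓘(ℝ, F) (𝓘(ℝ, F).prod 𝓘(ℝ, F)) ∞
      (fun q => (⟨q, Y q⟩ : TangentBundle 𝓘(ℝ, F) P)) p) :
    mvfderiv 𝓘(ℝ, F) f p (mlieBracket 𝓘(ℝ, F) X Y p) =
      mvfderiv 𝓘(ℝ, F) (fun q => mvfderiv 𝓘(ℝ, F) f q (Y q)) p (X p) -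
      mvfderiv 𝓘(ℝ, F) (fun q => mvfderiv 𝓘(ℝ, F) f q (X q)) p (Y p) := by
  set z₀ := extChartAt 𝓘(ℝ, F) p p with hz₀
  set fh : F → G := f ∘ (extChartAt 𝓘(ℝ, F) p).symm with hfh
  have hfh' : ContDiffAt ℝ ∞ fh z₀ :=
    (ContMDiffAt.comp_of_eq hf (contMDiffAt_extChartAt_symm_infty p)
      (extChartAt_to_inv p)).contDiffAt
  have hsrc : ∀ᶠ q in 𝓝 p, q ∈ (chartAt F p).source :=
    (chartAt F p).open_source.mem_nhds (mem_chart_source F p)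
  have hdf : ∀ᶠ q in 𝓝 p, MDifferentiableAt 𝓘(ℝ, F) 𝓘(ℝ, G) f q :=
    hf.eventually_one.mono fun q h => h.mdifferentiableAt (by simp)
  have hD2 : DifferentiableAt ℝ (fderiv ℝ fh) z₀ :=
    (hfh'.fderiv_right (m := 1) (by norm_cast)).differentiableAt (by simp)
  -- the commutator is computed in the chart, where the second derivatives are symmetric
  have key : ∀ (X Y : Π q : P, TangentSpace 𝓘(ℝ, F) q), ContMDiffAt 𝓘(ℝ, F)
      (𝓘(ℝ, F).prod 𝓘(ℝ, F)) ∞ (fun q => (⟨q, Y q⟩ : TangentBundle 𝓘(ℝ, F) P)) p →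
      mvfderiv 𝓘(ℝ, F) (fun q => mvfderiv 𝓘(ℝ, F) f q (Y q)) p (X p) =
        fderiv ℝ (fderiv ℝ fh) z₀ (X p : F) (Y p : F) +
          fderiv ℝ fh z₀ (fderiv ℝ (localVF p Y) z₀ (X p : F)) := by
    intro X Y hY
    have e1 : (fun q => mvfderiv 𝓘(ℝ, F) f q (Y q)) =ᶠ[𝓝 p]
        (fun z => fderiv ℝ fh z (localVF p Y z)) ∘ extChartAt 𝓘(ℝ, F) p := by
      filter_upwards [hsrc, hdf] with q hq hd
      rw [Function.comp_apply, localVF_extChartAt p Y hq]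
      exact mfderiv_eq_fderiv_tcoord hq hd (Y q)
    have hYd : DifferentiableAt ℝ (localVF p Y) z₀ :=
      (contDiffAt_localVF hY).differentiableAt (by simp)
    have e2 : HasFDerivAt (fun z => fderiv ℝ fh z (localVF p Y z))
        ((fderiv ℝ fh z₀).comp (fderiv ℝ (localVF p Y) z₀) +
          (fderiv ℝ (fderiv ℝ fh) z₀).flip (localVF p Y z₀)) z₀ :=
      hD2.hasFDerivAt.clm_apply hYd.hasFDerivAt
    have e3 : MDifferentiableAt 𝓘(ℝ, F) 𝓘(ℝ, G) (fun z => fderiv ℝ fh z (localVF p Y z)) z₀ :=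
      mdifferentiableAt_iff_differentiableAt.2 e2.differentiableAt
    have e4 : mvfderiv 𝓘(ℝ, F) ((fun z => fderiv ℝ fh z (localVF p Y z)) ∘
        extChartAt 𝓘(ℝ, F) p) p (X p) =
        fderiv ℝ (fun z => fderiv ℝ fh z (localVF p Y z)) z₀ (tcoord F p p (X p)) := by
      have h := mfderiv_comp_apply p (I := 𝓘(ℝ, F)) (f := extChartAt 𝓘(ℝ, F) p) e3
        (mdifferentiableAt_extChartAt (mem_chart_source F p)) (X p)
      refine h.trans ?_
      rw [mfderiv_eq_fderiv]
      rfl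
    have e5 : localVF p Y z₀ = (Y p : F) := by
      rw [hz₀, localVF_extChartAt p Y (mem_chart_source F p), tcoord_self]
    refine (e1.mvfderiv_apply _).trans (e4.trans ?_)
    rw [e2.fderiv, e5, tcoord_self, add_comm]
    rfl
  rw [key X Y hY, key Y X hX]
  have hsymm : IsSymmSndFDerivAt ℝ fh z₀ :=
    (hfh'.of_le (m := 2) (by norm_cast)).isSymmSndFDerivAt (by simp)
  have h1 := mfderiv_eq_fderiv_tcoord (mem_chart_source F p) hf.mdiffAt_of_infty
    (mlieBracket 𝓘(ℝ, F) X Y p)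
  refine h1.trans ?_
  have h2 : tcoord F p p (mlieBracket 𝓘(ℝ, F) X Y p) =
      lieBracket ℝ (localVF p X) (localVF p Y) z₀ :=
    (tcoord_self p _).trans (mlieBracket_eq_lieBracket_localVF p X Y)
  have e5 : ∀ Y : Π q : P, TangentSpace 𝓘(ℝ, F) q, localVF p Y z₀ = (Y p : F) := by
    intro Y
    rw [hz₀, localVF_extChartAt p Y (mem_chart_source F p), tcoord_self]
  rw [h2, lieBracket_eq]
  simp only [e5]
  have h3 : fderiv ℝ (fderiv ℝ fh) z₀ (X p : F) (Y p : F) =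
    fderiv ℝ (fderiv ℝ fh) z₀ (Y p : F) (X p : F) := hsymm.eq _ _
  have h4 := map_sub (fderiv ℝ fh z₀) (fderiv ℝ (localVF p Y) z₀ (X p : F))
    (fderiv ℝ (localVF p X) z₀ (Y p : F))
  refine h4.trans ?_
  rw [h3]
  abel

end ManifoldBracket

/-! ### First-order variation of a vector field along a flow -/

noncomputable section FlowBracket

variable {F : Type*} [NormedAddCommGroup F] [NormedSpace ℝ F] {P : Type*} [TopologicalSpace P]
  [ChartedSpace F P] [IsManifold 𝓘(ℝ, F) ∞ P]
  {G : Type*} [NormedAddCommGroup G] [NormedSpace ℝ G]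
  {V W : Type*} [NormedAddCommGroup V] [NormedSpace ℝ V] [NormedAddCommGroup W] [NormedSpace ℝ W]

theorem contDiffAt_of_contMDiffAt_prod {f : V × W → G} {x : V × W}
    (h : ContMDiffAt (𝓘(ℝ, V).prod 𝓘(ℝ, W)) 𝓘(ℝ, G) ∞ f x) : ContDiffAt ℝ ∞ f x := by
  rw [← contMDiffAt_iff_contDiffAt, modelWithCornersSelf_prod, ← chartedSpaceSelf_prod]
  exact h

/-- Symmetry of the mixed second derivatives of a one-parameter family of maps. -/
theorem ContDiffAt.hasDerivAt_fderiv_family {h : ℝ × F → G} {z₀ : F}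
    (hh : ContDiffAt ℝ ∞ h (0, z₀)) (y : F) :
    HasDerivAt (fun t => fderiv ℝ (fun z => h (t, z)) z₀ y)
      (fderiv ℝ (fun z => deriv (fun t => h (t, z)) 0) z₀ y) 0 := by
  have hd : ∀ᶠ w in 𝓝 ((0 : ℝ), z₀), DifferentiableAt ℝ h w :=
    ((hh.of_le (m := 1) (by norm_cast)).eventually (by simp)).mono
      fun w hw => hw.differentiableAt (by simp)
  have hD2 : DifferentiableAt ℝ (fderiv ℝ h) (0, z₀) :=
    (hh.fderiv_right (m := 1) (by norm_cast)).differentiableAt (by simp)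
  have hsymm : IsSymmSndFDerivAt ℝ h (0, z₀) :=
    (hh.of_le (m := 2) (by norm_cast)).isSymmSndFDerivAt (by simp)
  have c1 : HasDerivAt (fun t : ℝ => (t, z₀)) ((1 : ℝ), (0 : F)) 0 :=
    (hasDerivAt_id 0).prodMk (hasDerivAt_const 0 z₀)
  have c2 : HasFDerivAt (fun z : F => ((0 : ℝ), z)) (ContinuousLinearMap.inr ℝ ℝ F) z₀ :=
    hasFDerivAt_prodMk_right 0 z₀
  -- both sides are values of the second derivative of `h` on `(1, 0)` and `(0, y)`
  have e1 : (fun t => fderiv ℝ (fun z => h (t, z)) z₀ y) =ᶠ[𝓝 0]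
      fun t => fderiv ℝ h (t, z₀) (0, y) := by
    filter_upwards [c1.continuousAt.eventually hd] with t ht
    have : HasFDerivAt (fun z => h (t, z)) _ z₀ :=
      ht.hasFDerivAt.comp z₀ (hasFDerivAt_prodMk_right t z₀)
    rw [this.fderiv]
    simp
  have e2 : (fun z => deriv (fun t => h (t, z)) 0) =ᶠ[𝓝 z₀]
      fun z => fderiv ℝ h (0, z) (1, 0) := by
    filter_upwards [c2.continuousAt.eventually hd] with z hz
    have : HasDerivAt (fun t => h (t, z)) _ 0 :=
      hz.hasFDerivAt.comp_hasDerivAt (0 : ℝ) ((hasDerivAt_id (0 : ℝ)).prodMk (hasDerivAt_const 0 z))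
    rw [this.deriv]
  have d1 : HasDerivAt (fun t => fderiv ℝ h (t, z₀) (0, y))
      (fderiv ℝ (fderiv ℝ h) (0, z₀) (1, 0) (0, y)) 0 := by
    have h1 : HasDerivAt (fun t : ℝ => fderiv ℝ h (t, z₀)) (fderiv ℝ (fderiv ℝ h) (0, z₀) (1, 0)) 0 :=
      hD2.hasFDerivAt.comp_hasDerivAt (0 : ℝ) c1
    exact (ContinuousLinearMap.apply ℝ G ((0 : ℝ), y)).hasFDerivAt.comp_hasDerivAt (0 : ℝ) h1
  have d2 : HasFDerivAt (fun z => fderiv ℝ h (0, z) (1, 0))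
      ((ContinuousLinearMap.apply ℝ G ((1 : ℝ), (0 : F))).comp
        ((fderiv ℝ (fderiv ℝ h) (0, z₀)).comp (ContinuousLinearMap.inr ℝ ℝ F))) z₀ :=
    (ContinuousLinearMap.apply ℝ G ((1 : ℝ), (0 : F))).hasFDerivAt.comp z₀
      (hD2.hasFDerivAt.comp z₀ c2)
  rw [e2.fderiv_eq, d2.fderiv]
  have h3 : fderiv ℝ (fderiv ℝ h) (0, z₀) (1, 0) (0, y) =
    fderiv ℝ (fderiv ℝ h) (0, z₀) (0, y) (1, 0) := hsymm.eq _ _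
  refine (d1.congr_of_eventuallyEq e1).congr_deriv ?_
  rw [h3]
  simp

/-- Let `Φ` be a smooth one-parameter family of maps with `Φ₀ = id` and initial velocity `X`. Then
the derivative at time zero of the difference between `dΦ_t (Y p)` and `Y (Φ_t p)` is
`-[X, Y] p`. -/
theorem hasDerivAt_flow_sub [CompleteSpace F] {p : P} {Φ : ℝ → P → P}
    {X Y : Π q : P, TangentSpace 𝓘(ℝ, F) q}
    (hΦ : ContMDiffAt (𝓘(ℝ, ℝ).prod 𝓘(ℝ, F)) 𝓘(ℝ, F) ∞ (Function.uncurry Φ) (0, p))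
    (h0 : ∀ᶠ q in 𝓝 p, Φ 0 q = q)
    (hX : ∀ᶠ q in 𝓝 p, (velocity F (fun t => Φ t q) : F) = X q)
    (hY : ContMDiffAt 𝓘(ℝ, F) (𝓘(ℝ, F).prod 𝓘(ℝ, F)) ∞
      (fun q => (⟨q, Y q⟩ : TangentBundle 𝓘(ℝ, F) P)) p) :
    HasDerivAt (fun t => tcoord F p (Φ t p) (mfderiv 𝓘(ℝ, F) 𝓘(ℝ, F) (Φ t) p (Y p)) -
      tcoord F p (Φ t p) (Y (Φ t p))) (-(mlieBracket 𝓘(ℝ, F) X Y p : F)) 0 := by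
  set φ := extChartAt 𝓘(ℝ, F) p with hφ
  set z₀ := φ p with hz₀
  have hp0 : Φ 0 p = p := h0.self_of_nhds
  have hsrc : ∀ᶠ q in 𝓝 p, q ∈ (chartAt F p).source :=
    (chartAt F p).open_source.mem_nhds (mem_chart_source F p)
  have hφ' : ∀ {q}, q ∈ (chartAt F p).source → MDifferentiableAt 𝓘(ℝ, F) 𝓘(ℝ, F) φ q :=
    fun hq => (contMDiffAt_extChartAt_infty hq).mdiffAt_of_infty
  -- the family in the chart
  set h : ℝ × F → F := fun w => φ (Φ w.1 (φ.symm w.2)) with hh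
  have hsm : ContDiffAt ℝ ∞ h (0, z₀) := by
    apply contDiffAt_of_contMDiffAt_prod
    have h1 : ContMDiffAt (𝓘(ℝ, ℝ).prod 𝓘(ℝ, F)) (𝓘(ℝ, ℝ).prod 𝓘(ℝ, F)) ∞
        (fun w : ℝ × F => (w.1, φ.symm w.2)) (0, z₀) :=
      contMDiffAt_fst.prodMk
        (ContMDiffAt.comp ((0 : ℝ), z₀) (contMDiffAt_extChartAt_symm_infty p) contMDiffAt_snd)
    have h2 : ContMDiffAt (𝓘(ℝ, ℝ).prod 𝓘(ℝ, F)) 𝓘(ℝ, F) ∞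
        (fun w : ℝ × F => Φ w.1 (φ.symm w.2)) (0, z₀) := by
      refine ContMDiffAt.comp_of_eq hΦ h1 ?_
      simp [hz₀, hφ]
    refine ContMDiffAt.comp_of_eq (contMDiffAt_extChartAt_infty (mem_chart_source F p)) h2 ?_
    simp [hz₀, hφ, hp0]
  have hΦ1 := hΦ.eventually_one
  have hcurve : ContinuousAt (fun t : ℝ => (t, p)) 0 := by fun_prop
  have hΦp : ∀ᶠ t in 𝓝 (0 : ℝ), Φ t p ∈ (chartAt F p).source := by
    have : ContinuousAt (fun t : ℝ => Φ t p) 0 :=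
      ContinuousAt.comp (f := fun t : ℝ => (t, p)) (g := Function.uncurry Φ) hΦ.continuousAt hcurve
    refine this.eventually ((chartAt F p).open_source.mem_nhds ?_)
    change Φ 0 p ∈ _
    rw [hp0]; exact mem_chart_source F p
  -- in the chart, the first term is the derivative of the family in the direction of `Y p`
  have t1 : (fun t => tcoord F p (Φ t p) (mfderiv 𝓘(ℝ, F) 𝓘(ℝ, F) (Φ t) p (Y p))) =ᶠ[𝓝 0]
      fun t => fderiv ℝ (fun z => h (t, z)) z₀ (Y p : F) := by
    filter_upwards [hΦp, hcurve.eventually hΦ1] with t ht ht1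
    have hd : MDifferentiableAt 𝓘(ℝ, F) 𝓘(ℝ, F) (Φ t) p := by
      have h2 : MDifferentiableAt 𝓘(ℝ, F) (𝓘(ℝ, ℝ).prod 𝓘(ℝ, F)) (fun q : P => (t, q)) p :=
        mdifferentiableAt_const.prodMk mdifferentiableAt_id
      exact MDifferentiableAt.comp p (g := Function.uncurry Φ) (ht1.mdifferentiableAt (by simp)) h2
    have e1 := mfderiv_comp_apply p (hφ' ht) hd (Y p)
    have e2 := mfderiv_eq_fderiv_tcoord (mem_chart_source F p) ((hφ' ht).comp p hd) (Y p)
    refine e1.symm.trans (e2.trans ?_)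
    rw [tcoord_self]
    rfl
  -- in the chart, the second term is the value of `Y` along the curve through `z₀`
  have hYd : DifferentiableAt ℝ (localVF p Y) z₀ :=
    (contDiffAt_localVF hY).differentiableAt (by simp)
  have t2 : (fun t => tcoord F p (Φ t p) (Y (Φ t p))) =ᶠ[𝓝 0]
      fun t => localVF p Y (h (t, z₀)) := by
    filter_upwards [hΦp] with t ht
    have : φ.symm z₀ = p := extChartAt_to_inv p
    simp only [hh, this]
    exact (localVF_extChartAt p Y ht).symm
  -- the initial velocity in the chart
  have hXl : (fun z => deriv (fun t => h (t, z)) 0) =ᶠ[𝓝 z₀] localVF p X := by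
    have hc : Filter.Tendsto φ.symm (𝓝 z₀) (𝓝 p) := by
      have := continuousAt_extChartAt_symm (I := 𝓘(ℝ, F)) p
      rwa [ContinuousAt, extChartAt_to_inv] at this
    have hc2 : ContinuousAt (fun q : P => ((0 : ℝ), q)) p := by fun_prop
    filter_upwards [hc.eventually hX, hc.eventually h0, hc.eventually hsrc,
      hc.eventually (hc2.eventually hΦ1)] with z hz hz0 hzs hz1
    have hg : MDifferentiableAt 𝓘(ℝ, ℝ) 𝓘(ℝ, F) (fun t => Φ t (φ.symm z)) 0 := by
      have h2 : MDifferentiableAt 𝓘(ℝ, ℝ) (𝓘(ℝ, ℝ).prod 𝓘(ℝ, F))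
          (fun t : ℝ => (t, φ.symm z)) 0 :=
        mdifferentiableAt_id.prodMk mdifferentiableAt_const
      exact MDifferentiableAt.comp (0 : ℝ) (g := Function.uncurry Φ)
        (hz1.mdifferentiableAt (by simp)) h2
    have h3 := (hasDerivAt_velocity hz0 hg (hφ' hzs)).deriv
    refine h3.trans ?_
    exact congrArg (fun v : F => tcoord F p (φ.symm z) v) hz
  have hX0 : deriv (fun t => h (t, z₀)) 0 = localVF p X z₀ := hXl.self_of_nhds
  have hYX : ∀ Y : Π q : P, TangentSpace 𝓘(ℝ, F) q, localVF p Y z₀ = (Y p : F) := by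
    intro Y
    rw [hz₀, localVF_extChartAt p Y (mem_chart_source F p), tcoord_self]
  -- by the symmetry of mixed derivatives the first term contributes `dX(Y)`, and the second one
  -- `dY(X)` by the chain rule
  have d1 := hsm.hasDerivAt_fderiv_family (Y p : F)
  rw [hXl.fderiv_eq] at d1
  have hcd : DifferentiableAt ℝ (fun t : ℝ => h (t, z₀)) 0 :=
    DifferentiableAt.comp (0 : ℝ) (g := h) (hsm.differentiableAt (by simp))
      (differentiableAt_id.prodMk (differentiableAt_const _))
  have hhz : h (0, z₀) = z₀ := by
    have : φ.symm z₀ = p := extChartAt_to_inv p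
    change φ (Φ 0 (φ.symm z₀)) = z₀
    rw [this, hp0]
  have d2 : HasDerivAt (fun t => localVF p Y (h (t, z₀)))
      (fderiv ℝ (localVF p Y) z₀ (localVF p X z₀)) 0 := by
    have := hcd.hasDerivAt
    rw [hX0] at this
    have h5 : HasFDerivAt (localVF p Y) (fderiv ℝ (localVF p Y) z₀) (h (0, z₀)) := by
      rw [hhz]
      exact hYd.hasFDerivAt
    exact h5.comp_hasDerivAt (0 : ℝ) this
  have d3 := (d1.congr_of_eventuallyEq t1).sub (d2.congr_of_eventuallyEq t2)
  refine d3.congr_deriv ?_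
  have e1 : (mlieBracket 𝓘(ℝ, F) X Y p : F) = lieBracket ℝ (localVF p X) (localVF p Y) z₀ :=
    mlieBracket_eq_lieBracket_localVF p X Y
  refine Eq.trans ?_ (congrArg (fun v : F => -v) e1).symm
  have e2 : lieBracket ℝ (localVF p X) (localVF p Y) z₀ =
      fderiv ℝ (localVF p Y) z₀ (localVF p X z₀) - fderiv ℝ (localVF p X) z₀ (Y p : F) :=
    congrArg (fun v : F => fderiv ℝ (localVF p Y) z₀ (localVF p X z₀) -
      fderiv ℝ (localVF p X) z₀ v) (hYX Y)
  rw [e2]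
  exact (neg_sub _ _).symm

end FlowBracket

/-! ### Source charts -/

noncomputable section SourceCharts

universe u v w z

variable {E : Type u} [NormedAddCommGroup E] [NormedSpace ℝ E]
  {M : Type v} [TopologicalSpace M] [ChartedSpace E M] [IsManifold 𝓘(ℝ, E) ∞ M]
  {F : Type w} [NormedAddCommGroup F] [NormedSpace ℝ F]
  {𝒢 : Type z} [TopologicalSpace 𝒢] [ChartedSpace F 𝒢] [IsManifold 𝓘(ℝ, F) ∞ 𝒢]

namespace LieGroupoid

variable (G : LieGroupoid E M F 𝒢)

/-- A chart of `𝒢` in which the source map is the first projection of `M × ℝ^r`. -/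
structure SourceChart where
  chart : OpenPartialHomeomorph 𝒢 (M × (Fin G.lieAlgebroid.rank → ℝ))
  contMDiffOn : ContMDiffOn 𝓘(ℝ, F) (𝓘(ℝ, E).prod 𝓘(ℝ, Fin G.lieAlgebroid.rank → ℝ)) ∞
    chart chart.source
  contMDiffOn_symm : ContMDiffOn (𝓘(ℝ, E).prod 𝓘(ℝ, Fin G.lieAlgebroid.rank → ℝ)) 𝓘(ℝ, F) ∞
    chart.symm chart.target
  fst_eq : ∀ g ∈ chart.source, (chart g).1 = G.src g

/-- The source map is a submersion, so it has the form of a projection near every arrow. The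
complement that the submersion provides has dimension `dim 𝒢 - dim M`, the rank of the algebroid. -/
theorem exists_sourceChart [FiniteDimensional ℝ F] (g : 𝒢) :
    ∃ e : G.SourceChart, g ∈ e.chart.source := by
  have h := G.isSubmersion_src.isSubmersionAt g
  have : FiniteDimensional ℝ (E × h.complement) :=
    LinearEquiv.finiteDimensional h.equiv.toLinearEquiv
  have : FiniteDimensional ℝ E :=
    FiniteDimensional.of_surjective (LinearMap.fst ℝ E h.complement) Prod.fst_surjective
  have : FiniteDimensional ℝ h.complement :=
    FiniteDimensional.of_surjective (LinearMap.snd ℝ E h.complement) Prod.snd_surjective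
  have hr : finrank ℝ h.complement = finrank ℝ (Fin G.lieAlgebroid.rank → ℝ) := by
    have h1 := h.equiv.toLinearEquiv.finrank_eq
    rw [Module.finrank_prod] at h1
    rw [Module.finrank_fin_fun]
    change _ = finrank ℝ F - finrank ℝ E
    omega
  -- the abstract complement is identified with `ℝ^r`
  let L : h.complement ≃L[ℝ] (Fin G.lieAlgebroid.rank → ℝ) := ContinuousLinearEquiv.ofFinrankEq hr
  let e₁ : OpenPartialHomeomorph 𝒢 (E × h.complement) :=
    h.domChart ≫ₕ h.equiv.toHomeomorph.toOpenPartialHomeomorph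
  let e : OpenPartialHomeomorph 𝒢 (M × (Fin G.lieAlgebroid.rank → ℝ)) :=
    e₁ ≫ₕ (h.codChart.symm.prod L.toHomeomorph.toOpenPartialHomeomorph)
  -- in the charts of the submersion the source map is the first projection
  have hw : ∀ g ∈ h.domChart.source, (h.equiv (h.domChart g)).1 = h.codChart (G.src g) := by
    intro g hg
    have h0 : h.domChart g ∈ (h.domChart.extend 𝓘(ℝ, F)).target := by
      simpa using h.domChart.map_source hg
    have h1 := h.writtenInCharts h0
    simpa [h.domChart.left_inv hg] using h1.symm
  have hsrc : e.source ⊆ h.domChart.source := by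
    intro g hg
    simp only [e, e₁, mfld_simps] at hg
    exact hg.1
  have hcod : ∀ g ∈ h.domChart.source, G.src g ∈ h.codChart.source :=
    fun g hg => h.source_subset_preimage_source hg
  have hcc := contMDiffOn_symm_of_mem_maximalAtlas h.codChart_mem_maximalAtlas
  have hcc' := contMDiffOn_of_mem_maximalAtlas h.codChart_mem_maximalAtlas
  have hdc := contMDiffOn_of_mem_maximalAtlas h.domChart_mem_maximalAtlas
  have hdc' := contMDiffOn_symm_of_mem_maximalAtlas h.domChart_mem_maximalAtlas
  have heq : ContMDiff 𝓘(ℝ, F) 𝓘(ℝ, E × h.complement) ∞ h.equiv := h.equiv.contDiff.contMDiff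
  have heq' : ContMDiff 𝓘(ℝ, E × h.complement) 𝓘(ℝ, F) ∞ h.equiv.symm :=
    h.equiv.symm.contDiff.contMDiff
  refine ⟨⟨e, ?_, ?_, ?_⟩, ?_⟩
  · have h1 : ContMDiffOn 𝓘(ℝ, F) 𝓘(ℝ, E × h.complement) ∞ (fun g => h.equiv (h.domChart g))
        h.domChart.source := heq.comp_contMDiffOn hdc
    have h2 : ContMDiffOn 𝓘(ℝ, F) 𝓘(ℝ, E) ∞ (fun g => (h.equiv (h.domChart g)).1)
        h.domChart.source :=
      (ContinuousLinearMap.fst ℝ E h.complement).contDiff.contMDiff.comp_contMDiffOn h1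
    have h3 : ContMDiffOn 𝓘(ℝ, F) 𝓘(ℝ, Fin G.lieAlgebroid.rank → ℝ) ∞
        (fun g => L (h.equiv (h.domChart g)).2) h.domChart.source :=
      ((L : h.complement →L[ℝ] (Fin G.lieAlgebroid.rank → ℝ)).comp
        (ContinuousLinearMap.snd ℝ E h.complement)).contDiff.contMDiff.comp_contMDiffOn h1
    refine ContMDiffOn.prodMk ?_ (h3.mono hsrc)
    refine hcc.comp (h2.mono hsrc) ?_
    intro g hg
    have := hw g (hsrc hg)
    change (h.equiv (h.domChart g)).1 ∈ h.codChart.target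
    rw [this]
    exact h.codChart.map_source (hcod g (hsrc hg))
  · have htgt : ∀ p ∈ e.target, p.1 ∈ h.codChart.source ∧
        h.equiv.symm (h.codChart p.1, L.symm p.2) ∈ h.domChart.target := by
      intro p hp
      simp only [e, e₁, mfld_simps] at hp
      exact hp
    have h1 : ContMDiffOn (𝓘(ℝ, E).prod 𝓘(ℝ, Fin G.lieAlgebroid.rank → ℝ)) 𝓘(ℝ, E × h.complement) ∞
        (fun p : M × (Fin G.lieAlgebroid.rank → ℝ) => (h.codChart p.1, L.symm p.2)) e.target :=
      ContMDiffOn.prodMk_space (hcc'.comp contMDiffOn_fst fun p hp => (htgt p hp).1)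
        (L.symm.contDiff.contMDiff.comp_contMDiffOn contMDiffOn_snd)
    exact hdc'.comp (heq'.comp_contMDiffOn h1) fun p hp => (htgt p hp).2
  · intro g hg
    change h.codChart.symm (h.equiv (h.domChart g)).1 = _
    rw [hw g (hsrc hg), h.codChart.left_inv (hcod g (hsrc hg))]
  · have hg := h.mem_domChart_source
    simp only [e, e₁, mfld_simps]
    refine ⟨hg, ?_⟩
    change (h.equiv (h.domChart g)).1 ∈ h.codChart.target
    rw [hw g hg]
    exact h.codChart.map_source (hcod g hg)

namespace SourceChart

variable {G} (e : G.SourceChart)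

/-- The fibre coordinates of a source chart. -/
def fib (g : 𝒢) : Fin G.lieAlgebroid.rank → ℝ := (e.chart g).2

/-- The arrow with source `x` and fibre coordinates `y`. -/
def arrow (x : M) (y : Fin G.lieAlgebroid.rank → ℝ) : 𝒢 := e.chart.symm (x, y)

theorem chart_eq {g : 𝒢} (hg : g ∈ e.chart.source) : e.chart g = (G.src g, e.fib g) :=
  Prod.ext (e.fst_eq g hg) rfl

theorem src_arrow {x : M} {y} (h : (x, y) ∈ e.chart.target) : G.src (e.arrow x y) = x := by
  rw [arrow, ← e.fst_eq _ (e.chart.map_target h), e.chart.right_inv h]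

theorem fib_arrow {x : M} {y} (h : (x, y) ∈ e.chart.target) : e.fib (e.arrow x y) = y := by
  rw [fib, arrow, e.chart.right_inv h]

theorem arrow_fib {g : 𝒢} (hg : g ∈ e.chart.source) : e.arrow (G.src g) (e.fib g) = g := by
  rw [arrow, ← e.chart_eq hg, e.chart.left_inv hg]

theorem mem_target {g : 𝒢} (hg : g ∈ e.chart.source) :
    (G.src g, e.fib g) ∈ e.chart.target := by
  rw [← e.chart_eq hg]; exact e.chart.map_source hg

theorem contMDiffAt_fib {g : 𝒢} (hg : g ∈ e.chart.source) :
    ContMDiffAt 𝓘(ℝ, F) 𝓘(ℝ, Fin G.lieAlgebroid.rank → ℝ) ∞ e.fib g :=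
  contMDiffAt_snd.comp g (e.contMDiffOn.contMDiffAt (e.chart.open_source.mem_nhds hg))

theorem contMDiffAt_arrow {p : M × (Fin G.lieAlgebroid.rank → ℝ)} (hp : p ∈ e.chart.target) :
    ContMDiffAt (𝓘(ℝ, E).prod 𝓘(ℝ, Fin G.lieAlgebroid.rank → ℝ)) 𝓘(ℝ, F) ∞
      (fun p : M × (Fin G.lieAlgebroid.rank → ℝ) => e.arrow p.1 p.2) p :=
  e.contMDiffOn_symm.contMDiffAt (e.chart.open_target.mem_nhds hp)

end SourceChart

theorem contMDiff_src : ContMDiff 𝓘(ℝ, F) 𝓘(ℝ, E) ∞ G.src := G.isSubmersion_src.contMDiff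

theorem mdifferentiableAt_src (g : 𝒢) : MDifferentiableAt 𝓘(ℝ, F) 𝓘(ℝ, E) G.src g :=
  (G.contMDiff_src.contMDiffAt).mdiffAt_of_infty

theorem mdifferentiableAt_tgt (g : 𝒢) : MDifferentiableAt 𝓘(ℝ, F) 𝓘(ℝ, E) G.tgt g :=
  (G.contMDiff_tgt.contMDiffAt).mdiffAt_of_infty

theorem mdifferentiableAt_inv (g : 𝒢) : MDifferentiableAt 𝓘(ℝ, F) 𝓘(ℝ, F) G.inv g :=
  (G.contMDiff_inv.contMDiffAt).mdiffAt_of_infty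

namespace SourceChart

variable {G} (e : G.SourceChart)

/-- The differential of the fibre coordinates of a source chart. -/
def dfib (g : 𝒢) : TangentSpace 𝓘(ℝ, F) g →L[ℝ] (Fin G.lieAlgebroid.rank → ℝ) :=
  mfderiv 𝓘(ℝ, F) 𝓘(ℝ, Fin G.lieAlgebroid.rank → ℝ) e.fib g

/-- Tangent vectors to the arrows are determined by their images under `ds` and the differential of
the fibre coordinates. -/
theorem eq_of_dsrc_dfib {g : 𝒢} (hg : g ∈ e.chart.source) {v v' : TangentSpace 𝓘(ℝ, F) g}
    (h1 : (mfderiv 𝓘(ℝ, F) 𝓘(ℝ, E) G.src g v : E) = mfderiv 𝓘(ℝ, F) 𝓘(ℝ, E) G.src g v')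
    (h2 : e.dfib g v = e.dfib g v') : v = v' := by
  have hA := (e.contMDiffAt_arrow (e.mem_target hg)).mdiffAt_of_infty
  have hc : MDifferentiableAt 𝓘(ℝ, F) (𝓘(ℝ, E).prod 𝓘(ℝ, Fin G.lieAlgebroid.rank → ℝ))
      (fun g => (G.src g, e.fib g)) g :=
    (G.mdifferentiableAt_src g).prodMk (e.contMDiffAt_fib hg).mdiffAt_of_infty
  -- the chart is invertible, so `v` is recovered from its image under the differential of the
  -- chart
  have key : ∀ v : TangentSpace 𝓘(ℝ, F) g, (v : F) =
      mfderiv (𝓘(ℝ, E).prod 𝓘(ℝ, Fin G.lieAlgebroid.rank → ℝ)) 𝓘(ℝ, F)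
        (fun p : M × (Fin G.lieAlgebroid.rank → ℝ) => e.arrow p.1 p.2) (G.src g, e.fib g)
        ((mfderiv 𝓘(ℝ, F) 𝓘(ℝ, E) G.src g v, e.dfib g v) : E × (Fin G.lieAlgebroid.rank → ℝ)) := by
    intro v
    have h3 := mfderiv_comp_apply (f := fun g => (G.src g, e.fib g)) g hA hc v
    have h4 : ((fun p : M × (Fin G.lieAlgebroid.rank → ℝ) => e.arrow p.1 p.2) ∘
        fun g => (G.src g, e.fib g)) =ᶠ[𝓝 g] id := by
      filter_upwards [e.chart.open_source.mem_nhds hg] with g' hg'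
      exact e.arrow_fib hg'
    have h5 : (mfderiv 𝓘(ℝ, F) 𝓘(ℝ, F) ((fun p : M × (Fin G.lieAlgebroid.rank → ℝ) =>
        e.arrow p.1 p.2) ∘ fun g => (G.src g, e.fib g)) g v : F) = v :=
      (congrArg (fun L : F →L[ℝ] F => L v) h4.mfderiv_eq).trans
        (congrArg (fun L : F →L[ℝ] F => L v) (mfderiv_id (I := 𝓘(ℝ, F)) (x := g)))
    refine h5.symm.trans (h3.trans ?_)
    have h6 := (G.mdifferentiableAt_src g).mfderiv_prod (e.contMDiffAt_fib hg).mdiffAt_of_infty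
    exact congrArg (fun L : F →L[ℝ] E × (Fin G.lieAlgebroid.rank → ℝ) =>
      (mfderiv (𝓘(ℝ, E).prod 𝓘(ℝ, Fin G.lieAlgebroid.rank → ℝ)) 𝓘(ℝ, F)
        (fun p : M × (Fin G.lieAlgebroid.rank → ℝ) => e.arrow p.1 p.2) (G.src g, e.fib g) :
        E × (Fin G.lieAlgebroid.rank → ℝ) →L[ℝ] F) (L v)) h6
  have h7 : ((mfderiv 𝓘(ℝ, F) 𝓘(ℝ, E) G.src g v, e.dfib g v) : E × (Fin G.lieAlgebroid.rank → ℝ)) =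
    (mfderiv 𝓘(ℝ, F) 𝓘(ℝ, E) G.src g v', e.dfib g v') := Prod.ext h1 h2
  exact (key v).trans ((congrArg (fun p : E × (Fin G.lieAlgebroid.rank → ℝ) =>
      (mfderiv (𝓘(ℝ, E).prod 𝓘(ℝ, Fin G.lieAlgebroid.rank → ℝ)) 𝓘(ℝ, F)
        (fun p : M × (Fin G.lieAlgebroid.rank → ℝ) => e.arrow p.1 p.2) (G.src g, e.fib g) :
        E × (Fin G.lieAlgebroid.rank → ℝ) →L[ℝ] F) p) h7).trans (key v').symm)

theorem contMDiffAt_arrow_comp {B : Type*} [NormedAddCommGroup B] [NormedSpace ℝ B] {H : Type*}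
    [TopologicalSpace H] {I : ModelWithCorners ℝ B H} {N : Type*} [TopologicalSpace N]
    [ChartedSpace H N] {x : N → M} {y : N → Fin G.lieAlgebroid.rank → ℝ} {n : N}
    (h : (x n, y n) ∈ e.chart.target) (hx : ContMDiffAt I 𝓘(ℝ, E) ∞ x n)
    (hy : ContMDiffAt I 𝓘(ℝ, Fin G.lieAlgebroid.rank → ℝ) ∞ y n) :
    ContMDiffAt I 𝓘(ℝ, F) ∞ (fun n => e.arrow (x n) (y n)) n :=
  ContMDiffAt.comp (g := fun p : M × (Fin G.lieAlgebroid.rank → ℝ) => e.arrow p.1 p.2)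
    (f := fun n => (x n, y n)) n (e.contMDiffAt_arrow h) (hx.prodMk hy)

theorem eventually_mem_target {N : Type*} [TopologicalSpace N]
    {x : N → M} {y : N → Fin G.lieAlgebroid.rank → ℝ} {n : N}
    (h : (x n, y n) ∈ e.chart.target) (hx : ContinuousAt x n) (hy : ContinuousAt y n) :
    ∀ᶠ n in 𝓝 n, (x n, y n) ∈ e.chart.target :=
  (hx.prodMk hy).eventually (e.chart.open_target.mem_nhds h)

end SourceChart

section Rank

variable [FiniteDimensional ℝ F]

/-- The differential of the source map is onto: it has the differential of a local section as a
right inverse. -/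
theorem mfderiv_src_surjective (g : 𝒢) :
    Function.Surjective (mfderiv 𝓘(ℝ, F) 𝓘(ℝ, E) G.src g) := by
  obtain ⟨e, he⟩ := G.exists_sourceChart g
  intro w
  have hβ : MDifferentiableAt 𝓘(ℝ, E) 𝓘(ℝ, F) (fun x => e.arrow x (e.fib g)) (G.src g) :=
    (e.contMDiffAt_arrow_comp (x := id) (y := fun _ => e.fib g) (n := G.src g) (e.mem_target he)
      contMDiffAt_id contMDiffAt_const).mdiffAt_of_infty
  have hg : e.arrow (G.src g) (e.fib g) = g := e.arrow_fib he
  have h1 : (fun x => G.src (e.arrow x (e.fib g))) =ᶠ[𝓝 (G.src g)] id := by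
    filter_upwards [e.eventually_mem_target (e.mem_target he) continuousAt_id continuousAt_const]
      with x hx
    exact e.src_arrow hx
  have hs : MDifferentiableAt 𝓘(ℝ, F) 𝓘(ℝ, E) G.src (e.arrow (G.src g) (e.fib g)) :=
    G.mdifferentiableAt_src _
  have h2 := mfderiv_comp_apply (G.src g) hs hβ w
  have h3 := congrArg (fun L : E →L[ℝ] E => L w)
    (h1.mfderiv_eq.trans (mfderiv_id (I := 𝓘(ℝ, E)) (x := G.src g)))
  have h4 := h2.symm.trans h3
  rw [hg] at h4
  exact ⟨_, h4⟩

theorem finrank_lieFiber (x : M) : finrank ℝ (G.lieFiber x) = G.lieAlgebroid.rank := by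
  have h1 := (mfderiv 𝓘(ℝ, F) 𝓘(ℝ, E) G.src (G.unit x)).toLinearMap.finrank_range_add_finrank_ker
  rw [LinearMap.range_eq_top.2 (G.mfderiv_src_surjective (G.unit x)), finrank_top] at h1
  change finrank ℝ E + finrank ℝ (G.lieFiber x) = finrank ℝ F at h1
  change _ = finrank ℝ F - finrank ℝ E
  omega

theorem rank_add (x : M) : G.lieAlgebroid.rank + finrank ℝ E = finrank ℝ F := by
  have h1 := (mfderiv 𝓘(ℝ, F) 𝓘(ℝ, E) G.src (G.unit x)).toLinearMap.finrank_range_add_finrank_ker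
  rw [LinearMap.range_eq_top.2 (G.mfderiv_src_surjective (G.unit x)), finrank_top] at h1
  change finrank ℝ E + finrank ℝ (G.lieFiber x) = finrank ℝ F at h1
  change finrank ℝ F - finrank ℝ E + _ = _
  omega

end Rank

end LieGroupoid

end SourceCharts

/-! ### Right translations -/

noncomputable section RightTranslation

universe u v w z

theorem tangentBundle_mk_eq {F : Type*} [NormedAddCommGroup F] [NormedSpace ℝ F] {P : Type*}
    [TopologicalSpace P] [ChartedSpace F P] {p q : P} (h : p = q)
    {v : TangentSpace 𝓘(ℝ, F) p} {w : TangentSpace 𝓘(ℝ, F) q} (hv : (v : F) = w) :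
    (⟨p, v⟩ : TangentBundle 𝓘(ℝ, F) P) = ⟨q, w⟩ := by
  subst h
  exact congrArg (fun v : TangentSpace 𝓘(ℝ, F) p => (⟨p, v⟩ : TangentBundle 𝓘(ℝ, F) P)) hv

variable {E : Type u} [NormedAddCommGroup E] [NormedSpace ℝ E]
  {M : Type v} [TopologicalSpace M] [ChartedSpace E M] [IsManifold 𝓘(ℝ, E) ∞ M]
  {F : Type w} [NormedAddCommGroup F] [NormedSpace ℝ F] [FiniteDimensional ℝ F]
  {𝒢 : Type z} [TopologicalSpace 𝒢] [ChartedSpace F 𝒢] [IsManifold 𝓘(ℝ, F) ∞ 𝒢]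
  {B : Type*} [NormedAddCommGroup B] [NormedSpace ℝ B] {H : Type*}
  [TopologicalSpace H] {I : ModelWithCorners ℝ B H} {N : Type*} [TopologicalSpace N]
  [ChartedSpace H N]

namespace LieGroupoid

variable (G : LieGroupoid E M F 𝒢)

theorem mul_inv_cancel_right {g h : 𝒢} (hg : G.src g = G.tgt h) :
    G.mul (G.mul g h) (G.inv h) = g := by
  rw [G.mul_assoc g h _ hg (G.tgt_inv h).symm, G.mul_inv, ← hg, G.mul_unit]

theorem inv_mul_cancel_right {g h : 𝒢} (hg : G.src g = G.src h) :
    G.mul (G.mul g (G.inv h)) h = g := by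
  rw [G.mul_assoc g _ h (hg.trans (G.tgt_inv h).symm) (G.src_inv h), G.inv_mul, ← hg, G.mul_unit]

theorem eq_inv_of_mul_eq_unit {g h : 𝒢} (hg : G.src g = G.tgt h)
    (h1 : G.mul g h = G.unit (G.src h)) : g = G.inv h := by
  have h2 := G.mul_inv_cancel_right hg
  rw [h1, ← G.tgt_inv h, G.unit_mul] at h2
  exact h2.symm

theorem inv_inv (g : 𝒢) : G.inv (G.inv g) = g := by
  refine (G.eq_inv_of_mul_eq_unit (G.tgt_inv g).symm ?_).symm
  rw [G.mul_inv, G.src_inv]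

theorem inv_unit (x : M) : G.inv (G.unit x) = G.unit x := by
  refine (G.eq_inv_of_mul_eq_unit ?_ ?_).symm
  · rw [G.src_unit, G.tgt_unit]
  · have := G.mul_unit (G.unit x)
    rwa [G.src_unit] at this ⊢

theorem inv_mul_rev {g h : 𝒢} (hg : G.src g = G.tgt h) :
    G.inv (G.mul g h) = G.mul (G.inv h) (G.inv g) := by
  have h0 : G.src (G.inv h) = G.tgt (G.inv g) := by rw [G.src_inv, G.tgt_inv, hg]
  have h1 : G.src (G.inv g) = G.tgt (G.mul g h) := by rw [G.src_inv, G.tgt_mul g h hg]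
  refine (G.eq_inv_of_mul_eq_unit ?_ ?_).symm
  · rw [G.src_mul _ _ h0, h1]
  · rw [G.mul_assoc _ _ _ h0 h1, ← G.mul_assoc (G.inv g) g h (G.src_inv g) hg, G.inv_mul, hg,
      G.unit_mul, G.inv_mul, G.src_mul g h hg]

/-- The product of two smooth families of composable arrows is smooth. -/
theorem contMDiffAt_mul {f g : N → 𝒢} {n : N} (hf : ContMDiffAt I 𝓘(ℝ, F) ∞ f n)
    (hg : ContMDiffAt I 𝓘(ℝ, F) ∞ g n) (h : ∀ᶠ n in 𝓝 n, G.src (f n) = G.tgt (g n)) :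
    ContMDiffAt I 𝓘(ℝ, F) ∞ (fun n => G.mul (f n) (g n)) n := by
  have h1 := G.contMDiffOn_mul (f n, g n) h.self_of_nhds
  have h2 : ContMDiffWithinAt I (𝓘(ℝ, F).prod 𝓘(ℝ, F)) ∞ (fun n => (f n, g n))
      {n | G.src (f n) = G.tgt (g n)} n := (hf.prodMk hg).contMDiffWithinAt
  exact (h1.comp n h2 fun n hn => hn).contMDiffAt h

/-- The differential of `h ↦ hg` along the source fibre, at the velocity of a curve in the source
fibre. -/
theorem velocity_mul_right {k : ℝ → 𝒢} {g h : 𝒢} {y : M} (hy : y = G.tgt g)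
    (hk : MDifferentiableAt 𝓘(ℝ, ℝ) 𝓘(ℝ, F) k 0) (h0 : k 0 = h)
    (hs : ∀ᶠ t in 𝓝 0, G.src (k t) = y) :
    (velocity F (fun t => G.mul (k t) g) : F) =
      mfderivWithin 𝓘(ℝ, F) 𝓘(ℝ, F) (fun h => G.mul h g) (G.src ⁻¹' {y}) h (velocity F k) := by
  subst h0 hy
  have h1 := G.contMDiffOn_mul (k 0, g) hs.self_of_nhds
  have h2 : ContMDiffWithinAt 𝓘(ℝ, F) 𝓘(ℝ, F) ∞ (fun h => G.mul h g) (G.src ⁻¹' {G.tgt g}) (k 0) :=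
    h1.comp (f := fun h => (h, g)) (k 0) ((contMDiffAt_id.prodMk contMDiffAt_const).contMDiffWithinAt) fun n hn => hn
  have h3 := (h2.mdifferentiableWithinAt (by simp)).hasMFDerivWithinAt
  have h4 := (h3.comp (s := {t | G.src (k t) = G.tgt g}) (0 : ℝ)
    hk.hasMFDerivAt.hasMFDerivWithinAt fun t ht => ht).hasMFDerivAt hs
  exact congrArg (fun L : ℝ →L[ℝ] F => L 1) h4.mfderiv

/-- Right translation in terms of curves: if `k` is a curve in a source fibre that starts at the
unit with velocity `v`, then `t ↦ k t · g` has velocity `v` translated by `g`. -/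
theorem velocity_mul_eq_rightTranslation {k : ℝ → 𝒢} {g : 𝒢} {y : M} (hy : y = G.tgt g)
    (hk : MDifferentiableAt 𝓘(ℝ, ℝ) 𝓘(ℝ, F) k 0) (h0 : k 0 = G.unit y)
    (hs : ∀ᶠ t in 𝓝 0, G.src (k t) = y) {v : G.lieFiber y} (hv : (velocity F k : F) = v.1) :
    (velocity F (fun t => G.mul (k t) g) : F) = G.rightTranslation g y v := by
  refine (G.velocity_mul_right hy hk h0 hs).trans ?_
  exact congrArg (fun v : F => (mfderivWithin 𝓘(ℝ, F) 𝓘(ℝ, F) (fun h => G.mul h g)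
    (G.src ⁻¹' {y}) (G.unit y) : F →L[ℝ] F) v) hv

/-- Right translation as a linear map. -/
def rightTranslationₗ (g : 𝒢) (y : M) : G.lieFiber y →ₗ[ℝ] TangentSpace 𝓘(ℝ, F) g :=
  ((mfderivWithin 𝓘(ℝ, F) 𝓘(ℝ, F) (fun h => G.mul h g) (G.src ⁻¹' {y}) (G.unit y)).toLinearMap ∘ₗ
    (G.lieFiber y).subtype : G.lieFiber y →ₗ[ℝ] TangentSpace 𝓘(ℝ, F) (G.mul (G.unit y) g))

/-- Every smooth family of vertical tangent vectors consists of the velocities of a smooth family of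
curves in the source fibres. -/
theorem exists_vertical_family [IsManifold I ∞ N] {u : N → 𝒢} {v : Π n, TangentSpace 𝓘(ℝ, F) (u n)}
    {n₀ : N}
    (hv : ContMDiffAt I (𝓘(ℝ, F).prod 𝓘(ℝ, F)) ∞
      (fun n => (⟨u n, v n⟩ : TangentBundle 𝓘(ℝ, F) 𝒢)) n₀)
    (hs : ∀ᶠ n in 𝓝 n₀, (mfderiv 𝓘(ℝ, F) 𝓘(ℝ, E) G.src (u n) (v n) : E) = 0) :
    ∃ Θ : ℝ → N → 𝒢,
      ContMDiffAt (𝓘(ℝ, ℝ).prod I) 𝓘(ℝ, F) ∞ (Function.uncurry Θ) (0, n₀) ∧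
      (∀ᶠ p in 𝓝 ((0 : ℝ), n₀), G.src (Θ p.1 p.2) = G.src (u p.2)) ∧
      (∀ᶠ n in 𝓝 n₀, Θ 0 n = u n ∧ MDifferentiableAt 𝓘(ℝ, ℝ) 𝓘(ℝ, F) (fun t => Θ t n) 0 ∧
        (velocity F (fun t => Θ t n) : F) = v n) ∧
      ((∀ᶠ n in 𝓝 n₀, ContMDiffAt I (𝓘(ℝ, F).prod 𝓘(ℝ, F)) ∞
        (fun n => (⟨u n, v n⟩ : TangentBundle 𝓘(ℝ, F) 𝒢)) n) →
        ∀ᶠ p in 𝓝 ((0 : ℝ), n₀),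
          ContMDiffAt (𝓘(ℝ, ℝ).prod I) 𝓘(ℝ, F) ∞ (Function.uncurry Θ) p) := by
  obtain ⟨e, he⟩ := G.exists_sourceChart (u n₀)
  have hu : ContMDiffAt I 𝓘(ℝ, F) ∞ u n₀ := (Bundle.contMDiffAt_totalSpace.1 hv).1
  -- the curves are straight lines in the fibre coordinates of a source chart, with the velocity
  -- that `v` has in these coordinates; the source is constant along them
  have hXY : ∀ p : ℝ × N, ContMDiffAt I (𝓘(ℝ, F).prod 𝓘(ℝ, F)) ∞
      (fun n => (⟨u n, v n⟩ : TangentBundle 𝓘(ℝ, F) 𝒢)) p.2 → u p.2 ∈ e.chart.source →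
      ContMDiffAt (𝓘(ℝ, ℝ).prod I) 𝓘(ℝ, E) ∞ (fun p : ℝ × N => G.src (u p.2)) p ∧
      ContMDiffAt (𝓘(ℝ, ℝ).prod I) 𝓘(ℝ, Fin G.lieAlgebroid.rank → ℝ) ∞
        (fun p : ℝ × N => e.fib (u p.2) + p.1 • e.dfib (u p.2) (v p.2)) p := by
    intro p hv he
    have hu : ContMDiffAt I 𝓘(ℝ, F) ∞ u p.2 := (Bundle.contMDiffAt_totalSpace.1 hv).1
    have hw : ContMDiffAt I 𝓘(ℝ, Fin G.lieAlgebroid.rank → ℝ) ∞ (fun n => e.dfib (u n) (v n)) p.2 :=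
      contMDiffAt_mfderiv_vectorSpace (e.contMDiffAt_fib he) hv
    have hy : ContMDiffAt I 𝓘(ℝ, Fin G.lieAlgebroid.rank → ℝ) ∞ (fun n => e.fib (u n)) p.2 :=
      ContMDiffAt.comp p.2 (g := e.fib) (e.contMDiffAt_fib he) hu
    have hx : ContMDiffAt I 𝓘(ℝ, E) ∞ (fun n => G.src (u n)) p.2 :=
      ContMDiffAt.comp p.2 (g := G.src) G.contMDiff_src.contMDiffAt hu
    exact ⟨ContMDiffAt.comp (f := Prod.snd) p hx contMDiffAt_snd,
      (ContMDiffAt.comp (f := Prod.snd) p hy contMDiffAt_snd).add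
        (contMDiffAt_fst.smul (ContMDiffAt.comp (f := Prod.snd) p hw contMDiffAt_snd))⟩
  obtain ⟨hX, hY⟩ := hXY ((0 : ℝ), n₀) hv he
  have hT : (G.src (u n₀), e.fib (u n₀) + (0 : ℝ) • e.dfib (u n₀) (v n₀)) ∈ e.chart.target := by
    rw [zero_smul, add_zero]
    exact e.mem_target he
  refine ⟨fun t n => e.arrow (G.src (u n)) (e.fib (u n) + t • e.dfib (u n) (v n)), ?_, ?_, ?_,
    fun hv' => ?_⟩
  · exact e.contMDiffAt_arrow_comp (n := ((0 : ℝ), n₀)) hT hX hY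
  · filter_upwards [e.eventually_mem_target (n := ((0 : ℝ), n₀)) hT hX.continuousAt hY.continuousAt]
      with p hp
    exact e.src_arrow hp
  · filter_upwards [hs, hu.continuousAt.eventually (e.chart.open_source.mem_nhds he)] with n hn hn'
    have hT' : (G.src (u n), e.fib (u n) + (0 : ℝ) • e.dfib (u n) (v n)) ∈ e.chart.target := by
      rw [zero_smul, add_zero]
      exact e.mem_target hn'
    have h0 : e.arrow (G.src (u n)) (e.fib (u n) + (0 : ℝ) • e.dfib (u n) (v n)) = u n := by
      rw [zero_smul, add_zero, e.arrow_fib hn']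
    have hc : ContMDiffAt 𝓘(ℝ, ℝ) 𝓘(ℝ, Fin G.lieAlgebroid.rank → ℝ) ∞
        (fun t : ℝ => e.fib (u n) + t • e.dfib (u n) (v n)) 0 :=
      contMDiffAt_const.add (contMDiffAt_id.smul contMDiffAt_const)
    have hγ := (e.contMDiffAt_arrow_comp (x := fun _ => G.src (u n)) (n := (0 : ℝ)) hT'
      contMDiffAt_const hc).mdiffAt_of_infty
    have hev := e.eventually_mem_target (x := fun _ => G.src (u n)) (n := (0 : ℝ)) hT'
      continuousAt_const hc.continuousAt
    refine ⟨h0, hγ, ?_⟩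
    refine e.eq_of_dsrc_dfib hn' ?_ ?_
    · refine Eq.trans ?_ hn.symm
      refine (velocity_comp h0 hγ (G.mdifferentiableAt_src (u n))).symm.trans ?_
      refine Eq.trans (velocity_congr ?_) (velocity_const (G.src (u n)))
      filter_upwards [hev] with t ht
      exact e.src_arrow ht
    · have h1 := hasDerivAt_velocity h0 hγ (e.contMDiffAt_fib hn').mdiffAt_of_infty
      have h2 : HasDerivAt (fun t : ℝ => e.fib (u n) + t • e.dfib (u n) (v n))
          (e.dfib (u n) (v n)) 0 := by
        simpa using ((hasDerivAt_id (0 : ℝ)).smul_const (e.dfib (u n) (v n))).const_add (e.fib (u n))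
      refine h1.unique (h2.congr_of_eventuallyEq ?_)
      filter_upwards [hev] with t ht
      exact e.fib_arrow ht
  · have hsnd : Filter.Tendsto (Prod.snd : ℝ × N → N) (𝓝 ((0 : ℝ), n₀)) (𝓝 n₀) :=
      continuous_snd.continuousAt
    filter_upwards [e.eventually_mem_target (n := ((0 : ℝ), n₀)) hT hX.continuousAt hY.continuousAt,
      hsnd.eventually hv', hsnd.eventually
        (hu.continuousAt.eventually (e.chart.open_source.mem_nhds he))] with p hp hvp hup
    obtain ⟨hX', hY'⟩ := hXY p hvp hup
    exact e.contMDiffAt_arrow_comp (n := p) hp hX' hY'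

/-- Every vertical tangent vector is the velocity of a curve in the source fibre. -/
theorem exists_vertical_curve {g : 𝒢} {v : TangentSpace 𝓘(ℝ, F) g}
    (hv : (mfderiv 𝓘(ℝ, F) 𝓘(ℝ, E) G.src g v : E) = 0) :
    ∃ k : ℝ → 𝒢, ContMDiffAt 𝓘(ℝ, ℝ) 𝓘(ℝ, F) ∞ k 0 ∧ k 0 = g ∧
      (∀ᶠ t in 𝓝 0, G.src (k t) = G.src g) ∧ (velocity F k : F) = v := by
  obtain ⟨Θ, h1, h2, h3, -⟩ := G.exists_vertical_family (I := 𝓘(ℝ, ℝ)) (u := fun _ : ℝ => g)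
    (v := fun _ => v) (n₀ := (0 : ℝ)) contMDiffAt_const (Filter.Eventually.of_forall fun _ => hv)
  obtain ⟨h3, h4, h5⟩ := h3.self_of_nhds
  have hc : ContMDiffAt 𝓘(ℝ, ℝ) (𝓘(ℝ, ℝ).prod 𝓘(ℝ, ℝ)) ∞ (fun t : ℝ => (t, (0 : ℝ))) 0 :=
    contMDiffAt_id.prodMk contMDiffAt_const
  exact ⟨fun t => Θ t 0, ContMDiffAt.comp (g := Function.uncurry Θ) (f := fun t : ℝ => (t, (0 : ℝ)))
    (0 : ℝ) h1 hc, h3,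
    hc.continuousAt.eventually h2, h5⟩

/-- Every element of the Lie algebroid is the velocity of a curve in the source fibre. -/
theorem exists_unit_curve {y : M} (v : G.lieFiber y) :
    ∃ k : ℝ → 𝒢, ContMDiffAt 𝓘(ℝ, ℝ) 𝓘(ℝ, F) ∞ k 0 ∧ k 0 = G.unit y ∧
      (∀ᶠ t in 𝓝 0, G.src (k t) = y) ∧ (velocity F k : F) = v.1 := by
  obtain ⟨k, h1, h2, h3, h4⟩ := G.exists_vertical_curve (g := G.unit y) (v := v.1) v.2
  rw [G.src_unit] at h3
  exact ⟨k, h1, h2, h3, h4⟩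

theorem contMDiffAt_mul_const {k : N → 𝒢} {g : 𝒢} {n : N} (hk : ContMDiffAt I 𝓘(ℝ, F) ∞ k n)
    (hs : ∀ᶠ t in 𝓝 n, G.src (k t) = G.tgt g) :
    ContMDiffAt I 𝓘(ℝ, F) ∞ (fun t => G.mul (k t) g) n :=
  G.contMDiffAt_mul hk contMDiffAt_const hs

/-- The image of right translation is tangent to the source fibre. -/
theorem mfderiv_src_rightTranslation {g : 𝒢} {y : M} (hy : y = G.tgt g) (v : G.lieFiber y) :
    (mfderiv 𝓘(ℝ, F) 𝓘(ℝ, E) G.src g (G.rightTranslation g y v) : E) = 0 := by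
  obtain ⟨k, hk, k0, ks, kv⟩ := G.exists_unit_curve v
  have h1 := G.velocity_mul_eq_rightTranslation hy hk.mdiffAt_of_infty k0 ks kv
  have h2 := (G.contMDiffAt_mul_const hk (hy ▸ ks)).mdiffAt_of_infty
  have h3 : G.mul (k 0) g = g := by rw [k0, hy, G.unit_mul]
  have h4 := velocity_comp h3 h2 (G.mdifferentiableAt_src g)
  refine (congrArg (fun v : F => (mfderiv 𝓘(ℝ, F) 𝓘(ℝ, E) G.src g : F →L[ℝ] E) v) h1).symm.trans ?_
  refine h4.symm.trans (Eq.trans (velocity_congr ?_) (velocity_const (G.src g)))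
  filter_upwards [ks] with t ht
  exact G.src_mul _ _ (ht.trans hy)

/-- Right translation by `g` has values in, and is onto, the tangent space of the source fibre. -/
theorem exists_rightTranslation_eq {g : 𝒢} {y : M} (hy : y = G.tgt g) {v : TangentSpace 𝓘(ℝ, F) g}
    (hv : (mfderiv 𝓘(ℝ, F) 𝓘(ℝ, E) G.src g v : E) = 0) :
    ∃ a : G.lieFiber y, G.rightTranslation g y a = v := by
  -- a curve in the source fibre of `g`, translated by the inverse of `g`, starts at a unit
  obtain ⟨k, hk, k0, ks, kv⟩ := G.exists_vertical_curve hv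
  have hs : ∀ᶠ t in 𝓝 0, G.src (k t) = G.tgt (G.inv g) := by rwa [G.tgt_inv]
  have h1 := G.contMDiffAt_mul_const hk hs
  have h0 : G.mul (k 0) (G.inv g) = G.unit y := by rw [k0, G.mul_inv, hy]
  have h2 : ∀ᶠ t in 𝓝 0, G.src (G.mul (k t) (G.inv g)) = y := by
    filter_upwards [hs] with t ht
    rw [G.src_mul _ _ ht, G.src_inv, hy]
  have h3 : (mfderiv 𝓘(ℝ, F) 𝓘(ℝ, E) G.src (G.unit y)
      (velocity F fun t => G.mul (k t) (G.inv g)) : E) = 0 :=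
    (velocity_comp h0 h1.mdiffAt_of_infty (G.mdifferentiableAt_src (G.unit y))).symm.trans
      (Eq.trans (velocity_congr h2) (velocity_const y))
  refine ⟨⟨(velocity F fun t => G.mul (k t) (G.inv g) : F), h3⟩, ?_⟩
  refine (G.velocity_mul_eq_rightTranslation hy h1.mdiffAt_of_infty h0 h2 rfl).symm.trans
    (Eq.trans (velocity_congr ?_) kv)
  filter_upwards [ks] with t ht
  exact G.inv_mul_cancel_right ht

/-- Right translation by `g` is injective, since right translation by the inverse of `g` is a left
inverse of it. -/
theorem rightTranslation_injective {g : 𝒢} {y : M} (hy : y = G.tgt g) :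
    Function.Injective (G.rightTranslation g y) := by
  intro v v' h
  obtain ⟨k, hk, k0, ks, kv⟩ := G.exists_unit_curve v
  obtain ⟨k', hk', k0', ks', kv'⟩ := G.exists_unit_curve v'
  have key : ∀ (k : ℝ → 𝒢) (v : G.lieFiber y), ContMDiffAt 𝓘(ℝ, ℝ) 𝓘(ℝ, F) ∞ k 0 → k 0 = G.unit y →
      (∀ᶠ t in 𝓝 0, G.src (k t) = y) → (velocity F k : F) = v.1 →
      (v.1 : F) = mfderivWithin 𝓘(ℝ, F) 𝓘(ℝ, F) (fun h => G.mul h (G.inv g)) (G.src ⁻¹' {G.src g}) g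
        (G.rightTranslation g y v) := by
    intro k v hk k0 ks kv
    have h1 := G.velocity_mul_eq_rightTranslation hy hk.mdiffAt_of_infty k0 ks kv
    have h2 := G.contMDiffAt_mul_const hk (hy ▸ ks)
    have h3 : G.mul (k 0) g = g := by rw [k0, hy, G.unit_mul]
    have h4 : ∀ᶠ t in 𝓝 0, G.src (G.mul (k t) g) = G.src g := by
      filter_upwards [ks] with t ht
      exact G.src_mul _ _ (ht.trans hy)
    have h5 := G.velocity_mul_right (G.tgt_inv g).symm h2.mdiffAt_of_infty h3 h4
    refine kv.symm.trans (Eq.trans (velocity_congr (γ' := fun t => G.mul (G.mul (k t) g) (G.inv g)) ?_)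
      (h5.trans ?_))
    · filter_upwards [ks] with t ht
      exact (G.mul_inv_cancel_right (ht.trans hy)).symm
    · exact congrArg (fun v : F => (mfderivWithin 𝓘(ℝ, F) 𝓘(ℝ, F) (fun h => G.mul h (G.inv g))
        (G.src ⁻¹' {G.src g}) g : F →L[ℝ] F) v) h1
  refine Subtype.ext ((key k v hk k0 ks kv).trans (Eq.trans ?_ (key k' v' hk' k0' ks' kv').symm))
  rw [h]

/-- Right-invariance: the velocity of a curve in a source fibre, translated by `h`. -/
theorem velocity_mul_of_rightTranslation {k : ℝ → 𝒢} {g h : 𝒢} {y : M} (hy : y = G.tgt g)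
    (hgh : G.src g = G.tgt h) (hk : ContMDiffAt 𝓘(ℝ, ℝ) 𝓘(ℝ, F) ∞ k 0) (k0 : k 0 = g)
    (ks : ∀ᶠ t in 𝓝 0, G.src (k t) = G.src g) {v : G.lieFiber y}
    (kv : (velocity F k : F) = G.rightTranslation g y v) :
    (velocity F (fun t => G.mul (k t) h) : F) = G.rightTranslation (G.mul g h) y v := by
  obtain ⟨l, hl, l0, ls, lv⟩ := G.exists_unit_curve v
  have h1 := G.velocity_mul_eq_rightTranslation hy hl.mdiffAt_of_infty l0 ls lv
  have h2 := G.contMDiffAt_mul_const hl (hy ▸ ls)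
  have h3 : G.mul (l 0) g = g := by rw [l0, hy, G.unit_mul]
  have h4 : ∀ᶠ t in 𝓝 0, G.src (G.mul (l t) g) = G.src g := by
    filter_upwards [ls] with t ht
    exact G.src_mul _ _ (ht.trans hy)
  have h5 := G.velocity_mul_right hgh h2.mdiffAt_of_infty h3 h4
  have h6 := G.velocity_mul_right hgh hk.mdiffAt_of_infty k0 ks
  have h7 := G.velocity_mul_eq_rightTranslation (g := G.mul g h) (hy.trans (G.tgt_mul g h hgh).symm)
    hl.mdiffAt_of_infty l0 ls lv
  refine h6.trans (Eq.trans ?_ h7)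
  refine (congrArg (fun v : F => (mfderivWithin 𝓘(ℝ, F) 𝓘(ℝ, F) (fun h' => G.mul h' h)
        (G.src ⁻¹' {G.src g}) g : F →L[ℝ] F) v) (kv.trans h1.symm)).trans (h5.symm.trans ?_)
  refine velocity_congr ?_
  filter_upwards [ls] with t ht
  exact G.mul_assoc _ _ _ (ht.trans hy) hgh

/-- Right translations of a smooth family of elements of the algebroid. -/
theorem contMDiffAt_rightTranslation [IsManifold I ∞ N] {g : N → 𝒢} {α : Π n, G.lieFiber (G.tgt (g n))}
    {n₀ : N} (hg : ContMDiffAt I 𝓘(ℝ, F) ∞ g n₀)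
    (hα : ContMDiffAt I (𝓘(ℝ, F).prod 𝓘(ℝ, F)) ∞
      (fun n => (⟨G.unit (G.tgt (g n)), (α n).1⟩ : TangentBundle 𝓘(ℝ, F) 𝒢)) n₀) :
    ContMDiffAt I (𝓘(ℝ, F).prod 𝓘(ℝ, F)) ∞
      (fun n => (⟨g n, G.rightTranslation (g n) (G.tgt (g n)) (α n)⟩ : TangentBundle 𝓘(ℝ, F) 𝒢)) n₀ := by
  -- the translated vectors are velocities at `t = 0` of the family `Θ t n · g n`
  obtain ⟨Θ, h1, h2, h3, -⟩ := G.exists_vertical_family hα (Filter.Eventually.of_forall fun n => (α n).2)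
  simp only [G.src_unit] at h2
  have hG : ContMDiffAt (𝓘(ℝ, ℝ).prod I) 𝓘(ℝ, F) ∞ (fun p : ℝ × N => g p.2) (0, n₀) :=
    ContMDiffAt.comp (f := Prod.snd) ((0 : ℝ), n₀) hg contMDiffAt_snd
  have h4 := G.contMDiffAt_mul h1 hG h2
  have hsw : ContMDiffAt (I.prod 𝓘(ℝ, ℝ)) (𝓘(ℝ, ℝ).prod I) ∞ (fun p : N × ℝ => (p.2, p.1)) (n₀, 0) :=
    contMDiffAt_snd.prodMk contMDiffAt_fst
  have h5 : ContMDiffAt (I.prod 𝓘(ℝ, ℝ)) 𝓘(ℝ, F) ∞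
      (Function.uncurry fun n t => G.mul (Θ t n) (g n)) (n₀, 0) :=
    ContMDiffAt.comp (f := fun p : N × ℝ => (p.2, p.1)) (n₀, (0 : ℝ)) h4 hsw
  have h6 := ContMDiffAt.mfderiv_apply_family (J := 𝓘(ℝ, ℝ)) (g := fun _ => (0 : ℝ))
    (v := fun _ => (1 : ℝ)) h5 contMDiffAt_const
  refine h6.congr_of_eventuallyEq ?_
  have hev : ∀ᶠ n in 𝓝 n₀, ∀ᶠ t in 𝓝 (0 : ℝ), G.src (Θ t n) = G.tgt (g n) :=
    (h2.eventually_nhds).mono (fun p hp => hp) |> fun h =>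
      ((Continuous.prodMk_right (0 : ℝ)).continuousAt (x := n₀)).eventually h |>.mono fun n hn =>
        ((Continuous.prodMk_left n).continuousAt (x := (0 : ℝ))).eventually hn
  filter_upwards [h3, hev] with n hn hs
  obtain ⟨hn0, hn1, hn2⟩ := hn
  refine tangentBundle_mk_eq ?_ ?_
  · rw [hn0, G.unit_mul]
  · exact (G.velocity_mul_eq_rightTranslation rfl hn1 hn0 hs hn2).symm

/-- The right-invariant vector field of a smooth section of the Lie algebroid is smooth. -/
theorem contMDiff_rightInvariant {α : Π x, G.lieFiber x} (hα : G.lieAlgebroid.IsSmooth α) :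
    ContMDiff 𝓘(ℝ, F) (𝓘(ℝ, F).prod 𝓘(ℝ, F)) ∞
      (fun g => (⟨g, G.rightInvariant α g⟩ : TangentBundle 𝓘(ℝ, F) 𝒢)) := fun g =>
  G.contMDiffAt_rightTranslation contMDiffAt_id
    (ContMDiffAt.comp g (g := fun x => (⟨G.unit x, (α x).1⟩ : TangentBundle 𝓘(ℝ, F) 𝒢))
      hα.contMDiffAt G.contMDiff_tgt.contMDiffAt)

theorem rightTranslation_congr {g g' : 𝒢} (h : g = g') (y : M) (v : G.lieFiber y) :
    (G.rightTranslation g y v : F) = G.rightTranslation g' y v := by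
  subst h; rfl

theorem rightTranslation_unit {x y : M} (hx : x = y) (v : G.lieFiber y) :
    (G.rightTranslation (G.unit x) y v : F) = v.1 := by
  subst hx
  obtain ⟨k, hk, k0, ks, kv⟩ := G.exists_unit_curve v
  refine (G.velocity_mul_eq_rightTranslation (G.tgt_unit x).symm hk.mdiffAt_of_infty k0 ks kv).symm.trans
    (Eq.trans (velocity_congr ?_) kv)
  filter_upwards [ks] with t ht
  rw [← ht, G.mul_unit]

theorem rightInvariant_unit (α : Π x, G.lieFiber x) (x : M) :
    (G.rightInvariant α (G.unit x) : F) = (α x).1 := by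
  have key : ∀ y, x = y → (G.rightTranslation (G.unit x) y (α y) : F) = (α x).1 := by
    rintro y rfl
    exact G.rightTranslation_unit rfl (α x)
  exact key _ (G.tgt_unit x).symm

end LieGroupoid

end RightTranslation

/-! ### The Van Est map -/

noncomputable section VanEst

universe u v w z

variable {E : Type u} [NormedAddCommGroup E] [NormedSpace ℝ E]
  {M : Type v} [TopologicalSpace M] [ChartedSpace E M] [IsManifold 𝓘(ℝ, E) ∞ M]
  {F : Type w} [NormedAddCommGroup F] [NormedSpace ℝ F] [FiniteDimensional ℝ F]
  {𝒢 : Type z} [TopologicalSpace 𝒢] [ChartedSpace F 𝒢] [IsManifold 𝓘(ℝ, F) ∞ 𝒢]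

namespace LieGroupoid

variable (G : LieGroupoid E M F 𝒢)

/-- The bracket of right-invariant vector fields is tangent to the source fibres, so it is an
element of the Lie algebroid, and the default value in the definition of the bracket does not occur.
-/
theorem mlieBracket_rightInvariant_mem (α β : {α // G.lieAlgebroid.IsSmooth α}) (x : M) :
    mlieBracket 𝓘(ℝ, F) (G.rightInvariant α.1) (G.rightInvariant β.1) (G.unit x)
      ∈ G.lieFiber x := by
  have : CompleteSpace F := FiniteDimensional.complete ℝ F
  set s₀ := G.src (G.unit x) with hs₀
  have hchart : ContMDiffAt 𝓘(ℝ, E) 𝓘(ℝ, E) ∞ (extChartAt 𝓘(ℝ, E) s₀) s₀ :=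
    contMDiffAt_extChartAt_infty (mem_chart_source E s₀)
  have hf : ContMDiffAt 𝓘(ℝ, F) 𝓘(ℝ, E) ∞ (fun g => extChartAt 𝓘(ℝ, E) s₀ (G.src g)) (G.unit x) :=
    ContMDiffAt.comp (G.unit x) hchart G.contMDiff_src.contMDiffAt
  -- the coordinates of the source map are functions that right-invariant vector fields
  -- annihilate, hence so does their commutator
  have hz : ∀ γ : {α // G.lieAlgebroid.IsSmooth α},
      (fun g => mvfderiv 𝓘(ℝ, F) (fun g => extChartAt 𝓘(ℝ, E) s₀ (G.src g)) g
        (G.rightInvariant γ.1 g)) =ᶠ[𝓝 (G.unit x)] fun _ => 0 := by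
    intro γ
    filter_upwards [G.contMDiff_src.continuous.continuousAt.eventually
      ((chartAt E s₀).open_source.mem_nhds (mem_chart_source E s₀))] with g hg
    refine (mfderiv_comp_apply g (contMDiffAt_extChartAt_infty hg).mdiffAt_of_infty
      (G.mdifferentiableAt_src g) (G.rightInvariant γ.1 g)).trans ?_
    refine (congrArg (fun v : E => (mfderiv 𝓘(ℝ, E) 𝓘(ℝ, E) (extChartAt 𝓘(ℝ, E) s₀) (G.src g) :
      E →L[ℝ] E) v) (G.mfderiv_src_rightTranslation rfl (γ.1 (G.tgt g)))).trans (map_zero _)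
  have h1 := mfderiv_mlieBracket hf (G.contMDiff_rightInvariant α.2).contMDiffAt
    (G.contMDiff_rightInvariant β.2).contMDiffAt
  rw [(hz α).mvfderiv_apply, (hz β).mvfderiv_apply, mvfderiv_const] at h1
  have h2 : mvfderiv 𝓘(ℝ, F) (fun g => extChartAt 𝓘(ℝ, E) s₀ (G.src g)) (G.unit x)
      (mlieBracket 𝓘(ℝ, F) (G.rightInvariant α.1) (G.rightInvariant β.1) (G.unit x)) = 0 :=
    h1.trans (sub_zero (0 : E))
  have h3 := mfderiv_comp_apply (G.unit x) (hchart.mdiffAt_of_infty)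
    (G.mdifferentiableAt_src (G.unit x))
    (mlieBracket 𝓘(ℝ, F) (G.rightInvariant α.1) (G.rightInvariant β.1) (G.unit x))
  exact (tcoord_self (F := E) s₀ _).symm.trans (h3.symm.trans h2)

theorem lieAlgebroid_bracket (α β : {α // G.lieAlgebroid.IsSmooth α}) (x : M) :
    (show G.lieFiber x from G.lieAlgebroid.bracket α β x).1 =
      mlieBracket 𝓘(ℝ, F) (G.rightInvariant α.1) (G.rightInvariant β.1) (G.unit x) := by
  simp only [lieAlgebroid, dif_pos (G.mlieBracket_rightInvariant_mem α β x)]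

/-- The differential of a cocycle along the source fibres is right-invariant, because `c` and its
right translate by `g` differ by the constant `c g`. -/
theorem mvfderiv_cocycle_rightTranslation (c : G.Z1) {g : 𝒢} {y : M} (hy : y = G.tgt g)
    (v : G.lieFiber y) :
    mvfderiv 𝓘(ℝ, F) c.1 g (G.rightTranslation g y v) = mvfderiv 𝓘(ℝ, F) c.1 (G.unit y) v.1 := by
  obtain ⟨k, hk, k0, ks, kv⟩ := G.exists_unit_curve v
  have h1 := G.velocity_mul_eq_rightTranslation hy hk.mdiffAt_of_infty k0 ks kv
  have h2 := (G.contMDiffAt_mul_const hk (hy ▸ ks)).mdiffAt_of_infty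
  have h3 : G.mul (k 0) g = g := by rw [k0, hy, G.unit_mul]
  have hc : ∀ g, MDifferentiableAt 𝓘(ℝ, F) 𝓘(ℝ, ℝ) c.1 g := fun g =>
    (c.2.1.contMDiffAt).mdiffAt_of_infty
  have h4 := hasDerivAt_velocity h3 h2 (hc g)
  have h5 := hasDerivAt_velocity k0 hk.mdiffAt_of_infty (hc (G.unit y))
  have h6 := (h5.add_const (c.1 g)).congr_of_eventuallyEq (f₁ := fun t => c.1 (G.mul (k t) g)) (by
    filter_upwards [ks] with t ht
    exact c.2.2 _ _ (ht.trans hy))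
  refine (congrArg (fun v : F => mvfderiv 𝓘(ℝ, F) c.1 g v) h1).symm.trans ((h4.unique h6).trans ?_)
  exact congrArg (fun v : F => mvfderiv 𝓘(ℝ, F) c.1 (G.unit y) v) kv

/-- The form `α_x ↦ (dc)_{1_x}(α_x)` of a cocycle `c`. -/
def vanEstSection (c : 𝒢 → ℝ) : G.lieAlgebroid.DualSection := fun x =>
  ((mvfderiv 𝓘(ℝ, F) c (G.unit x)).toLinearMap ∘ₗ (G.lieFiber x).subtype : G.lieFiber x →ₗ[ℝ] ℝ)

/-- The form of a cocycle is closed. The function that the right-invariant vector field of `γ`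
yields on `c` is the pullback under `t` of the value of the form on `γ`, so the formula for the
bracket as a commutator is the equation that defines closed forms. -/
theorem vanEstSection_mem (c : G.Z1) : G.vanEstSection c.1 ∈ G.lieAlgebroid.Z1 := by
  have : CompleteSpace F := FiniteDimensional.complete ℝ F
  have hsm : G.lieAlgebroid.IsSmoothForm (G.vanEstSection c.1) := fun α hα x =>
    contMDiffAt_mfderiv_vectorSpace c.2.1.contMDiffAt hα.contMDiffAt
  refine ⟨hsm, fun α β x => ?_⟩
  have h1 := mfderiv_mlieBracket (c.2.1.contMDiffAt (x := G.unit x))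
    (G.contMDiff_rightInvariant α.2).contMDiffAt (G.contMDiff_rightInvariant β.2).contMDiffAt
  have h2 : ∀ γ δ : {α // G.lieAlgebroid.IsSmooth α},
      mvfderiv 𝓘(ℝ, F) (fun g => mvfderiv 𝓘(ℝ, F) c.1 g (G.rightInvariant γ.1 g)) (G.unit x)
        (G.rightInvariant δ.1 (G.unit x)) =
      mvfderiv 𝓘(ℝ, E) (fun y => G.vanEstSection c.1 y (γ.1 y)) x
        (G.lieAlgebroid.anchor x (δ.1 x)) := by
    intro γ δ
    -- the derivative of a pullback under `t` along the right-invariant vector field of `δ` is the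
    -- derivative along the anchor of `δ`
    have h3 : (fun g => mvfderiv 𝓘(ℝ, F) c.1 g (G.rightInvariant γ.1 g)) =
        fun g => (fun y => G.vanEstSection c.1 y (γ.1 y)) (G.tgt g) :=
      funext fun g => G.mvfderiv_cocycle_rightTranslation c rfl (γ.1 (G.tgt g))
    rw [h3]
    have hd : MDifferentiableAt 𝓘(ℝ, E) 𝓘(ℝ, ℝ) (fun y => G.vanEstSection c.1 y (γ.1 y))
        (G.tgt (G.unit x)) := ((hsm γ.1 γ.2).contMDiffAt).mdiffAt_of_infty
    refine (mfderiv_comp_apply (G.unit x) hd (G.mdifferentiableAt_tgt _) _).trans ?_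
    refine (congrArg (fun v : F => (mfderiv 𝓘(ℝ, E) 𝓘(ℝ, ℝ)
      (fun y => G.vanEstSection c.1 y (γ.1 y)) (G.tgt (G.unit x)) : E →L[ℝ] ℝ)
      ((mfderiv 𝓘(ℝ, F) 𝓘(ℝ, E) G.tgt (G.unit x) : F →L[ℝ] E) v))
      (G.rightInvariant_unit δ.1 x)).trans ?_
    exact congrArg (fun y => (mfderiv 𝓘(ℝ, E) 𝓘(ℝ, ℝ)
      (fun y => G.vanEstSection c.1 y (γ.1 y)) y : E →L[ℝ] ℝ)
      ((mfderiv 𝓘(ℝ, F) 𝓘(ℝ, E) G.tgt (G.unit x) : F →L[ℝ] E) (δ.1 x).1)) (G.tgt_unit x)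
  rw [h2 β α, h2 α β] at h1
  refine Eq.trans ?_ h1
  exact congrArg (fun v : F => mvfderiv 𝓘(ℝ, F) c.1 (G.unit x) v) (G.lieAlgebroid_bracket α β x)

/-- The Van Est map on the level of cocycles. -/
def vanEstForm : G.Z1 →ₗ[ℝ] G.lieAlgebroid.Z1 where
  toFun c := ⟨G.vanEstSection c.1, G.vanEstSection_mem c⟩
  map_add' c d := by
    refine Subtype.ext (funext fun x => LinearMap.ext fun a => ?_)
    exact congrArg (fun L : F →L[ℝ] ℝ => L a.1) (mvfderiv_add
      (c.2.1.contMDiffAt (x := G.unit x)).mdiffAt_of_infty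
      (d.2.1.contMDiffAt (x := G.unit x)).mdiffAt_of_infty)
  map_smul' k c := by
    refine Subtype.ext (funext fun x => LinearMap.ext fun a => ?_)
    exact congrArg (fun L : F →L[ℝ] ℝ => L a.1) (AlgebroidData.mvfderiv_const_smul_aux
      (c.2.1.contMDiffAt (x := G.unit x)).mdiffAt_of_infty k)

/-- The form of the coboundary of `f` is the differential of `-f`: along a curve in a source fibre
only `-f ∘ t` varies. -/
theorem vanEstForm_mem_of_mem (c : G.Z1) (hc : c ∈ G.B1.submoduleOf G.Z1) :
    G.vanEstForm c ∈ G.lieAlgebroid.B1.submoduleOf G.lieAlgebroid.Z1 := by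
  obtain ⟨f, hf, hcf⟩ := hc
  refine ⟨fun x => -f x, hf.neg, fun x a => ?_⟩
  obtain ⟨k, hk, k0, ks, kv⟩ := G.exists_unit_curve a
  have hc1 : MDifferentiableAt 𝓘(ℝ, F) 𝓘(ℝ, ℝ) c.1 (G.unit x) :=
    (c.2.1.contMDiffAt).mdiffAt_of_infty
  have h1 := hasDerivAt_velocity k0 hk.mdiffAt_of_infty hc1
  have hft : MDifferentiableAt 𝓘(ℝ, E) 𝓘(ℝ, ℝ) (fun x => -f x) x :=
    (hf.neg.contMDiffAt).mdiffAt_of_infty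
  have htk : MDifferentiableAt 𝓘(ℝ, ℝ) 𝓘(ℝ, E) (fun t => G.tgt (k t)) 0 :=
    (ContMDiffAt.comp (0 : ℝ) G.contMDiff_tgt.contMDiffAt hk).mdiffAt_of_infty
  have h2 := hasDerivAt_velocity (by rw [k0, G.tgt_unit]) htk hft
  have h3 := (h2.const_add (f x)).congr_of_eventuallyEq (f₁ := fun t => c.1 (k t)) (by
    filter_upwards [ks] with t ht
    refine (hcf (k t)).trans ?_
    rw [ht]
    ring)
  refine (congrArg (fun v : F => mvfderiv 𝓘(ℝ, F) c.1 (G.unit x) v) kv).symm.trans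
    ((h1.unique h3).trans ?_)
  refine congrArg (fun v : E => mvfderiv 𝓘(ℝ, E) (fun x => -f x) x v) ?_
  refine (velocity_comp k0 hk.mdiffAt_of_infty (G.mdifferentiableAt_tgt (G.unit x))).trans ?_
  exact congrArg (fun v : F => (mfderiv 𝓘(ℝ, F) 𝓘(ℝ, E) G.tgt (G.unit x) : F →L[ℝ] E) v) kv

theorem exists_isVanEst : ∃ Φ, G.IsVanEst Φ :=
  ⟨Submodule.mapQ _ _ G.vanEstForm G.vanEstForm_mem_of_mem, fun c =>
    ⟨G.vanEstForm c, fun _ _ => rfl, rfl⟩⟩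

theorem isVanEst_vanEst : G.IsVanEst G.vanEst := by
  unfold vanEst
  rw [dif_pos G.exists_isVanEst]
  exact G.exists_isVanEst.choose_spec

theorem vanEst_mkH1 (c : G.Z1) : G.vanEst (G.mkH1 c) = G.lieAlgebroid.mkH1 (G.vanEstForm c) := by
  obtain ⟨θ, h1, h2⟩ := G.isVanEst_vanEst c
  have h3 : θ = G.vanEstForm c := Subtype.ext (funext fun x => LinearMap.ext fun a => h1 x a)
  rw [h2, h3]

end LieGroupoid

end VanEst

/-! ### Extension of tangent vectors to smooth sections -/

noncomputable section GlobalSections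

universe u v w z

section TangentVectors

variable {F : Type*} [NormedAddCommGroup F] [NormedSpace ℝ F] {P : Type*} [TopologicalSpace P]
  [ChartedSpace F P] [IsManifold 𝓘(ℝ, F) ∞ P]
  {B : Type*} [NormedAddCommGroup B] [NormedSpace ℝ B] {H : Type*}
  [TopologicalSpace H] {I : ModelWithCorners ℝ B H} {N : Type*} [TopologicalSpace N]
  [ChartedSpace H N] [IsManifold I ∞ N]

theorem contMDiffAt_smul_vector {u : N → P} {f : N → ℝ} {v : Π n, TangentSpace 𝓘(ℝ, F) (u n)}
    {n₀ : N} (hf : ContMDiffAt I 𝓘(ℝ, ℝ) ∞ f n₀)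
    (hv : ContMDiffAt I (𝓘(ℝ, F).prod 𝓘(ℝ, F)) ∞
      (fun n => (⟨u n, v n⟩ : TangentBundle 𝓘(ℝ, F) P)) n₀) :
    ContMDiffAt I (𝓘(ℝ, F).prod 𝓘(ℝ, F)) ∞
      (fun n => (⟨u n, f n • v n⟩ : TangentBundle 𝓘(ℝ, F) P)) n₀ := by
  refine contMDiffAt_of_tcoord (Bundle.contMDiffAt_totalSpace.1 hv).1 ?_
  simp only [map_smul]
  exact hf.smul (contMDiffAt_tcoord (mem_chart_source F _) hv)

theorem contMDiffAt_zero_vector {u : N → P} {n₀ : N} (hu : ContMDiffAt I 𝓘(ℝ, F) ∞ u n₀) :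
    ContMDiffAt I (𝓘(ℝ, F).prod 𝓘(ℝ, F)) ∞
      (fun n => (⟨u n, 0⟩ : TangentBundle 𝓘(ℝ, F) P)) n₀ := by
  refine contMDiffAt_of_tcoord hu ?_
  simp only [map_zero]
  exact contMDiffAt_const

/-- Cutting off a family of tangent vectors that is smooth on an open set. -/
theorem exists_contMDiff_smul_vector {E : Type*} [NormedAddCommGroup E] [NormedSpace ℝ E]
    [FiniteDimensional ℝ E] {M : Type*} [TopologicalSpace M] [ChartedSpace E M]
    [IsManifold 𝓘(ℝ, E) ∞ M] [T2Space M] {u : M → P} (hu : ContMDiff 𝓘(ℝ, E) 𝓘(ℝ, F) ∞ u)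
    {v : Π x, TangentSpace 𝓘(ℝ, F) (u x)} {U : Set M} (hU : IsOpen U)
    (hv : ∀ x ∈ U, ContMDiffAt 𝓘(ℝ, E) (𝓘(ℝ, F).prod 𝓘(ℝ, F)) ∞
      (fun n => (⟨u n, v n⟩ : TangentBundle 𝓘(ℝ, F) P)) x) {x₀ : M} (hx₀ : x₀ ∈ U) :
    ∃ f : M → ℝ, f x₀ = 1 ∧ (∀ x ∉ U, f x = 0) ∧
      ContMDiff 𝓘(ℝ, E) (𝓘(ℝ, F).prod 𝓘(ℝ, F)) ∞
        (fun n => (⟨u n, f n • v n⟩ : TangentBundle 𝓘(ℝ, F) P)) := by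
  obtain ⟨f, -, hf⟩ := (SmoothBumpFunction.nhds_basis_tsupport (I := 𝓘(ℝ, E)) x₀).mem_iff.1
    (hU.mem_nhds hx₀)
  refine ⟨f, f.eq_one, fun x hx => image_eq_zero_of_notMem_tsupport fun h => hx (hf h), fun x => ?_⟩
  by_cases hx : x ∈ tsupport f
  · exact contMDiffAt_smul_vector f.contMDiffAt (hv x (hf hx))
  · refine (contMDiffAt_zero_vector hu.contMDiffAt).congr_of_eventuallyEq ?_
    filter_upwards [(isClosed_tsupport f).isOpen_compl.mem_nhds hx] with y hy
    refine tangentBundle_mk_eq rfl ?_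
    rw [image_eq_zero_of_notMem_tsupport hy, zero_smul]

/-- Every tangent vector is a value of a smooth vector field. -/
theorem exists_smoothVectorField {E : Type*} [NormedAddCommGroup E] [NormedSpace ℝ E]
    [FiniteDimensional ℝ E] {M : Type*} [TopologicalSpace M] [ChartedSpace E M]
    [IsManifold 𝓘(ℝ, E) ∞ M] [T2Space M] (x₀ : M) (v : TangentSpace 𝓘(ℝ, E) x₀) :
    ∃ X : {X : Π x : M, TangentSpace 𝓘(ℝ, E) x // IsSmoothVectorField X}, X.1 x₀ = v := by
  classical
  have hinv : ∀ x ∈ (chartAt E x₀).source, ∃ w : TangentSpace 𝓘(ℝ, E) x, tcoord E x₀ x w = v :=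
    fun x hx => (tcoord_bijective hx).2 v
  -- the vector field that is constant in the chart at `x₀`, to be cut off
  let V : Π x : M, TangentSpace 𝓘(ℝ, E) x := fun x =>
    if hx : x ∈ (chartAt E x₀).source then (hinv x hx).choose else 0
  have hV : ∀ x ∈ (chartAt E x₀).source, tcoord E x₀ x (V x) = v := by
    intro x hx
    simp only [V, dif_pos hx]
    exact (hinv x hx).choose_spec
  have hsm : ∀ x ∈ (chartAt E x₀).source, ContMDiffAt 𝓘(ℝ, E) (𝓘(ℝ, E).prod 𝓘(ℝ, E)) ∞
      (fun n => (⟨n, V n⟩ : TangentBundle 𝓘(ℝ, E) M)) x := by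
    intro x hx
    have hz : extChartAt 𝓘(ℝ, E) x₀ x ∈ (extChartAt 𝓘(ℝ, E) x₀).target :=
      (extChartAt 𝓘(ℝ, E) x₀).map_source (by rwa [extChartAt_source])
    have hsymm : ∀ z ∈ (extChartAt 𝓘(ℝ, E) x₀).target,
        ContMDiffAt 𝓘(ℝ, E) 𝓘(ℝ, E) ∞ (extChartAt 𝓘(ℝ, E) x₀).symm z := fun z hz =>
      (contMDiffOn_extChartAt_symm x₀).contMDiffAt ((isOpen_extChartAt_target x₀).mem_nhds hz)
    have hleft : ∀ y ∈ (chartAt E x₀).source,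
        (extChartAt 𝓘(ℝ, E) x₀).symm (extChartAt 𝓘(ℝ, E) x₀ y) = y := fun y hy =>
      (extChartAt 𝓘(ℝ, E) x₀).left_inv (by rwa [extChartAt_source])
    have h1 : ContMDiffAt (𝓘(ℝ, E).prod 𝓘(ℝ, E)) 𝓘(ℝ, E) ∞
        (Function.uncurry fun (_ : M) z => (extChartAt 𝓘(ℝ, E) x₀).symm z)
        (x, extChartAt 𝓘(ℝ, E) x₀ x) :=
      ContMDiffAt.comp (f := Prod.snd) (x, extChartAt 𝓘(ℝ, E) x₀ x) (hsymm _ hz) contMDiffAt_snd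
    have h2 : ContMDiffAt 𝓘(ℝ, E) (𝓘(ℝ, E).prod 𝓘(ℝ, E)) ∞
        (fun y : M => (⟨extChartAt 𝓘(ℝ, E) x₀ y, v⟩ : TangentBundle 𝓘(ℝ, E) E)) x :=
      contMDiffAt_vectorSpace_mk (contMDiffAt_extChartAt_infty hx) contMDiffAt_const
    have h3 := ContMDiffAt.mfderiv_apply_family h1 h2
    refine h3.congr_of_eventuallyEq ?_
    filter_upwards [(chartAt E x₀).open_source.mem_nhds hx] with y hy
    refine tangentBundle_mk_eq (hleft y hy).symm ?_
    have hzy : extChartAt 𝓘(ℝ, E) x₀ y ∈ (extChartAt 𝓘(ℝ, E) x₀).target :=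
      (extChartAt 𝓘(ℝ, E) x₀).map_source (by rwa [extChartAt_source])
    have h4 := mfderiv_comp_apply y (g := (extChartAt 𝓘(ℝ, E) x₀).symm) (f := extChartAt 𝓘(ℝ, E) x₀)
      ((hsymm _ hzy).mdiffAt_of_infty)
      (contMDiffAt_extChartAt_infty hy).mdiffAt_of_infty (V y)
    have h5 : ((extChartAt 𝓘(ℝ, E) x₀).symm ∘ extChartAt 𝓘(ℝ, E) x₀) =ᶠ[𝓝 y] id := by
      filter_upwards [(chartAt E x₀).open_source.mem_nhds hy] with y' hy'
      exact hleft y' hy'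
    have h6 := congrArg (fun L : E →L[ℝ] E => L (V y))
      (h5.mfderiv_eq.trans (mfderiv_id (I := 𝓘(ℝ, E)) (x := y)))
    refine h6.symm.trans (h4.trans ?_)
    exact congrArg (fun w : E => (mfderiv 𝓘(ℝ, E) 𝓘(ℝ, E) (extChartAt 𝓘(ℝ, E) x₀).symm
      (extChartAt 𝓘(ℝ, E) x₀ y) : E →L[ℝ] E) w) (hV y hy)
  obtain ⟨f, h1, -, h3⟩ := exists_contMDiff_smul_vector (F := E) contMDiff_id
    (chartAt E x₀).open_source hsm (mem_chart_source E x₀)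
  refine ⟨⟨fun x => f x • V x, h3⟩, ?_⟩
  change f x₀ • V x₀ = v
  have := hV x₀ (mem_chart_source E x₀)
  rw [tcoord_self] at this
  rw [h1, one_smul]
  exact this

end TangentVectors

variable {E : Type u} [NormedAddCommGroup E] [NormedSpace ℝ E]
  {M : Type v} [TopologicalSpace M] [ChartedSpace E M] [IsManifold 𝓘(ℝ, E) ∞ M]
  {F : Type w} [NormedAddCommGroup F] [NormedSpace ℝ F] [FiniteDimensional ℝ F]
  {𝒢 : Type z} [TopologicalSpace 𝒢] [ChartedSpace F 𝒢] [IsManifold 𝓘(ℝ, F) ∞ 𝒢]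
  {B : Type*} [NormedAddCommGroup B] [NormedSpace ℝ B] {H : Type*}
  [TopologicalSpace H] {I : ModelWithCorners ℝ B H} {N : Type*} [TopologicalSpace N]
  [ChartedSpace H N]

namespace LieGroupoid

variable (G : LieGroupoid E M F 𝒢)

namespace SourceChart

variable {G} (e : G.SourceChart)

/-- The vertical tangent vector at `g` with prescribed fibre coordinates. -/
def vert (g : 𝒢) (w : Fin G.lieAlgebroid.rank → ℝ) : F :=
  mfderiv 𝓘(ℝ, Fin G.lieAlgebroid.rank → ℝ) 𝓘(ℝ, F) (fun y => e.arrow (G.src g) y) (e.fib g) w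

/-- The tangent vector at `g` with prescribed image under `ds`, and constant fibre coordinates. -/
def horiz (g : 𝒢) (w : TangentSpace 𝓘(ℝ, E) (G.src g)) : F :=
  mfderiv 𝓘(ℝ, E) 𝓘(ℝ, F) (fun x => e.arrow x (e.fib g)) (G.src g) w

theorem mdiff_vert {g : 𝒢} (hg : g ∈ e.chart.source) :
    MDifferentiableAt 𝓘(ℝ, Fin G.lieAlgebroid.rank → ℝ) 𝓘(ℝ, F)
      (fun y => e.arrow (G.src g) y) (e.fib g) :=
  (e.contMDiffAt_arrow_comp (I := 𝓘(ℝ, Fin G.lieAlgebroid.rank → ℝ)) (x := fun _ => G.src g)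
    (y := fun y => y) (n := e.fib g)
    (e.mem_target hg) contMDiffAt_const contMDiffAt_id).mdiffAt_of_infty

theorem mdiff_horiz {g : 𝒢} (hg : g ∈ e.chart.source) :
    MDifferentiableAt 𝓘(ℝ, E) 𝓘(ℝ, F) (fun x => e.arrow x (e.fib g)) (G.src g) :=
  (e.contMDiffAt_arrow_comp (I := 𝓘(ℝ, E)) (x := id) (y := fun _ => e.fib g) (n := G.src g)
    (e.mem_target hg) contMDiffAt_id contMDiffAt_const).mdiffAt_of_infty

theorem mfderiv_src_vert {g : 𝒢} (hg : g ∈ e.chart.source) (w : Fin G.lieAlgebroid.rank → ℝ) :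
    (mfderiv 𝓘(ℝ, F) 𝓘(ℝ, E) G.src g (e.vert g w) : E) = 0 := by
  have h0 : e.arrow (G.src g) (e.fib g) = g := e.arrow_fib hg
  have h1 : MDifferentiableAt 𝓘(ℝ, F) 𝓘(ℝ, E) G.src (e.arrow (G.src g) (e.fib g)) :=
    G.mdifferentiableAt_src _
  have h2 := mfderiv_comp_apply (e.fib g) h1 (e.mdiff_vert hg) w
  have h3 : (G.src ∘ fun y => e.arrow (G.src g) y) =ᶠ[𝓝 (e.fib g)] fun _ => G.src g := by
    filter_upwards [e.eventually_mem_target (x := fun _ => G.src g) (y := fun y => y)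
      (e.mem_target hg) continuousAt_const continuousAt_id] with y hy
    exact e.src_arrow hy
  have h4 := congrArg (fun L : (Fin G.lieAlgebroid.rank → ℝ) →L[ℝ] E => L w)
    (h3.mfderiv_eq.trans (mfderiv_const (I := 𝓘(ℝ, Fin G.lieAlgebroid.rank → ℝ)) (I' := 𝓘(ℝ, E))
      (x := e.fib g) (c := G.src g)))
  refine Eq.trans ?_ (h2.symm.trans h4)
  exact congrArg (fun g' => (mfderiv 𝓘(ℝ, F) 𝓘(ℝ, E) G.src g' : F →L[ℝ] E) (e.vert g w)) h0.symm

theorem mfderiv_src_horiz {g : 𝒢} (hg : g ∈ e.chart.source) (w : TangentSpace 𝓘(ℝ, E) (G.src g)) :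
    (mfderiv 𝓘(ℝ, F) 𝓘(ℝ, E) G.src g (e.horiz g w) : E) = w := by
  have h0 : e.arrow (G.src g) (e.fib g) = g := e.arrow_fib hg
  have h1 : MDifferentiableAt 𝓘(ℝ, F) 𝓘(ℝ, E) G.src (e.arrow (G.src g) (e.fib g)) :=
    G.mdifferentiableAt_src _
  have h2 := mfderiv_comp_apply (G.src g) h1 (e.mdiff_horiz hg) w
  have h3 : (G.src ∘ fun x => e.arrow x (e.fib g)) =ᶠ[𝓝 (G.src g)] id := by
    filter_upwards [e.eventually_mem_target (x := fun x => x) (y := fun _ => e.fib g)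
      (e.mem_target hg) continuousAt_id continuousAt_const] with y hy
    exact e.src_arrow hy
  have h4 := congrArg (fun L : E →L[ℝ] E => L w)
    (h3.mfderiv_eq.trans (mfderiv_id (I := 𝓘(ℝ, E)) (x := G.src g)))
  refine Eq.trans ?_ (h2.symm.trans h4)
  exact congrArg (fun g' => (mfderiv 𝓘(ℝ, F) 𝓘(ℝ, E) G.src g' : F →L[ℝ] E) (e.horiz g w)) h0.symm

theorem dfib_vert {g : 𝒢} (hg : g ∈ e.chart.source) (w : Fin G.lieAlgebroid.rank → ℝ) :
    e.dfib g (e.vert g w) = w := by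
  have h0 : e.arrow (G.src g) (e.fib g) = g := e.arrow_fib hg
  have h1 : MDifferentiableAt 𝓘(ℝ, F) 𝓘(ℝ, Fin G.lieAlgebroid.rank → ℝ) e.fib
      (e.arrow (G.src g) (e.fib g)) := by
    rw [h0]; exact (e.contMDiffAt_fib hg).mdiffAt_of_infty
  have h2 := mfderiv_comp_apply (e.fib g) h1 (e.mdiff_vert hg) w
  have h3 : (e.fib ∘ fun y => e.arrow (G.src g) y) =ᶠ[𝓝 (e.fib g)] id := by
    filter_upwards [e.eventually_mem_target (x := fun _ => G.src g) (y := fun y => y)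
      (e.mem_target hg) continuousAt_const continuousAt_id] with y hy
    exact e.fib_arrow hy
  have h4 := congrArg (fun L : (Fin G.lieAlgebroid.rank → ℝ) →L[ℝ] (Fin G.lieAlgebroid.rank → ℝ) =>
    L w) (h3.mfderiv_eq.trans (mfderiv_id (I := 𝓘(ℝ, Fin G.lieAlgebroid.rank → ℝ)) (x := e.fib g)))
  refine Eq.trans ?_ (h2.symm.trans h4)
  exact congrArg (fun g' => (mfderiv 𝓘(ℝ, F) 𝓘(ℝ, Fin G.lieAlgebroid.rank → ℝ) e.fib g' :
    F →L[ℝ] _) (e.vert g w)) h0.symm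

theorem contMDiffAt_vert [IsManifold I ∞ N] {u : N → 𝒢} {n₀ : N} (hn : u n₀ ∈ e.chart.source)
    (hu : ContMDiffAt I 𝓘(ℝ, F) ∞ u n₀) (w : Fin G.lieAlgebroid.rank → ℝ) :
    ContMDiffAt I (𝓘(ℝ, F).prod 𝓘(ℝ, F)) ∞
      (fun n => (⟨u n, e.vert (u n) w⟩ : TangentBundle 𝓘(ℝ, F) 𝒢)) n₀ := by
  have hx : ContMDiffAt I 𝓘(ℝ, E) ∞ (fun n => G.src (u n)) n₀ :=
    ContMDiffAt.comp n₀ (g := G.src) G.contMDiff_src.contMDiffAt hu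
  have hy : ContMDiffAt I 𝓘(ℝ, Fin G.lieAlgebroid.rank → ℝ) ∞ (fun n => e.fib (u n)) n₀ :=
    ContMDiffAt.comp n₀ (g := e.fib) (e.contMDiffAt_fib hn) hu
  have h1 : ContMDiffAt (I.prod 𝓘(ℝ, Fin G.lieAlgebroid.rank → ℝ)) 𝓘(ℝ, F) ∞
      (Function.uncurry fun n y => e.arrow (G.src (u n)) y) (n₀, e.fib (u n₀)) :=
    e.contMDiffAt_arrow_comp (n := (n₀, e.fib (u n₀))) (x := fun p => G.src (u p.1))
      (y := fun p => p.2) (e.mem_target hn)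
      (ContMDiffAt.comp (f := Prod.fst) (n₀, e.fib (u n₀)) hx contMDiffAt_fst) contMDiffAt_snd
  have h2 := ContMDiffAt.mfderiv_apply_family h1 (contMDiffAt_vectorSpace_mk hy
    (contMDiffAt_const (c := w)))
  refine h2.congr_of_eventuallyEq ?_
  filter_upwards [hu.continuousAt.eventually (e.chart.open_source.mem_nhds hn)] with n hn'
  exact tangentBundle_mk_eq (e.arrow_fib hn').symm rfl

theorem contMDiffAt_horiz [IsManifold I ∞ N] {u : N → 𝒢} {n₀ : N} (hn : u n₀ ∈ e.chart.source)
    {w : Π n, TangentSpace 𝓘(ℝ, E) (G.src (u n))}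
    (hu : ContMDiffAt I 𝓘(ℝ, F) ∞ u n₀)
    (hw : ContMDiffAt I (𝓘(ℝ, E).prod 𝓘(ℝ, E)) ∞
      (fun n => (⟨G.src (u n), w n⟩ : TangentBundle 𝓘(ℝ, E) M)) n₀) :
    ContMDiffAt I (𝓘(ℝ, F).prod 𝓘(ℝ, F)) ∞
      (fun n => (⟨u n, e.horiz (u n) (w n)⟩ : TangentBundle 𝓘(ℝ, F) 𝒢)) n₀ := by
  have hy : ContMDiffAt I 𝓘(ℝ, Fin G.lieAlgebroid.rank → ℝ) ∞ (fun n => e.fib (u n)) n₀ :=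
    ContMDiffAt.comp n₀ (g := e.fib) (e.contMDiffAt_fib hn) hu
  have h1 : ContMDiffAt (I.prod 𝓘(ℝ, E)) 𝓘(ℝ, F) ∞
      (Function.uncurry fun n x => e.arrow x (e.fib (u n))) (n₀, G.src (u n₀)) :=
    e.contMDiffAt_arrow_comp (n := (n₀, G.src (u n₀))) (x := fun p => p.2)
      (y := fun p => e.fib (u p.1)) (e.mem_target hn) contMDiffAt_snd
      (ContMDiffAt.comp (f := Prod.fst) (n₀, G.src (u n₀)) hy contMDiffAt_fst)
  have h2 := ContMDiffAt.mfderiv_apply_family h1 hw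
  refine h2.congr_of_eventuallyEq ?_
  filter_upwards [hu.continuousAt.eventually (e.chart.open_source.mem_nhds hn)] with n hn'
  exact tangentBundle_mk_eq (e.arrow_fib hn').symm rfl

end SourceChart

/-- Every element of the Lie algebroid is a value of a smooth section. -/
theorem exists_smooth_section [FiniteDimensional ℝ E] [T2Space M] (x₀ : M) (a : G.lieFiber x₀) :
    ∃ α : {α // G.lieAlgebroid.IsSmooth α}, α.1 x₀ = a := by
  obtain ⟨e, he⟩ := G.exists_sourceChart (G.unit x₀)
  set w := e.dfib (G.unit x₀) a.1
  -- the section with constant fibre coordinates in a source chart, cut off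
  obtain ⟨f, h1, h2, h3⟩ := exists_contMDiff_smul_vector (F := F) G.contMDiff_unit
    (v := fun x => e.vert (G.unit x) w)
    (U := G.unit ⁻¹' e.chart.source) (e.chart.open_source.preimage G.contMDiff_unit.continuous)
    (fun x hx => e.contMDiffAt_vert hx G.contMDiff_unit.contMDiffAt w) he
  have hmem : ∀ x, (f x • (e.vert (G.unit x) w : TangentSpace 𝓘(ℝ, F) (G.unit x))) ∈ G.lieFiber x := by
    intro x
    by_cases hx : x ∈ G.unit ⁻¹' e.chart.source
    · exact (G.lieFiber x).smul_mem _ (e.mfderiv_src_vert hx w)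
    · rw [h2 x hx, zero_smul]
      exact (G.lieFiber x).zero_mem
  refine ⟨⟨fun x => ⟨_, hmem x⟩, h3⟩, Subtype.ext ?_⟩
  change f x₀ • (e.vert (G.unit x₀) w : F) = a.1
  rw [h1, one_smul]
  refine e.eq_of_dsrc_dfib he ?_ (e.dfib_vert he w)
  exact (e.mfderiv_src_vert he w).trans (LinearMap.mem_ker.1 a.2).symm

end LieGroupoid

end GlobalSections

/-! ### Adapted frames and the action on transverse densities -/

noncomputable section AdaptedFrames

section LinearAlgebra

variable {ι κ A V T : Type*} [Fintype ι] [DecidableEq ι] [Fintype κ] [DecidableEq κ]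
  [AddCommGroup A] [Module ℝ A] [AddCommGroup V] [Module ℝ V] [AddCommGroup T] [Module ℝ T]

/-- The change of frames of an extension of vector spaces is block triangular. -/
theorem Module.Basis.det_adapted {R : A →ₗ[ℝ] V} {p : V →ₗ[ℝ] T} (hR : ∀ a, p (R a) = 0)
    {a a₁ : Basis ι ℝ A} {e e₁ : Basis κ ℝ T} {b b₁ : Basis (ι ⊕ κ) ℝ V}
    (ha : ∀ i, b (Sum.inl i) = R (a i)) (he : ∀ j, p (b (Sum.inr j)) = e j)
    (ha₁ : ∀ i, b₁ (Sum.inl i) = R (a₁ i)) (he₁ : ∀ j, p (b₁ (Sum.inr j)) = e₁ j) :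
    b.det b₁ = a.det a₁ * e.det e₁ := by
  have h1 : ∀ i, b.repr (b₁ (Sum.inl i)) = Finsupp.equivFunOnFinite.symm
      (Sum.elim (fun k => a.repr (a₁ i) k) fun _ => 0) := by
    intro i
    have : b₁ (Sum.inl i) = ∑ s, (Sum.elim (fun k => a.repr (a₁ i) k) fun _ => 0) s • b s := by
      rw [ha₁, Fintype.sum_sum_type]
      simp only [Sum.elim_inl, Sum.elim_inr, zero_smul, Finset.sum_const_zero, add_zero, ha]
      rw [← a.sum_repr (a₁ i), map_sum]
      simp
    rw [this]
    ext s
    rw [b.repr_sum_self]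
    rfl
  have h2 : ∀ j l, b.repr (b₁ (Sum.inr j)) (Sum.inr l) = e.repr (e₁ j) l := by
    intro j l
    have : e₁ j = ∑ l, b.repr (b₁ (Sum.inr j)) (Sum.inr l) • e l := by
      rw [← he₁]
      conv_lhs => rw [← b.sum_repr (b₁ (Sum.inr j)), Fintype.sum_sum_type, map_add, map_sum, map_sum]
      simp [ha, hR, he]
    rw [this, e.repr_sum_self]
  have h3 : b.toMatrix b₁ = Matrix.fromBlocks (a.toMatrix a₁)
      (Matrix.of fun i j => b.repr (b₁ (Sum.inr j)) (Sum.inl i)) 0 (e.toMatrix e₁) := by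
    ext s t
    rcases s with s | s <;> rcases t with t | t
    · simp [Basis.toMatrix_apply, h1]
    · simp [Basis.toMatrix_apply]
    · simp [Basis.toMatrix_apply, h1]
    · simp [Basis.toMatrix_apply, h2]
  rw [Basis.det_apply, h3, Matrix.det_fromBlocks_zero₂₁, Basis.det_apply, Basis.det_apply]

/-- Images of a frame of the subspace and lifts of a frame of the quotient form a frame. -/
theorem Module.Basis.exists_adapted [FiniteDimensional ℝ V] {R : A →ₗ[ℝ] V} {p : V →ₗ[ℝ] T}
    (hR : ∀ a, p (R a) = 0) (hinj : Function.Injective R)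
    (hcard : Fintype.card ι + Fintype.card κ = finrank ℝ V) (a : Basis ι ℝ A) (e : Basis κ ℝ T)
    {v : ι ⊕ κ → V} (ha : ∀ i, v (Sum.inl i) = R (a i)) (he : ∀ j, p (v (Sum.inr j)) = e j) :
    ∃ b : Basis (ι ⊕ κ) ℝ V, ⇑b = v := by
  have hli : LinearIndependent ℝ v := by
    rw [Fintype.linearIndependent_iff]
    intro c hc
    rw [Fintype.sum_sum_type] at hc
    have h1 : ∑ j, c (Sum.inr j) • e j = 0 := by
      have := congrArg p hc
      simpa [ha, hR, he] using this
    have h2 := Fintype.linearIndependent_iff.1 e.linearIndependent _ h1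
    have h3 : ∑ i, c (Sum.inl i) • a i = 0 := by
      refine hinj ?_
      have h4 : ∑ j, c (Sum.inr j) • v (Sum.inr j) = 0 :=
        Finset.sum_eq_zero fun j _ => by rw [h2 j, zero_smul]
      rw [h4, add_zero] at hc
      rw [map_zero, ← hc, map_sum]
      simp [ha]
    have h4 := Fintype.linearIndependent_iff.1 a.linearIndependent _ h3
    rintro (i | j)
    · exact h4 i
    · exact h2 j
  have hc : Fintype.card (ι ⊕ κ) = finrank ℝ V := by rw [Fintype.card_sum, hcard]
  by_cases hne : Nonempty (ι ⊕ κ)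
  · exact ⟨basisOfLinearIndependentOfCardEqFinrank hli hc,
      coe_basisOfLinearIndependentOfCardEqFinrank hli hc⟩
  · have : IsEmpty (ι ⊕ κ) := not_nonempty_iff.1 hne
    have h0 : finrank ℝ V = 0 := by rw [← hc]; simp
    have := finrank_zero_iff.1 h0
    exact ⟨Basis.empty V, funext fun i => isEmptyElim i⟩

/-- A frame with the signs of the first half reversed, up to a block triangular correction. -/
theorem Module.Basis.abs_det_neg_add (b : Basis (ι ⊕ κ) ℝ V) {v : ι ⊕ κ → V} {c : ι → κ → ℝ}
    (h1 : ∀ i, v (Sum.inl i) = (∑ j, c i j • b (Sum.inr j)) - b (Sum.inl i))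
    (h2 : ∀ j, v (Sum.inr j) = b (Sum.inr j)) : |b.det v| = 1 := by
  have h3 : b.toMatrix v = Matrix.fromBlocks (-1) 0 (Matrix.of fun j i => c i j) 1 := by
    ext s t
    rcases s with s | s <;> rcases t with t | t
    · simp only [Basis.toMatrix_apply, h1, map_sub, map_sum, map_smul, b.repr_self,
        Finsupp.sub_apply, Finsupp.finsetSum_apply, Matrix.fromBlocks_apply₁₁, Matrix.neg_apply,
        Matrix.one_apply, Finsupp.smul_apply, Finsupp.single_apply]
      simp [eq_comm]
    · simp [Basis.toMatrix_apply, h2]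
    · simp only [Basis.toMatrix_apply, h1, map_sub, map_sum, map_smul, b.repr_self,
        Finsupp.sub_apply, Finsupp.finsetSum_apply, Matrix.fromBlocks_apply₂₁, Matrix.of_apply,
        Finsupp.smul_apply, Finsupp.single_apply]
      simp
    · simp [Basis.toMatrix_apply, h2, Matrix.one_apply, Finsupp.single_apply, eq_comm]
  rw [Basis.det_apply, h3, Matrix.det_fromBlocks_zero₁₂, Matrix.det_one, mul_one, Matrix.det_neg,
    Matrix.det_one, mul_one, abs_pow, abs_neg, abs_one, one_pow]

/-- The relation that defines the action of an arrow on transverse densities does not depend on the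
choice of frames. -/
theorem TransverseDensity.eval_mul_of_eval_mul {r n : ℕ} {A A' T T' V : Type*}
    [AddCommGroup A] [Module ℝ A] [AddCommGroup A'] [Module ℝ A'] [AddCommGroup T] [Module ℝ T]
    [AddCommGroup T'] [Module ℝ T'] [AddCommGroup V] [Module ℝ V]
    {τ : TransverseDensity r n A T} {τ' : TransverseDensity r n A' T'}
    {a a₁ : Basis (Fin r) ℝ A} {a' a₁' : Basis (Fin r) ℝ A'} {e e₁ : Basis (Fin n) ℝ T}
    {e' e₁' : Basis (Fin n) ℝ T'} {b b₁ b' b₁' : Basis (Fin r ⊕ Fin n) ℝ V}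
    (d1 : b.det b₁ = a'.det a₁' * e.det e₁) (d2 : b'.det b₁' = a.det a₁ * e'.det e₁')
    (h : eval a' e' τ' = eval a e τ * |b.det b'|) (ζ : Density (Fin r ⊕ Fin n) V) :
    eval a₁' e₁' τ' * ζ.1 b₁ = eval a₁ e₁ τ * ζ.1 b₁' := by
  have e1 := eval_mul_abs_det a a₁ e e₁ τ
  have e2 := eval_mul_abs_det a' a₁' e' e₁' τ'
  have z1 := ζ.2 b b₁
  have z2 := ζ.2 b' b₁'
  have z3 := ζ.2 b b'
  rw [d1, abs_mul] at z1
  rw [d2, abs_mul] at z2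
  calc _ = eval a₁' e₁' τ' * |a'.det a₁'| * |e.det e₁| * ζ.1 b := by rw [z1]; ring
    _ = |e'.det e₁'| * |e.det e₁| * ζ.1 b * eval a' e' τ' := by rw [e2]; ring
    _ = |e'.det e₁'| * ζ.1 b' * (|e.det e₁| * eval a e τ) := by rw [h, z3]; ring
    _ = eval a₁ e₁ τ * ζ.1 b₁' := by rw [← e1, z2]; ring

end LinearAlgebra

universe u v w z

variable {E : Type u} [NormedAddCommGroup E] [NormedSpace ℝ E]
  {M : Type v} [TopologicalSpace M] [ChartedSpace E M] [IsManifold 𝓘(ℝ, E) ∞ M]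
  {F : Type w} [NormedAddCommGroup F] [NormedSpace ℝ F] [FiniteDimensional ℝ F]
  {𝒢 : Type z} [TopologicalSpace 𝒢] [ChartedSpace F 𝒢] [IsManifold 𝓘(ℝ, F) ∞ 𝒢]

namespace LieGroupoid

variable (G : LieGroupoid E M F 𝒢)

theorem mfderiv_inv_mfderiv_inv (g : 𝒢) (v : F) :
    (mfderiv 𝓘(ℝ, F) 𝓘(ℝ, F) G.inv (G.inv g) (mfderiv 𝓘(ℝ, F) 𝓘(ℝ, F) G.inv g v) : F) = v := by
  have h1 := mfderiv_comp_apply g (G.mdifferentiableAt_inv (G.inv g)) (G.mdifferentiableAt_inv g) v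
  have h2 : G.inv ∘ G.inv = id := funext G.inv_inv
  rw [h2] at h1
  exact h1.symm.trans (congrArg (fun L : F →L[ℝ] F => L v) (mfderiv_id (I := 𝓘(ℝ, F)) (x := g)))

theorem mfderiv_inv_mfderiv_inv' (g : 𝒢) (v : F) :
    (mfderiv 𝓘(ℝ, F) 𝓘(ℝ, F) G.inv g (mfderiv 𝓘(ℝ, F) 𝓘(ℝ, F) G.inv (G.inv g) v) : F) = v := by
  have h := G.mfderiv_inv_mfderiv_inv (G.inv g) v
  rwa [G.inv_inv g] at h

theorem mfderiv_src_inv (g : 𝒢) (v : F) :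
    (mfderiv 𝓘(ℝ, F) 𝓘(ℝ, E) G.src (G.inv g) (mfderiv 𝓘(ℝ, F) 𝓘(ℝ, F) G.inv g v) : E) =
      mfderiv 𝓘(ℝ, F) 𝓘(ℝ, E) G.tgt g v := by
  have h1 := mfderiv_comp_apply g (G.mdifferentiableAt_src (G.inv g)) (G.mdifferentiableAt_inv g) v
  have h2 : G.src ∘ G.inv = G.tgt := funext G.src_inv
  rw [h2] at h1
  exact h1.symm

/-- Right translation by `g⁻¹` followed by the differential of the inversion: it takes the algebroid
at the source of `g` to the kernel of `dt` at `g`. -/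
def leftTranslationₗ (g : 𝒢) (x : M) : G.lieFiber x →ₗ[ℝ] TangentSpace 𝓘(ℝ, F) g :=
  ((mfderiv 𝓘(ℝ, F) 𝓘(ℝ, F) G.inv (G.inv g)).toLinearMap ∘ₗ G.rightTranslationₗ (G.inv g) x :
    G.lieFiber x →ₗ[ℝ] TangentSpace 𝓘(ℝ, F) (G.inv (G.inv g)))

theorem mfderiv_inv_leftTranslationₗ (g : 𝒢) (x : M) (a : G.lieFiber x) :
    (mfderiv 𝓘(ℝ, F) 𝓘(ℝ, F) G.inv g (G.leftTranslationₗ g x a) : F) =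
      G.rightTranslation (G.inv g) x a :=
  G.mfderiv_inv_mfderiv_inv' g _

theorem mfderiv_tgt_leftTranslationₗ (g : 𝒢) {x : M} (hx : x = G.src g) (a : G.lieFiber x) :
    (mfderiv 𝓘(ℝ, F) 𝓘(ℝ, E) G.tgt g (G.leftTranslationₗ g x a) : E) = 0 :=
  (G.mfderiv_src_inv g _).symm.trans ((congrArg (fun v : F =>
    (mfderiv 𝓘(ℝ, F) 𝓘(ℝ, E) G.src (G.inv g) : F →L[ℝ] E) v)
    (G.mfderiv_inv_leftTranslationₗ g x a)).trans
    (G.mfderiv_src_rightTranslation (hx.trans (G.tgt_inv g).symm) a))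

theorem leftTranslationₗ_injective (g : 𝒢) {x : M} (hx : x = G.src g) :
    Function.Injective (G.leftTranslationₗ g x) := by
  intro a a' h
  refine G.rightTranslation_injective (g := G.inv g) (hx.trans (G.tgt_inv g).symm) ?_
  refine (G.mfderiv_inv_leftTranslationₗ g x a).symm.trans
    (Eq.trans ?_ (G.mfderiv_inv_leftTranslationₗ g x a'))
  rw [h]

/-- The action of `g` on transverse densities can be tested on one set of adapted frames. -/
theorem actsTo_iff {g : 𝒢} {τ : G.lieAlgebroid.Dtr (G.src g)} {τ' : G.lieAlgebroid.Dtr (G.tgt g)}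
    {a : Basis (Fin G.lieAlgebroid.rank) ℝ (G.lieFiber (G.src g))}
    {a' : Basis (Fin G.lieAlgebroid.rank) ℝ (G.lieFiber (G.tgt g))}
    {e : Basis (Fin (finrank ℝ E)) ℝ (TangentSpace 𝓘(ℝ, E) (G.src g))}
    {e' : Basis (Fin (finrank ℝ E)) ℝ (TangentSpace 𝓘(ℝ, E) (G.tgt g))}
    {b b' : Basis (Fin G.lieAlgebroid.rank ⊕ Fin (finrank ℝ E)) ℝ (TangentSpace 𝓘(ℝ, F) g)}
    (hb : G.IsAdapted g a' e b)
    (hb' : G.IsAdapted (G.inv g) a e' fun k => mfderiv 𝓘(ℝ, F) 𝓘(ℝ, F) G.inv g (b' k)) :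
    G.ActsTo g τ τ' ↔
      TransverseDensity.eval a' e' τ' = TransverseDensity.eval a e τ * |b.det b'| := by
  constructor
  · intro h
    have h1 := h a a' e e' b b' hb hb' (Density.ofBasis b)
    rwa [Density.ofBasis_self, mul_one, Density.ofBasis_apply] at h1
  intro h a₁ a₁' e₁ e₁' b₁ b₁' hb₁ hb₁' ζ
  have d1 : b.det b₁ = a'.det a₁' * e.det e₁ :=
    Basis.det_adapted (R := G.rightTranslationₗ g (G.tgt g))
      (p := (mfderiv 𝓘(ℝ, F) 𝓘(ℝ, E) G.src g).toLinearMap)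
      (fun a => G.mfderiv_src_rightTranslation rfl a) hb.1 hb.2 hb₁.1 hb₁.2
  -- frames whose images under the inversion are adapted at `g⁻¹` are adapted to the sequence
  -- that `dt` and left translation define at `g`
  have key : ∀ (a : Basis (Fin G.lieAlgebroid.rank) ℝ (G.lieFiber (G.src g)))
      (e' : Basis (Fin (finrank ℝ E)) ℝ (TangentSpace 𝓘(ℝ, E) (G.tgt g)))
      (b' : Basis (Fin G.lieAlgebroid.rank ⊕ Fin (finrank ℝ E)) ℝ (TangentSpace 𝓘(ℝ, F) g)),
      (G.IsAdapted (G.inv g) a e' fun k => mfderiv 𝓘(ℝ, F) 𝓘(ℝ, F) G.inv g (b' k)) →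
      (∀ i, b' (Sum.inl i) = G.leftTranslationₗ g (G.src g) (a i)) ∧
      ∀ j, (mfderiv 𝓘(ℝ, F) 𝓘(ℝ, E) G.tgt g (b' (Sum.inr j))) = e' j := by
    intro a e' b' hb'
    refine ⟨fun i => ?_, fun j => (G.mfderiv_src_inv g _).symm.trans (hb'.2 j)⟩
    refine (G.mfderiv_inv_mfderiv_inv g (b' (Sum.inl i))).symm.trans ?_
    exact congrArg (fun v : F => (mfderiv 𝓘(ℝ, F) 𝓘(ℝ, F) G.inv (G.inv g) : F →L[ℝ] F) v) (hb'.1 i)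
  have k1 := key a e' b' hb'
  have k2 := key a₁ e₁' b₁' hb₁'
  have d2 : b'.det b₁' = a.det a₁ * e'.det e₁' :=
    Basis.det_adapted (R := G.leftTranslationₗ g (G.src g))
      (p := (mfderiv 𝓘(ℝ, F) 𝓘(ℝ, E) G.tgt g).toLinearMap)
      (fun a => G.mfderiv_tgt_leftTranslationₗ g rfl a) k1.1 k1.2 k2.1 k2.2
  exact TransverseDensity.eval_mul_of_eval_mul d1 d2 h ζ

/-- `σ` is multiplied by `k` under the action of `g`: `g_* σ(s(g)) = k σ(t(g))`. -/
def Scales (σ : Π x, G.lieAlgebroid.Dtr x) (g : 𝒢) (k : ℝ) : Prop :=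
  G.ActsTo g (σ (G.src g)) (k • σ (G.tgt g))

/-- The action on a density, tested on frames at points `x` and `y` that are only propositionally
equal to the source and the target of `g`. -/
theorem scales_iff {σ : Π x, G.lieAlgebroid.Dtr x} {k : ℝ} {g : 𝒢} {x y : M} (hx : x = G.src g)
    (hy : y = G.tgt g)
    {a : Basis (Fin G.lieAlgebroid.rank) ℝ (G.lieFiber x)}
    {a' : Basis (Fin G.lieAlgebroid.rank) ℝ (G.lieFiber y)}
    {e : Basis (Fin (finrank ℝ E)) ℝ (TangentSpace 𝓘(ℝ, E) x)}
    {e' : Basis (Fin (finrank ℝ E)) ℝ (TangentSpace 𝓘(ℝ, E) y)}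
    {b b' : Basis (Fin G.lieAlgebroid.rank ⊕ Fin (finrank ℝ E)) ℝ (TangentSpace 𝓘(ℝ, F) g)}
    (hb : G.IsAdapted g a' e b)
    (hb' : G.IsAdapted (G.inv g) a e' fun k => mfderiv 𝓘(ℝ, F) 𝓘(ℝ, F) G.inv g (b' k)) :
    G.Scales σ g k ↔ k * TransverseDensity.eval a' e' (σ y) =
      TransverseDensity.eval a e (σ x) * |b.det b'| := by
  subst hx hy
  have h := (TransverseDensity.eval a' e').map_smul k (σ (G.tgt g))
  exact (G.actsTo_iff hb hb').trans ⟨fun h' => h.symm.trans h', fun h' => h.trans h'⟩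

end LieGroupoid

end AdaptedFrames

/-! ### Local bisections -/

noncomputable section Bisections

universe u v w z

variable {E : Type u} [NormedAddCommGroup E] [NormedSpace ℝ E]
  {M : Type v} [TopologicalSpace M] [ChartedSpace E M] [IsManifold 𝓘(ℝ, E) ∞ M]
  {F : Type w} [NormedAddCommGroup F] [NormedSpace ℝ F] [FiniteDimensional ℝ F]
  {𝒢 : Type z} [TopologicalSpace 𝒢] [ChartedSpace F 𝒢] [IsManifold 𝓘(ℝ, F) ∞ 𝒢]

namespace LieGroupoid

variable (G : LieGroupoid E M F 𝒢)

/-- A local bisection near `x`, up to first order: a smooth local section `β` of the source map such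
that `t ∘ β` has an invertible differential at `x`. -/
structure IsBisectionAt (β : M → 𝒢) (x : M) : Prop where
  contMDiffAt : ContMDiffAt 𝓘(ℝ, E) 𝓘(ℝ, F) ∞ β x
  src_eq : ∀ᶠ x' in 𝓝 x, G.src (β x') = x'
  bijective : Function.Bijective (mfderiv 𝓘(ℝ, E) 𝓘(ℝ, E) (fun x => G.tgt (β x)) x)

/-- Left translation by a local bisection. -/
def bisMap (β : M → 𝒢) (h : 𝒢) : 𝒢 := G.mul (β (G.tgt h)) h

/-- A section of the source map through `g` with prescribed differential. -/
theorem exists_local_section {g : 𝒢} {x : M} (hx : x = G.src g) (L : E →L[ℝ] F)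
    (hL : ∀ v, (mfderiv 𝓘(ℝ, F) 𝓘(ℝ, E) G.src g (L v) : E) = v) :
    ∃ β : M → 𝒢, ContMDiffAt 𝓘(ℝ, E) 𝓘(ℝ, F) ∞ β x ∧ (∀ᶠ x' in 𝓝 x, G.src (β x') = x') ∧
      β x = g ∧ ∀ v, (mfderiv 𝓘(ℝ, E) 𝓘(ℝ, F) β x v : F) = L v := by
  subst hx
  obtain ⟨e, he⟩ := G.exists_sourceChart g
  set x := G.src g
  set φ := extChartAt 𝓘(ℝ, E) x
  have hφ : ContMDiffAt 𝓘(ℝ, E) 𝓘(ℝ, E) ∞ φ x := contMDiffAt_extChartAt_infty (mem_chart_source E x)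
  -- the section is the graph, in a source chart, of an affine map in the chart of `M`
  let D : F →L[ℝ] (Fin G.lieAlgebroid.rank → ℝ) := e.dfib g
  let K : E →L[ℝ] (Fin G.lieAlgebroid.rank → ℝ) := D.comp L
  set y : M → (Fin G.lieAlgebroid.rank → ℝ) := fun x' => e.fib g + K (φ x' - φ x)
  have hy : ContMDiffAt 𝓘(ℝ, E) 𝓘(ℝ, Fin G.lieAlgebroid.rank → ℝ) ∞ y x :=
    contMDiffAt_const.add (ContMDiffAt.comp x (K.contDiff.contMDiff.contMDiffAt)
      (hφ.sub contMDiffAt_const))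
  have hyx : y x = e.fib g := by simp [y]
  have hT : (id x, y x) ∈ e.chart.target := by rw [hyx]; exact e.mem_target he
  have hβ := e.contMDiffAt_arrow_comp (I := 𝓘(ℝ, E)) (x := id) (y := y) (n := x) hT contMDiffAt_id hy
  have hβx : e.arrow (id x) (y x) = g := by rw [hyx]; exact e.arrow_fib he
  have hev := e.eventually_mem_target (x := id) (y := y) (n := x) hT continuousAt_id hy.continuousAt
  refine ⟨fun x' => e.arrow x' (y x'), hβ, hev.mono fun x' hx' => e.src_arrow hx', hβx, fun v => ?_⟩
  have hgen : ∀ g', g' = g → ((mfderiv 𝓘(ℝ, F) 𝓘(ℝ, E) G.src g' : F →L[ℝ] E) =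
      mfderiv 𝓘(ℝ, F) 𝓘(ℝ, E) G.src g ∧ (e.dfib g' : F →L[ℝ] _) = e.dfib g) := by
    rintro g' rfl; exact ⟨rfl, rfl⟩
  have hg1 := hgen _ hβx
  have hfib : MDifferentiableAt 𝓘(ℝ, F) 𝓘(ℝ, Fin G.lieAlgebroid.rank → ℝ) e.fib
      (e.arrow (id x) (y x)) := by
    rw [hβx]; exact (e.contMDiffAt_fib he).mdiffAt_of_infty
  refine e.eq_of_dsrc_dfib he ?_ ?_
  · refine Eq.trans ?_ (hL v).symm
    have h2 := mfderiv_comp_apply (f := fun x' => e.arrow (id x') (y x')) x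
      (G.mdifferentiableAt_src (e.arrow (id x) (y x))) hβ.mdiffAt_of_infty v
    have h3 : (G.src ∘ fun x' => e.arrow (id x') (y x')) =ᶠ[𝓝 x] id :=
      hev.mono fun x' hx' => e.src_arrow hx'
    have h4 := congrArg (fun L : E →L[ℝ] E => L v)
      (h3.mfderiv_eq.trans (mfderiv_id (I := 𝓘(ℝ, E)) (x := x)))
    refine Eq.trans ?_ (h2.symm.trans h4)
    exact congrArg (fun L : F →L[ℝ] E => L (mfderiv 𝓘(ℝ, E) 𝓘(ℝ, F)
      (fun x' => e.arrow x' (y x')) x v)) hg1.1.symm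
  · have h2 := mfderiv_comp_apply (f := fun x' => e.arrow (id x') (y x')) x hfib
      hβ.mdiffAt_of_infty v
    have h3 : (e.fib ∘ fun x' => e.arrow (id x') (y x')) =ᶠ[𝓝 x] y :=
      hev.mono fun x' hx' => e.fib_arrow hx'
    have h4 := congrArg (fun L : E →L[ℝ] (Fin G.lieAlgebroid.rank → ℝ) => L v)
      (h3.mfderiv_eq (I := 𝓘(ℝ, E)) (I' := 𝓘(ℝ, Fin G.lieAlgebroid.rank → ℝ)))
    have h5 := mfderiv_comp_apply (f := φ) (g := fun z => e.fib g + K (z - φ x)) x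
      (((differentiableAt_const _).add (K.differentiableAt.comp _
        (differentiableAt_id.sub (differentiableAt_const _)))).mdifferentiableAt)
      hφ.mdiffAt_of_infty v
    have h6 : fderiv ℝ (fun z => e.fib g + K (z - φ x)) (φ x) = K := by
      have : HasFDerivAt (fun z => e.fib g + K (z - φ x)) K (φ x) := by
        have h7 : HasFDerivAt (fun z : E => z - φ x) (ContinuousLinearMap.id ℝ E) (φ x) :=
          (hasFDerivAt_id _).sub_const _
        exact (K.hasFDerivAt.comp (φ x) h7).const_add (e.fib g)
      exact this.fderiv
    have h8 : (mfderiv 𝓘(ℝ, E) 𝓘(ℝ, E) φ x v : E) = v := tcoord_self (F := E) x v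
    refine Eq.trans ?_ (h2.symm.trans (h4.trans (h5.trans ?_)))
    · exact congrArg (fun L : F →L[ℝ] (Fin G.lieAlgebroid.rank → ℝ) => L (mfderiv 𝓘(ℝ, E) 𝓘(ℝ, F)
        (fun x' => e.arrow x' (y x')) x v)) hg1.2.symm
    · refine (congrArg (fun v : E => (mfderiv 𝓘(ℝ, E) 𝓘(ℝ, Fin G.lieAlgebroid.rank → ℝ)
        (fun z => e.fib g + K (z - φ x)) (φ x) : E →L[ℝ] _) v) h8).trans ?_
      refine (congrArg (fun L : E →L[ℝ] (Fin G.lieAlgebroid.rank → ℝ) => L v)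
        (mfderiv_eq_fderiv (f := fun z => e.fib g + K (z - φ x)) (x := φ x))).trans ?_
      rw [h6]
      rfl

theorem mfderiv_tgt_surjective (g : 𝒢) :
    Function.Surjective (mfderiv 𝓘(ℝ, F) 𝓘(ℝ, E) G.tgt g) := by
  intro w
  have hw : Function.Surjective (mfderiv 𝓘(ℝ, F) 𝓘(ℝ, E) G.src (G.inv g)) :=
    G.mfderiv_src_surjective (G.inv g)
  obtain ⟨v, hv⟩ := hw (w : E)
  refine ⟨(mfderiv 𝓘(ℝ, F) 𝓘(ℝ, F) G.inv (G.inv g) v : F), ?_⟩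
  refine (G.mfderiv_src_inv g _).symm.trans (Eq.trans ?_ hv)
  exact congrArg (fun v : F => (mfderiv 𝓘(ℝ, F) 𝓘(ℝ, E) G.src (G.inv g) : F →L[ℝ] E) v)
    (G.mfderiv_inv_mfderiv_inv (G.inv g) v |> fun h => by
      rw [G.inv_inv g] at h; exact h)

/-- There is a local bisection through every arrow. -/
theorem exists_isBisectionAt [FiniteDimensional ℝ E] (g : 𝒢) :
    ∃ β : M → 𝒢, G.IsBisectionAt β (G.src g) ∧ β (G.src g) = g := by
  let S : F →L[ℝ] E := mfderiv 𝓘(ℝ, F) 𝓘(ℝ, E) G.src g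
  let T : F →L[ℝ] E := mfderiv 𝓘(ℝ, F) 𝓘(ℝ, E) G.tgt g
  obtain ⟨L, h1, h2⟩ := LinearMap.exists_section_comp_bijective S.toLinearMap T.toLinearMap
    (G.mfderiv_src_surjective g) (G.mfderiv_tgt_surjective g)
  obtain ⟨β, b1, b2, b3, b4⟩ := G.exists_local_section (g := g) rfl
    (LinearMap.toContinuousLinearMap L) h1
  refine ⟨β, ⟨b1, b2, ?_⟩, b3⟩
  have key : ∀ v : E, (mfderiv 𝓘(ℝ, E) 𝓘(ℝ, E) (fun x => G.tgt (β x)) (G.src g) v : E) =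
      mfderiv 𝓘(ℝ, F) 𝓘(ℝ, E) G.tgt g (L v) := by
    intro v
    refine (mfderiv_comp_apply (G.src g) (G.mdifferentiableAt_tgt (β (G.src g)))
      b1.mdiffAt_of_infty v).trans ?_
    refine (congrArg (fun v : F => (mfderiv 𝓘(ℝ, F) 𝓘(ℝ, E) G.tgt (β (G.src g)) : F →L[ℝ] E) v)
      (b4 v)).trans ?_
    exact congrArg (fun g' => (mfderiv 𝓘(ℝ, F) 𝓘(ℝ, E) G.tgt g' : F →L[ℝ] E) (L v)) b3
  have h3 : (fun v : E => (mfderiv 𝓘(ℝ, E) 𝓘(ℝ, E) (fun x => G.tgt (β x)) (G.src g) v : E)) =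
    fun v : E => (mfderiv 𝓘(ℝ, F) 𝓘(ℝ, E) G.tgt g (L v) : E) := funext key
  change Function.Bijective
    (fun v : E => (mfderiv 𝓘(ℝ, E) 𝓘(ℝ, E) (fun x => G.tgt (β x)) (G.src g) v : E))
  rw [h3]
  exact h2

namespace IsBisectionAt

variable {G} {β : M → 𝒢} {x : M} (hβ : G.IsBisectionAt β x)

include hβ

theorem eventually_src_tgt :
    ∀ᶠ h in 𝓝 (G.unit x), G.src (β (G.tgt h)) = G.tgt h := by
  have h1 : Filter.Tendsto G.tgt (𝓝 (G.unit x)) (𝓝 x) := by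
    have := G.contMDiff_tgt.continuous.tendsto (G.unit x)
    rwa [G.tgt_unit] at this
  exact h1.eventually hβ.src_eq

theorem contMDiffAt_comp_tgt :
    ContMDiffAt 𝓘(ℝ, F) 𝓘(ℝ, F) ∞ (fun h => β (G.tgt h)) (G.unit x) :=
  ContMDiffAt.comp_of_eq hβ.contMDiffAt G.contMDiff_tgt.contMDiffAt (G.tgt_unit x)

theorem contMDiffAt_bisMap : ContMDiffAt 𝓘(ℝ, F) 𝓘(ℝ, F) ∞ (G.bisMap β) (G.unit x) :=
  G.contMDiffAt_mul hβ.contMDiffAt_comp_tgt contMDiffAt_id hβ.eventually_src_tgt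

theorem src_apply : G.src (β x) = x := hβ.src_eq.self_of_nhds

theorem bisMap_unit : G.bisMap β (G.unit x) = β x := by
  have := G.mul_unit (β x)
  rw [hβ.src_apply] at this
  rw [bisMap, G.tgt_unit, this]

theorem mfderiv_src_bisMap (v : G.lieFiber x) :
    (mfderiv 𝓘(ℝ, F) 𝓘(ℝ, E) G.src (β x)
      (mfderiv 𝓘(ℝ, F) 𝓘(ℝ, F) (G.bisMap β) (G.unit x) v.1) : E) = 0 := by
  have h1 := mfderiv_comp_apply (G.unit x) (G.mdifferentiableAt_src (G.bisMap β (G.unit x)))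
    hβ.contMDiffAt_bisMap.mdiffAt_of_infty v.1
  have h2 : G.src ∘ G.bisMap β =ᶠ[𝓝 (G.unit x)] G.src :=
    hβ.eventually_src_tgt.mono fun h hh => G.src_mul _ _ hh
  have h3 := congrArg (fun L : F →L[ℝ] E => L v.1)
    (h2.mfderiv_eq (I := 𝓘(ℝ, F)) (I' := 𝓘(ℝ, E)))
  refine Eq.trans ?_ (h1.symm.trans (h3.trans v.2))
  exact congrArg (fun g' => (mfderiv 𝓘(ℝ, F) 𝓘(ℝ, E) G.src g' : F →L[ℝ] E)
      (mfderiv 𝓘(ℝ, F) 𝓘(ℝ, F) (G.bisMap β) (G.unit x) v.1)) hβ.bisMap_unit.symm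

/-- The vertical vectors at `β x` for the source and for the target map that come from the same
element of the algebroid differ, up to sign, by a vector that is tangent to the bisection. -/
theorem leftTranslation_eq (v : G.lieFiber x) :
    (G.leftTranslationₗ (β x) x v : F) =
      HSub.hSub (α := F) (β := F) (γ := F)
        (mfderiv 𝓘(ℝ, E) 𝓘(ℝ, F) β x (G.lieAlgebroid.anchor x v))
        (mfderiv 𝓘(ℝ, F) 𝓘(ℝ, F) (G.bisMap β) (G.unit x) v.1) := by
  obtain ⟨k, hk, k0, ks, kv⟩ := G.exists_unit_curve v
  have hmap : Filter.Tendsto k (𝓝 0) (𝓝 (G.unit x)) := by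
    have := hk.continuousAt.tendsto
    rwa [k0] at this
  have hev := hmap.eventually hβ.eventually_src_tgt
  have hxsrc : x = G.tgt (G.inv (β x)) := by rw [G.tgt_inv, hβ.src_apply]
  -- the two-parameter family `β(t k_η) k_η k_ζ⁻¹`, whose diagonal is `β (t k_η)`
  set W : ℝ → ℝ → 𝒢 := fun η ζ => G.mul (G.bisMap β (k η)) (G.inv (k ζ)) with hW
  have hWsm : ContMDiffAt (𝓘(ℝ, ℝ).prod 𝓘(ℝ, ℝ)) 𝓘(ℝ, F) ∞ (Function.uncurry W) (0, 0) := by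
    have c1 : ContMDiffAt (𝓘(ℝ, ℝ).prod 𝓘(ℝ, ℝ)) 𝓘(ℝ, F) ∞ (fun p : ℝ × ℝ => k p.1) (0, 0) :=
      ContMDiffAt.comp (f := Prod.fst) ((0 : ℝ), (0 : ℝ)) hk contMDiffAt_fst
    have c2 : ContMDiffAt (𝓘(ℝ, ℝ).prod 𝓘(ℝ, ℝ)) 𝓘(ℝ, F) ∞ (fun p : ℝ × ℝ => k p.2) (0, 0) :=
      ContMDiffAt.comp (f := Prod.snd) ((0 : ℝ), (0 : ℝ)) hk contMDiffAt_snd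
    refine G.contMDiffAt_mul
      (ContMDiffAt.comp_of_eq (f := fun p : ℝ × ℝ => k p.1) hβ.contMDiffAt_bisMap c1 k0)
      (ContMDiffAt.comp (f := fun p : ℝ × ℝ => k p.2) ((0 : ℝ), (0 : ℝ))
        G.contMDiff_inv.contMDiffAt c2) ?_
    have t1 : Filter.Tendsto (Prod.fst : ℝ × ℝ → ℝ) (𝓝 (0, 0)) (𝓝 0) := continuousAt_fst
    have t2 : Filter.Tendsto (Prod.snd : ℝ × ℝ → ℝ) (𝓝 (0, 0)) (𝓝 0) := continuousAt_snd
    filter_upwards [t1.eventually hev, t1.eventually ks, t2.eventually ks] with p h1 h2 h3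
    rw [bisMap, G.src_mul _ _ h1, h2, G.tgt_inv, h3]
  have hd := velocity_diag hWsm
  have hkm := hk.mdiffAt_of_infty
  have e1 : (velocity F (fun t => W t t) : F) =
      mfderiv 𝓘(ℝ, E) 𝓘(ℝ, F) β x (G.lieAlgebroid.anchor x v) := by
    have h1 : (velocity F (fun t => W t t) : F) = velocity F (fun t => β (G.tgt (k t))) := by
      refine velocity_congr ?_
      filter_upwards [hev] with t ht
      exact G.mul_inv_cancel_right ht
    have htk : MDifferentiableAt 𝓘(ℝ, ℝ) 𝓘(ℝ, E) (fun t => G.tgt (k t)) 0 :=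
      (ContMDiffAt.comp (0 : ℝ) G.contMDiff_tgt.contMDiffAt hk).mdiffAt_of_infty
    have h2 := velocity_comp (f := β) (p := x) (by rw [k0, G.tgt_unit]) htk
      hβ.contMDiffAt.mdiffAt_of_infty
    refine h1.trans (h2.trans ?_)
    refine congrArg (fun v : E => (mfderiv 𝓘(ℝ, E) 𝓘(ℝ, F) β x : E →L[ℝ] F) v) ?_
    refine (velocity_comp k0 hkm (G.mdifferentiableAt_tgt (G.unit x))).trans ?_
    exact congrArg (fun v : F => (mfderiv 𝓘(ℝ, F) 𝓘(ℝ, E) G.tgt (G.unit x) : F →L[ℝ] E) v) kv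
  have e2 : (velocity F (fun t => W t 0) : F) =
      mfderiv 𝓘(ℝ, F) 𝓘(ℝ, F) (G.bisMap β) (G.unit x) v.1 := by
    have h1 : (velocity F (fun t => W t 0) : F) = velocity F (fun t => G.bisMap β (k t)) := by
      refine velocity_congr ?_
      filter_upwards [hev, ks] with t ht ht'
      have h3 : G.src (G.bisMap β (k t)) = x := by rw [bisMap, G.src_mul _ _ ht, ht']
      have h4 := G.mul_unit (G.bisMap β (k t))
      rw [h3] at h4
      simp only [hW, k0, G.inv_unit, h4]
    refine h1.trans ((velocity_comp k0 hkm hβ.contMDiffAt_bisMap.mdiffAt_of_infty).trans ?_)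
    exact congrArg (fun v : F => (mfderiv 𝓘(ℝ, F) 𝓘(ℝ, F) (G.bisMap β) (G.unit x) : F →L[ℝ] F) v) kv
  have e3 : (velocity F (fun t => W 0 t) : F) = G.leftTranslationₗ (β x) x v := by
    have hs : ∀ᶠ t in 𝓝 0, G.src (k t) = G.tgt (G.inv (β x)) := ks.mono fun t ht => ht.trans hxsrc
    have h1 : (velocity F (fun t => W 0 t) : F) =
        velocity F (fun t => G.inv (G.mul (k t) (G.inv (β x)))) := by
      refine velocity_congr ?_
      filter_upwards [hs] with t ht
      simp only [hW, k0, hβ.bisMap_unit]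
      rw [G.inv_mul_rev ht, G.inv_inv]
    have h2 := (G.contMDiffAt_mul_const hk hs).mdiffAt_of_infty
    have h3 : G.mul (k 0) (G.inv (β x)) = G.inv (β x) := by
      have := G.unit_mul (G.inv (β x))
      rwa [← hxsrc, ← k0] at this
    refine h1.trans ((velocity_comp h3 h2 (G.mdifferentiableAt_inv (G.inv (β x)))).trans ?_)
    exact congrArg (fun v : F => (mfderiv 𝓘(ℝ, F) 𝓘(ℝ, F) G.inv (G.inv (β x)) : F →L[ℝ] F) v)
      (G.velocity_mul_eq_rightTranslation hxsrc hkm k0 ks kv)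
  exact eq_sub_of_add_eq ((add_comm _ _).trans
    ((congrArg₂ (fun a b : F => a + b) e2 e3).symm.trans (hd.symm.trans e1)))

/-- The adjoint action of a local bisection on the Lie algebroid. -/
theorem exists_adjoint : ∃ Ad : G.lieFiber x ≃ₗ[ℝ] G.lieFiber (G.tgt (β x)), ∀ v,
    (G.rightTranslation (β x) (G.tgt (β x)) (Ad v) : F) =
      mfderiv 𝓘(ℝ, F) 𝓘(ℝ, F) (G.bisMap β) (G.unit x) v.1 := by
  let D : F →L[ℝ] F := mfderiv 𝓘(ℝ, F) 𝓘(ℝ, F) (G.bisMap β) (G.unit x)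
  have hex : ∀ v : G.lieFiber x, ∃ w : G.lieFiber (G.tgt (β x)),
      G.rightTranslationₗ (β x) (G.tgt (β x)) w = D v.1 := fun v =>
    G.exists_rightTranslation_eq rfl (hβ.mfderiv_src_bisMap v)
  choose f hf using hex
  have hinj : Function.Injective (G.rightTranslationₗ (β x) (G.tgt (β x))) :=
    G.rightTranslation_injective rfl
  let L : G.lieFiber x →ₗ[ℝ] G.lieFiber (G.tgt (β x)) :=
    { toFun := f
      map_add' := fun v w => hinj (by
        rw [map_add]
        refine (hf _).trans ((map_add D v.1 w.1).trans ?_)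
        exact (congrArg₂ (fun a b : F => a + b) (hf v) (hf w)).symm)
      map_smul' := fun c v => hinj (by
        rw [map_smul]
        refine (hf _).trans ((map_smul D c v.1).trans ?_)
        exact (congrArg (fun a : F => c • a) (hf v)).symm) }
  -- if `v` is in the kernel, its left translate is tangent to the bisection and killed by `dt`,
  -- so the anchor of `v` vanishes, because `t ∘ β` has an invertible differential, and with it
  -- the left translate
  have hLinj : Function.Injective L := by
    rw [← LinearMap.ker_eq_bot, LinearMap.ker_eq_bot']
    intro v hv
    have h1 : (D v.1 : F) = 0 := (hf v).symm.trans ((congrArg _ hv).trans (map_zero _))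
    have h2 : (G.leftTranslationₗ (β x) x v : F) =
        mfderiv 𝓘(ℝ, E) 𝓘(ℝ, F) β x (G.lieAlgebroid.anchor x v) :=
      (hβ.leftTranslation_eq v).trans ((congrArg (fun w : F => HSub.hSub (α := F)
        (mfderiv 𝓘(ℝ, E) 𝓘(ℝ, F) β x (G.lieAlgebroid.anchor x v)) w) h1).trans (sub_zero _))
    have h3 := G.mfderiv_tgt_leftTranslationₗ (β x) hβ.src_apply.symm v
    have h4 : (mfderiv 𝓘(ℝ, E) 𝓘(ℝ, E) (fun x => G.tgt (β x)) x (G.lieAlgebroid.anchor x v) : E) = 0 :=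
      (mfderiv_comp_apply x (G.mdifferentiableAt_tgt (β x)) hβ.contMDiffAt.mdiffAt_of_infty
        (G.lieAlgebroid.anchor x v)).trans ((congrArg (fun w : F =>
          (mfderiv 𝓘(ℝ, F) 𝓘(ℝ, E) G.tgt (β x) : F →L[ℝ] E) w) h2.symm).trans h3)
    have h5 : (G.lieAlgebroid.anchor x v : E) = 0 :=
      hβ.bijective.1 (h4.trans (map_zero _).symm)
    have h6 : (G.leftTranslationₗ (β x) x v : F) = 0 :=
      h2.trans ((congrArg (fun w : E => (mfderiv 𝓘(ℝ, E) 𝓘(ℝ, F) β x : E →L[ℝ] F) w) h5).trans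
        (map_zero _))
    exact G.leftTranslationₗ_injective (β x) hβ.src_apply.symm
      (h6.trans (map_zero (G.leftTranslationₗ (β x) x)).symm)
  have hrank : finrank ℝ (G.lieFiber x) = finrank ℝ (G.lieFiber (G.tgt (β x))) := by
    rw [G.finrank_lieFiber, G.finrank_lieFiber]
  have : FiniteDimensional ℝ (G.lieFiber x) := inferInstance
  exact ⟨L.linearEquivOfInjective hLinj hrank, hf⟩

/-- The action of an arrow on transverse densities, in terms of a bisection through it. -/
theorem scales_iff {σ : Π x, G.lieAlgebroid.Dtr x} {c : ℝ} {y : M} (hy : y = G.tgt (β x))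
    {a : Basis (Fin G.lieAlgebroid.rank) ℝ (G.lieFiber x)}
    {a' : Basis (Fin G.lieAlgebroid.rank) ℝ (G.lieFiber y)}
    {e : Basis (Fin (finrank ℝ E)) ℝ (TangentSpace 𝓘(ℝ, E) x)}
    {e' : Basis (Fin (finrank ℝ E)) ℝ (TangentSpace 𝓘(ℝ, E) y)}
    (ha : ∀ i, (G.rightTranslation (β x) y (a' i) : F) =
      mfderiv 𝓘(ℝ, F) 𝓘(ℝ, F) (G.bisMap β) (G.unit x) (a i).1)
    (he : ∀ j, (e' j : E) = mfderiv 𝓘(ℝ, E) 𝓘(ℝ, E) (fun x => G.tgt (β x)) x (e j)) :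
    G.Scales σ (β x) c ↔ c * TransverseDensity.eval a' e' (σ y) =
      TransverseDensity.eval a e (σ x) := by
  subst hy
  -- The tangent vectors `D (e j)` to the bisection lift `e` along `ds` and `e'` along `dt`.
  -- They complete the right translates of `a'` to a frame `b` that is adapted at `β x`, and the
  -- left translates of `a` to a frame `b'` whose image under the inversion is adapted at the
  -- inverse. By `leftTranslation_eq` the two frames differ by signs and a triangular matrix.
  let D : E →L[ℝ] F := mfderiv 𝓘(ℝ, E) 𝓘(ℝ, F) β x
  let S : F →L[ℝ] E := mfderiv 𝓘(ℝ, F) 𝓘(ℝ, E) G.src (β x)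
  have hSD : ∀ v, S (D v) = v := by
    intro v
    have h1 := mfderiv_comp_apply x (G.mdifferentiableAt_src (β x)) hβ.contMDiffAt.mdiffAt_of_infty v
    have h2 : G.src ∘ β =ᶠ[𝓝 x] id := hβ.src_eq
    exact h1.symm.trans (congrArg (fun L : E →L[ℝ] E => L v)
      (h2.mfderiv_eq.trans (mfderiv_id (I := 𝓘(ℝ, E)) (x := x))))
  let p : TangentSpace 𝓘(ℝ, F) (β x) →ₗ[ℝ] TangentSpace 𝓘(ℝ, E) x := S.toLinearMap
  obtain ⟨b, hb⟩ := Basis.exists_adapted (R := G.rightTranslationₗ (β x) (G.tgt (β x))) (p := p)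
    (fun a => G.mfderiv_src_rightTranslation rfl a) (G.rightTranslation_injective rfl)
    (by rw [Fintype.card_fin, Fintype.card_fin]; exact G.rank_add x) a' e
    (v := Sum.elim (fun i => G.rightTranslationₗ (β x) (G.tgt (β x)) (a' i)) fun j => D (e j))
    (fun i => rfl) (fun j => hSD (e j))
  have hbl : ∀ i, b (Sum.inl i) = G.rightTranslationₗ (β x) (G.tgt (β x)) (a' i) :=
    fun i => congrFun hb _
  have hbr : ∀ j, b (Sum.inr j) = D (e j) := fun j => congrFun hb _
  set v : Fin G.lieAlgebroid.rank ⊕ Fin (finrank ℝ E) → TangentSpace 𝓘(ℝ, F) (β x) :=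
    Sum.elim (fun i => G.leftTranslationₗ (β x) x (a i)) fun j => D (e j) with hv
  let ρ : Fin G.lieAlgebroid.rank → TangentSpace 𝓘(ℝ, E) x := fun i => G.lieAlgebroid.anchor x (a i)
  have hdet : |b.det v| = 1 := by
    refine b.abs_det_neg_add (c := fun i j => e.repr (ρ i) j) (fun i => ?_) fun j => (hbr j).symm
    have h1 : (∑ j, e.repr (ρ i) j • b (Sum.inr j)) = D (ρ i) := by
      refine Eq.trans ?_ (congrArg D (e.sum_repr (ρ i)))
      refine Eq.trans ?_ (map_sum D (fun j => (e.repr (ρ i) j • e j : E)) Finset.univ).symm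
      refine Finset.sum_congr rfl fun j _ => ?_
      exact (congrArg (fun w : F => e.repr (ρ i) j • w) (hbr j)).trans
        (map_smul D (e.repr (ρ i) j) (e j : E)).symm
    rw [h1, hbl]
    refine (hβ.leftTranslation_eq (a i)).trans ?_
    exact congrArg (fun w : F => D (ρ i) - w) (ha i).symm
  obtain ⟨b', hb'⟩ := Basis.exists_of_det_ne_zero b (v := v) (by
    intro h0; rw [h0, abs_zero] at hdet; exact zero_ne_one hdet)
  have hb'l : ∀ i, b' (Sum.inl i) = G.leftTranslationₗ (β x) x (a i) := fun i => congrFun hb' _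
  have hb'r : ∀ j, b' (Sum.inr j) = D (e j) := fun j => congrFun hb' _
  have had : G.IsAdapted (β x) a' e b := by
    refine ⟨hbl, fun j => ?_⟩
    exact (congrArg S (hbr j)).trans (hSD (e j))
  have had' : G.IsAdapted (G.inv (β x)) a e'
      fun k => mfderiv 𝓘(ℝ, F) 𝓘(ℝ, F) G.inv (β x) (b' k) := by
    refine ⟨fun i => ?_, fun j => ?_⟩
    · exact (congrArg (fun w : F => (mfderiv 𝓘(ℝ, F) 𝓘(ℝ, F) G.inv (β x) : F →L[ℝ] F) w)
        (hb'l i)).trans (G.mfderiv_inv_leftTranslationₗ (β x) x (a i))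
    · refine (G.mfderiv_src_inv (β x) (b' (Sum.inr j))).trans (Eq.trans ?_ (he j).symm)
      refine (congrArg (fun w : F => (mfderiv 𝓘(ℝ, F) 𝓘(ℝ, E) G.tgt (β x) : F →L[ℝ] E) w)
        (hb'r j)).trans ?_
      exact (mfderiv_comp_apply x (G.mdifferentiableAt_tgt (β x))
        hβ.contMDiffAt.mdiffAt_of_infty (e j)).symm
  have hfin := G.scales_iff (σ := σ) (k := c) hβ.src_apply.symm rfl had had'
  rw [hb', hdet, mul_one] at hfin
  exact hfin

end IsBisectionAt

end LieGroupoid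

end Bisections

/-! ### Multiplicativity of the action on transverse densities -/

noncomputable section ModularCocycle

universe u v w z

variable {E : Type u} [NormedAddCommGroup E] [NormedSpace ℝ E]
  {M : Type v} [TopologicalSpace M] [ChartedSpace E M] [IsManifold 𝓘(ℝ, E) ∞ M]
  {F : Type w} [NormedAddCommGroup F] [NormedSpace ℝ F] [FiniteDimensional ℝ F]
  {𝒢 : Type z} [TopologicalSpace 𝒢] [ChartedSpace F 𝒢] [IsManifold 𝓘(ℝ, F) ∞ 𝒢]

namespace LieGroupoid

variable (G : LieGroupoid E M F 𝒢)

namespace IsBisectionAt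

variable {G} {β βg βh : M → 𝒢} {x : M}

/-- Transport of frames along a bisection. -/
theorem exists_frames (hβ : G.IsBisectionAt β x)
    (a : Basis (Fin G.lieAlgebroid.rank) ℝ (G.lieFiber x))
    (e : Basis (Fin (finrank ℝ E)) ℝ (TangentSpace 𝓘(ℝ, E) x)) :
    ∃ (a' : Basis (Fin G.lieAlgebroid.rank) ℝ (G.lieFiber (G.tgt (β x))))
      (e' : Basis (Fin (finrank ℝ E)) ℝ (TangentSpace 𝓘(ℝ, E) (G.tgt (β x)))),
      (∀ i, (G.rightTranslation (β x) (G.tgt (β x)) (a' i) : F) =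
        mfderiv 𝓘(ℝ, F) 𝓘(ℝ, F) (G.bisMap β) (G.unit x) (a i).1) ∧
      ∀ j, (e' j : E) = mfderiv 𝓘(ℝ, E) 𝓘(ℝ, E) (fun x => G.tgt (β x)) x (e j) := by
  obtain ⟨Ad, hAd⟩ := hβ.exists_adjoint
  let lam : TangentSpace 𝓘(ℝ, E) x ≃ₗ[ℝ] TangentSpace 𝓘(ℝ, E) (G.tgt (β x)) :=
    LinearEquiv.ofBijective
      (mfderiv 𝓘(ℝ, E) 𝓘(ℝ, E) (fun x => G.tgt (β x)) x).toLinearMap hβ.bijective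
  refine ⟨a.map Ad, e.map lam, fun i => ?_, fun j => ?_⟩
  · rw [Basis.map_apply]; exact hAd (a i)
  · rw [Basis.map_apply]; rfl

/-- The product of local bisections is a local bisection. -/
theorem mul (hh : G.IsBisectionAt βh x) (hg : G.IsBisectionAt βg (G.tgt (βh x))) :
    G.IsBisectionAt (fun x => G.mul (βg (G.tgt (βh x))) (βh x)) x := by
  have hth : ContMDiffAt 𝓘(ℝ, E) 𝓘(ℝ, E) ∞ (fun x => G.tgt (βh x)) x :=
    ContMDiffAt.comp x G.contMDiff_tgt.contMDiffAt hh.contMDiffAt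
  have hcomp : ContMDiffAt 𝓘(ℝ, E) 𝓘(ℝ, F) ∞ (fun x => βg (G.tgt (βh x))) x :=
    ContMDiffAt.comp (f := fun x => G.tgt (βh x)) x hg.contMDiffAt hth
  have hev : ∀ᶠ x' in 𝓝 x, G.src (βg (G.tgt (βh x'))) = G.tgt (βh x') :=
    hth.continuousAt.eventually hg.src_eq
  refine ⟨G.contMDiffAt_mul hcomp hh.contMDiffAt hev, ?_, ?_⟩
  · filter_upwards [hev, hh.src_eq] with x' h1 h2
    rw [G.src_mul _ _ h1, h2]
  · have h1 : (fun x => G.tgt (G.mul (βg (G.tgt (βh x))) (βh x))) =ᶠ[𝓝 x]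
        (fun y => G.tgt (βg y)) ∘ fun x => G.tgt (βh x) := hev.mono fun x' h1 => G.tgt_mul _ _ h1
    have h2 : MDifferentiableAt 𝓘(ℝ, E) 𝓘(ℝ, E) (fun y => G.tgt (βg y)) (G.tgt (βh x)) :=
      (ContMDiffAt.comp (G.tgt (βh x)) G.contMDiff_tgt.contMDiffAt hg.contMDiffAt).mdiffAt_of_infty
    have key : ∀ v : E, (mfderiv 𝓘(ℝ, E) 𝓘(ℝ, E)
        (fun x => G.tgt (G.mul (βg (G.tgt (βh x))) (βh x))) x v : E) =
        mfderiv 𝓘(ℝ, E) 𝓘(ℝ, E) (fun y => G.tgt (βg y)) (G.tgt (βh x))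
          (mfderiv 𝓘(ℝ, E) 𝓘(ℝ, E) (fun x => G.tgt (βh x)) x v) := fun v =>
      (congrArg (fun L : E →L[ℝ] E => L v)
        (h1.mfderiv_eq (I := 𝓘(ℝ, E)) (I' := 𝓘(ℝ, E)))).trans
        (mfderiv_comp_apply x h2 hth.mdiffAt_of_infty v)
    have := hg.bijective.comp hh.bijective
    have h3 := funext key
    change Function.Bijective (fun v : E => (mfderiv 𝓘(ℝ, E) 𝓘(ℝ, E)
        (fun x => G.tgt (G.mul (βg (G.tgt (βh x))) (βh x))) x v : E))
    rw [h3]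
    exact this

/-- The adjoint action is multiplicative. -/
theorem rightTranslation_mul (hh : G.IsBisectionAt βh x) {y z : M} (hy : y = G.tgt (βh x))
    (hz : z = G.tgt (βg y)) (hg : G.IsBisectionAt βg y)
    {a : G.lieFiber x} {a' : G.lieFiber y} {a'' : G.lieFiber z}
    (ha : (G.rightTranslation (βh x) y a' : F) =
      mfderiv 𝓘(ℝ, F) 𝓘(ℝ, F) (G.bisMap βh) (G.unit x) a.1)
    (ha' : (G.rightTranslation (βg y) z a'' : F) =
      mfderiv 𝓘(ℝ, F) 𝓘(ℝ, F) (G.bisMap βg) (G.unit y) a'.1) :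
    (G.rightTranslation (G.mul (βg y) (βh x)) z a'' : F) =
      mfderiv 𝓘(ℝ, F) 𝓘(ℝ, F) (G.bisMap fun x => G.mul (βg (G.tgt (βh x))) (βh x)) (G.unit x) a.1 := by
  obtain ⟨h, hh_def⟩ : ∃ h, h = βh x := ⟨_, rfl⟩
  rw [← hh_def] at hy ha ⊢
  obtain ⟨k, hk, k0, ks, kv⟩ := G.exists_unit_curve a
  have hmap : Filter.Tendsto k (𝓝 0) (𝓝 (G.unit x)) := by
    have := hk.continuousAt.tendsto
    rwa [k0] at this
  have hev := hmap.eventually hh.eventually_src_tgt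
  -- the curve `l` in the source fibre through `h`, and its right translate `m` through the unit
  set l : ℝ → 𝒢 := fun t => G.bisMap βh (k t) with hl_def
  have hl : ContMDiffAt 𝓘(ℝ, ℝ) 𝓘(ℝ, F) ∞ l 0 :=
    ContMDiffAt.comp_of_eq hh.contMDiffAt_bisMap hk k0
  have l0 : l 0 = h := by simp only [hl_def, k0, hh.bisMap_unit, hh_def]
  have ls : ∀ᶠ t in 𝓝 0, G.src (l t) = x := by
    filter_upwards [hev, ks] with t h1 h2
    exact (G.src_mul _ _ h1).trans h2
  have lv : (velocity F l : F) = G.rightTranslation h y a' :=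
    (velocity_comp k0 hk.mdiffAt_of_infty hh.contMDiffAt_bisMap.mdiffAt_of_infty).trans
      ((congrArg (fun v : F => (mfderiv 𝓘(ℝ, F) 𝓘(ℝ, F) (G.bisMap βh) (G.unit x) : F →L[ℝ] F) v)
        kv).trans ha.symm)
  have hsx : G.src h = x := hh_def ▸ hh.src_apply
  have ls' : ∀ᶠ t in 𝓝 0, G.src (l t) = G.src h := ls.mono fun t ht => ht.trans hsx.symm
  have hti : ∀ᶠ t in 𝓝 0, G.src (l t) = G.tgt (G.inv h) :=
    ls'.mono fun t ht => ht.trans (G.tgt_inv h).symm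
  set m : ℝ → 𝒢 := fun t => G.mul (l t) (G.inv h) with hm_def
  have hm : ContMDiffAt 𝓘(ℝ, ℝ) 𝓘(ℝ, F) ∞ m 0 := G.contMDiffAt_mul_const hl hti
  have m0 : m 0 = G.unit y := by simp only [hm_def, l0, G.mul_inv, hy]
  have ms : ∀ᶠ t in 𝓝 0, G.src (m t) = y := by
    filter_upwards [hti] with t ht
    exact (G.src_mul _ _ ht).trans ((G.src_inv h).trans hy.symm)
  have mv : (velocity F m : F) = a'.1 := by
    have h1 := G.velocity_mul_of_rightTranslation (h := G.inv h) hy (G.tgt_inv h).symm hl l0 ls' lv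
    exact h1.trans ((G.rightTranslation_congr ((G.mul_inv h).trans (congrArg G.unit hy.symm)) y
      a').trans (G.rightTranslation_unit rfl a'))
  have hmap' : Filter.Tendsto m (𝓝 0) (𝓝 (G.unit y)) := by
    have := hm.continuousAt.tendsto
    rwa [m0] at this
  have hevg := hmap'.eventually hg.eventually_src_tgt
  -- the right translate by `h` of the curve `n` is the image of `k` under the product of the
  -- two bisections
  set n : ℝ → 𝒢 := fun t => G.bisMap βg (m t) with hn_def
  have hn : ContMDiffAt 𝓘(ℝ, ℝ) 𝓘(ℝ, F) ∞ n 0 :=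
    ContMDiffAt.comp_of_eq hg.contMDiffAt_bisMap hm m0
  have n0 : n 0 = βg y := by simp only [hn_def, m0, hg.bisMap_unit]
  have ns : ∀ᶠ t in 𝓝 0, G.src (n t) = G.src (βg y) := by
    filter_upwards [hevg, ms] with t h1 h2
    exact (G.src_mul _ _ h1).trans (h2.trans hg.src_apply.symm)
  have nv : (velocity F n : F) = G.rightTranslation (βg y) z a'' :=
    (velocity_comp m0 hm.mdiffAt_of_infty hg.contMDiffAt_bisMap.mdiffAt_of_infty).trans
      ((congrArg (fun v : F => (mfderiv 𝓘(ℝ, F) 𝓘(ℝ, F) (G.bisMap βg) (G.unit y) : F →L[ℝ] F) v)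
        mv).trans ha'.symm)
  have hfin := G.velocity_mul_of_rightTranslation (h := h) hz (hg.src_apply.trans hy) hn n0 ns nv
  refine hfin.symm.trans (Eq.trans (velocity_congr (γ' := fun t =>
    G.bisMap (fun x => G.mul (βg (G.tgt (βh x))) (βh x)) (k t)) ?_) ?_)
  · filter_upwards [hev, hevg, hti, ms] with t h1 h2 h3 h4
    have e1 : G.tgt (m t) = G.tgt (l t) := G.tgt_mul _ _ h3
    have e2 : G.tgt (l t) = G.tgt (βh (G.tgt (k t))) := G.tgt_mul _ _ h1
    have e3 : G.mul (m t) h = l t := G.inv_mul_cancel_right (h3.trans (G.tgt_inv h))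
    change G.mul (G.mul (βg (G.tgt (m t))) (m t)) h =
      G.mul (G.mul (βg (G.tgt (βh (G.tgt (k t))))) (βh (G.tgt (k t)))) (k t)
    rw [G.mul_assoc _ _ _ h2 (h4.trans hy), e3, e1, e2]
    refine (G.mul_assoc _ _ _ ?_ h1).symm
    rwa [e1, e2] at h2
  · refine (velocity_comp k0 hk.mdiffAt_of_infty
      (hh.mul (hy.trans (congrArg G.tgt hh_def) ▸ hg)).contMDiffAt_bisMap.mdiffAt_of_infty).trans ?_
    exact congrArg (fun v : F => (mfderiv 𝓘(ℝ, F) 𝓘(ℝ, F)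
      (G.bisMap fun x => G.mul (βg (G.tgt (βh x))) (βh x)) (G.unit x) : F →L[ℝ] F) v) kv

end IsBisectionAt

/-- A frame of a fibre of the Lie algebroid. -/
def lieFrame (x : M) : Basis (Fin G.lieAlgebroid.rank) ℝ (G.lieFiber x) :=
  finBasisOfFinrankEq ℝ _ (G.finrank_lieFiber x)

variable [FiniteDimensional ℝ E]

omit [IsManifold 𝓘(ℝ, E) ∞ M] in
/-- A frame of a tangent space. -/
def tangentFrame (x : M) : Basis (Fin (finrank ℝ E)) ℝ (TangentSpace 𝓘(ℝ, E) x) :=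
  (finBasis ℝ E : Basis (Fin (finrank ℝ E)) ℝ E)

variable {σ : Π x, G.lieAlgebroid.Dtr x}

theorem ne_zero_of_isPositive (hσ : ∀ x, (σ x).IsPositive) (x : M) : σ x ≠ 0 := fun h => by
  have := hσ x (G.lieFrame x) (tangentFrame x)
  rw [h] at this
  exact lt_irrefl 0 (this.trans_eq (TransverseDensity.eval _ _).map_zero)

variable {G} in
/-- The action of the arrows on transverse densities is multiplicative: frames are transported along
a bisection through `h` and from there along a bisection through `g`. -/
theorem Scales.mul {g h : 𝒢} (hgh : G.src g = G.tgt h) {k l : ℝ} (hg : G.Scales σ g k)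
    (hh : G.Scales σ h l) : G.Scales σ (G.mul g h) (k * l) := by
  obtain ⟨βh, bh, eh⟩ := G.exists_isBisectionAt h
  obtain ⟨βg, bg, eg⟩ := G.exists_isBisectionAt g
  generalize G.src h = x at bh eh
  subst eh
  rw [hgh] at bg eg
  subst eg
  obtain ⟨a', e', ha, he⟩ := bh.exists_frames (G.lieFrame x) (tangentFrame x)
  obtain ⟨a'', e'', ha', he'⟩ := bg.exists_frames a' e'
  have h1 := (bh.scales_iff rfl ha he).1 hh
  have h2 := (bg.scales_iff rfl ha' he').1 hg
  have hth : MDifferentiableAt 𝓘(ℝ, E) 𝓘(ℝ, E) (fun x => G.tgt (βh x)) x :=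
    (ContMDiffAt.comp x G.contMDiff_tgt.contMDiffAt bh.contMDiffAt).mdiffAt_of_infty
  have hev : ∀ᶠ x' in 𝓝 x, G.src (βg (G.tgt (βh x'))) = G.tgt (βh x') :=
    (ContMDiffAt.comp x G.contMDiff_tgt.contMDiffAt bh.contMDiffAt).continuousAt.eventually bg.src_eq
  refine ((bh.mul bg).scales_iff (y := G.tgt (βg (G.tgt (βh x)))) (a := G.lieFrame x) (a' := a'')
    (e := tangentFrame x) (e' := e'') (G.tgt_mul _ _ hgh).symm
    (fun i => bh.rightTranslation_mul rfl rfl bg (ha i) (ha' i)) (fun j => ?_)).2 ?_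
  · have h3 : (fun x => G.tgt (G.mul (βg (G.tgt (βh x))) (βh x))) =ᶠ[𝓝 x]
        (fun y => G.tgt (βg y)) ∘ fun x => G.tgt (βh x) := hev.mono fun x' h1 => G.tgt_mul _ _ h1
    have h4 : MDifferentiableAt 𝓘(ℝ, E) 𝓘(ℝ, E) (fun y => G.tgt (βg y)) (G.tgt (βh x)) :=
      (ContMDiffAt.comp (G.tgt (βh x)) G.contMDiff_tgt.contMDiffAt bg.contMDiffAt).mdiffAt_of_infty
    refine (he' j).trans (Eq.trans ?_ ((congrArg (fun L : E →L[ℝ] E => L (tangentFrame (E := E) x j))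
        (h3.mfderiv_eq (I := 𝓘(ℝ, E)) (I' := 𝓘(ℝ, E)))).trans
        (mfderiv_comp_apply x h4 hth (tangentFrame (E := E) x j))).symm)
    exact congrArg (fun v : E => (mfderiv 𝓘(ℝ, E) 𝓘(ℝ, E) (fun y => G.tgt (βg y))
      (G.tgt (βh x)) : E →L[ℝ] E) v) (he j)
  · rw [← h1, ← h2]; ring

/-- Every arrow acts on a positive density by a positive factor. -/
theorem exists_scales (hσ : ∀ x, (σ x).IsPositive) (g : 𝒢) : ∃ k, 0 < k ∧ G.Scales σ g k := by
  obtain ⟨β, b, hb⟩ := G.exists_isBisectionAt g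
  generalize G.src g = x at b hb
  subst hb
  obtain ⟨a', e', ha, he⟩ := b.exists_frames (G.lieFrame x) (tangentFrame x)
  have h1 := hσ x (G.lieFrame x) (tangentFrame x)
  have h2 := hσ _ a' e'
  refine ⟨_, div_pos h1 h2, (b.scales_iff rfl ha he).2 (div_mul_cancel₀ _ h2.ne')⟩

variable {G} in
/-- The factor by which an arrow acts on a nonvanishing density is unique. -/
theorem Scales.unique {g : 𝒢} (hσ : ∀ x, σ x ≠ 0) {k l : ℝ} (hk : G.Scales σ g k)
    (hl : G.Scales σ g l) : k = l := by
  obtain ⟨β, b, hb⟩ := G.exists_isBisectionAt g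
  generalize G.src g = x at b hb
  subst hb
  obtain ⟨a', e', ha, he⟩ := b.exists_frames (G.lieFrame x) (tangentFrame x)
  have h1 := (b.scales_iff rfl ha he).1 hk
  have h2 := (b.scales_iff rfl ha he).1 hl
  exact mul_right_cancel₀ (TransverseDensity.eval_ne_zero (hσ _)) (h1.trans h2.symm)

variable {G} in
/-- Rescaling the density. -/
theorem Scales.smul {g : 𝒢} {k : ℝ} (hk : G.Scales σ g k) (f : M → ℝ) (hf : f (G.tgt g) ≠ 0) :
    G.Scales (fun x => f x • σ x) g (f (G.src g) * k / f (G.tgt g)) := by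
  obtain ⟨β, b, hb⟩ := G.exists_isBisectionAt g
  generalize hx : G.src g = x at b hb
  subst hb
  obtain ⟨a', e', ha, he⟩ := b.exists_frames (G.lieFrame x) (tangentFrame x)
  have h1 := (b.scales_iff rfl ha he).1 hk
  refine (b.scales_iff rfl ha he).2 ?_
  have e1 : TransverseDensity.eval a' e' (f (G.tgt (β x)) • σ (G.tgt (β x))) = _ :=
    (TransverseDensity.eval a' e').map_smul _ _
  have e2 : TransverseDensity.eval (G.lieFrame x) (tangentFrame x) (f x • σ x) = _ :=
    (TransverseDensity.eval (G.lieFrame x) (tangentFrame x)).map_smul _ _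
  refine (congrArg (fun r => f x * k / f (G.tgt (β x)) * r) e1).trans (Eq.trans ?_ e2.symm)
  rw [smul_eq_mul, smul_eq_mul, ← h1]
  field_simp

end LieGroupoid

end ModularCocycle

/-! ### Smoothness of the modular cocycle -/

noncomputable section ModularSmooth

universe u v w z

variable {E : Type u} [NormedAddCommGroup E] [NormedSpace ℝ E] [FiniteDimensional ℝ E]
  {M : Type v} [TopologicalSpace M] [ChartedSpace E M] [IsManifold 𝓘(ℝ, E) ∞ M]
  {F : Type w} [NormedAddCommGroup F] [NormedSpace ℝ F] [FiniteDimensional ℝ F]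
  {𝒢 : Type z} [TopologicalSpace 𝒢] [ChartedSpace F 𝒢] [IsManifold 𝓘(ℝ, F) ∞ 𝒢]

/-- Smooth vector fields that form a frame at a point form a frame nearby. -/
theorem eventually_tangent_frame {ι : Type*} [Fintype ι] [DecidableEq ι]
    (X : ι → {X : Π x : M, TangentSpace 𝓘(ℝ, E) x // IsSmoothVectorField X}) {x : M}
    (e : Basis ι ℝ (TangentSpace 𝓘(ℝ, E) x)) (he : ∀ j, e j = (X j).1 x) :
    ∀ᶠ x' in 𝓝 x, ∃ e : Basis ι ℝ (TangentSpace 𝓘(ℝ, E) x'), ⇑e = fun j => (X j).1 x' :=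
  (exists_contMDiffAt_det (u := fun x : M => x) (v := fun j => (X j).1) (w := fun j => (X j).1)
    (fun j => (X j).2.contMDiffAt) (fun j => (X j).2.contMDiffAt) contMDiffAt_id e he).1

namespace LieGroupoid

variable (G : LieGroupoid E M F 𝒢)

/-- Smooth sections of the Lie algebroid that form a frame at a point form a frame nearby. -/
theorem eventually_lie_frame [T2Space M]
    (α : Fin G.lieAlgebroid.rank → {α // G.lieAlgebroid.IsSmooth α}) {x : M}
    (a : Basis (Fin G.lieAlgebroid.rank) ℝ (G.lieFiber x)) (ha : ∀ i, a i = (α i).1 x) :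
    ∀ᶠ x' in 𝓝 x, ∃ a : Basis (Fin G.lieAlgebroid.rank) ℝ (G.lieFiber x'),
      ⇑a = fun i => ((α i).1 x' : G.lieFiber x') := by
  obtain ⟨c, hc⟩ := G.exists_sourceChart (G.unit x)
  choose X hX using fun j => exists_smoothVectorField (G.src (G.unit x))
    (tangentFrame (E := E) (G.src (G.unit x)) j)
  -- the sections are completed to a frame of the tangent spaces of `𝒢` at the units by lifts of
  -- vector fields on `M`, so that the corresponding fact for frames of a tangent bundle applies
  let v : Fin G.lieAlgebroid.rank ⊕ Fin (finrank ℝ E) → Π x, TangentSpace 𝓘(ℝ, F) (G.unit x) :=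
    Sum.elim (fun i x => ((α i).1 x : G.lieFiber x).1)
      fun j x => c.horiz (G.unit x) ((X j).1 (G.src (G.unit x)))
  have hv : ∀ s, ContMDiffAt 𝓘(ℝ, E) (𝓘(ℝ, F).prod 𝓘(ℝ, F)) ∞
      (fun x => (⟨G.unit x, v s x⟩ : TangentBundle 𝓘(ℝ, F) 𝒢)) x := by
    rintro (i | j)
    · exact (α i).2.contMDiffAt
    · refine c.contMDiffAt_horiz hc G.contMDiff_unit.contMDiffAt ?_
      exact ContMDiffAt.comp x (g := fun x => (⟨x, (X j).1 x⟩ : TangentBundle 𝓘(ℝ, E) M))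
        (X j).2.contMDiffAt
        (ContMDiffAt.comp x G.contMDiff_src.contMDiffAt G.contMDiff_unit.contMDiffAt)
  obtain ⟨b, hb⟩ := Basis.exists_adapted (R := (G.lieFiber x).subtype)
    (p := (mfderiv 𝓘(ℝ, F) 𝓘(ℝ, E) G.src (G.unit x)).toLinearMap) (fun a => a.2)
    (Submodule.subtype_injective _)
    (by rw [Fintype.card_fin, Fintype.card_fin]; exact G.rank_add x) a
    (tangentFrame (G.src (G.unit x))) (v := fun s => v s x)
    (fun i => congrArg Subtype.val (ha i).symm) (fun j => by
      rw [← hX j]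
      exact c.mfderiv_src_horiz hc _)
  have h1 := (exists_contMDiffAt_det hv hv G.contMDiff_unit.contMDiffAt b (fun s => congrFun hb s)).1
  filter_upwards [h1] with x' ⟨b', hb'⟩
  let f : Fin G.lieAlgebroid.rank → G.lieFiber x' := fun i => (α i).1 x'
  have hli : LinearIndependent ℝ f := by
    have h2 := b'.linearIndependent.comp Sum.inl Sum.inl_injective
    rw [hb'] at h2
    exact LinearIndependent.of_comp (G.lieFiber x').subtype h2
  have : FiniteDimensional ℝ (TangentSpace 𝓘(ℝ, F) (G.unit x')) :=
    inferInstanceAs (FiniteDimensional ℝ F)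
  exact ⟨Basis.mk hli (hli.span_eq_top_of_card_eq_finrank'
    ((Fintype.card_fin _).trans (G.finrank_lieFiber x').symm)).ge, Basis.coe_mk _ _⟩

/-- Smooth sections through a frame of a fibre of the Lie algebroid. -/
theorem exists_smooth_frame [T2Space M] (x : M) :
    ∃ α : Fin G.lieAlgebroid.rank → {α // G.lieAlgebroid.IsSmooth α},
      ∀ i, G.lieFrame x i = (α i).1 x := by
  choose α hα using fun i => G.exists_smooth_section x (G.lieFrame x i)
  exact ⟨α, fun i => (hα i).symm⟩

theorem exists_smooth_tangentFrame [T2Space M] (x : M) :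
    ∃ X : Fin (finrank ℝ E) → {X : Π x : M, TangentSpace 𝓘(ℝ, E) x // IsSmoothVectorField X},
      ∀ j, tangentFrame x j = (X j).1 x := by
  choose X hX using fun j => exists_smoothVectorField x (tangentFrame (E := E) x j)
  exact ⟨X, fun j => (hX j).symm⟩

/-- The value of a smooth section of the transverse density bundle on smooth local frames. -/
theorem exists_contMDiffAt_eval [T2Space M] {σ : Π x, G.lieAlgebroid.Dtr x}
    (hσ : G.lieAlgebroid.IsSmoothDtr σ)
    {α : Fin G.lieAlgebroid.rank → {α // G.lieAlgebroid.IsSmooth α}}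
    {X : Fin (finrank ℝ E) → {X : Π x : M, TangentSpace 𝓘(ℝ, E) x // IsSmoothVectorField X}}
    {x : M} (hα : ∀ i, G.lieFrame x i = (α i).1 x) (hX : ∀ j, tangentFrame x j = (X j).1 x) :
    ∃ P : M → ℝ, ContMDiffAt 𝓘(ℝ, E) 𝓘(ℝ, ℝ) ∞ P x ∧ ∀ᶠ x' in 𝓝 x,
      ∃ (a : Basis (Fin G.lieAlgebroid.rank) ℝ (G.lieFiber x'))
        (e : Basis (Fin (finrank ℝ E)) ℝ (TangentSpace 𝓘(ℝ, E) x')),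
        (⇑a = fun i => ((α i).1 x' : G.lieFiber x')) ∧ (⇑e = fun j => (X j).1 x') ∧
        TransverseDensity.eval a e (σ x') = P x' := by
  refine ⟨_, hσ α X x (G.lieFrame x) (tangentFrame x) hα hX, ?_⟩
  filter_upwards [G.eventually_lie_frame α (G.lieFrame x) hα,
    eventually_tangent_frame X (tangentFrame x) hX] with x' ⟨a, ha⟩ ⟨e, he⟩
  exact ⟨a, e, ha, he, (TransverseDensity.evalTuple_eq a e ha he (σ x')).symm⟩

/-- The logarithmic factor by which the arrows scale a positive smooth density is smooth. -/
theorem contMDiff_of_scales [T2Space M] {σ : Π x, G.lieAlgebroid.Dtr x}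
    (hσ : G.lieAlgebroid.IsSmoothDtr σ)
    (hpos : ∀ x, (σ x).IsPositive) {c : 𝒢 → ℝ} (hc : ∀ g, G.Scales σ g (Real.exp (-c g))) :
    ContMDiff 𝓘(ℝ, F) 𝓘(ℝ, ℝ) ∞ c := by
  intro g₀
  obtain ⟨α, hα⟩ := G.exists_smooth_frame (G.src g₀)
  obtain ⟨α', hα'⟩ := G.exists_smooth_frame (G.tgt g₀)
  obtain ⟨X, hX⟩ := exists_smooth_tangentFrame (E := E) (G.src g₀)
  obtain ⟨X', hX'⟩ := exists_smooth_tangentFrame (E := E) (G.tgt g₀)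
  obtain ⟨P, hP, hPe⟩ := G.exists_contMDiffAt_eval hσ hα hX
  obtain ⟨Q, hQ, hQe⟩ := G.exists_contMDiffAt_eval hσ hα' hX'
  obtain ⟨c₁, hc₁⟩ := G.exists_sourceChart g₀
  obtain ⟨c₂, hc₂⟩ := G.exists_sourceChart (G.inv g₀)
  have hinv : ContMDiffAt 𝓘(ℝ, F) 𝓘(ℝ, F) ∞ G.inv g₀ := G.contMDiff_inv.contMDiffAt
  have hXs : ∀ (Y : {X : Π x : M, TangentSpace 𝓘(ℝ, E) x // IsSmoothVectorField X}) (u : 𝒢 → 𝒢),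
      ContMDiffAt 𝓘(ℝ, F) 𝓘(ℝ, F) ∞ u g₀ → ContMDiffAt 𝓘(ℝ, F) (𝓘(ℝ, E).prod 𝓘(ℝ, E)) ∞
        (fun g => (⟨G.src (u g), Y.1 (G.src (u g))⟩ : TangentBundle 𝓘(ℝ, E) M)) g₀ := fun Y u hu =>
    ContMDiffAt.comp g₀ (g := fun x => (⟨x, Y.1 x⟩ : TangentBundle 𝓘(ℝ, E) M)) Y.2.contMDiffAt
      (ContMDiffAt.comp g₀ G.contMDiff_src.contMDiffAt hu)
  -- frames adapted to the sequence at `g`, and frames whose images under the inversion are adapted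
  -- to the sequence at `g⁻¹`
  let v : Fin G.lieAlgebroid.rank ⊕ Fin (finrank ℝ E) → Π g, TangentSpace 𝓘(ℝ, F) g :=
    Sum.elim (fun i => G.rightInvariant (α' i).1) fun j g => c₁.horiz g ((X j).1 (G.src g))
  have hv : ∀ s, ContMDiffAt 𝓘(ℝ, F) (𝓘(ℝ, F).prod 𝓘(ℝ, F)) ∞
      (fun g => (⟨g, v s g⟩ : TangentBundle 𝓘(ℝ, F) 𝒢)) g₀ := by
    rintro (i | j)
    · exact (G.contMDiff_rightInvariant (α' i).2).contMDiffAt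
    · exact c₁.contMDiffAt_horiz hc₁ contMDiffAt_id (hXs (X j) id contMDiffAt_id)
  let w' : Fin G.lieAlgebroid.rank ⊕ Fin (finrank ℝ E) → Π g, TangentSpace 𝓘(ℝ, F) (G.inv g) :=
    Sum.elim (fun i g => G.rightTranslation (G.inv g) (G.src g) ((α i).1 (G.src g)))
      fun j g => c₂.horiz (G.inv g) ((X' j).1 (G.src (G.inv g)))
  let w : Fin G.lieAlgebroid.rank ⊕ Fin (finrank ℝ E) → Π g, TangentSpace 𝓘(ℝ, F) g :=
    fun s g => (mfderiv 𝓘(ℝ, F) 𝓘(ℝ, F) G.inv (G.inv g) (w' s g) : F)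
  have hw' : ∀ s, ContMDiffAt 𝓘(ℝ, F) (𝓘(ℝ, F).prod 𝓘(ℝ, F)) ∞
      (fun g => (⟨G.inv g, w' s g⟩ : TangentBundle 𝓘(ℝ, F) 𝒢)) g₀ := by
    rintro (i | j)
    · have h1 : ContMDiffAt 𝓘(ℝ, F) (𝓘(ℝ, F).prod 𝓘(ℝ, F)) ∞
          (fun g => (⟨G.inv g, G.rightInvariant (α i).1 (G.inv g)⟩ : TangentBundle 𝓘(ℝ, F) 𝒢)) g₀ :=
        ContMDiffAt.comp g₀ (g := fun g => (⟨g, G.rightInvariant (α i).1 g⟩ : TangentBundle 𝓘(ℝ, F) 𝒢))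
          (G.contMDiff_rightInvariant (α i).2).contMDiffAt hinv
      refine h1.congr_of_eventuallyEq (Filter.Eventually.of_forall fun g => ?_)
      refine tangentBundle_mk_eq rfl ?_
      have : ∀ y, y = G.src g → (G.rightTranslation (G.inv g) y ((α i).1 y) : F) =
          G.rightTranslation (G.inv g) (G.src g) ((α i).1 (G.src g)) := by
        rintro y rfl; rfl
      exact (this _ (G.tgt_inv g)).symm
    · exact c₂.contMDiffAt_horiz hc₂ hinv (hXs (X' j) G.inv hinv)
  have hw : ∀ s, ContMDiffAt 𝓘(ℝ, F) (𝓘(ℝ, F).prod 𝓘(ℝ, F)) ∞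
      (fun g => (⟨g, w s g⟩ : TangentBundle 𝓘(ℝ, F) 𝒢)) g₀ := by
    intro s
    have h1 : ContMDiffAt (𝓘(ℝ, F).prod 𝓘(ℝ, F)) 𝓘(ℝ, F) ∞
        (Function.uncurry fun (_ : 𝒢) g => G.inv g) (g₀, G.inv g₀) :=
      ContMDiffAt.comp (f := Prod.snd) (g₀, G.inv g₀) G.contMDiff_inv.contMDiffAt contMDiffAt_snd
    refine (ContMDiffAt.mfderiv_apply_family h1 (hw' s)).congr_of_eventuallyEq
      (Filter.Eventually.of_forall fun g => ?_)
    exact tangentBundle_mk_eq (G.inv_inv g).symm rfl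
  have hwl : ∀ i g, w (Sum.inl i) g = G.leftTranslationₗ g (G.src g) ((α i).1 (G.src g)) :=
    fun i g => rfl
  have hwi : ∀ s g, (mfderiv 𝓘(ℝ, F) 𝓘(ℝ, F) G.inv g (w s g) : F) = w' s g := fun s g =>
    G.mfderiv_inv_mfderiv_inv' g (w' s g)
  have hsv : ∀ᶠ g in 𝓝 g₀, ∀ j, (mfderiv 𝓘(ℝ, F) 𝓘(ℝ, E) G.src g (v (Sum.inr j) g) : E) =
      (X j).1 (G.src g) := by
    filter_upwards [c₁.chart.open_source.mem_nhds hc₁] with g hg j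
    exact c₁.mfderiv_src_horiz hg _
  have hsw : ∀ᶠ g in 𝓝 g₀, ∀ j, (mfderiv 𝓘(ℝ, F) 𝓘(ℝ, E) G.src (G.inv g)
      (w' (Sum.inr j) g) : E) = (X' j).1 (G.tgt g) := by
    filter_upwards [hinv.continuousAt.eventually (c₂.chart.open_source.mem_nhds hc₂)] with g hg j
    refine (c₂.mfderiv_src_horiz hg _).trans ?_
    exact congrArg (fun x => ((X' j).1 x : E)) (G.src_inv g)
  have hcard : Fintype.card (Fin G.lieAlgebroid.rank) + Fintype.card (Fin (finrank ℝ E)) =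
      finrank ℝ F := by
    rw [Fintype.card_fin, Fintype.card_fin]; exact G.rank_add (G.src g₀)
  obtain ⟨b₀, hb₀⟩ := Basis.exists_adapted (R := G.rightTranslationₗ g₀ (G.tgt g₀))
    (p := (mfderiv 𝓘(ℝ, F) 𝓘(ℝ, E) G.src g₀).toLinearMap)
    (fun a => G.mfderiv_src_rightTranslation rfl a) (G.rightTranslation_injective rfl) hcard
    (G.lieFrame (G.tgt g₀)) (tangentFrame (G.src g₀)) (v := fun s => v s g₀)
    (fun i => by rw [hα' i]; rfl) (fun j => (hsv.self_of_nhds j).trans (hX j).symm)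
  obtain ⟨b₁, hb₁⟩ := Basis.exists_adapted (R := G.leftTranslationₗ g₀ (G.src g₀))
    (p := (mfderiv 𝓘(ℝ, F) 𝓘(ℝ, E) G.tgt g₀).toLinearMap)
    (fun a => G.mfderiv_tgt_leftTranslationₗ g₀ rfl a) (G.leftTranslationₗ_injective g₀ rfl) hcard
    (G.lieFrame (G.src g₀)) (tangentFrame (G.tgt g₀)) (v := fun s => w s g₀)
    (fun i => by rw [hwl, hα i]) (fun j => (G.mfderiv_src_inv g₀ _).symm.trans
      ((congrArg (fun u : F => (mfderiv 𝓘(ℝ, F) 𝓘(ℝ, E) G.src (G.inv g₀) : F →L[ℝ] E) u)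
        (hwi (Sum.inr j) g₀)).trans ((hsw.self_of_nhds j).trans (hX' j).symm)))
  obtain ⟨hvb, δ, hδ, hδe⟩ := exists_contMDiffAt_det hv hw contMDiffAt_id b₀ (fun s => congrFun hb₀ s)
  have hwb := (exists_contMDiffAt_det hw hw contMDiffAt_id b₁ (fun s => congrFun hb₁ s)).1
  have hs : Filter.Tendsto G.src (𝓝 g₀) (𝓝 (G.src g₀)) := G.contMDiff_src.continuous.continuousAt
  have ht : Filter.Tendsto G.tgt (𝓝 g₀) (𝓝 (G.tgt g₀)) := G.contMDiff_tgt.continuous.continuousAt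
  -- the logarithm of the equation that defines the action; `Real.log` is even, so the sign of
  -- the determinant `δ` does not matter
  have key : ∀ᶠ g in 𝓝 g₀, P (G.src g) ≠ 0 ∧ Q (G.tgt g) ≠ 0 ∧ δ g ≠ 0 ∧
      c g = Real.log (Q (G.tgt g)) - Real.log (P (G.src g)) - Real.log (δ g) := by
    filter_upwards [hvb, hwb, hδe, hs.eventually hPe, ht.eventually hQe, hsv, hsw] with g
      ⟨b, hb⟩ ⟨b', hb'⟩ hdet ⟨a, e, ha, he, hP⟩ ⟨a', e', ha', he', hQ⟩ hsv hsw
    have hPp : 0 < P (G.src g) := hP ▸ hpos _ a e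
    have hQp : 0 < Q (G.tgt g) := hQ ▸ hpos _ a' e'
    have hdet' := hdet b hb
    have hδ0 : δ g ≠ 0 := by
      rw [← hdet']
      have := b.det_ne_zero' b'
      rwa [hb'] at this
    refine ⟨hPp.ne', hQp.ne', hδ0, ?_⟩
    have hadb : G.IsAdapted g a' e b := by
      refine ⟨fun i => ?_, fun j => ?_⟩
      · rw [hb, ha']; rfl
      · rw [hb, he]; exact hsv j
    have hadb' : G.IsAdapted (G.inv g) a e' fun k => mfderiv 𝓘(ℝ, F) 𝓘(ℝ, F) G.inv g (b' k) := by
      refine ⟨fun i => ?_, fun j => ?_⟩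
      · rw [hb', ha]; exact hwi _ g
      · rw [hb', he']
        exact (congrArg (fun u : F => (mfderiv 𝓘(ℝ, F) 𝓘(ℝ, E) G.src (G.inv g) : F →L[ℝ] E) u)
          (hwi (Sum.inr j) g)).trans (hsw j)
    have h1 := (G.scales_iff rfl rfl hadb hadb').1 (hc g)
    rw [hP, hQ, hb', hdet'] at h1
    have h2 := congrArg Real.log h1
    rw [Real.log_mul (Real.exp_pos _).ne' hQp.ne', Real.log_mul hPp.ne' (abs_pos.2 hδ0).ne',
      Real.log_exp, Real.log_abs] at h2
    linarith
  obtain ⟨hP0, hQ0, hδ0, -⟩ := key.self_of_nhds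
  have hlog : ∀ {f : 𝒢 → ℝ}, ContMDiffAt 𝓘(ℝ, F) 𝓘(ℝ, ℝ) ∞ f g₀ → f g₀ ≠ 0 →
      ContMDiffAt 𝓘(ℝ, F) 𝓘(ℝ, ℝ) ∞ (fun g => Real.log (f g)) g₀ := fun {f} hf h0 =>
    ContMDiffAt.comp (g := Real.log) g₀ (Real.contDiffAt_log.2 h0).contMDiffAt hf
  refine (((hlog (ContMDiffAt.comp g₀ hQ G.contMDiff_tgt.contMDiffAt) hQ0).sub
    (hlog (ContMDiffAt.comp g₀ hP G.contMDiff_src.contMDiffAt) hP0)).sub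
    (hlog hδ hδ0)).congr_of_eventuallyEq ?_
  filter_upwards [key] with g hg
  exact hg.2.2.2

end LieGroupoid

end ModularSmooth

/-! ### Existence of positive transverse densities -/

noncomputable section PositiveDensities

universe u v w z

variable {E : Type u} [NormedAddCommGroup E] [NormedSpace ℝ E] [FiniteDimensional ℝ E]
  {M : Type v} [TopologicalSpace M] [ChartedSpace E M] [IsManifold 𝓘(ℝ, E) ∞ M]
  {F : Type w} [NormedAddCommGroup F] [NormedSpace ℝ F] [FiniteDimensional ℝ F]
  {𝒢 : Type z} [TopologicalSpace 𝒢] [ChartedSpace F 𝒢] [IsManifold 𝓘(ℝ, F) ∞ 𝒢]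

namespace LieGroupoid

variable (G : LieGroupoid E M F 𝒢)

/-- The change of frame between two smooth frames of the Lie algebroid has smooth determinant. -/
theorem exists_contMDiffAt_lie_det [T2Space M]
    (α α' : Fin G.lieAlgebroid.rank → {α // G.lieAlgebroid.IsSmooth α}) {x : M}
    (a a' : Basis (Fin G.lieAlgebroid.rank) ℝ (G.lieFiber x)) (ha : ∀ i, a i = (α i).1 x)
    (ha' : ∀ i, a' i = (α' i).1 x) :
    ∃ δ : M → ℝ, ContMDiffAt 𝓘(ℝ, E) 𝓘(ℝ, ℝ) ∞ δ x ∧ ∀ᶠ x' in 𝓝 x,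
      ∀ b b' : Basis (Fin G.lieAlgebroid.rank) ℝ (G.lieFiber x'),
        (⇑b = fun i => ((α i).1 x' : G.lieFiber x')) →
        (⇑b' = fun i => ((α' i).1 x' : G.lieFiber x')) → b.det b' = δ x' := by
  obtain ⟨c, hc⟩ := G.exists_sourceChart (G.unit x)
  obtain ⟨X, hX⟩ := exists_smooth_tangentFrame (E := E) (G.src (G.unit x))
  -- both frames are completed by the same lifts of vector fields on `M`, so that the change of
  -- frame is block triangular with an identity block
  let h : Fin (finrank ℝ E) → Π x, TangentSpace 𝓘(ℝ, F) (G.unit x) :=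
    fun j x => c.horiz (G.unit x) ((X j).1 (G.src (G.unit x)))
  let v : (Fin G.lieAlgebroid.rank → {α // G.lieAlgebroid.IsSmooth α}) →
      Fin G.lieAlgebroid.rank ⊕ Fin (finrank ℝ E) → Π x, TangentSpace 𝓘(ℝ, F) (G.unit x) :=
    fun α => Sum.elim (fun i x => ((α i).1 x : G.lieFiber x).1) h
  have hsu : ContMDiffAt 𝓘(ℝ, E) 𝓘(ℝ, E) ∞ (fun x => G.src (G.unit x)) x :=
    ContMDiffAt.comp x G.contMDiff_src.contMDiffAt G.contMDiff_unit.contMDiffAt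
  have hv : ∀ α s, ContMDiffAt 𝓘(ℝ, E) (𝓘(ℝ, F).prod 𝓘(ℝ, F)) ∞
      (fun x => (⟨G.unit x, v α s x⟩ : TangentBundle 𝓘(ℝ, F) 𝒢)) x := by
    rintro α (i | j)
    · exact (α i).2.contMDiffAt
    · refine c.contMDiffAt_horiz hc G.contMDiff_unit.contMDiffAt ?_
      exact ContMDiffAt.comp x (g := fun x => (⟨x, (X j).1 x⟩ : TangentBundle 𝓘(ℝ, E) M))
        (X j).2.contMDiffAt hsu
  have hb : ∀ (α : Fin G.lieAlgebroid.rank → {α // G.lieAlgebroid.IsSmooth α})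
      (a : Basis (Fin G.lieAlgebroid.rank) ℝ (G.lieFiber x)), (∀ i, a i = (α i).1 x) →
      ∃ b : Basis (Fin G.lieAlgebroid.rank ⊕ Fin (finrank ℝ E)) ℝ (TangentSpace 𝓘(ℝ, F) (G.unit x)),
        ⇑b = fun s => v α s x := fun α a ha =>
    Basis.exists_adapted (R := (G.lieFiber x).subtype)
      (p := (mfderiv 𝓘(ℝ, F) 𝓘(ℝ, E) G.src (G.unit x)).toLinearMap) (fun a => a.2)
      (Submodule.subtype_injective _)
      (by rw [Fintype.card_fin, Fintype.card_fin]; exact G.rank_add x) a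
      (tangentFrame (G.src (G.unit x))) (v := fun s => v α s x)
      (fun i => congrArg Subtype.val (ha i).symm) (fun j => by
        rw [hX j]
        exact c.mfderiv_src_horiz hc _)
  obtain ⟨b, hb₁⟩ := hb α a ha
  obtain ⟨b', hb₁'⟩ := hb α' a' ha'
  obtain ⟨h1, δ, hδ, hδe⟩ := exists_contMDiffAt_det (hv α) (hv α') G.contMDiff_unit.contMDiffAt b
    (fun s => congrFun hb₁ s)
  have h2 := (exists_contMDiffAt_det (hv α') (hv α') G.contMDiff_unit.contMDiffAt b'
    (fun s => congrFun hb₁' s)).1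
  refine ⟨δ, hδ, ?_⟩
  filter_upwards [h1, h2, hδe, hsu.continuousAt.eventually (eventually_tangent_frame X _ hX),
    G.contMDiff_unit.continuous.continuousAt.eventually (c.chart.open_source.mem_nhds hc)] with x'
    ⟨b, hb⟩ ⟨b', hb'⟩ hδ ⟨e, he⟩ hx' f f' hf hf'
  have hl : ∀ j, (mfderiv 𝓘(ℝ, F) 𝓘(ℝ, E) G.src (G.unit x')).toLinearMap (h j x') = e j := by
    intro j
    rw [he]
    exact c.mfderiv_src_horiz hx' _
  have h3 := Basis.det_adapted (R := (G.lieFiber x').subtype)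
    (p := (mfderiv 𝓘(ℝ, F) 𝓘(ℝ, E) G.src (G.unit x')).toLinearMap) (fun a => a.2)
    (a := f) (a₁ := f') (e := e) (e₁ := e) (b := b) (b₁ := b')
    (fun i => by rw [hb, hf]; rfl) (fun j => by rw [hb]; exact hl j)
    (fun i => by rw [hb', hf']; rfl) (fun j => by rw [hb']; exact hl j)
  rw [e.det_self, mul_one] at h3
  rw [← h3, ← hδ b hb, hb']

/-- The change of frame between two smooth frames of the tangent bundle has smooth determinant. -/
theorem exists_contMDiffAt_tangent_det
    (X X' : Fin (finrank ℝ E) → {X : Π x : M, TangentSpace 𝓘(ℝ, E) x // IsSmoothVectorField X})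
    {x : M} (e : Basis (Fin (finrank ℝ E)) ℝ (TangentSpace 𝓘(ℝ, E) x))
    (he : ∀ j, e j = (X j).1 x) :
    ∃ δ : M → ℝ, ContMDiffAt 𝓘(ℝ, E) 𝓘(ℝ, ℝ) ∞ δ x ∧ ∀ᶠ x' in 𝓝 x,
      ∀ b b' : Basis (Fin (finrank ℝ E)) ℝ (TangentSpace 𝓘(ℝ, E) x'),
        (⇑b = fun j => (X j).1 x') → (⇑b' = fun j => (X' j).1 x') → b.det b' = δ x' := by
  obtain ⟨-, δ, hδ, hδe⟩ := exists_contMDiffAt_det (u := fun x : M => x)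
    (v := fun j => (X j).1) (w := fun j => (X' j).1)
    (fun j => (X j).2.contMDiffAt) (fun j => (X' j).2.contMDiffAt) contMDiffAt_id e he
  exact ⟨δ, hδ, hδe.mono fun x' h b b' hb hb' => by rw [hb']; exact h b hb⟩

/-- Around every point there is a transverse density with value `1` on a smooth frame. -/
theorem exists_local_density [T2Space M] (x : M) :
    ∃ (U : Set M) (τ : Π x, G.lieAlgebroid.Dtr x), IsOpen U ∧ x ∈ U ∧ (∀ x' ∈ U, (τ x').IsPositive) ∧
      ∀ (α : Fin G.lieAlgebroid.rank → {α // G.lieAlgebroid.IsSmooth α})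
        (X : Fin (finrank ℝ E) → {X : Π x : M, TangentSpace 𝓘(ℝ, E) x // IsSmoothVectorField X})
        (x' : M) (b : Basis (Fin G.lieAlgebroid.rank) ℝ (G.lieFiber x'))
        (c : Basis (Fin (finrank ℝ E)) ℝ (TangentSpace 𝓘(ℝ, E) x')), x' ∈ U →
        (∀ i, b i = (α i).1 x') → (∀ j, c j = (X j).1 x') → ContMDiffAt 𝓘(ℝ, E) 𝓘(ℝ, ℝ) ∞
        (fun y => (τ y).evalTuple (fun i => (α i).1 y) (fun j => (X j).1 y)) x' := by
  classical
  obtain ⟨α₀, hα₀⟩ := G.exists_smooth_frame x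
  obtain ⟨X₀, hX₀⟩ := exists_smooth_tangentFrame (E := E) x
  -- near `x` the sections `α₀` and the vector fields `X₀` form frames; `τ` is the density with
  -- value `1` on them
  let P : M → Prop := fun x' => ∃ p : Basis (Fin G.lieAlgebroid.rank) ℝ (G.lieFiber x') ×
    Basis (Fin (finrank ℝ E)) ℝ (TangentSpace 𝓘(ℝ, E) x'),
    (⇑p.1 = fun i => ((α₀ i).1 x' : G.lieFiber x')) ∧ ⇑p.2 = fun j => (X₀ j).1 x'
  have hP : ∀ᶠ x' in 𝓝 x, P x' := by
    filter_upwards [G.eventually_lie_frame α₀ _ hα₀, eventually_tangent_frame X₀ _ hX₀] with x'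
      ⟨a, ha⟩ ⟨e, he⟩
    exact ⟨(a, e), ha, he⟩
  obtain ⟨U, hU, hUo, hxU⟩ := eventually_nhds_iff.1 hP
  let τ : Π x, G.lieAlgebroid.Dtr x := fun x' =>
    if h : P x' then TransverseDensity.ofFrames h.choose.1 h.choose.2 else 0
  have hτ : ∀ x' (a : Basis (Fin G.lieAlgebroid.rank) ℝ (G.lieFiber x'))
      (e : Basis (Fin (finrank ℝ E)) ℝ (TangentSpace 𝓘(ℝ, E) x')),
      (⇑a = fun i => ((α₀ i).1 x' : G.lieFiber x')) → (⇑e = fun j => (X₀ j).1 x') →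
      TransverseDensity.eval a e (τ x') = 1 := by
    intro x' a e ha he
    have h : P x' := ⟨(a, e), ha, he⟩
    have h1 : h.choose.1 = a := DFunLike.coe_injective (h.choose_spec.1.trans ha.symm)
    have h2 : h.choose.2 = e := DFunLike.coe_injective (h.choose_spec.2.trans he.symm)
    have h3 : τ x' = TransverseDensity.ofFrames a e := by
      rw [← h1, ← h2]
      exact dif_pos h
    rw [h3]
    exact TransverseDensity.eval_ofFrames a e
  refine ⟨U, τ, hUo, hxU, fun x' hx' => ?_, ?_⟩
  · obtain ⟨⟨a, e⟩, ha, he⟩ := hU x' hx'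
    exact TransverseDensity.isPositive_of_eval_pos (a := a) (e := e)
      ((hτ x' a e ha he).symm ▸ one_pos)
  · intro α X x' b c hx' hb hc
    obtain ⟨⟨a, e⟩, ha, he⟩ := hU x' hx'
    obtain ⟨δ₁, hδ₁, h1⟩ := G.exists_contMDiffAt_lie_det α₀ α a b (fun i => congrFun ha i) hb
    obtain ⟨δ₂, hδ₂, h2⟩ := exists_contMDiffAt_tangent_det X₀ X e (fun j => congrFun he j)
    have key : ∀ᶠ y in 𝓝 x', δ₁ y ≠ 0 ∧ δ₂ y ≠ 0 ∧
        (τ y).evalTuple (fun i => (α i).1 y) (fun j => (X j).1 y) = |δ₂ y| / |δ₁ y| := by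
      filter_upwards [h1, h2, hUo.mem_nhds hx', G.eventually_lie_frame α b hb,
        eventually_tangent_frame X c hc] with y h1 h2 hy ⟨b, hb⟩ ⟨c, hc⟩
      obtain ⟨⟨a, e⟩, ha, he⟩ := hU y hy
      have h3 := TransverseDensity.eval_mul_abs_det a b e c (τ y)
      rw [hτ y a e ha he, h1 a b ha hb, h2 e c he hc, mul_one] at h3
      have hn1 : δ₁ y ≠ 0 := h1 a b ha hb ▸ a.det_ne_zero' b
      have hn2 : δ₂ y ≠ 0 := h2 e c he hc ▸ e.det_ne_zero' c
      refine ⟨hn1, hn2, ?_⟩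
      rw [eq_div_iff (abs_ne_zero.2 hn1), ← h3]
      exact congrArg (· * |δ₁ y|) (TransverseDensity.evalTuple_eq b c hb hc (τ y))
    obtain ⟨hn1, hn2, -⟩ := key.self_of_nhds
    have habs : ∀ {f : M → ℝ}, ContMDiffAt 𝓘(ℝ, E) 𝓘(ℝ, ℝ) ∞ f x' → f x' ≠ 0 →
        ContMDiffAt 𝓘(ℝ, E) 𝓘(ℝ, ℝ) ∞ (fun y => |f y|) x' := fun {f} hf h0 =>
      ContMDiffAt.comp (g := fun r : ℝ => |r|) x' (contDiffAt_abs h0).contMDiffAt hf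
    refine ((habs hδ₂ hn2).div₀ (habs hδ₁ hn1) (abs_ne_zero.2 hn1)).congr_of_eventuallyEq ?_
    exact key.mono fun y hy => hy.2.2

/-- There are strictly positive smooth transverse densities. -/
theorem exists_positive_density [T2Space M] [SecondCountableTopology M] :
    ∃ σ, G.lieAlgebroid.IsSmoothDtr σ ∧ ∀ x, (σ x).IsPositive := by
  choose U τ hUo hxU hpos hsm using G.exists_local_density
  have : LocallyCompactSpace M := ChartedSpace.locallyCompactSpace E M
  obtain ⟨ρ, hρ⟩ := SmoothPartitionOfUnity.exists_isSubordinate 𝓘(ℝ, E) (s := (Set.univ : Set M))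
    isClosed_univ U hUo (fun x _ => Set.mem_iUnion.2 ⟨x, hxU x⟩)
  have hfin : ∀ x, (Function.support fun i => ρ i x • τ i x).Finite := fun x =>
    (ρ.locallyFinite.point_finite x).subset fun i hi h0 => hi (by
      change ρ i x • τ i x = 0
      rw [show ρ i x = 0 from h0, zero_smul])
  have heval : ∀ x (a : Basis (Fin G.lieAlgebroid.rank) ℝ (G.lieFiber x))
      (e : Basis (Fin (finrank ℝ E)) ℝ (TangentSpace 𝓘(ℝ, E) x)),
      TransverseDensity.eval a e (∑ᶠ i, ρ i x • τ i x) =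
        ∑ᶠ i, ρ i x • TransverseDensity.eval a e (τ i x) := by
    intro x a e
    have h1 := AddMonoidHom.map_finsum (TransverseDensity.eval a e).toAddMonoidHom (hfin x)
    refine h1.trans (finsum_congr fun i => ?_)
    exact (TransverseDensity.eval a e).map_smul _ _
  refine ⟨fun x => ∑ᶠ i, ρ i x • τ i x, ?_, fun x a e => ?_⟩
  · intro α X x b c hb hc
    refine (ρ.contMDiffAt_finsum (x₀ := x) (g := fun i y =>
      (τ i y).evalTuple (fun i => (α i).1 y) (fun j => (X j).1 y)) fun i hi =>
        hsm i α X x b c (hρ i hi) hb hc).congr_of_eventuallyEq ?_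
    filter_upwards [G.eventually_lie_frame α b hb, eventually_tangent_frame X c hc] with y
      ⟨a, ha⟩ ⟨e, he⟩
    refine (TransverseDensity.evalTuple_eq a e ha he _).trans ((heval y a e).trans ?_)
    exact finsum_congr fun i => congrArg (ρ i y • ·)
      (TransverseDensity.evalTuple_eq a e ha he (τ i y)).symm
  · have hnn : ∀ i, 0 ≤ ρ i x • TransverseDensity.eval a e (τ i x) := by
      intro i
      by_cases hi : ρ i x = 0
      · rw [hi, zero_smul]
      · exact smul_nonneg (ρ.nonneg i x) (hpos i x (hρ i (subset_closure hi)) a e).le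
    obtain ⟨i, hi⟩ := ρ.exists_pos_of_mem (Set.mem_univ x)
    refine lt_of_lt_of_eq ?_ (heval x a e).symm
    refine finsum_pos hnn ⟨i, smul_pos hi (hpos i x (hρ i (subset_closure hi.ne')) a e)⟩ ?_
    exact (ρ.locallyFinite.point_finite x).subset fun i hi h0 => hi (by
      change ρ i x • _ = 0
      rw [show ρ i x = 0 from h0, zero_smul])

end LieGroupoid

end PositiveDensities

/-! ### The modular class of a Lie groupoid -/

noncomputable section ModularClass

universe u v w z

variable {E : Type u} [NormedAddCommGroup E] [NormedSpace ℝ E] [FiniteDimensional ℝ E]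
  {M : Type v} [TopologicalSpace M] [ChartedSpace E M] [IsManifold 𝓘(ℝ, E) ∞ M]
  {F : Type w} [NormedAddCommGroup F] [NormedSpace ℝ F] [FiniteDimensional ℝ F]
  {𝒢 : Type z} [TopologicalSpace 𝒢] [ChartedSpace F 𝒢] [IsManifold 𝓘(ℝ, F) ∞ 𝒢]

namespace LieGroupoid

variable (G : LieGroupoid E M F 𝒢)

/-- Two smooth sections of the transverse density bundle, the first one nowhere vanishing, differ by
a smooth function. -/
theorem exists_smooth_ratio [T2Space M] {σ σ' : Π x, G.lieAlgebroid.Dtr x}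
    (hσ : G.lieAlgebroid.IsSmoothDtr σ) (h0 : ∀ x, σ x ≠ 0) (hσ' : G.lieAlgebroid.IsSmoothDtr σ') :
    ∃ f : M → ℝ, ContMDiff 𝓘(ℝ, E) 𝓘(ℝ, ℝ) ∞ f ∧ ∀ x, σ' x = f x • σ x := by
  let r : M → ℝ := fun x => TransverseDensity.eval (G.lieFrame x) (tangentFrame x) (σ' x) /
    TransverseDensity.eval (G.lieFrame x) (tangentFrame x) (σ x)
  have hr : ∀ x, σ' x = r x • σ x := by
    intro x
    refine TransverseDensity.eval_injective (G.lieFrame x) (tangentFrame x) ?_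
    refine Eq.trans ?_ ((TransverseDensity.eval (G.lieFrame x) (tangentFrame x)).map_smul
      (r x) (σ x)).symm
    exact (div_mul_cancel₀ _ (TransverseDensity.eval_ne_zero (h0 x))).symm
  refine ⟨r, fun x => ?_, hr⟩
  obtain ⟨α, hα⟩ := G.exists_smooth_frame x
  obtain ⟨X, hX⟩ := exists_smooth_tangentFrame (E := E) x
  obtain ⟨P, hP, hPe⟩ := G.exists_contMDiffAt_eval hσ hα hX
  obtain ⟨P', hP', hPe'⟩ := G.exists_contMDiffAt_eval hσ' hα hX
  have key : ∀ᶠ x' in 𝓝 x, P x' ≠ 0 ∧ r x' = P' x' / P x' := by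
    filter_upwards [hPe, hPe'] with x' ⟨a, e, ha, he, hP⟩ ⟨a', e', ha', he', hP'⟩
    have e1 : a' = a := DFunLike.coe_injective (ha'.trans ha.symm)
    have e2 : e' = e := DFunLike.coe_injective (he'.trans he.symm)
    subst e1 e2
    have hne : P x' ≠ 0 := hP ▸ TransverseDensity.eval_ne_zero (h0 x')
    refine ⟨hne, ?_⟩
    rw [eq_div_iff hne, ← hP, ← hP', hr x']
    exact ((TransverseDensity.eval a' e').map_smul (r x') (σ x')).symm
  exact (hP'.div₀ hP key.self_of_nhds.1).congr_of_eventuallyEq (key.mono fun x' hx => hx.2)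

/-- The modular cocycle of a positive transverse density. -/
theorem exists_modular_cocycle [T2Space M] {σ : Π x, G.lieAlgebroid.Dtr x}
    (hσ : G.lieAlgebroid.IsSmoothDtr σ) (hpos : ∀ x, (σ x).IsPositive) :
    ∃ c : G.Z1, ∀ g, G.Scales σ g (Real.exp (-c.1 g)) := by
  choose k hk hs using G.exists_scales hpos
  have hs' : ∀ g, G.Scales σ g (Real.exp (-(fun g => -Real.log (k g)) g)) := fun g => by
    simpa only [neg_neg, Real.exp_log (hk g)] using hs g
  refine ⟨⟨fun g => -Real.log (k g), G.contMDiff_of_scales hσ hpos hs', fun g h hgh => ?_⟩, hs'⟩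
  have h1 := (hs (G.mul g h)).unique (G.ne_zero_of_isPositive hpos) ((hs g).mul hgh (hs h))
  change -Real.log (k (G.mul g h)) = -Real.log (k g) + -Real.log (k h)
  rw [h1, Real.log_mul (hk g).ne' (hk h).ne']
  ring

/-- The modular class of a Lie groupoid exists: positive densities exist, and rescaling a density by
a positive function `f` changes its cocycle by the coboundary of `-log f`. -/
theorem exists_isModularClass [T2Space M] [SecondCountableTopology M] :
    ∃ m, G.IsModularClass m := by
  obtain ⟨σ, hσ, hpos⟩ := G.exists_positive_density
  obtain ⟨c, hc⟩ := G.exists_modular_cocycle hσ hpos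
  refine ⟨G.mkH1 c, ⟨σ, hσ, hpos⟩, fun σ' hσ' hpos' => ?_⟩
  obtain ⟨c', hc'⟩ := G.exists_modular_cocycle hσ' hpos'
  refine ⟨c', hc', ?_⟩
  obtain ⟨f, hf, hfσ⟩ := G.exists_smooth_ratio hσ (G.ne_zero_of_isPositive hpos) hσ'
  have hfpos : ∀ x, 0 < f x := by
    intro x
    have h1 := hpos' x (G.lieFrame x) (tangentFrame x)
    rw [hfσ x] at h1
    exact pos_of_mul_pos_left (h1.trans_eq ((TransverseDensity.eval _ _).map_smul _ _))
      (hpos x (G.lieFrame x) (tangentFrame x)).le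
  have hσ'eq : σ' = fun x => f x • σ x := funext hfσ
  subst hσ'eq
  refine (Submodule.Quotient.eq (G.B1.submoduleOf G.Z1)).2 ?_
  refine ⟨fun x => -Real.log (f x), fun x => ?_, fun g => ?_⟩
  · exact (ContMDiffAt.comp (g := Real.log) x (Real.contDiffAt_log.2 (hfpos x).ne').contMDiffAt
      (hf x)).neg
  · have h1 := congrArg Real.log ((hc' g).unique (G.ne_zero_of_isPositive hpos')
      ((hc g).smul f (hfpos _).ne'))
    rw [Real.log_exp, Real.log_div (mul_pos (hfpos _) (Real.exp_pos _)).ne' (hfpos _).ne',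
      Real.log_mul (hfpos _).ne' (Real.exp_pos _).ne', Real.log_exp] at h1
    change c'.1 g - c.1 g = _
    linarith

theorem isModularClass_modularClass [T2Space M] [SecondCountableTopology M] :
    G.IsModularClass G.modularClass := by
  have h := G.exists_isModularClass
  rw [modularClass, dif_pos h]
  exact h.choose_spec

end LieGroupoid

end ModularClass

/-! ### Derivatives of determinants and flows of sections -/

noncomputable section InfinitesimalScaling

universe u v w z

section

variable {F : Type*} [NormedAddCommGroup F] [NormedSpace ℝ F] [FiniteDimensional ℝ F]
  {P : Type*} [TopologicalSpace P] [ChartedSpace F P] [IsManifold 𝓘(ℝ, F) ∞ P]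

/-- The determinant of a moving family `u` of vectors with respect to a moving frame `w`, along a
curve on which both agree at time `0`, has the derivative `∑ i, f_i^*(d_i)`, where `d` is the
derivative of `u - w` in a chart. -/
theorem exists_hasDerivAt_det {ι : Type*} [Fintype ι] [DecidableEq ι] {γ : ℝ → P} {p : P}
    (hp : γ 0 = p) {u w : ι → Π t, TangentSpace 𝓘(ℝ, F) (γ t)}
    (f : Basis ι ℝ (TangentSpace 𝓘(ℝ, F) p))
    (hw : ∀ i, ContMDiffAt 𝓘(ℝ, ℝ) (𝓘(ℝ, F).prod 𝓘(ℝ, F)) ∞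
      (fun t => (⟨γ t, w i t⟩ : TangentBundle 𝓘(ℝ, F) P)) 0)
    (hw0 : ∀ i, (w i 0 : F) = f i) (hu0 : ∀ i, (u i 0 : F) = f i) {d : ι → F}
    (hd : ∀ i, HasDerivAt (fun t => tcoord F p (γ t) (u i t) - tcoord F p (γ t) (w i t)) (d i) 0)
    (hγ : ContMDiffAt 𝓘(ℝ, ℝ) 𝓘(ℝ, F) ∞ γ 0) :
    ∃ D : ℝ → ℝ, D 0 = 1 ∧ HasDerivAt D (∑ i, f.coord i (d i)) 0 ∧
      ∀ᶠ t in 𝓝 0, ∀ b : Basis ι ℝ (TangentSpace 𝓘(ℝ, F) (γ t)), (⇑b = fun i => w i t) →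
        b.det (fun i => u i t) = D t := by
  subst hp
  let f' : Basis ι ℝ F := f
  let W : ι → ℝ → F := fun i t => tcoord F (γ 0) (γ t) (w i t)
  let U : ι → ℝ → F := fun i t => tcoord F (γ 0) (γ t) (u i t)
  have hWd : ∀ i, HasDerivAt (W i) (deriv (W i) 0) 0 := fun i => by
    have h1 : ContMDiffAt 𝓘(ℝ, ℝ) 𝓘(ℝ, F) ∞ (W i) 0 :=
      contMDiffAt_tcoord (mem_chart_source F _) (hw i)
    exact (mdifferentiableAt_iff_differentiableAt.1 h1.mdiffAt_of_infty).hasDerivAt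
  have hUd : ∀ i, HasDerivAt (U i) (d i + deriv (W i) 0) 0 := fun i => by
    have := (hd i).add (hWd i)
    refine this.congr_of_eventuallyEq (Filter.Eventually.of_forall fun t => ?_)
    exact (sub_add_cancel (U i t) (W i t)).symm
  have hW0 : ∀ i, W i 0 = f' i := fun i => (tcoord_self _ _).trans (hw0 i)
  have hU0 : ∀ i, U i 0 = f' i := fun i => (tcoord_self _ _).trans (hu0 i)
  -- the determinant is the quotient of those of `u` and `w` with respect to the fixed frame
  -- `f`; by Jacobi's formula the contributions of the derivative of `w` cancel
  have h1 := f'.hasDerivAt_det hW0 hWd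
  have h2 := f'.hasDerivAt_det hU0 hUd
  have hone : ∀ {V : ι → ℝ → F}, (∀ i, V i 0 = f' i) → (f'.det fun i => V i 0) = 1 := fun hV => by
    rw [funext hV, f'.det_self]
  refine ⟨fun t => (f'.det fun i => U i t) / (f'.det fun i => W i t), ?_, ?_, ?_⟩
  · simp only [hone hU0, hone hW0, div_one]
  · have h3 := h2.div h1 (by rw [hone hW0]; exact one_ne_zero)
    rw [hone hU0, hone hW0] at h3
    have h4 : ∑ i, f'.coord i (d i + deriv (W i) 0) =
        ∑ i, f'.coord i (d i) + ∑ i, f'.coord i (deriv (W i) 0) := by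
      rw [← Finset.sum_add_distrib]
      exact Finset.sum_congr rfl fun i _ => map_add _ _ _
    refine h3.congr_deriv ?_
    rw [h4]
    change _ = ∑ i, f'.coord i (d i)
    ring
  · filter_upwards [hγ.continuousAt.eventually ((chartAt F (γ 0)).open_source.mem_nhds
      (mem_chart_source F (γ 0)))] with t ht b hb
    let T : TangentSpace 𝓘(ℝ, F) (γ t) ≃ₗ[ℝ] F :=
      LinearEquiv.ofBijective (tcoord F (γ 0) (γ t)).toLinearMap (tcoord_bijective ht)
    have h4 : ⇑(b.map T) = fun i => W i t := by
      funext i; rw [Basis.map_apply, hb]; rfl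
    have h5 : (b.map T).det (fun i => U i t) = b.det (fun i => u i t) := by
      rw [Basis.det_map]
      congr 1
      funext i
      exact T.symm_apply_apply (u i t)
    have h6 : f'.det (fun i => W i t) ≠ 0 := by
      rw [← h4]; exact f'.det_ne_zero' _
    rw [eq_div_iff h6, ← h5, ← h4, mul_comm]
    have h7 := (f'.det).eq_smul_basis_det (b.map T)
    exact (congrArg (fun φ => φ fun i => U i t) h7).symm

end

variable {E : Type u} [NormedAddCommGroup E] [NormedSpace ℝ E] [FiniteDimensional ℝ E]
  {M : Type v} [TopologicalSpace M] [ChartedSpace E M] [IsManifold 𝓘(ℝ, E) ∞ M]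
  {F : Type w} [NormedAddCommGroup F] [NormedSpace ℝ F] [FiniteDimensional ℝ F]
  {𝒢 : Type z} [TopologicalSpace 𝒢] [ChartedSpace F 𝒢] [IsManifold 𝓘(ℝ, F) ∞ 𝒢]

namespace LieGroupoid

variable (G : LieGroupoid E M F 𝒢)

/-- A family of local sections of the source map that generates the section `α` of the Lie algebroid
near `x`: it consists of units at time `0`, with velocity `α`. -/
structure IsFlowAt (α : Π x, G.lieFiber x) (Θ : ℝ → M → 𝒢) (x : M) : Prop where
  contMDiffAt : ContMDiffAt (𝓘(ℝ, ℝ).prod 𝓘(ℝ, E)) 𝓘(ℝ, F) ∞ (Function.uncurry Θ) (0, x)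
  src_eq : ∀ᶠ p in 𝓝 ((0 : ℝ), x), G.src (Θ p.1 p.2) = p.2
  zero_eq : ∀ᶠ y in 𝓝 x, Θ 0 y = G.unit y
  mdifferentiableAt : ∀ᶠ y in 𝓝 x, MDifferentiableAt 𝓘(ℝ, ℝ) 𝓘(ℝ, F) (fun t => Θ t y) 0
  velocity_eq : ∀ᶠ y in 𝓝 x, (velocity F (fun t => Θ t y) : F) = (α y).1
  isBisectionAt : ∀ᶠ t in 𝓝 (0 : ℝ), G.IsBisectionAt (Θ t) x

/-- Every smooth section of the Lie algebroid is generated by a family of local bisections. The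
curves need not be integral curves of the right-invariant vector field, since only first derivatives
at time `0` matter. -/
theorem exists_isFlowAt (α : {α // G.lieAlgebroid.IsSmooth α}) (x : M) :
    ∃ Θ, G.IsFlowAt α.1 Θ x := by
  obtain ⟨Θ, h1, h2, h3, h4⟩ := G.exists_vertical_family (u := G.unit) (v := fun x => (α.1 x).1)
    (n₀ := x) α.2.contMDiffAt (Filter.Eventually.of_forall fun n => (α.1 n).2)
  replace h4 := h4 (Filter.Eventually.of_forall fun y => α.2.contMDiffAt)
  simp only [G.src_unit] at h2
  refine ⟨Θ, h1, h2, h3.mono fun y h => h.1, h3.mono fun y h => h.2.1, h3.mono fun y h => h.2.2, ?_⟩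
  have hl : Filter.Tendsto (fun t : ℝ => (t, x)) (𝓝 0) (𝓝 ((0 : ℝ), x)) :=
    (Continuous.prodMk_left x).continuousAt
  -- the differentials of the maps on the base form a smooth family that starts at the identity
  have h5 : ContMDiffAt (𝓘(ℝ, ℝ).prod 𝓘(ℝ, E)) 𝓘(ℝ, E) ∞
      (Function.uncurry fun t y => G.tgt (Θ t y)) (0, x) :=
    ContMDiffAt.comp ((0 : ℝ), x) (g := G.tgt) G.contMDiff_tgt.contMDiffAt h1
  let e : Basis (Fin (finrank ℝ E)) ℝ (TangentSpace 𝓘(ℝ, E) x) := tangentFrame x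
  have h6 : ∀ j, ContMDiffAt 𝓘(ℝ, ℝ) (𝓘(ℝ, E).prod 𝓘(ℝ, E)) ∞ (fun t =>
      (⟨G.tgt (Θ t x), mfderiv 𝓘(ℝ, E) 𝓘(ℝ, E) (fun y => G.tgt (Θ t y)) x (e j)⟩ :
        TangentBundle 𝓘(ℝ, E) M)) 0 := fun j =>
    ContMDiffAt.mfderiv_apply_family (J := 𝓘(ℝ, E)) (g := fun _ : ℝ => x) (v := fun _ => e j) h5
      contMDiffAt_const
  have hu : ContMDiffAt 𝓘(ℝ, ℝ) 𝓘(ℝ, E) ∞ (fun t => G.tgt (Θ t x)) 0 :=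
    ContMDiffAt.comp (g := Function.uncurry fun t y => G.tgt (Θ t y)) (f := fun t : ℝ => (t, x))
      (0 : ℝ) h5 (contMDiffAt_id.prodMk contMDiffAt_const)
  have h7 : ∀ v : E, (mfderiv 𝓘(ℝ, E) 𝓘(ℝ, E) (fun y => G.tgt (Θ 0 y)) x v : E) = v := by
    intro v
    have h8 : (fun y => G.tgt (Θ 0 y)) =ᶠ[𝓝 x] id := h3.mono fun y h =>
      (congrArg G.tgt h.1).trans (G.tgt_unit y)
    exact (congrArg (fun L : E →L[ℝ] E => L v)
      (h8.mfderiv_eq (I := 𝓘(ℝ, E)) (I' := 𝓘(ℝ, E)))).trans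
      (congrArg (fun L : E →L[ℝ] E => L v) (mfderiv_id (I := 𝓘(ℝ, E)) (x := x)))
  have h9 := (exists_contMDiffAt_det h6 h6 hu (tangentFrame _)
    (fun j => (h7 (tangentFrame (E := E) x j)).symm)).1
  filter_upwards [h9, hl.eventually h4, hl.eventually h2.eventually_nhds] with t ⟨b, hb⟩ ht hs
  refine ⟨ContMDiffAt.comp (g := Function.uncurry Θ) (f := fun y => (t, y)) x ht
    (contMDiffAt_const.prodMk contMDiffAt_id),
    ((Continuous.prodMk_right t).continuousAt (x := x)).eventually hs, ?_⟩
  let L : TangentSpace 𝓘(ℝ, E) x →ₗ[ℝ] TangentSpace 𝓘(ℝ, E) (G.tgt (Θ t x)) :=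
    (mfderiv 𝓘(ℝ, E) 𝓘(ℝ, E) (fun y => G.tgt (Θ t y)) x).toLinearMap
  have hL : L = (e.equiv b (Equiv.refl _)).toLinearMap := by
    refine e.ext fun j => ?_
    rw [LinearEquiv.coe_coe, Basis.equiv_apply, hb]
    rfl
  have : Function.Bijective L := by
    rw [hL]; exact (e.equiv b (Equiv.refl _)).bijective
  exact this

end LieGroupoid

end InfinitesimalScaling

/-! ### Transport of frames along the flow of a section -/

noncomputable section InfinitesimalModular

universe u v w z

variable {E : Type u} [NormedAddCommGroup E] [NormedSpace ℝ E] [FiniteDimensional ℝ E]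
  {M : Type v} [TopologicalSpace M] [ChartedSpace E M] [IsManifold 𝓘(ℝ, E) ∞ M]
  {F : Type w} [NormedAddCommGroup F] [NormedSpace ℝ F] [FiniteDimensional ℝ F]
  {𝒢 : Type z} [TopologicalSpace 𝒢] [ChartedSpace F 𝒢] [IsManifold 𝓘(ℝ, F) ∞ 𝒢]

namespace LieGroupoid

variable {G : LieGroupoid E M F 𝒢} {Θ : ℝ → M → 𝒢} {x : M} {α : {α // G.lieAlgebroid.IsSmooth α}}

namespace IsFlowAt

theorem contMDiffAt_tgt (hΘ : G.IsFlowAt α.1 Θ x) :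
    ContMDiffAt (𝓘(ℝ, ℝ).prod 𝓘(ℝ, E)) 𝓘(ℝ, E) ∞
      (Function.uncurry fun t y => G.tgt (Θ t y)) (0, x) :=
  ContMDiffAt.comp ((0 : ℝ), x) (g := G.tgt) G.contMDiff_tgt.contMDiffAt hΘ.contMDiffAt

theorem contMDiffAt_curve (hΘ : G.IsFlowAt α.1 Θ x) :
    ContMDiffAt 𝓘(ℝ, ℝ) 𝓘(ℝ, F) ∞ (fun t => Θ t x) 0 :=
  ContMDiffAt.comp (g := Function.uncurry Θ) (f := fun t : ℝ => (t, x)) (0 : ℝ)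
    hΘ.contMDiffAt (contMDiffAt_id.prodMk contMDiffAt_const)

theorem contMDiffAt_tgt_curve (hΘ : G.IsFlowAt α.1 Θ x) :
    ContMDiffAt 𝓘(ℝ, ℝ) 𝓘(ℝ, E) ∞ (fun t => G.tgt (Θ t x)) 0 :=
  ContMDiffAt.comp (0 : ℝ) G.contMDiff_tgt.contMDiffAt hΘ.contMDiffAt_curve

theorem tgt_zero (hΘ : G.IsFlowAt α.1 Θ x) : ∀ᶠ y in 𝓝 x, G.tgt (Θ 0 y) = y :=
  hΘ.zero_eq.mono fun y h => (congrArg G.tgt h).trans (G.tgt_unit y)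

theorem velocity_tgt (hΘ : G.IsFlowAt α.1 Θ x) : ∀ᶠ y in 𝓝 x,
    (velocity E (fun t => G.tgt (Θ t y)) : E) = G.lieAlgebroid.anchor y (α.1 y) := by
  filter_upwards [hΘ.zero_eq, hΘ.mdifferentiableAt, hΘ.velocity_eq] with y h0 hd hv
  refine (velocity_comp h0 hd (G.mdifferentiableAt_tgt (G.unit y))).trans ?_
  exact congrArg (fun v : F => (mfderiv 𝓘(ℝ, F) 𝓘(ℝ, E) G.tgt (G.unit y) : F →L[ℝ] E) v) hv

/-- The determinant of the transport of a frame of the tangent bundle along the flow. -/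
theorem exists_tangent_det (hΘ : G.IsFlowAt α.1 Θ x)
    (X : Fin (finrank ℝ E) → {X : Π x : M, TangentSpace 𝓘(ℝ, E) x // IsSmoothVectorField X})
    (e : Basis (Fin (finrank ℝ E)) ℝ (TangentSpace 𝓘(ℝ, E) x)) (he : ∀ j, e j = (X j).1 x) :
    ∃ D : ℝ → ℝ, D 0 = 1 ∧ HasDerivAt D (-(∑ j, e.coord j (mlieBracket 𝓘(ℝ, E)
        (fun y => G.lieAlgebroid.anchor y (α.1 y)) (X j).1 x))) 0 ∧
      ∀ᶠ t in 𝓝 0, ∀ b : Basis (Fin (finrank ℝ E)) ℝ (TangentSpace 𝓘(ℝ, E) (G.tgt (Θ t x))),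
        (⇑b = fun j => (X j).1 (G.tgt (Θ t x))) →
        b.det (fun j => mfderiv 𝓘(ℝ, E) 𝓘(ℝ, E) (fun y => G.tgt (Θ t y)) x (e j)) = D t := by
  have : CompleteSpace E := FiniteDimensional.complete ℝ E
  have h1 := fun j => hasDerivAt_flow_sub hΘ.contMDiffAt_tgt hΘ.tgt_zero hΘ.velocity_tgt
    ((X j).2.contMDiffAt (x := x))
  have hx0 : G.tgt (Θ 0 x) = x := hΘ.tgt_zero.self_of_nhds
  obtain ⟨D, hD0, hD, hDe⟩ := exists_hasDerivAt_det (γ := fun t => G.tgt (Θ t x)) hx0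
    (u := fun j t => mfderiv 𝓘(ℝ, E) 𝓘(ℝ, E) (fun y => G.tgt (Θ t y)) x ((X j).1 x))
    (w := fun j t => (X j).1 (G.tgt (Θ t x))) e
    (fun j => ContMDiffAt.comp (0 : ℝ) (g := fun x => (⟨x, (X j).1 x⟩ : TangentBundle 𝓘(ℝ, E) M))
      (X j).2.contMDiffAt hΘ.contMDiffAt_tgt_curve)
    (fun j => (congrArg (fun y => ((X j).1 y : E)) hx0).trans (he j).symm)
    (fun j => by
      have h8 : (fun y => G.tgt (Θ 0 y)) =ᶠ[𝓝 x] id := hΘ.tgt_zero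
      refine Eq.trans ?_ (he j).symm
      exact (congrArg (fun L : E →L[ℝ] E => L ((X j).1 x))
        (h8.mfderiv_eq (I := 𝓘(ℝ, E)) (I' := 𝓘(ℝ, E)))).trans
        (congrArg (fun L : E →L[ℝ] E => L ((X j).1 x)) (mfderiv_id (I := 𝓘(ℝ, E)) (x := x))))
    h1 hΘ.contMDiffAt_tgt_curve
  refine ⟨D, hD0, hD.congr_deriv ?_, hDe.mono fun t ht b hb => ?_⟩
  · rw [← Finset.sum_neg_distrib]
    exact Finset.sum_congr rfl fun j _ => map_neg (e.coord j) _
  · refine Eq.trans ?_ (ht b hb)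
    congr 1
    funext j
    exact congrArg (fun v : E => (mfderiv 𝓘(ℝ, E) 𝓘(ℝ, E) (fun y => G.tgt (Θ t y)) x : E →L[ℝ] E) v)
      (he j)

/-- The family of left translations by the bisections of the flow. -/
theorem contMDiffAt_bisMap (hΘ : G.IsFlowAt α.1 Θ x) :
    ContMDiffAt (𝓘(ℝ, ℝ).prod 𝓘(ℝ, F)) 𝓘(ℝ, F) ∞
      (Function.uncurry fun t h => G.bisMap (Θ t) h) (0, G.unit x) := by
  have ht : ContMDiffAt (𝓘(ℝ, ℝ).prod 𝓘(ℝ, F)) (𝓘(ℝ, ℝ).prod 𝓘(ℝ, E)) ∞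
      (fun p : ℝ × 𝒢 => (p.1, G.tgt p.2)) (0, G.unit x) :=
    contMDiffAt_fst.prodMk (ContMDiffAt.comp (f := Prod.snd) ((0 : ℝ), G.unit x)
      G.contMDiff_tgt.contMDiffAt contMDiffAt_snd)
  have h0 : (fun p : ℝ × 𝒢 => (p.1, G.tgt p.2)) (0, G.unit x) = ((0 : ℝ), x) :=
    Prod.ext rfl (G.tgt_unit x)
  have hs : ∀ᶠ p : ℝ × 𝒢 in 𝓝 (0, G.unit x), G.src (Θ p.1 (G.tgt p.2)) = G.tgt p.2 := by
    have := ht.continuousAt.tendsto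
    change Filter.Tendsto _ _ (𝓝 ((0 : ℝ), G.tgt (G.unit x))) at this
    rw [G.tgt_unit] at this
    exact this.eventually hΘ.src_eq
  exact G.contMDiffAt_mul (f := fun p : ℝ × 𝒢 => Θ p.1 (G.tgt p.2)) (g := Prod.snd)
    (ContMDiffAt.comp_of_eq (g := Function.uncurry Θ) hΘ.contMDiffAt ht h0) contMDiffAt_snd hs

theorem bisMap_zero (hΘ : G.IsFlowAt α.1 Θ x) : ∀ᶠ h in 𝓝 (G.unit x), G.bisMap (Θ 0) h = h := by
  have ht : Filter.Tendsto G.tgt (𝓝 (G.unit x)) (𝓝 x) := by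
    have := G.contMDiff_tgt.continuous.tendsto (G.unit x)
    rwa [G.tgt_unit] at this
  filter_upwards [ht.eventually hΘ.zero_eq] with h hh
  rw [bisMap, hh, G.unit_mul]

/-- The bisections of the flow of a section generate the right-invariant vector field. -/
theorem velocity_bisMap (hΘ : G.IsFlowAt α.1 Θ x) : ∀ᶠ h in 𝓝 (G.unit x),
    (velocity F (fun t => G.bisMap (Θ t) h) : F) = G.rightInvariant α.1 h := by
  have ht : Filter.Tendsto G.tgt (𝓝 (G.unit x)) (𝓝 x) := by
    have := G.contMDiff_tgt.continuous.tendsto (G.unit x)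
    rwa [G.tgt_unit] at this
  have hs : ∀ᶠ y in 𝓝 x, ∀ᶠ t in 𝓝 (0 : ℝ), G.src (Θ t y) = y :=
    (((Continuous.prodMk_right (0 : ℝ)).continuousAt (x := x)).eventually
      hΘ.src_eq.eventually_nhds).mono fun y hy =>
        ((Continuous.prodMk_left y).continuousAt (x := (0 : ℝ))).eventually hy
  filter_upwards [ht.eventually hΘ.zero_eq, ht.eventually hΘ.mdifferentiableAt,
    ht.eventually hΘ.velocity_eq, ht.eventually hs] with h h0 hd hv hs
  exact G.velocity_mul_eq_rightTranslation rfl hd h0 hs hv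

/-- The determinant of the transport of a frame of the Lie algebroid along the flow. -/
theorem exists_lie_det [T2Space M] (hΘ : G.IsFlowAt α.1 Θ x)
    (β : Fin G.lieAlgebroid.rank → {α // G.lieAlgebroid.IsSmooth α})
    (a : Basis (Fin G.lieAlgebroid.rank) ℝ (G.lieFiber x)) (ha : ∀ i, a i = (β i).1 x) :
    ∃ D : ℝ → ℝ, D 0 = 1 ∧
      HasDerivAt D (-(∑ i, a.coord i (G.lieAlgebroid.bracket α (β i) x))) 0 ∧
      ∀ᶠ t in 𝓝 0, ∀ b b' : Basis (Fin G.lieAlgebroid.rank) ℝ (G.lieFiber (G.tgt (Θ t x))),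
        (⇑b = fun i => ((β i).1 (G.tgt (Θ t x)) : G.lieFiber (G.tgt (Θ t x)))) →
        (∀ i, (G.rightTranslation (Θ t x) (G.tgt (Θ t x)) (b' i) : F) =
          mfderiv 𝓘(ℝ, F) 𝓘(ℝ, F) (G.bisMap (Θ t)) (G.unit x) (a i).1) → b.det b' = D t := by
  have : CompleteSpace F := FiniteDimensional.complete ℝ F
  have h1 := fun i => hasDerivAt_flow_sub hΘ.contMDiffAt_bisMap hΘ.bisMap_zero hΘ.velocity_bisMap
    ((G.contMDiff_rightInvariant (β i).2).contMDiffAt (x := G.unit x))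
  obtain ⟨c, hc⟩ := G.exists_sourceChart (G.unit x)
  obtain ⟨X, hX⟩ := exists_smooth_tangentFrame (E := E) (G.src (G.unit x))
  -- lifts of a frame of the base complete the frames of the source fibres
  let l : Fin (finrank ℝ E) → Π g, TangentSpace 𝓘(ℝ, F) g :=
    fun j g => c.horiz g ((X j).1 (G.src g))
  have hl : ∀ j, ContMDiffAt 𝓘(ℝ, F) (𝓘(ℝ, F).prod 𝓘(ℝ, F)) ∞
      (fun g => (⟨g, l j g⟩ : TangentBundle 𝓘(ℝ, F) 𝒢)) (G.unit x) := fun j =>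
    c.contMDiffAt_horiz (u := id) (n₀ := G.unit x) hc contMDiffAt_id
      (ContMDiffAt.comp (G.unit x) (g := fun x => (⟨x, (X j).1 x⟩ : TangentBundle 𝓘(ℝ, E) M))
        (X j).2.contMDiffAt G.contMDiff_src.contMDiffAt)
  let γ : ℝ → 𝒢 := fun t => G.bisMap (Θ t) (G.unit x)
  have γ0 : γ 0 = G.unit x := hΘ.bisMap_zero.self_of_nhds
  have hγ : ContMDiffAt 𝓘(ℝ, ℝ) 𝓘(ℝ, F) ∞ γ 0 :=
    ContMDiffAt.comp (g := Function.uncurry fun t h => G.bisMap (Θ t) h)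
      (f := fun t : ℝ => (t, G.unit x)) (0 : ℝ) hΘ.contMDiffAt_bisMap
      (contMDiffAt_id.prodMk contMDiffAt_const)
  have hcard : Fintype.card (Fin G.lieAlgebroid.rank) + Fintype.card (Fin (finrank ℝ E)) =
      finrank ℝ F := by
    rw [Fintype.card_fin, Fintype.card_fin]; exact G.rank_add x
  -- `w` is the frame of right-invariant fields and lifts, `u` the transport of its value at the
  -- unit along the flow, with the lifts left unchanged, so that these do not contribute to the
  -- derivative
  let w : Fin G.lieAlgebroid.rank ⊕ Fin (finrank ℝ E) → Π g, TangentSpace 𝓘(ℝ, F) g :=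
    Sum.elim (fun i => G.rightInvariant (β i).1) l
  let u : Fin G.lieAlgebroid.rank ⊕ Fin (finrank ℝ E) → Π t, TangentSpace 𝓘(ℝ, F) (γ t) :=
    Sum.elim (fun i t => mfderiv 𝓘(ℝ, F) 𝓘(ℝ, F) (G.bisMap (Θ t)) (G.unit x)
      (G.rightInvariant (β i).1 (G.unit x))) fun j t => l j (γ t)
  let d : Fin G.lieAlgebroid.rank ⊕ Fin (finrank ℝ E) → F :=
    Sum.elim (fun i => -(mlieBracket 𝓘(ℝ, F) (G.rightInvariant α.1) (G.rightInvariant (β i).1)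
      (G.unit x) : F)) fun _ => 0
  have hw : ∀ s, ContMDiffAt 𝓘(ℝ, F) (𝓘(ℝ, F).prod 𝓘(ℝ, F)) ∞
      (fun g => (⟨g, w s g⟩ : TangentBundle 𝓘(ℝ, F) 𝒢)) (G.unit x) := by
    rintro (i | j)
    · exact (G.contMDiff_rightInvariant (β i).2).contMDiffAt
    · exact hl j
  obtain ⟨f, hf⟩ := Basis.exists_adapted (R := (G.lieFiber x).subtype)
    (p := (mfderiv 𝓘(ℝ, F) 𝓘(ℝ, E) G.src (G.unit x)).toLinearMap) (fun a => a.2)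
    (Submodule.subtype_injective _) hcard a
    (tangentFrame (G.src (G.unit x))) (v := fun s => w s (G.unit x))
    (fun i => by
      rw [ha i]
      exact G.rightInvariant_unit (β i).1 x)
    (fun j => by
      rw [hX j]
      exact c.mfderiv_src_horiz hc _)
  have hw0 : ∀ s, (w s (γ 0) : F) = f s := fun s =>
    (congrArg (fun g => (w s g : F)) γ0).trans (congrFun hf s).symm
  have hu0 : ∀ s, (u s 0 : F) = f s := by
    rintro (i | j)
    · have h8 : G.bisMap (Θ 0) =ᶠ[𝓝 (G.unit x)] id := hΘ.bisMap_zero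
      refine Eq.trans ?_ (congrFun hf (Sum.inl i)).symm
      exact (congrArg (fun L : F →L[ℝ] F => L (G.rightInvariant (β i).1 (G.unit x)))
        (h8.mfderiv_eq (I := 𝓘(ℝ, F)) (I' := 𝓘(ℝ, F)))).trans
        (congrArg (fun L : F →L[ℝ] F => L (G.rightInvariant (β i).1 (G.unit x)))
          (mfderiv_id (I := 𝓘(ℝ, F)) (x := G.unit x)))
    · exact hw0 (Sum.inr j)
  obtain ⟨D, hD0, hD, hDe⟩ := exists_hasDerivAt_det γ0 (u := u) (w := fun s t => w s (γ t)) f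
    (fun s => ContMDiffAt.comp_of_eq (g := fun g => (⟨g, w s g⟩ : TangentBundle 𝓘(ℝ, F) 𝒢))
      (hw s) hγ γ0) hw0 hu0 (d := d) (by
      rintro (i | j)
      · exact h1 i
      · refine (hasDerivAt_const (0 : ℝ) (0 : F)).congr_of_eventuallyEq
          (Filter.Eventually.of_forall fun t => ?_)
        exact sub_self (tcoord F (G.unit x) (γ t) (l j (γ t)))) hγ
  refine ⟨D, hD0, hD.congr_deriv ?_, ?_⟩
  · rw [Fintype.sum_sum_type, ← Finset.sum_neg_distrib]
    have h2 : ∀ j, f.coord (Sum.inr j) (d (Sum.inr j)) = 0 := fun j => map_zero (f.coord _)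
    rw [Finset.sum_eq_zero fun j _ => h2 j, add_zero]
    refine Finset.sum_congr rfl fun i _ => ?_
    -- the bracket is tangent to the source fibre, where the coordinates with respect to `f` and
    -- `a` agree
    have h3 : ∀ v : G.lieFiber x, f.coord (Sum.inl i) v.1 = a.coord i v := by
      intro v
      have h4 : (f.coord (Sum.inl i)) ∘ₗ (G.lieFiber x).subtype = a.coord i := by
        refine a.ext fun k => ?_
        have h5 : (G.lieFiber x).subtype (a k) = f (Sum.inl k) := by
          rw [congrFun hf (Sum.inl k), ha k]
          exact (G.rightInvariant_unit (β k).1 x).symm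
        rw [LinearMap.comp_apply, h5, Basis.coord_apply, Basis.coord_apply, f.repr_self, a.repr_self]
        simp [Finsupp.single_apply]
      exact congrArg (fun L : G.lieFiber x →ₗ[ℝ] ℝ => L v) h4
    refine (map_neg (f.coord (Sum.inl i)) _).trans (congrArg Neg.neg ?_)
    refine Eq.trans ?_ (h3 _)
    exact congrArg (f.coord (Sum.inl i)) (G.lieAlgebroid_bracket α (β i) x).symm
  · have hmap : Filter.Tendsto γ (𝓝 0) (𝓝 (G.unit x)) := by
      have := hγ.continuousAt.tendsto
      rwa [γ0] at this
    have hsm : Filter.Tendsto (fun t => G.src (γ t)) (𝓝 0) (𝓝 (G.src (G.unit x))) :=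
      (G.contMDiff_src.continuous.tendsto _).comp hmap
    filter_upwards [hDe, hmap.eventually (c.chart.open_source.mem_nhds hc),
      hsm.eventually (eventually_tangent_frame X _ hX), hΘ.isBisectionAt] with t hDt hct ⟨e, he⟩ hβ
      b b' hb hb'
    have hg : γ t = Θ t x := hβ.bisMap_unit
    have hy : G.tgt (Θ t x) = G.tgt (γ t) := congrArg G.tgt hg.symm
    have hlift : ∀ j, (mfderiv 𝓘(ℝ, F) 𝓘(ℝ, E) G.src (γ t)).toLinearMap (l j (γ t)) = e j := by
      intro j
      rw [he]
      exact c.mfderiv_src_horiz hct _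
    have hwl : ∀ i, w (Sum.inl i) (γ t) = G.rightTranslationₗ (γ t) (G.tgt (Θ t x)) (b i) := by
      intro i
      rw [hb]
      have : ∀ y, y = G.tgt (γ t) → (G.rightInvariant (β i).1 (γ t) : F) =
          G.rightTranslation (γ t) y ((β i).1 y) := by
        rintro y rfl; rfl
      exact this _ hy
    have hul : ∀ i, u (Sum.inl i) t = G.rightTranslationₗ (γ t) (G.tgt (Θ t x)) (b' i) := by
      intro i
      refine Eq.trans ?_ (G.rightTranslation_congr hg (G.tgt (Θ t x)) (b' i)).symm
      refine Eq.trans ?_ (hb' i).symm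
      refine congrArg (fun v : F => (mfderiv 𝓘(ℝ, F) 𝓘(ℝ, F) (G.bisMap (Θ t)) (G.unit x) :
        F →L[ℝ] F) v) ?_
      exact (G.rightInvariant_unit (β i).1 x).trans (congrArg Subtype.val (ha i).symm)
    obtain ⟨b₁, hb₁⟩ := Basis.exists_adapted (R := G.rightTranslationₗ (γ t) (G.tgt (Θ t x)))
      (p := (mfderiv 𝓘(ℝ, F) 𝓘(ℝ, E) G.src (γ t)).toLinearMap)
      (fun a => G.mfderiv_src_rightTranslation hy a) (G.rightTranslation_injective hy) hcard
      b e (v := fun s => w s (γ t)) hwl hlift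
    obtain ⟨b₂, hb₂⟩ := Basis.exists_adapted (R := G.rightTranslationₗ (γ t) (G.tgt (Θ t x)))
      (p := (mfderiv 𝓘(ℝ, F) 𝓘(ℝ, E) G.src (γ t)).toLinearMap)
      (fun a => G.mfderiv_src_rightTranslation hy a) (G.rightTranslation_injective hy) hcard
      b' e (v := fun s => u s t) hul hlift
    have h3 := Basis.det_adapted (R := G.rightTranslationₗ (γ t) (G.tgt (Θ t x)))
      (p := (mfderiv 𝓘(ℝ, F) 𝓘(ℝ, E) G.src (γ t)).toLinearMap)
      (fun a => G.mfderiv_src_rightTranslation hy a)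
      (a := b) (a₁ := b') (e := e) (e₁ := e) (b := b₁) (b₁ := b₂)
      (fun i => (congrFun hb₁ _).trans (hwl i)) (fun j => by rw [hb₁]; exact hlift j)
      (fun i => (congrFun hb₂ _).trans (hul i)) (fun j => by rw [hb₂]; exact hlift j)
    rw [e.det_self, mul_one] at h3
    rw [← h3, ← hDt b₁ hb₁, hb₂]

end IsFlowAt

end LieGroupoid

end InfinitesimalModular

/-! ### The modular class of the Lie algebroid -/

noncomputable section AlgebroidModularClass

universe u v w z

variable {E : Type u} [NormedAddCommGroup E] [NormedSpace ℝ E] [FiniteDimensional ℝ E]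
  {M : Type v} [TopologicalSpace M] [ChartedSpace E M] [IsManifold 𝓘(ℝ, E) ∞ M]
  {F : Type w} [NormedAddCommGroup F] [NormedSpace ℝ F] [FiniteDimensional ℝ F]
  {𝒢 : Type z} [TopologicalSpace 𝒢] [ChartedSpace F 𝒢] [IsManifold 𝓘(ℝ, F) ∞ 𝒢]

namespace LieGroupoid

variable (G : LieGroupoid E M F 𝒢)

theorem cocycle_unit (c : G.Z1) (x : M) : c.1 (G.unit x) = 0 := by
  have h1 := c.2.2 (G.unit x) (G.unit x) (by rw [G.src_unit, G.tgt_unit])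
  have h2 : G.mul (G.unit x) (G.unit x) = G.unit x := by
    have := G.unit_mul (G.unit x)
    rwa [G.tgt_unit] at this
  rw [h2] at h1
  linarith

/-- The infinitesimal action of the Lie algebroid on a transverse density is the derivative at the
units of the action of the arrows. -/
theorem isNabla_of_scales [T2Space M] {σ : Π x, G.lieAlgebroid.Dtr x}
    (hσ : G.lieAlgebroid.IsSmoothDtr σ) (c : G.Z1)
    (hc : ∀ x, ∀ᶠ g in 𝓝 (G.unit x), G.Scales σ g (Real.exp (-c.1 g)))
    (α : {α // G.lieAlgebroid.IsSmooth α}) :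
    G.lieAlgebroid.IsNabla α σ fun x => (G.vanEstForm c).1 x (α.1 x) • σ x := by
  intro β X x a e ha he
  obtain ⟨Θ, hΘ⟩ := G.exists_isFlowAt α x
  obtain ⟨DX, hX0, hX, hXe⟩ := hΘ.exists_tangent_det X e he
  obtain ⟨DA, hA0, hA, hAe⟩ := hΘ.exists_lie_det β a ha
  have hP := hσ β X x a e ha he
  set P : M → ℝ := fun y => (σ y).evalTuple (fun i => (β i).1 y) (fun j => (X j).1 y) with hP_def
  have hPx : P x = TransverseDensity.eval a e (σ x) :=
    TransverseDensity.evalTuple_eq a e (funext ha) (funext he) (σ x)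
  have hΘ0 : Θ 0 x = G.unit x := hΘ.zero_eq.self_of_nhds
  have hy0 : G.tgt (Θ 0 x) = x := hΘ.tgt_zero.self_of_nhds
  have hlim : Filter.Tendsto (fun t => Θ t x) (𝓝 0) (𝓝 (G.unit x)) := by
    have := hΘ.contMDiffAt_curve.continuousAt.tendsto
    rwa [hΘ0] at this
  have hylim : Filter.Tendsto (fun t => G.tgt (Θ t x)) (𝓝 0) (𝓝 x) := by
    have := hΘ.contMDiffAt_tgt_curve.continuousAt.tendsto
    rwa [hy0] at this
  -- the action of the arrow `Θ t x`, evaluated on the given frames; the equation that defines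
  -- the infinitesimal action is its derivative at `t = 0`
  have key : ∀ᶠ t in 𝓝 (0 : ℝ), Real.exp (-c.1 (Θ t x)) * (DX t * P (G.tgt (Θ t x))) =
      DA t * P x := by
    have hXp : ∀ᶠ t in 𝓝 0, 0 < DX t :=
      hX.continuousAt.eventually (lt_mem_nhds (hX0 ▸ one_pos))
    have hAp : ∀ᶠ t in 𝓝 0, 0 < DA t :=
      hA.continuousAt.eventually (lt_mem_nhds (hA0 ▸ one_pos))
    filter_upwards [hXe, hAe, hXp, hAp, hlim.eventually (hc x), hΘ.isBisectionAt,
      hylim.eventually (G.eventually_lie_frame β a ha),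
      hylim.eventually (eventually_tangent_frame X e he)] with t hXt hAt hXp hAp hs hβ
      ⟨b, hb⟩ ⟨f, hf⟩
    obtain ⟨a', e', ha', he'⟩ := hβ.exists_frames a e
    have h1 := (hβ.scales_iff rfl ha' he').1 hs
    have h2 := TransverseDensity.eval_mul_abs_det b a' f e' (σ (G.tgt (Θ t x)))
    have h3 : f.det e' = DX t := by
      rw [← hXt f hf]
      congr 1
      exact funext he'
    have h4 : TransverseDensity.eval b f (σ (G.tgt (Θ t x))) = P (G.tgt (Θ t x)) :=
      (TransverseDensity.evalTuple_eq b f hb hf _).symm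
    rw [hAt b a' hb ha', h3, h4, abs_of_pos hXp, abs_of_pos hAp] at h2
    have h5 := h1.trans hPx.symm
    rw [← h5, ← h2]
    ring
  have hcd : HasDerivAt (fun t => c.1 (Θ t x)) ((G.vanEstForm c).1 x (α.1 x)) 0 := by
    have h1 := hasDerivAt_velocity hΘ0 hΘ.contMDiffAt_curve.mdiffAt_of_infty
      (c.2.1.contMDiffAt (x := G.unit x)).mdiffAt_of_infty
    refine h1.congr_deriv ?_
    exact congrArg (fun v : F => mvfderiv 𝓘(ℝ, F) c.1 (G.unit x) v) hΘ.velocity_eq.self_of_nhds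
  have hPd : HasDerivAt (fun t => P (G.tgt (Θ t x)))
      (mvfderiv 𝓘(ℝ, E) P x (G.lieAlgebroid.anchor x (α.1 x))) 0 := by
    have h1 := hasDerivAt_velocity hy0 hΘ.contMDiffAt_tgt_curve.mdiffAt_of_infty hP.mdiffAt_of_infty
    refine h1.congr_deriv ?_
    exact congrArg (fun v : E => mvfderiv 𝓘(ℝ, E) P x v) hΘ.velocity_tgt.self_of_nhds
  have h5 := (hcd.neg.exp.mul (hX.mul hPd)).unique ((hA.mul_const (P x)).congr_of_eventuallyEq key)
  have h6 : c.1 (Θ 0 x) = 0 := by rw [hΘ0, G.cocycle_unit]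
  simp only [Pi.neg_apply, Pi.mul_apply] at h5
  rw [h6, hX0, hy0, neg_zero, Real.exp_zero] at h5
  have h7 : TransverseDensity.eval a e ((G.vanEstForm c).1 x (α.1 x) • σ x) =
      (G.vanEstForm c).1 x (α.1 x) * P x := by
    rw [hPx]
    exact (TransverseDensity.eval a e).map_smul _ _
  refine h7.trans ?_
  rw [← hPx]
  have aux : ∀ θ p X A p' : ℝ, 1 * -θ * (1 * p) + 1 * (-X * p + 1 * p') = -A * p →
      θ * p = p' + (A - X) * p := fun θ p X A p' h => by linear_combination (-1 : ℝ) * h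
  exact aux _ _ _ _ _ h5

/-- A nowhere vanishing density, of any sign, is scaled by a representative of the modular class, at
least by the arrows near the units. -/
theorem exists_cocycle_of_ne_zero [T2Space M] [SecondCountableTopology M]
    {σ : Π x, G.lieAlgebroid.Dtr x} (hσ : G.lieAlgebroid.IsSmoothDtr σ) (h0 : ∀ x, σ x ≠ 0) :
    ∃ c : G.Z1, (∀ x, ∀ᶠ g in 𝓝 (G.unit x), G.Scales σ g (Real.exp (-c.1 g))) ∧
      G.mkH1 c = G.modularClass := by
  obtain ⟨⟨τ, hτ, hpos⟩, hm⟩ := G.isModularClass_modularClass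
  obtain ⟨c, hc, hcm⟩ := hm τ hτ hpos
  obtain ⟨f, hf, hfσ⟩ := G.exists_smooth_ratio hτ (G.ne_zero_of_isPositive hpos) hσ
  have hf0 : ∀ x, f x ≠ 0 := fun x hx => h0 x (by
    rw [hfσ x, hx]
    exact zero_smul ℝ (τ x))
  obtain rfl : σ = fun x => f x • τ x := funext hfσ
  have hlog : ContMDiff 𝓘(ℝ, E) 𝓘(ℝ, ℝ) ∞ fun x => Real.log (f x) := fun x =>
    ContMDiffAt.comp (g := Real.log) x (Real.contDiffAt_log.2 (hf0 x)).contMDiffAt (hf x)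
  let d : G.Z1 := ⟨fun g => Real.log (f (G.src g)) - Real.log (f (G.tgt g)),
    (hlog.comp G.contMDiff_src).sub (hlog.comp G.contMDiff_tgt), fun g h hgh => by
      simp only [G.src_mul g h hgh, G.tgt_mul g h hgh, hgh]
      ring⟩
  have hd : G.mkH1 d = 0 := (Submodule.Quotient.mk_eq_zero _).2 ⟨_, hlog, fun g => rfl⟩
  refine ⟨c - d, fun x => ?_, by rw [map_sub, hd, sub_zero, hcm]⟩
  -- `f` may have different signs at the two ends of an arrow, but not near a unit; away from
  -- the units `Real.log` is the logarithm of the absolute value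
  have h1 : ∀ᶠ g in 𝓝 (G.unit x), 0 < f (G.src g) / f (G.tgt g) := by
    have h2 : ContinuousAt (fun g => f (G.src g) / f (G.tgt g)) (G.unit x) :=
      ((hf.continuous.comp G.contMDiff_src.continuous).continuousAt).div
        ((hf.continuous.comp G.contMDiff_tgt.continuous).continuousAt) (hf0 _)
    refine h2.eventually (lt_mem_nhds ?_)
    change 0 < f (G.src (G.unit x)) / f (G.tgt (G.unit x))
    rw [G.src_unit, G.tgt_unit, div_self (hf0 x)]
    exact one_pos
  filter_upwards [h1] with g hg
  have h3 := Scales.smul (show G.Scales τ g _ from hc g) f (hf0 _)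
  have h4 : Real.exp (-(c - d).1 g) = f (G.src g) * Real.exp (-c.1 g) / f (G.tgt g) := by
    have h5 : -(c - d).1 g = -c.1 g + (Real.log (f (G.src g)) - Real.log (f (G.tgt g))) := by
      change -(c.1 g - (Real.log (f (G.src g)) - Real.log (f (G.tgt g)))) = _
      ring
    rw [h5, ← Real.log_div (hf0 _) (hf0 _), Real.exp_add, Real.exp_log hg]
    ring
  rw [h4]
  exact h3

/-- The image of the modular class of `G` under the Van Est map satisfies the definition of the
modular class of the Lie algebroid. -/
theorem lieAlgebroid_isModularClass [T2Space M] [SecondCountableTopology M] :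
    G.lieAlgebroid.IsModularClass (G.vanEst G.modularClass) := by
  obtain ⟨σ, hσ, hpos⟩ := G.exists_positive_density
  refine ⟨⟨σ, hσ, G.ne_zero_of_isPositive hpos⟩, fun σ hσ h0 => ?_⟩
  obtain ⟨c, hc, hcm⟩ := G.exists_cocycle_of_ne_zero hσ h0
  exact ⟨G.vanEstForm c, G.isNabla_of_scales hσ c hc, by rw [← hcm, G.vanEst_mkH1]⟩

end LieGroupoid

namespace AlgebroidData

/-- The characteristic class of the representation on the transverse density bundle is unique, if
there are smooth frames through every point. -/
theorem IsModularClass.unique {D : AlgebroidData E M} [T2Space M]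
    (hA : ∀ x, ∃ (β : Fin D.rank → {α // D.IsSmooth α}) (a : Basis (Fin D.rank) ℝ (D.Fiber x)),
      ∀ i, a i = (β i).1 x)
    (hs : ∀ x (v : D.Fiber x), ∃ α : {α // D.IsSmooth α}, α.1 x = v)
    {m m' : D.H1} (hm : D.IsModularClass m) (hm' : D.IsModularClass m') : m = m' := by
  obtain ⟨⟨σ, hσ, h0⟩, h1⟩ := hm
  obtain ⟨c, hc, rfl⟩ := h1 σ hσ h0
  obtain ⟨c', hc', rfl⟩ := hm'.2 σ hσ h0
  have : c = c' := by
    refine Subtype.ext (funext fun x => LinearMap.ext fun v => ?_)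
    obtain ⟨α, rfl⟩ := hs x v
    obtain ⟨β, a, ha⟩ := hA x
    obtain ⟨X, hX⟩ := LieGroupoid.exists_smooth_tangentFrame (E := E) x
    have h2 := (hc α β X x a _ ha hX).trans (hc' α β X x a _ ha hX).symm
    rw [map_smul, map_smul] at h2
    exact smul_left_injective ℝ (TransverseDensity.eval_ne_zero (h0 x)) h2
  rw [this]

theorem IsModularClass.isModularClass_modularClass {D : AlgebroidData E M} {m : D.H1}
    (hm : D.IsModularClass m) : D.IsModularClass D.modularClass := by
  have h : ∃ m, D.IsModularClass m := ⟨m, hm⟩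
  rw [modularClass, dif_pos h]
  exact h.choose_spec

end AlgebroidData

namespace LieGroupoid

variable (G : LieGroupoid E M F 𝒢)

theorem vanEst_modularClass [T2Space M] [SecondCountableTopology M] :
    G.vanEst G.modularClass = G.lieAlgebroid.modularClass :=
  G.lieAlgebroid_isModularClass.unique
    (fun x => (G.exists_smooth_frame x).imp fun _ hα => ⟨G.lieFrame x, hα⟩)
    (fun x v => G.exists_smooth_section x v)
    G.lieAlgebroid_isModularClass.isModularClass_modularClass

end LieGroupoid

end AlgebroidModularClass

/-! ### Invariance under isomorphisms of Lie algebroids -/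

noncomputable section Isomorphisms

universe u v w w' z

namespace TransverseDensity

variable {r r' n : ℕ} {A A' T : Type*} [AddCommGroup A] [Module ℝ A] [AddCommGroup A']
  [Module ℝ A'] [AddCommGroup T] [Module ℝ T]

/-- The transport of frames along a linear isomorphism. -/
def mapFrame (hr : r = r') (φ : A ≃ₗ[ℝ] A') (a : Basis (Fin r) ℝ A) : Basis (Fin r') ℝ A' :=
  (a.map φ).reindex (finCongr hr)

theorem mapFrame_apply (hr : r = r') (φ : A ≃ₗ[ℝ] A') (a : Basis (Fin r) ℝ A) (i : Fin r') :
    mapFrame hr φ a i = φ (a (finCongr hr.symm i)) := by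
  subst hr
  simp [mapFrame]

theorem mapFrame_symm_mapFrame (hr : r = r') (φ : A ≃ₗ[ℝ] A') (a : Basis (Fin r') ℝ A') :
    mapFrame hr φ (mapFrame hr.symm φ.symm a) = a := by
  subst hr
  ext i
  simp [mapFrame]

theorem mapFrame_coord (hr : r = r') (φ : A ≃ₗ[ℝ] A') (a : Basis (Fin r) ℝ A) (i : Fin r) (v : A) :
    (mapFrame hr φ a).coord (finCongr hr i) (φ v) = a.coord i v := by
  subst hr
  simp [mapFrame]

/-- Transverse densities are transported along linear isomorphisms. -/
theorem exists_transport (hr : r = r') (φ : A ≃ₗ[ℝ] A') (a₀ : Basis (Fin r) ℝ A)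
    (e₀ : Basis (Fin n) ℝ T) (τ : TransverseDensity r n A T) :
    ∃ τ' : TransverseDensity r' n A' T, ∀ a e, eval (mapFrame hr φ a) e τ' = eval a e τ := by
  subst hr
  refine ⟨eval a₀ e₀ τ • ofFrames (mapFrame rfl φ a₀) e₀, fun a e => ?_⟩
  have h1 := eval_mul_abs_det a₀ a e₀ e τ
  have h2 := eval_mul_abs_det (mapFrame rfl φ a₀) (mapFrame rfl φ a) e₀ e
    (ofFrames (mapFrame rfl φ a₀) e₀)
  have h3 : (mapFrame rfl φ a₀).det (mapFrame rfl φ a) = a₀.det a := by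
    have : mapFrame rfl φ a₀ = a₀.map φ := by ext i; simp [mapFrame]
    rw [this, Basis.det_map]
    congr 1
    funext i
    simp [mapFrame]
  rw [h3, eval_ofFrames, mul_one] at h2
  rw [map_smul, smul_eq_mul]
  refine mul_right_cancel₀ (abs_ne_zero.2 (a₀.det_ne_zero' a)) ?_
  rw [h1, mul_assoc, h2, mul_comm]

theorem evalTuple_transport (hr : r = r') (φ : A ≃ₗ[ℝ] A') {τ : TransverseDensity r n A T}
    {τ' : TransverseDensity r' n A' T} (h : ∀ a e, eval (mapFrame hr φ a) e τ' = eval a e τ)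
    (v : Fin r → A) (w : Fin n → T) :
    evalTuple (fun i => φ (v (finCongr hr.symm i))) w τ' = evalTuple v w τ := by
  by_cases hvw : (∃ b : Basis (Fin r) ℝ A, ⇑b = v) ∧ ∃ c : Basis (Fin n) ℝ T, ⇑c = w
  · obtain ⟨⟨a, ha⟩, e, he⟩ := hvw
    rw [evalTuple_eq a e ha he, ← h, evalTuple_eq (mapFrame hr φ a) e ?_ he]
    funext i
    rw [mapFrame_apply, ha]
  · have hvw' : ¬((∃ b : Basis (Fin r') ℝ A', ⇑b = fun i => φ (v (finCongr hr.symm i))) ∧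
        ∃ c : Basis (Fin n) ℝ T, ⇑c = w) := by
      rintro ⟨⟨b, hb⟩, hc⟩
      refine hvw ⟨⟨mapFrame hr.symm φ.symm b, ?_⟩, hc⟩
      funext i
      rw [mapFrame_apply, hb]
      simp
    unfold evalTuple
    rw [dif_neg hvw, dif_neg hvw']

end TransverseDensity

namespace AlgebroidData

variable {E : Type u} [NormedAddCommGroup E] [NormedSpace ℝ E] [FiniteDimensional ℝ E]
  {M : Type v} [TopologicalSpace M] [ChartedSpace E M] [IsManifold 𝓘(ℝ, E) ∞ M]
  {D : AlgebroidData.{u, v, w} E M} {D' : AlgebroidData.{u, v, w'} E M}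

open TransverseDensity

/-- The vanishing of the modular class is invariant under isomorphisms: nowhere vanishing sections of
the two transverse density bundles correspond to each other, with the corresponding forms. -/
theorem IsModularClass.zero_of_iso (Φ : D.Iso D') (hr : D.rank = D'.rank)
    (hA : ∀ x, Nonempty (Basis (Fin D.rank) ℝ (D.Fiber x))) (h : D'.IsModularClass 0) :
    D.IsModularClass 0 := by
  have hsymm : ∀ α' : {α // D'.IsSmooth α}, D.IsSmooth fun x => (Φ.toEquiv x).symm (α'.1 x) :=
    fun α' => (Φ.smooth_iff _).2 (by simpa only [LinearEquiv.apply_symm_apply] using α'.2)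
  let T : {α // D.IsSmooth α} → {α // D'.IsSmooth α} := fun α => ⟨_, (Φ.smooth_iff α.1).1 α.2⟩
  obtain ⟨⟨σ', hσ', h0'⟩, hm⟩ := h
  have hne : ∀ {x : M} {τ : D.Dtr x} {τ' : D'.Dtr x},
      (∀ a e, eval (mapFrame hr (Φ.toEquiv x) a) e τ' = eval a e τ) → (τ ≠ 0 ↔ τ' ≠ 0) := by
    intro x τ τ' hτ
    obtain ⟨a⟩ := hA x
    have h1 := hτ a (LieGroupoid.tangentFrame x)
    refine not_congr ⟨fun h0 => ?_, fun h0 => ?_⟩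
    · refine eval_injective (mapFrame hr (Φ.toEquiv x) a) (LieGroupoid.tangentFrame x) ?_
      rw [h1, h0, map_zero, map_zero]
    · refine eval_injective a (LieGroupoid.tangentFrame x) ?_
      rw [← h1, h0, map_zero, map_zero]
  constructor
  · choose σ hσ using fun x => exists_transport hr.symm (Φ.toEquiv x).symm
      (mapFrame hr (Φ.toEquiv x) (hA x).some) (LieGroupoid.tangentFrame x) (σ' x)
    -- `σ` is the transport of `σ'` along the inverse of the isomorphism
    have hev : ∀ x a e, eval (mapFrame hr (Φ.toEquiv x) a) e (σ' x) = eval a e (σ x) := by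
      intro x a e
      rw [← hσ]
      congr 2
      exact mapFrame_symm_mapFrame hr.symm (Φ.toEquiv x).symm a
    refine ⟨σ, fun α X x b c hb hc => ?_, fun x => (hne (hev x)).2 (h0' x)⟩
    refine (hσ' (fun i => T (α (finCongr hr.symm i))) X x (mapFrame hr (Φ.toEquiv x) b) c
      (fun i => ?_) hc).congr_of_eventuallyEq (Filter.Eventually.of_forall fun y => ?_)
    · rw [mapFrame_apply, hb]
    · exact (evalTuple_transport hr (Φ.toEquiv y) (hev y) (fun i => (α i).1 y) _).symm
  · intro σ hσ h0
    -- the form of the transported density `σ'`, pulled back along the isomorphism, is the form of `σ`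
    choose σ' hev using fun x => exists_transport hr (Φ.toEquiv x) (hA x).some
      (LieGroupoid.tangentFrame x) (σ x)
    obtain ⟨c', hc', hc'0⟩ := hm σ' (fun α' X x b' c hb' hc => by
      refine (hσ (fun i => ⟨_, hsymm (α' (finCongr hr i))⟩) X x
        (mapFrame hr.symm (Φ.toEquiv x).symm b') c (fun i => ?_) hc).congr_of_eventuallyEq
        (Filter.Eventually.of_forall fun y => ?_)
      · rw [mapFrame_apply, hb']
      · refine Eq.trans ?_ (evalTuple_transport hr (Φ.toEquiv y) (hev y)
          (fun i => (Φ.toEquiv y).symm ((α' (finCongr hr i)).1 y)) _)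
        refine congrArg (fun v => evalTuple v (fun j => (X j).1 y) (σ' y)) (funext fun i => ?_)
        rw [LinearEquiv.apply_symm_apply]
        rfl) fun x => (hne (hev x)).1 (h0 x)
    refine ⟨⟨fun x => c'.1 x ∘ₗ (Φ.toEquiv x).toLinearMap, fun α hα => c'.2.1 _ (T ⟨α, hα⟩).2,
      fun α β x => ?_⟩, fun α β X x b c hb hc => ?_, ?_⟩
    · have h1 := c'.2.2 (T α) (T β) x
      rw [← Φ.bracket_eq α β x] at h1
      refine h1.trans ?_
      rw [Φ.anchor_eq, Φ.anchor_eq]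
      rfl
    · have h1 := hc' (T α) (fun i => T (β (finCongr hr.symm i))) X x (mapFrame hr (Φ.toEquiv x) b) c
        (fun i => by rw [mapFrame_apply, hb]) hc
      have h2 : (fun y => (σ' y).evalTuple (fun i => (T (β (finCongr hr.symm i))).1 y)
          fun j => (X j).1 y) = fun y => (σ y).evalTuple (fun i => (β i).1 y) fun j => (X j).1 y :=
        funext fun y => evalTuple_transport hr (Φ.toEquiv y) (hev y) (fun i => (β i).1 y) _
      have h3 : (fun y => D'.anchor y ((T α).1 y)) = fun y => D.anchor y (α.1 y) :=
        funext fun y => Φ.anchor_eq y (α.1 y)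
      have h4 : ∑ i, (mapFrame hr (Φ.toEquiv x) b).coord i
          (D'.bracket (T α) (T (β (finCongr hr.symm i))) x) =
          ∑ i, b.coord i (D.bracket α (β i) x) := by
        refine (Fintype.sum_equiv (finCongr hr) _ _ fun i => ?_).symm
        rw [← mapFrame_coord hr (Φ.toEquiv x) b i, Φ.bracket_eq]
        rfl
      rw [h2, h3, h4, map_smul, hev] at h1
      rw [map_smul]
      refine h1.trans ?_
      rw [show D'.anchor x ((T α).1 x) = D.anchor x (α.1 x) from Φ.anchor_eq x (α.1 x)]
    · obtain ⟨f, hf, hfc⟩ := (Submodule.Quotient.mk_eq_zero _).1 hc'0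
      refine (Submodule.Quotient.mk_eq_zero _).2 ⟨f, hf, fun x a => ?_⟩
      exact (hfc x (Φ.toEquiv x a)).trans (by rw [Φ.anchor_eq])

/-- A Lie algebroid over the empty manifold is unimodular. -/
theorem isModularClass_zero_of_isEmpty [IsEmpty M] : D.IsModularClass 0 :=
  ⟨⟨fun x => isEmptyElim x, fun _ _ x => isEmptyElim x, fun x => isEmptyElim x⟩, fun _ _ _ =>
    ⟨0, fun _ _ _ x => isEmptyElim x, map_zero _⟩⟩

end AlgebroidData

namespace LieGroupoid

variable {E : Type u} [NormedAddCommGroup E] [NormedSpace ℝ E] [FiniteDimensional ℝ E]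
  {M : Type v} [TopologicalSpace M] [ChartedSpace E M] [IsManifold 𝓘(ℝ, E) ∞ M]
  {F : Type w} [NormedAddCommGroup F] [NormedSpace ℝ F] [FiniteDimensional ℝ F]
  {𝒢 : Type z} [TopologicalSpace 𝒢] [ChartedSpace F 𝒢] [IsManifold 𝓘(ℝ, F) ∞ 𝒢]
  (G : LieGroupoid E M F 𝒢)

open TransverseDensity

/-- The modular class of a Lie algebroid that is integrated by a unimodular Lie groupoid vanishes. -/
theorem IsUnimodular.modularClass_eq_zero [T2Space M] [SecondCountableTopology M]
    (hG : G.IsUnimodular) {D : AlgebroidData.{u, v, w'} E M}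
    (hr : ∀ x, finrank ℝ (D.Fiber x) = D.rank) (hD : G.Integrates D) :
    D.IsModularClass D.modularClass ∧ D.modularClass = 0 := by
  obtain ⟨Φ⟩ := hD
  have h0 : G.lieAlgebroid.IsModularClass 0 := by
    have := G.lieAlgebroid_isModularClass
    rwa [show G.modularClass = 0 from hG, map_zero] at this
  have hrank : ∀ x : M, D.rank = G.lieAlgebroid.rank := fun x => by
    rw [← hr x, ← G.finrank_lieFiber x]
    exact (Φ.toEquiv x).finrank_eq
  have hsymm : ∀ α' : {α // G.lieAlgebroid.IsSmooth α},
      D.IsSmooth fun x => (Φ.toEquiv x).symm (α'.1 x) :=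
    fun α' => (Φ.smooth_iff _).2 (by simpa only [LinearEquiv.apply_symm_apply] using α'.2)
  have hfr : ∀ x, ∃ (β : Fin D.rank → {α // D.IsSmooth α}) (a : Basis (Fin D.rank) ℝ (D.Fiber x)),
      ∀ i, a i = (β i).1 x := by
    intro x
    obtain ⟨α, hα⟩ := G.exists_smooth_frame x
    refine ⟨fun i => ⟨_, hsymm (α (finCongr (hrank x) i))⟩,
      mapFrame (hrank x).symm (Φ.toEquiv x).symm (G.lieFrame x), fun i => ?_⟩
    exact (mapFrame_apply _ _ _ i).trans (congrArg (Φ.toEquiv x).symm (hα _))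
  have hz : D.IsModularClass 0 := by
    rcases isEmpty_or_nonempty M with hM | ⟨⟨x⟩⟩
    · exact AlgebroidData.isModularClass_zero_of_isEmpty
    · exact AlgebroidData.IsModularClass.zero_of_iso Φ (hrank x)
        (fun x => ⟨(hfr x).choose_spec.choose⟩) h0
  refine ⟨hz.isModularClass_modularClass, hz.isModularClass_modularClass.unique hfr ?_ hz⟩
  intro x v
  obtain ⟨α, hα⟩ := G.exists_smooth_section x (Φ.toEquiv x v)
  refine ⟨⟨_, hsymm α⟩, ?_⟩
  refine (congrArg (Φ.toEquiv x).symm hα).trans ((Φ.toEquiv x).symm_apply_apply v)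

end LieGroupoid

theorem LieAlgebroid.finrank_fiber {E : Type*} {M : Type*} [NormedAddCommGroup E]
    [NormedSpace ℝ E] [TopologicalSpace M]
    [ChartedSpace E M] [IsManifold 𝓘(ℝ, E) ∞ M] {F' : Type*}
    [NormedAddCommGroup F'] [NormedSpace ℝ F'] {A : M → Type*}
    [TopologicalSpace (Bundle.TotalSpace F' A)]
    [∀ x, TopologicalSpace (A x)] [∀ x, AddCommGroup (A x)] [∀ x, Module ℝ (A x)]
    [FiberBundle F' A] [VectorBundle ℝ F' A] [ContMDiffVectorBundle ∞ F' A 𝓘(ℝ, E)]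
    (L : LieAlgebroid E M F' A) (x : M) : finrank ℝ (L.toData.Fiber x) = L.toData.rank :=
  ((trivializationAt F' A x).linearEquivAt ℝ x
    (FiberBundle.mem_baseSet_trivializationAt F' A x)).finrank_eq

end Isomorphisms

/-! ### Integrals over the source fibres -/

noncomputable section FibreIntegrals

universe u v w z

variable {E : Type u} [NormedAddCommGroup E] [NormedSpace ℝ E]
  {M : Type v} [TopologicalSpace M] [ChartedSpace E M] [IsManifold 𝓘(ℝ, E) ∞ M]
  {F : Type w} [NormedAddCommGroup F] [NormedSpace ℝ F] [FiniteDimensional ℝ F]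
  {𝒢 : Type z} [TopologicalSpace 𝒢] [ChartedSpace F 𝒢] [IsManifold 𝓘(ℝ, F) ∞ 𝒢]

namespace LieGroupoid.SourceChart

variable {G : LieGroupoid E M F 𝒢} (e : G.SourceChart)

/-- The Jacobian of the right-invariant vector fields of `α` in the fibre coordinates. -/
def jac (α : Fin G.lieAlgebroid.rank → Π x, G.lieFiber x) (g : 𝒢) : ℝ :=
  (Pi.basisFun ℝ (Fin G.lieAlgebroid.rank)).det fun i => e.dfib g (G.rightInvariant (α i) g)

theorem contMDiffAt_jac {α : Fin G.lieAlgebroid.rank → Π x, G.lieFiber x}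
    (hα : ∀ i, G.lieAlgebroid.IsSmooth (α i)) {g : 𝒢} (hg : g ∈ e.chart.source) :
    ContMDiffAt 𝓘(ℝ, F) 𝓘(ℝ, ℝ) ∞ (e.jac α) g := by
  have h1 : ContMDiffAt 𝓘(ℝ, F) 𝓘(ℝ, Fin G.lieAlgebroid.rank → Fin G.lieAlgebroid.rank → ℝ) ∞
      (fun g i => e.dfib g (G.rightInvariant (α i) g)) g :=
    contMDiffAt_pi_space.2 fun i =>
      contMDiffAt_mfderiv_vectorSpace (e.contMDiffAt_fib hg) (G.contMDiff_rightInvariant (hα i) g)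
  exact (Pi.basisFun ℝ (Fin G.lieAlgebroid.rank)).detCLM.contDiff.contMDiff.contMDiffAt.comp g h1

/-- Over the points at which `α` is a frame the Jacobian does not vanish. -/
theorem jac_ne_zero {α : Fin G.lieAlgebroid.rank → Π x, G.lieFiber x} {g : 𝒢}
    (hg : g ∈ e.chart.source) (hα : LinearIndependent ℝ fun i => α i (G.tgt g)) :
    e.jac α g ≠ 0 := by
  let L : G.lieFiber (G.tgt g) →ₗ[ℝ] (Fin G.lieAlgebroid.rank → ℝ) :=
    (e.dfib g).toLinearMap ∘ₗ G.rightTranslationₗ g (G.tgt g)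
  have hL : LinearMap.ker L = ⊥ := by
    refine LinearMap.ker_eq_bot.2 fun v w hvw => G.rightTranslation_injective rfl ?_
    exact e.eq_of_dsrc_dfib hg ((G.mfderiv_src_rightTranslation rfl v).trans
      (G.mfderiv_src_rightTranslation rfl w).symm) hvw
  have h1 := hα.map' L hL
  exact (Basis.is_basis_iff_det (Pi.basisFun ℝ (Fin G.lieAlgebroid.rank))).1
    ⟨h1, h1.span_eq_top_of_card_eq_finrank' (by simp)⟩ |>.ne_zero

/-- Right translation by the inverse of `h`, from the source fibre of `h` to the one over `tgt h`,
in source charts. -/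
def transition (e₁ e₂ : G.SourceChart) (h : 𝒢) (z : Fin G.lieAlgebroid.rank → ℝ) :
    Fin G.lieAlgebroid.rank → ℝ :=
  e₂.fib (G.mul (e₁.arrow (G.src h) z) (G.inv h))

variable {e₁ e₂ : G.SourceChart} {h : 𝒢}

theorem contMDiffAt_arrow_mul_inv {z : Fin G.lieAlgebroid.rank → ℝ}
    (h1 : (G.src h, z) ∈ e₁.chart.target) :
    ContMDiffAt 𝓘(ℝ, Fin G.lieAlgebroid.rank → ℝ) 𝓘(ℝ, F) ∞
      (fun z => G.mul (e₁.arrow (G.src h) z) (G.inv h)) z := by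
  refine G.contMDiffAt_mul_const (e₁.contMDiffAt_arrow_comp (x := fun _ => G.src h) (y := id) h1
    contMDiffAt_const contMDiffAt_id) ?_
  filter_upwards [e₁.eventually_mem_target (x := fun _ => G.src h) (y := id) h1 continuousAt_const
    continuousAt_id] with z hz
  exact (e₁.src_arrow hz).trans (G.tgt_inv h).symm

theorem hasFDerivAt_transition {z : Fin G.lieAlgebroid.rank → ℝ}
    (h1 : (G.src h, z) ∈ e₁.chart.target)
    (h2 : G.mul (e₁.arrow (G.src h) z) (G.inv h) ∈ e₂.chart.source) :
    HasFDerivAt (transition e₁ e₂ h) (fderiv ℝ (transition e₁ e₂ h) z) z :=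
  (((e₂.contMDiffAt_fib h2).comp z (contMDiffAt_arrow_mul_inv h1)).contDiffAt.differentiableAt
    (by simp)).hasFDerivAt

/-- Right-invariant vector fields are preserved by right translations. -/
theorem fderiv_transition_dfib {k : 𝒢} (hs : G.src k = G.src h) (h1 : k ∈ e₁.chart.source)
    (h2 : G.mul k (G.inv h) ∈ e₂.chart.source) (β : Π x, G.lieFiber x) :
    e₂.dfib (G.mul k (G.inv h)) (G.rightInvariant β (G.mul k (G.inv h))) =
      fderiv ℝ (transition e₁ e₂ h) (e₁.fib k) (e₁.dfib k (G.rightInvariant β k)) := by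
  have hc : G.src k = G.tgt (G.inv h) := hs.trans (G.tgt_inv h).symm
  obtain ⟨l, hl, l0, ls, lv⟩ := G.exists_vertical_curve (g := k) (v := G.rightInvariant β k)
    (G.mfderiv_src_rightTranslation rfl _)
  have h3 := G.velocity_mul_of_rightTranslation (h := G.inv h) rfl hc hl l0 ls lv
  have h4 : ∀ y (_ : y = G.tgt (G.mul k (G.inv h))), G.rightTranslation (G.mul k (G.inv h)) y (β y) =
      G.rightInvariant β (G.mul k (G.inv h)) := by
    rintro _ rfl; rfl
  have h5 := h3.trans (h4 _ (G.tgt_mul k _ hc).symm)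
  have ht : (G.src h, e₁.fib k) ∈ e₁.chart.target := hs ▸ e₁.mem_target h1
  have hk : e₁.arrow (G.src h) (e₁.fib k) = k := hs ▸ e₁.arrow_fib h1
  have h6 := hasDerivAt_velocity (f := e₂.fib) (p := G.mul k (G.inv h))
    (γ := fun t => G.mul (l t) (G.inv h)) (by rw [l0])
    (G.contMDiffAt_mul_const hl (ls.mono fun t ht => ht.trans hc)).mdiffAt_of_infty
    (e₂.contMDiffAt_fib h2).mdiffAt_of_infty
  have h7 := hasDerivAt_velocity (f := e₁.fib) l0 hl.mdiffAt_of_infty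
    (e₁.contMDiffAt_fib h1).mdiffAt_of_infty
  have h8 := (hasFDerivAt_transition (e₂ := e₂) ht (by rwa [hk])).comp_hasDerivAt_of_eq (0 : ℝ) h7
    (by rw [l0])
  have h9 : (fun t => e₂.fib (G.mul (l t) (G.inv h))) =ᶠ[𝓝 0]
      (transition e₁ e₂ h ∘ fun t => e₁.fib (l t)) := by
    have hl' := hl.continuousAt
    filter_upwards [ls, hl'.eventually (e₁.chart.open_source.mem_nhds (l0.symm ▸ h1))] with t h h'
    change _ = e₂.fib (G.mul (e₁.arrow (G.src _) (e₁.fib (l t))) _)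
    rw [← hs, ← h, e₁.arrow_fib h']
  have h10 := h6.unique (h8.congr_of_eventuallyEq h9)
  refine (congrArg (fun v : F => (mfderiv 𝓘(ℝ, F) 𝓘(ℝ, Fin G.lieAlgebroid.rank → ℝ) e₂.fib
    (G.mul k (G.inv h)) : F →L[ℝ] (Fin G.lieAlgebroid.rank → ℝ)) v) h5.symm).trans (h10.trans ?_)
  exact congrArg (fun v : F => fderiv ℝ (transition e₁ e₂ h) (e₁.fib k)
    ((mfderiv 𝓘(ℝ, F) 𝓘(ℝ, Fin G.lieAlgebroid.rank → ℝ) e₁.fib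
    k : F →L[ℝ] (Fin G.lieAlgebroid.rank → ℝ)) v)) lv

/-- The Jacobians at `k` and at its right translate differ by the Jacobian of the right translation,
because right-invariant vector fields correspond to each other. -/
theorem jac_mul_inv {k : 𝒢} (hs : G.src k = G.src h) (h1 : k ∈ e₁.chart.source)
    (h2 : G.mul k (G.inv h) ∈ e₂.chart.source)
    (α : Fin G.lieAlgebroid.rank → Π x, G.lieFiber x) :
    e₂.jac α (G.mul k (G.inv h)) =
      (fderiv ℝ (transition e₁ e₂ h) (e₁.fib k)).det * e₁.jac α k := by
  unfold jac
  rw [ContinuousLinearMap.det, ← Basis.det_comp]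
  congr 1
  ext1 i
  exact fderiv_transition_dfib hs h1 h2 (α i)

open Classical in
/-- A function on `𝒢` in the fibre coordinates of the source fibre over `x`, extended by zero. -/
def ext (P : 𝒢 → ℝ) (x : M) (z : Fin G.lieAlgebroid.rank → ℝ) : ℝ :=
  if (x, z) ∈ e.chart.target then P (e.arrow x z) else 0

theorem ext_of_mem (P : 𝒢 → ℝ) {x : M} {z} (h : (x, z) ∈ e.chart.target) :
    e.ext P x z = P (e.arrow x z) := if_pos h

theorem ext_of_notMem (P : 𝒢 → ℝ) {x : M} {z} (h : (x, z) ∉ e.chart.target) :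
    e.ext P x z = 0 := if_neg h

theorem ext_eq_zero {P : 𝒢 → ℝ} {x : M} {z}
    (h : (x, z) ∈ e.chart.target → P (e.arrow x z) = 0) : e.ext P x z = 0 := by
  by_cases hz : (x, z) ∈ e.chart.target
  · rw [e.ext_of_mem P hz, h hz]
  · exact e.ext_of_notMem P hz

/-- The integrals along the source fibres with respect to the density that takes the value one on
the right-invariant frame of `α` are invariant under right translations. -/
theorem integral_ext_eq (e₁ e₂ : G.SourceChart) (h : 𝒢)
    (α : Fin G.lieAlgebroid.rank → Π x, G.lieFiber x) (P : 𝒢 → ℝ)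
    (hP : ∀ k, G.src k = G.src h → P k ≠ 0 → k ∈ e₁.chart.source ∧
      G.mul k (G.inv h) ∈ e₂.chart.source ∧ LinearIndependent ℝ fun i => α i (G.tgt k)) :
    ∫ z, e₁.ext (fun k => P k / |e₁.jac α k|) (G.src h) z =
      ∫ z, e₂.ext (fun g => P (G.mul g h) / |e₂.jac α g|) (G.tgt h) z := by
  -- the change of variables is the right translation by the inverse of `h`, on the set `S` on
  -- which it is defined in the two charts; both integrands vanish off `S` and its image
  let S : Set (Fin G.lieAlgebroid.rank → ℝ) := {z | (G.src h, z) ∈ e₁.chart.target ∧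
    G.mul (e₁.arrow (G.src h) z) (G.inv h) ∈ e₂.chart.source}
  have hSo : IsOpen S := by
    refine isOpen_iff_eventually.2 fun z hz => ?_
    filter_upwards [e₁.eventually_mem_target (x := fun _ => G.src h) (y := id) hz.1
      continuousAt_const continuousAt_id, (contMDiffAt_arrow_mul_inv hz.1).continuousAt.eventually
      (e₂.chart.open_source.mem_nhds hz.2)] with z h1 h2 using ⟨h1, h2⟩
  have hsrc : ∀ {z}, (G.src h, z) ∈ e₁.chart.target →
      G.src (e₁.arrow (G.src h) z) = G.tgt (G.inv h) := fun hz =>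
    (e₁.src_arrow hz).trans (G.tgt_inv h).symm
  have harr : ∀ z ∈ S, e₂.arrow (G.tgt h) (transition e₁ e₂ h z) =
      G.mul (e₁.arrow (G.src h) z) (G.inv h) := by
    intro z hz
    have h1 := e₂.arrow_fib hz.2
    rwa [G.src_mul _ _ (hsrc hz.1), G.src_inv] at h1
  have hmem : ∀ z ∈ S, (G.tgt h, transition e₁ e₂ h z) ∈ e₂.chart.target := by
    intro z hz
    have h1 := e₂.mem_target hz.2
    rwa [G.src_mul _ _ (hsrc hz.1), G.src_inv] at h1
  have hback : ∀ z ∈ S, G.mul (G.mul (e₁.arrow (G.src h) z) (G.inv h)) h = e₁.arrow (G.src h) z :=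
    fun z hz => G.inv_mul_cancel_right (e₁.src_arrow hz.1)
  have hinj : Set.InjOn (transition e₁ e₂ h) S := by
    intro z hz z' hz' hzz
    have h1 : e₁.arrow (G.src h) z = e₁.arrow (G.src h) z' := by
      rw [← hback z hz, ← hback z' hz', ← harr z hz, ← harr z' hz', hzz]
    rw [← e₁.fib_arrow hz.1, h1, e₁.fib_arrow hz'.1]
  have h1 : ∀ z ∉ S, e₁.ext (fun k => P k / |e₁.jac α k|) (G.src h) z = 0 := by
    intro z hz
    refine e₁.ext_eq_zero fun hz1 => ?_
    by_cases hp : P (e₁.arrow (G.src h) z) = 0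
    · simp [hp]
    · exact absurd ⟨hz1, (hP _ (e₁.src_arrow hz1) hp).2.1⟩ hz
  have h2 : ∀ w ∉ transition e₁ e₂ h '' S,
      e₂.ext (fun g => P (G.mul g h) / |e₂.jac α g|) (G.tgt h) w = 0 := by
    intro w hw
    refine e₂.ext_eq_zero fun hw1 => ?_
    by_cases hp : P (G.mul (e₂.arrow (G.tgt h) w) h) = 0
    · simp [hp]
    · have hs := e₂.src_arrow hw1
      obtain ⟨h3, h4, -⟩ := hP _ (G.src_mul _ _ hs) hp
      have h5 : e₁.arrow (G.src h) (e₁.fib (G.mul (e₂.arrow (G.tgt h) w) h)) =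
          G.mul (e₂.arrow (G.tgt h) w) h := by
        have := e₁.arrow_fib h3
        rwa [G.src_mul _ _ hs] at this
      refine absurd ⟨e₁.fib (G.mul (e₂.arrow (G.tgt h) w) h), ⟨?_, ?_⟩, ?_⟩ hw
      · have := e₁.mem_target h3
        rwa [G.src_mul _ _ hs] at this
      · rwa [h5]
      · rw [transition, h5, G.mul_inv_cancel_right hs, e₂.fib_arrow hw1]
  rw [← MeasureTheory.setIntegral_eq_integral_of_forall_compl_eq_zero h1,
    ← MeasureTheory.setIntegral_eq_integral_of_forall_compl_eq_zero h2,
    MeasureTheory.integral_image_eq_integral_abs_det_fderiv_smul MeasureTheory.volume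
      hSo.measurableSet (fun z hz => (hasFDerivAt_transition hz.1 hz.2).hasFDerivWithinAt) hinj]
  refine MeasureTheory.setIntegral_congr_fun hSo.measurableSet fun z hz => ?_
  have h3 := jac_mul_inv (e₁ := e₁) (e₂ := e₂) (e₁.src_arrow hz.1) (e₁.chart.map_target hz.1) hz.2 α
  rw [e₁.fib_arrow hz.1] at h3
  simp only [e₁.ext_of_mem _ hz.1, e₂.ext_of_mem _ (hmem z hz), harr z hz, hback z hz, smul_eq_mul]
  by_cases hp : P (e₁.arrow (G.src h) z) = 0
  · simp [hp]
  · have h4 := e₂.jac_ne_zero (α := α) hz.2 (by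
      rw [G.tgt_mul _ _ (hsrc hz.1)]; exact (hP _ (e₁.src_arrow hz.1) hp).2.2)
    rw [h3] at h4 ⊢
    rw [abs_mul]
    have h5 := abs_ne_zero.2 (left_ne_zero_of_mul h4)
    field_simp

end LieGroupoid.SourceChart

end FibreIntegrals

/-! ### Smoothness of the integrals over the source fibres -/

noncomputable section FibreIntegralRegularity

universe u v w z

variable {E : Type u} [NormedAddCommGroup E] [NormedSpace ℝ E]
  {M : Type v} [TopologicalSpace M] [ChartedSpace E M] [IsManifold 𝓘(ℝ, E) ∞ M]
  {F : Type w} [NormedAddCommGroup F] [NormedSpace ℝ F] [FiniteDimensional ℝ F]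
  {𝒢 : Type z} [TopologicalSpace 𝒢] [ChartedSpace F 𝒢] [IsManifold 𝓘(ℝ, F) ∞ 𝒢]

namespace LieGroupoid.SourceChart

variable {G : LieGroupoid E M F 𝒢} (e : G.SourceChart)

theorem mem_image_of_ext_ne_zero {Q : 𝒢 → ℝ} {C : Set 𝒢} {x : M}
    (hQ : ∀ k, G.src k = x → Q k ≠ 0 → k ∈ C) {z : Fin G.lieAlgebroid.rank → ℝ}
    (hz : e.ext Q x z ≠ 0) : (x, z) ∈ e.chart '' C := by
  by_cases h : (x, z) ∈ e.chart.target
  · rw [e.ext_of_mem _ h] at hz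
    exact ⟨_, hQ _ (e.src_arrow h) hz, e.chart.right_inv h⟩
  · exact absurd (e.ext_of_notMem Q h) hz

theorem isCompact_image_chart {C : Set 𝒢} (hC : IsCompact C) (hCe : C ⊆ e.chart.source) :
    IsCompact (e.chart '' C) :=
  hC.image_of_continuousOn (e.chart.continuousOn.mono hCe)

theorem notMem_image_chart {C : Set 𝒢} (hCe : C ⊆ e.chart.source) {p}
    (hp : p ∉ e.chart.target) : p ∉ e.chart '' C := by
  rintro ⟨k, hk, rfl⟩
  exact hp (e.chart.map_source (hCe hk))

variable [T2Space M]

theorem continuous_ext {Q : 𝒢 → ℝ} {C : Set 𝒢} {x : M} (hC : IsCompact C)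
    (hCe : C ⊆ e.chart.source) (hQC : ∀ k, G.src k = x → Q k ≠ 0 → k ∈ C)
    (hQ : ∀ z, (x, z) ∈ e.chart.target → ContinuousAt (fun z => Q (e.arrow x z)) z) :
    Continuous (e.ext Q x) := by
  refine continuous_iff_continuousAt.2 fun z => ?_
  by_cases hz : (x, z) ∈ e.chart.target
  · refine (hQ z hz).congr ?_
    filter_upwards [e.eventually_mem_target (x := fun _ => x) (y := id) hz
      continuousAt_const continuousAt_id] with z' hz'
    exact (e.ext_of_mem _ hz').symm
  · refine (continuousAt_const (y := (0 : ℝ))).congr ?_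
    have h1 := (e.isCompact_image_chart hC hCe).isClosed.isOpen_compl.mem_nhds
      (e.notMem_image_chart hCe hz)
    filter_upwards [(Continuous.prodMk_right x).continuousAt.eventually h1] with z' hz'
    by_contra h
    exact hz' (e.mem_image_of_ext_ne_zero hQC (Ne.symm h))

theorem hasCompactSupport_ext {Q : 𝒢 → ℝ} {C : Set 𝒢} {x : M} (hC : IsCompact C)
    (hCe : C ⊆ e.chart.source) (hQC : ∀ k, G.src k = x → Q k ≠ 0 → k ∈ C) :
    HasCompactSupport (e.ext Q x) := by
  refine HasCompactSupport.intro ((e.isCompact_image_chart hC hCe).image continuous_snd)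
    fun z hz => ?_
  by_contra h
  exact hz ⟨_, e.mem_image_of_ext_ne_zero hQC h, rfl⟩

/-- The extension by zero of a smooth function with support in a compact subset of the chart is
smooth, also along the boundary of the chart. -/
theorem contMDiffAt_ext {Q : 𝒢 → ℝ} {C : Set 𝒢} {V : Set M} (hV : IsOpen V) (hC : IsCompact C)
    (hCe : C ⊆ e.chart.source) (hQC : ∀ k, G.src k ∈ V → Q k ≠ 0 → k ∈ C)
    (hQ : ContMDiff 𝓘(ℝ, F) 𝓘(ℝ, ℝ) ∞ Q) {p : M × (Fin G.lieAlgebroid.rank → ℝ)}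
    (hp : p.1 ∈ V) :
    ContMDiffAt (𝓘(ℝ, E).prod 𝓘(ℝ, Fin G.lieAlgebroid.rank → ℝ)) 𝓘(ℝ, ℝ) ∞
      (fun p : M × (Fin G.lieAlgebroid.rank → ℝ) => e.ext Q p.1 p.2) p := by
  by_cases hz : p ∈ e.chart.target
  · refine (hQ.contMDiffAt.comp p (e.contMDiffAt_arrow hz)).congr_of_eventuallyEq ?_
    filter_upwards [e.chart.open_target.mem_nhds hz] with p' hp'
    exact e.ext_of_mem _ hp'
  · refine (contMDiffAt_const (c := (0 : ℝ))).congr_of_eventuallyEq ?_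
    filter_upwards [(e.isCompact_image_chart hC hCe).isClosed.isOpen_compl.mem_nhds
      (e.notMem_image_chart hCe hz), continuousAt_fst.eventually (hV.mem_nhds hp)] with p' hp' hpV
    by_contra h
    exact hp' (e.mem_image_of_ext_ne_zero (fun k hk => hQC k (hk ▸ hpV)) h)

/-- The integrals of a smooth function over the source fibres depend smoothly on the base point. -/
theorem contMDiffAt_integral_ext {Q : 𝒢 → ℝ} {C : Set 𝒢} {V : Set M} (hV : IsOpen V)
    (hC : IsCompact C) (hCe : C ⊆ e.chart.source) (hQC : ∀ k, G.src k ∈ V → Q k ≠ 0 → k ∈ C)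
    (hQ : ContMDiff 𝓘(ℝ, F) 𝓘(ℝ, ℝ) ∞ Q) {x : M} (hx : x ∈ V) :
    ContMDiffAt 𝓘(ℝ, E) 𝓘(ℝ, ℝ) ∞ (fun x => ∫ z, e.ext Q x z) x := by
  let φ := extChartAt 𝓘(ℝ, E) x
  let s : Set E := φ.target ∩ φ.symm ⁻¹' V
  have hs : IsOpen s := (continuousOn_extChartAt_symm x).isOpen_inter_preimage
    (isOpen_extChartAt_target x) hV
  let K := Prod.snd '' (e.chart '' C)
  have hK : IsCompact K := (e.isCompact_image_chart hC hCe).image continuous_snd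
  have h1 : ContDiffOn ℝ ∞ (fun p : E × (Fin G.lieAlgebroid.rank → ℝ) =>
      e.ext Q (φ.symm p.1) p.2) (s ×ˢ Set.univ) := by
    intro p hp
    have h2 : ContMDiffAt 𝓘(ℝ, E) 𝓘(ℝ, E) ∞ φ.symm p.1 :=
      (contMDiffOn_extChartAt_symm x).contMDiffAt
        ((isOpen_extChartAt_target x).mem_nhds hp.1.1)
    have h3 : ContMDiffAt 𝓘(ℝ, E × (Fin G.lieAlgebroid.rank → ℝ))
        (𝓘(ℝ, E).prod 𝓘(ℝ, Fin G.lieAlgebroid.rank → ℝ)) ∞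
        (fun p : E × (Fin G.lieAlgebroid.rank → ℝ) => (φ.symm p.1, p.2)) p :=
      (h2.comp p contDiff_fst.contMDiff.contMDiffAt).prodMk contDiff_snd.contMDiff.contMDiffAt
    exact ((e.contMDiffAt_ext hV hC hCe hQC hQ (p := (φ.symm p.1, p.2)) hp.1.2).comp p
      h3).contDiffAt.contDiffWithinAt
  -- differentiation under the integral sign: the integral is the value at `0` of the
  -- convolution with the constant function `1`
  have h2 := MeasureTheory.contDiffOn_convolution_left_with_param_comp (n := ⊤) (μ := MeasureTheory.volume)
    (ContinuousLinearMap.mul ℝ ℝ) (v := fun _ : E => (0 : Fin G.lieAlgebroid.rank → ℝ))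
    contDiffOn_const (f := fun _ : Fin G.lieAlgebroid.rank → ℝ => (1 : ℝ))
    (g := fun p z => e.ext Q (φ.symm p) z) hs hK ?_ ?_ h1
  · have h3 : ContDiffAt ℝ ∞ (fun p => ∫ z, e.ext Q (φ.symm p) z) (φ x) := by
      refine (h2.contDiffAt (hs.mem_nhds ⟨mem_extChartAt_target x, ?_⟩)).congr_of_eventuallyEq
        (Filter.Eventually.of_forall fun p => ?_)
      · change φ.symm (φ x) ∈ V
        rwa [extChartAt_to_inv]
      · simp [MeasureTheory.convolution]
    refine (h3.contMDiffAt.comp x contMDiffAt_extChartAt).congr_of_eventuallyEq ?_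
    filter_upwards [extChartAt_source_mem_nhds (I := 𝓘(ℝ, E)) x] with x' hx'
    change _ = ∫ z, e.ext Q (φ.symm (φ x')) z
    rw [φ.left_inv hx']
  · intro p z hp hz
    by_contra h
    exact hz ⟨_, e.mem_image_of_ext_ne_zero (fun k hk => hQC k (hk ▸ hp.2)) h, rfl⟩
  · exact MeasureTheory.locallyIntegrable_const 1

end LieGroupoid.SourceChart

end FibreIntegralRegularity

/-! ### Averaging over the source fibres -/

noncomputable section Averaging

universe u v w z

variable {E : Type u} [NormedAddCommGroup E] [NormedSpace ℝ E]
  {M : Type v} [TopologicalSpace M] [ChartedSpace E M] [IsManifold 𝓘(ℝ, E) ∞ M]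
  {F : Type w} [NormedAddCommGroup F] [NormedSpace ℝ F] [FiniteDimensional ℝ F]
  {𝒢 : Type z} [TopologicalSpace 𝒢] [ChartedSpace F 𝒢] [IsManifold 𝓘(ℝ, F) ∞ 𝒢]

namespace LieGroupoid

variable (G : LieGroupoid E M F 𝒢)

/-- A smooth partition of unity on `𝒢` that is subordinate to a family of source charts. -/
structure ChartPartition (ι : Type*) where
  chart : ι → G.SourceChart
  weight : SmoothPartitionOfUnity ι 𝓘(ℝ, F) 𝒢 Set.univ
  isSubordinate : weight.IsSubordinate fun i => (chart i).chart.source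

/-- A smooth function `P` on `𝒢` that vanishes off the arrows with target in the compact set `T`,
together with a family `α` of smooth sections of the Lie algebroid that is a frame over `T`. -/
structure IsAveragable (α : Fin G.lieAlgebroid.rank → Π x, G.lieFiber x) (P : 𝒢 → ℝ)
    (T : Set M) : Prop where
  smooth_frame : ∀ i, G.lieAlgebroid.IsSmooth (α i)
  smooth : ContMDiff 𝓘(ℝ, F) 𝓘(ℝ, ℝ) ∞ P
  isCompact : IsCompact T
  linearIndependent : ∀ y ∈ T, LinearIndependent ℝ fun i => α i y
  tgt_mem : ∀ k, P k ≠ 0 → G.tgt k ∈ T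

variable {G}

namespace ChartPartition

variable {ι : Type*} (ρ : G.ChartPartition ι)
  (α : Fin G.lieAlgebroid.rank → Π x, G.lieFiber x) (P : 𝒢 → ℝ)

/-- The density of the `i`-th part of `P` in the fibre coordinates of the `i`-th chart. -/
def part (i : ι) (k : 𝒢) : ℝ := ρ.weight i k * P k / |(ρ.chart i).jac α k|

/-- The integral of `P` over the source fibre of `x`, with respect to the density that takes the
value one on the right-invariant frame of `α`. -/
def fibreIntegral (x : M) : ℝ := ∑ᶠ i, ∫ z, (ρ.chart i).ext (ρ.part α P i) x z

variable {ρ α P} {T : Set M}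

theorem exists_part_ne_zero {i : ι} {x : M}
    (h : ∫ z, (ρ.chart i).ext (ρ.part α P i) x z ≠ 0) :
    ∃ k, G.src k = x ∧ ρ.weight i k ≠ 0 ∧ P k ≠ 0 := by
  by_contra! hc
  refine h ?_
  have : (ρ.chart i).ext (ρ.part α P i) x = fun _ => 0 := by
    ext z
    refine (ρ.chart i).ext_eq_zero fun hz => ?_
    by_cases hw : ρ.weight i ((ρ.chart i).arrow x z) = 0
    · simp [part, hw]
    · simp [part, hc _ ((ρ.chart i).src_arrow hz) hw]
  simp [this]

theorem exists_ne_zero_of_fibreIntegral {x : M} (h : ρ.fibreIntegral α P x ≠ 0) :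
    ∃ k, G.src k = x ∧ P k ≠ 0 := by
  obtain ⟨i, hi⟩ := not_forall.1 fun h0 => h (finsum_eq_zero_of_forall_eq_zero h0)
  obtain ⟨k, h1, -, h2⟩ := exists_part_ne_zero hi
  exact ⟨k, h1, h2⟩

theorem part_ne_zero {i : ι} {k : 𝒢} (h : ρ.part α P i k ≠ 0) : ρ.weight i k ≠ 0 ∧ P k ≠ 0 := by
  constructor <;> (intro h0; exact h (by simp [part, h0]))

/-- The part of the domain of the `i`-th chart with source in `K` that meets the support. -/
def core (ρ : G.ChartPartition ι) (K T : Set M) (i : ι) : Set 𝒢 :=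
  tsupport (ρ.weight i) ∩ (fun g => (G.src g, G.tgt g)) ⁻¹' (K ×ˢ T)

theorem core_subset (ρ : G.ChartPartition ι) (K T : Set M) (i : ι) :
    ρ.core K T i ⊆ (ρ.chart i).chart.source := fun _ hk => ρ.isSubordinate i hk.1

variable (hG : IsProperMap fun g => (G.src g, G.tgt g))
include hG

theorem isCompact_core (ρ : G.ChartPartition ι) {K : Set M} (hK : IsCompact K) (hT : IsCompact T)
    (i : ι) : IsCompact (ρ.core K T i) :=
  (hG.isCompact_preimage (hK.prod hT)).inter_left (isClosed_tsupport _)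

theorem finite_weight_ne_zero (ρ : G.ChartPartition ι) {K : Set M} (hK : IsCompact K)
    (hT : IsCompact T) :
    {i | ∃ k, G.src k ∈ K ∧ G.tgt k ∈ T ∧ ρ.weight i k ≠ 0}.Finite := by
  refine (ρ.weight.locallyFinite.finite_nonempty_inter_compact
    (hG.isCompact_preimage (hK.prod hT))).subset ?_
  rintro i ⟨k, h1, h2, h3⟩
  exact ⟨k, h3, h1, h2⟩

variable (h : G.IsAveragable α P T)
include h

omit hG in
theorem mem_core {K : Set M} {i : ι} {k : 𝒢} (hk : G.src k ∈ K) (hP : ρ.part α P i k ≠ 0) :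
    k ∈ ρ.core K T i :=
  ⟨subset_tsupport _ (part_ne_zero hP).1, hk, h.tgt_mem k (part_ne_zero hP).2⟩

theorem fibreIntegral_eq_sum (ρ : G.ChartPartition ι) {K : Set M} (hK : IsCompact K) {x : M}
    (hx : x ∈ K) : ρ.fibreIntegral α P x =
      ∑ i ∈ (ρ.finite_weight_ne_zero hG hK h.isCompact).toFinset,
        ∫ z, (ρ.chart i).ext (ρ.part α P i) x z := by
  refine finsum_eq_sum_of_support_subset _ fun i hi => ?_
  obtain ⟨k, h1, h2, h3⟩ := exists_part_ne_zero hi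
  simpa using ⟨k, h1 ▸ hx, h.tgt_mem k h3, h2⟩

variable [T2Space M]

omit hG in
/-- The parts are smooth: the Jacobian in the denominator is smooth and nonzero, except at arrows
near which the numerator is zero. -/
theorem contMDiff_part (i : ι) : ContMDiff 𝓘(ℝ, F) 𝓘(ℝ, ℝ) ∞ (ρ.part α P i) := by
  intro k
  by_cases hk : k ∈ tsupport (ρ.weight i) ∧ G.tgt k ∈ T
  · have hs := ρ.isSubordinate i hk.1
    have h0 := (ρ.chart i).jac_ne_zero hs (h.linearIndependent _ hk.2)
    have h1 : ContMDiffAt 𝓘(ℝ, F) 𝓘(ℝ, ℝ) ∞ (fun k => |(ρ.chart i).jac α k|) k :=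
      (contDiffAt_abs (n := ⊤) h0).contMDiffAt.comp k
        ((ρ.chart i).contMDiffAt_jac h.smooth_frame hs)
    exact ((ρ.weight i).contMDiff.contMDiffAt.mul h.smooth.contMDiffAt).div₀ h1 (abs_ne_zero.2 h0)
  · refine (contMDiffAt_const (c := (0 : ℝ))).congr_of_eventuallyEq ?_
    rw [not_and_or] at hk
    rcases hk with hk | hk
    · filter_upwards [(isClosed_tsupport _).isOpen_compl.mem_nhds hk] with k' hk'
      simp [part, image_eq_zero_of_notMem_tsupport hk']
    · filter_upwards [G.contMDiff_tgt.continuous.continuousAt.eventually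
        (h.isCompact.isClosed.isOpen_compl.mem_nhds hk)] with k' hk'
      have : P k' = 0 := by_contra fun h0 => hk' (h.tgt_mem _ h0)
      simp [part, this]

/-- The parts of the fibre integral are integrals of continuous functions with compact support, also
when multiplied by a function that is continuous along the fibre. -/
theorem continuous_ext_mul_part {i : ι} {x : M} {u : 𝒢 → ℝ}
    (hu : ∀ z, (x, z) ∈ (ρ.chart i).chart.target →
      ContinuousAt (fun z => u ((ρ.chart i).arrow x z)) z) :
    Continuous ((ρ.chart i).ext (fun k => u k * ρ.part α P i k) x) ∧
      HasCompactSupport ((ρ.chart i).ext (fun k => u k * ρ.part α P i k) x) := by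
  have hc := ρ.isCompact_core hG (isCompact_singleton (x := x)) h.isCompact i
  have hm : ∀ k, G.src k = x → u k * ρ.part α P i k ≠ 0 → k ∈ ρ.core {x} T i :=
    fun k hk hne => mem_core h hk (right_ne_zero_of_mul hne)
  refine ⟨(ρ.chart i).continuous_ext hc (ρ.core_subset _ _ _) hm fun z hz => ?_,
    (ρ.chart i).hasCompactSupport_ext hc (ρ.core_subset _ _ _) hm⟩
  exact (hu z hz).mul (ContinuousAt.comp (g := ρ.part α P i) (contMDiff_part h i).continuous.continuousAt
    ((ρ.chart i).contMDiffAt_arrow_comp (x := fun _ => x) (y := id) hz contMDiffAt_const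
      contMDiffAt_id).continuousAt)

omit h in
/-- The fibre integral is smooth: locally over `M` only finitely many charts contribute, because
`(s, t)` is proper and `P` has compact support in the direction of the target. -/
theorem contMDiff_fibreIntegral [FiniteDimensional ℝ E] (h : G.IsAveragable α P T)
    (ρ : G.ChartPartition ι) : ContMDiff 𝓘(ℝ, E) 𝓘(ℝ, ℝ) ∞ (ρ.fibreIntegral α P) := by
  intro x
  have : LocallyCompactSpace M := Manifold.locallyCompact_of_finiteDimensional 𝓘(ℝ, E)
  obtain ⟨K, hK, hx⟩ := exists_compact_mem_nhds x
  have h1 : ∀ i, ContMDiffAt 𝓘(ℝ, E) 𝓘(ℝ, ℝ) ∞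
      (fun x => ∫ z, (ρ.chart i).ext (ρ.part α P i) x z) x := fun i =>
    (ρ.chart i).contMDiffAt_integral_ext isOpen_interior (ρ.isCompact_core hG hK h.isCompact i)
      (ρ.core_subset _ _ _) (fun k hk hP => mem_core h (interior_subset hk) hP)
      (contMDiff_part h i) (mem_interior_iff_mem_nhds.2 hx)
  refine (ContMDiffAt.sum (t := (ρ.finite_weight_ne_zero hG hK h.isCompact).toFinset)
    fun i _ => h1 i).congr_of_eventuallyEq ?_
  filter_upwards [hx] with x' hx'
  exact ρ.fibreIntegral_eq_sum hG h hK hx'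

omit hG h in
theorem integral_part_nonneg (hP : ∀ k, 0 ≤ P k) (i : ι) (x : M) :
    0 ≤ ∫ z, (ρ.chart i).ext (ρ.part α P i) x z := by
  refine MeasureTheory.integral_nonneg fun z => ?_
  by_cases hz : (x, z) ∈ (ρ.chart i).chart.target
  · rw [(ρ.chart i).ext_of_mem _ hz]
    exact div_nonneg (mul_nonneg (ρ.weight.nonneg i _) (hP _)) (abs_nonneg _)
  · exact ((ρ.chart i).ext_of_notMem _ hz).ge

omit hG h in
theorem fibreIntegral_nonneg (hP : ∀ k, 0 ≤ P k) (x : M) : 0 ≤ ρ.fibreIntegral α P x :=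
  finsum_nonneg fun i => integral_part_nonneg hP i x

/-- The average of a nonnegative function that does not vanish on a source fibre is positive. -/
theorem fibreIntegral_pos (hP : ∀ k, 0 ≤ P k) {k : 𝒢} (hk : P k ≠ 0) :
    0 < ρ.fibreIntegral α P (G.src k) := by
  obtain ⟨i, hi⟩ := ρ.weight.exists_pos_of_mem (Set.mem_univ k)
  have hs : k ∈ (ρ.chart i).chart.source := ρ.isSubordinate i (subset_tsupport _ hi.ne')
  refine finsum_pos (fun i => integral_part_nonneg hP i _) ⟨i, ?_⟩ ?_
  · have h1 := continuous_ext_mul_part (ρ := ρ) hG h (i := i) (x := G.src k) (u := fun _ => 1)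
      fun _ _ => continuousAt_const
    simp only [one_mul] at h1
    refine h1.1.integral_pos_of_hasCompactSupport_nonneg_nonzero h1.2 (x := (ρ.chart i).fib k) ?_ ?_
    · intro z
      change 0 ≤ (ρ.chart i).ext (ρ.part α P i) (G.src k) z
      by_cases hz : (G.src k, z) ∈ (ρ.chart i).chart.target
      · rw [(ρ.chart i).ext_of_mem _ hz]
        exact div_nonneg (mul_nonneg (ρ.weight.nonneg i _) (hP _)) (abs_nonneg _)
      · exact ((ρ.chart i).ext_of_notMem _ hz).ge
    · rw [(ρ.chart i).ext_of_mem _ ((ρ.chart i).mem_target hs), (ρ.chart i).arrow_fib hs]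
      exact div_ne_zero (mul_ne_zero hi.ne' hk) (abs_ne_zero.2
        ((ρ.chart i).jac_ne_zero hs (h.linearIndependent _ (h.tgt_mem k hk))))
  · refine (ρ.finite_weight_ne_zero hG (isCompact_singleton (x := G.src k)) h.isCompact).subset
      fun i hi => ?_
    obtain ⟨k, h1, h2, h3⟩ := exists_part_ne_zero hi
    exact ⟨k, h1, h.tgt_mem k h3, h2⟩

/-- The `i`-th part of the fibre integral over `src h`, split according to the partition of unity on
the source fibre over `tgt h`. -/
theorem integral_part_eq_sum (ρ : G.ChartPartition ι) (i : ι) (h' : 𝒢) :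
    ∫ z, (ρ.chart i).ext (ρ.part α P i) (G.src h') z =
      ∑ j ∈ (ρ.finite_weight_ne_zero hG (isCompact_singleton (x := G.tgt h')) h.isCompact).toFinset,
        ∫ z, (ρ.chart i).ext (fun k => ρ.weight j (G.mul k (G.inv h')) * ρ.part α P i k)
          (G.src h') z := by
  have h1 : ∀ j, Continuous ((ρ.chart i).ext
        (fun k => ρ.weight j (G.mul k (G.inv h')) * ρ.part α P i k) (G.src h')) ∧
      HasCompactSupport ((ρ.chart i).ext
        (fun k => ρ.weight j (G.mul k (G.inv h')) * ρ.part α P i k) (G.src h')) := fun j =>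
    continuous_ext_mul_part hG h fun z hz =>
      ContinuousAt.comp (g := ρ.weight j) (ρ.weight j).contMDiff.continuous.continuousAt
        (SourceChart.contMDiffAt_arrow_mul_inv hz).continuousAt
  rw [← MeasureTheory.integral_finsetSum _ fun j _ =>
    (h1 j).1.integrable_of_hasCompactSupport (h1 j).2]
  congr 1
  ext z
  by_cases hz : (G.src h', z) ∈ (ρ.chart i).chart.target
  · simp only [(ρ.chart i).ext_of_mem _ hz, ← Finset.sum_mul]
    by_cases hP : ρ.part α P i ((ρ.chart i).arrow (G.src h') z) = 0
    · simp [hP]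
    · have hs := ((ρ.chart i).src_arrow hz).trans (G.tgt_inv h').symm
      rw [← finsum_eq_sum_of_support_subset, ρ.weight.sum_eq_one (Set.mem_univ _), one_mul]
      intro j hj
      refine Set.Finite.mem_toFinset _ |>.2 ⟨_, ?_, ?_, hj⟩
      · rw [G.src_mul _ _ hs, G.src_inv]
        exact Set.mem_singleton _
      · rw [G.tgt_mul _ _ hs]
        exact h.tgt_mem _ (part_ne_zero hP).2
  · simp only [(ρ.chart i).ext_of_notMem _ hz, Finset.sum_const_zero]

/-- The fibre integrals are compatible with right translations. -/
theorem fibreIntegral_src {h' : 𝒢} {κ : ℝ}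
    (hκ : ∀ g, G.src g = G.tgt h' → P (G.mul g h') = κ * P g) :
    ρ.fibreIntegral α P (G.src h') = κ * ρ.fibreIntegral α P (G.tgt h') := by
  rw [ρ.fibreIntegral_eq_sum hG h isCompact_singleton (Set.mem_singleton (G.src h')),
    ρ.fibreIntegral_eq_sum hG h isCompact_singleton (Set.mem_singleton (G.tgt h')),
    Finset.sum_congr rfl fun i _ => ρ.integral_part_eq_sum hG h i h', Finset.mul_sum,
    Finset.sum_comm]
  refine Finset.sum_congr rfl fun j _ => ?_
  -- both sides are split according to the charts on both fibres, and compared term by term by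
  -- the change of variables
  have h1 := ρ.integral_part_eq_sum hG h j (G.inv h')
  simp only [G.src_inv, G.tgt_inv, G.inv_inv] at h1
  rw [h1, Finset.mul_sum]
  refine Finset.sum_congr rfl fun i _ => ?_
  have h2 := SourceChart.integral_ext_eq (ρ.chart i) (ρ.chart j) h' α
    (fun k => ρ.weight j (G.mul k (G.inv h')) * (ρ.weight i k * P k)) fun k hk hne =>
      ⟨ρ.isSubordinate i (subset_tsupport _ (left_ne_zero_of_mul (right_ne_zero_of_mul hne))),
        ρ.isSubordinate j (subset_tsupport _ (left_ne_zero_of_mul hne)),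
        h.linearIndependent _ (h.tgt_mem k (right_ne_zero_of_mul (right_ne_zero_of_mul hne)))⟩
  simp only [part, ← mul_div_assoc] at h2 ⊢
  rw [h2, ← MeasureTheory.integral_const_mul]
  congr 1
  ext z
  by_cases hz : (G.tgt h', z) ∈ (ρ.chart j).chart.target
  · have hs := (ρ.chart j).src_arrow hz
    simp only [(ρ.chart j).ext_of_mem _ hz, G.mul_inv_cancel_right hs, hκ _ hs]
    ring
  · simp only [(ρ.chart j).ext_of_notMem _ hz, mul_zero]

end ChartPartition

end LieGroupoid

end Averaging

/-! ### Cocycles of proper Lie groupoids -/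

noncomputable section ProperGroupoids

universe u v w z

variable {E : Type u} [NormedAddCommGroup E] [NormedSpace ℝ E] [FiniteDimensional ℝ E]
  {M : Type v} [TopologicalSpace M] [ChartedSpace E M] [IsManifold 𝓘(ℝ, E) ∞ M] [T2Space M]
  {F : Type w} [NormedAddCommGroup F] [NormedSpace ℝ F] [FiniteDimensional ℝ F]
  {𝒢 : Type z} [TopologicalSpace 𝒢] [ChartedSpace F 𝒢] [IsManifold 𝓘(ℝ, F) ∞ 𝒢]

namespace LieGroupoid

variable (G : LieGroupoid E M F 𝒢)

/-- A nonnegative smooth function `φ` on `M` with `φ (s(h)) = exp (c(h)) φ (t(h))`. -/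
structure IsEquivariant (c : 𝒢 → ℝ) (φ : M → ℝ) : Prop where
  smooth : IsSmoothFun (E := E) φ
  nonneg : ∀ x, 0 ≤ φ x
  src_eq : ∀ h, φ (G.src h) = Real.exp (c h) * φ (G.tgt h)

variable {G}

theorem IsEquivariant.src_pos {c : 𝒢 → ℝ} {φ : M → ℝ} (h : G.IsEquivariant c φ) {g : 𝒢}
    (hg : 0 < φ (G.tgt g)) : 0 < φ (G.src g) := by
  rw [h.src_eq]
  exact mul_pos (Real.exp_pos _) hg

theorem IsEquivariant.finsum {ι : Type*} {c : 𝒢 → ℝ} {φ : ι → M → ℝ}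
    (h : ∀ i, G.IsEquivariant c (φ i)) (hφ : LocallyFinite fun i => Function.support (φ i)) :
    G.IsEquivariant c fun x => ∑ᶠ i, φ i x where
  smooth := contMDiff_finsum (fun i => (h i).smooth) hφ
  nonneg x := finsum_nonneg fun i => (h i).nonneg x
  src_eq g := by
    rw [← smul_eq_mul, smul_finsum]
    exact finsum_congr fun i => (h i).src_eq g

variable (G)

/-- The union of the orbits that meet `A`. -/
def saturation (A : Set M) : Set M := G.src '' (G.tgt ⁻¹' A)

variable {G}

theorem subset_saturation (A : Set M) : A ⊆ G.saturation A := fun x hx =>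
  ⟨G.unit x, by rwa [Set.mem_preimage, G.tgt_unit], G.src_unit x⟩

theorem saturation_mono {A B : Set M} (h : A ⊆ B) : G.saturation A ⊆ G.saturation B :=
  Set.image_mono (Set.preimage_mono h)

theorem src_mem_saturation {A : Set M} {g : 𝒢} (h : G.tgt g ∈ G.saturation A) :
    G.src g ∈ G.saturation A := by
  obtain ⟨k, hk, hkg⟩ := h
  exact ⟨G.mul k g, by rwa [Set.mem_preimage, G.tgt_mul _ _ hkg], G.src_mul _ _ hkg⟩

theorem tgt_mem_saturation {A : Set M} {g : 𝒢} (h : G.src g ∈ G.saturation A) :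
    G.tgt g ∈ G.saturation A := by
  rw [← G.src_inv]
  exact src_mem_saturation (by rwa [G.tgt_inv])

/-- The source map has local sections, so saturations of open sets are open. -/
theorem isOpen_saturation {A : Set M} (hA : IsOpen A) : IsOpen (G.saturation A) := by
  rw [isOpen_iff_eventually]
  rintro _ ⟨g, hg, rfl⟩
  obtain ⟨e, he⟩ := G.exists_sourceChart g
  have hm := e.mem_target he
  have h1 := (e.contMDiffAt_arrow_comp (x := id) (y := fun _ => e.fib g) (n := G.src g) hm
    contMDiffAt_id contMDiffAt_const).continuousAt
  have h2 := ContinuousAt.comp (g := G.tgt) G.contMDiff_tgt.continuous.continuousAt h1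
  filter_upwards [e.eventually_mem_target (x := id) (y := fun _ => e.fib g) hm continuousAt_id
    continuousAt_const, h2.eventually (hA.mem_nhds (by
      change G.tgt (e.arrow (G.src g) (e.fib g)) ∈ A
      rwa [e.arrow_fib he]))] with x hx hxA
  exact ⟨_, hxA, e.src_arrow hx⟩

/-- On a proper groupoid saturations of compact sets are closed. -/
theorem isClosed_saturation (hG : IsProperMap fun g => (G.src g, G.tgt g)) {K : Set M}
    (hK : IsCompact K) : IsClosed (G.saturation K) := by
  have : LocallyCompactSpace M := Manifold.locallyCompact_of_finiteDimensional 𝓘(ℝ, E)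
  refine isClosed_of_closure_subset fun x hx => ?_
  obtain ⟨C, hC, hxC⟩ := exists_compact_mem_nhds x
  have h1 : IsClosed (G.src '' ((fun g => (G.src g, G.tgt g)) ⁻¹' (C ×ˢ K))) :=
    ((hG.isCompact_preimage (hC.prod hK)).image G.contMDiff_src.continuous).isClosed
  have h2 : x ∈ closure (G.src '' ((fun g => (G.src g, G.tgt g)) ⁻¹' (C ×ˢ K))) := by
    rw [mem_closure_iff_frequently] at hx ⊢
    refine (hx.and_eventually hxC).mono ?_
    rintro _ ⟨⟨g, hg, rfl⟩, hgC⟩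
    exact ⟨g, ⟨hgC, hg⟩, rfl⟩
  rw [h1.closure_eq] at h2
  obtain ⟨g, hg, hgx⟩ := h2
  exact ⟨g, hg.2, hgx⟩

theorem nonempty_chartPartition [SecondCountableTopology M] (hG : G.IsProper) :
    Nonempty (G.ChartPartition 𝒢) := by
  have : LocallyCompactSpace M := Manifold.locallyCompact_of_finiteDimensional 𝓘(ℝ, E)
  have : T2Space 𝒢 := hG.1
  have : SigmaCompactSpace 𝒢 := by
    let K : CompactExhaustion M := default
    refine ⟨⟨fun n => (fun g => (G.src g, G.tgt g)) ⁻¹' (K n ×ˢ K n),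
      fun n => hG.2.isCompact_preimage ((K.isCompact n).prod (K.isCompact n)), ?_⟩⟩
    refine Set.eq_univ_of_forall fun g => Set.mem_iUnion.2 ?_
    obtain ⟨m, hm⟩ := K.exists_mem (G.src g)
    obtain ⟨n, hn⟩ := K.exists_mem (G.tgt g)
    exact ⟨max m n, K.subset (le_max_left _ _) hm, K.subset (le_max_right _ _) hn⟩
  choose e he using G.exists_sourceChart
  obtain ⟨ρ, hρ⟩ := SmoothPartitionOfUnity.exists_isSubordinate 𝓘(ℝ, F) (isClosed_univ (X := 𝒢))
    (fun g => (e g).chart.source) (fun g => (e g).chart.open_source)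
    fun g _ => Set.mem_iUnion.2 ⟨g, he g⟩
  exact ⟨⟨e, ρ, hρ⟩⟩

/-- A cutoff function near `y`, averaged along the source fibres with the weight `exp c`. -/
theorem exists_isEquivariant_pos [SecondCountableTopology M] (hG : G.IsProper) {c : 𝒢 → ℝ}
    (hc : c ∈ G.Z1) {y : M} {O : Set M} (hO : O ∈ 𝓝 y) :
    ∃ φ, G.IsEquivariant c φ ∧ 0 < φ y ∧ ∀ x, φ x ≠ 0 → x ∈ G.saturation O := by
  obtain ⟨ρ⟩ := nonempty_chartPartition hG
  obtain ⟨α, hα⟩ := G.exists_smooth_frame y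
  have h1 := G.eventually_lie_frame α (G.lieFrame y) hα
  obtain ⟨χ, -, hχ⟩ := (SmoothBumpFunction.nhds_basis_tsupport (I := 𝓘(ℝ, E)) y).mem_iff.1
    (Filter.inter_mem hO h1)
  let P : 𝒢 → ℝ := fun g => Real.exp (c g) * χ (G.tgt g)
  have hP : ∀ k, P k ≠ 0 → G.tgt k ∈ tsupport χ := fun k hk =>
    subset_tsupport _ (right_ne_zero_of_mul hk)
  have hP0 : ∀ k, 0 ≤ P k := fun k => mul_nonneg (Real.exp_pos _).le χ.nonneg
  have h2 : G.IsAveragable (fun i => (α i).1) P (tsupport χ) :=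
    { smooth_frame := fun i => (α i).2
      smooth := (Real.contDiff_exp.contMDiff.comp hc.1).mul (χ.contMDiff.comp G.contMDiff_tgt)
      isCompact := χ.hasCompactSupport
      linearIndependent := fun y hy => by
        obtain ⟨a, ha⟩ := (hχ hy).2
        rw [← ha]
        exact a.linearIndependent
      tgt_mem := hP }
  refine ⟨ρ.fibreIntegral (fun i => (α i).1) P,
    ⟨ρ.contMDiff_fibreIntegral hG.2 h2, ChartPartition.fibreIntegral_nonneg hP0, fun h =>
      ChartPartition.fibreIntegral_src hG.2 h2 fun g hg => ?_⟩, ?_, fun x hx => ?_⟩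
  · change Real.exp (c (G.mul g h)) * χ (G.tgt (G.mul g h)) = _ * (Real.exp (c g) * _)
    rw [hc.2 g h hg, G.tgt_mul g h hg, Real.exp_add]
    ring
  · have h3 := ChartPartition.fibreIntegral_pos (ρ := ρ) hG.2 h2 hP0 (k := G.unit y) (by
      refine mul_ne_zero (Real.exp_pos _).ne' ?_
      rw [G.tgt_unit, χ.eq_one]
      exact one_ne_zero)
    rwa [G.src_unit] at h3
  · obtain ⟨k, hk, hk0⟩ := ChartPartition.exists_ne_zero_of_fibreIntegral hx
    exact ⟨k, (hχ (hP k hk0)).1, hk⟩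

/-- There is an equivariant function that is positive on a compact set and vanishes on a closed
invariant set that is disjoint from it. -/
theorem exists_isEquivariant_pos_on [SecondCountableTopology M] (hG : G.IsProper) {c : 𝒢 → ℝ}
    (hc : c ∈ G.Z1) {L Z : Set M} (hL : IsCompact L) (hZ : IsClosed Z)
    (hZs : ∀ g, G.src g ∈ Z → G.tgt g ∈ Z) (hLZ : Disjoint L Z) :
    ∃ φ, G.IsEquivariant c φ ∧ (∀ x ∈ L, 0 < φ x) ∧ ∀ x ∈ Z, φ x = 0 := by
  have hO : ∀ y : L, Zᶜ ∈ 𝓝 (y : M) := fun y =>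
    hZ.isOpen_compl.mem_nhds (Set.disjoint_left.1 hLZ y.2)
  choose φ h1 h2 h3 using fun y : L => exists_isEquivariant_pos hG hc (hO y)
  obtain ⟨t, ht⟩ := hL.elim_nhds_subcover' (fun y hy => {x | 0 < φ ⟨y, hy⟩ x}) fun y hy =>
    (h1 ⟨y, hy⟩).smooth.continuous.continuousAt.eventually (lt_mem_nhds (h2 ⟨y, hy⟩))
  refine ⟨fun x => ∑ᶠ y : t, φ y x, IsEquivariant.finsum (fun y => h1 _)
    (locallyFinite_of_finite _), fun x hx => ?_, fun x hx => ?_⟩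
  · obtain ⟨y, hy, hxy⟩ := Set.mem_iUnion₂.1 (ht hx)
    exact finsum_pos (fun y => (h1 _).nonneg x) ⟨⟨y, hy⟩, hxy⟩ (Set.toFinite _)
  · refine finsum_eq_zero_of_forall_eq_zero fun y => ?_
    by_contra h0
    obtain ⟨g, hg, rfl⟩ := h3 _ _ h0
    exact hg (hZs g hx)

/-- On a proper groupoid every cocycle is the logarithm of the ratio of the values of a positive
equivariant function. -/
theorem exists_isEquivariant_forall_pos [SecondCountableTopology M] (hG : G.IsProper) {c : 𝒢 → ℝ}
    (hc : c ∈ G.Z1) : ∃ φ, G.IsEquivariant c φ ∧ ∀ x, 0 < φ x := by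
  have : LocallyCompactSpace M := Manifold.locallyCompact_of_finiteDimensional 𝓘(ℝ, E)
  -- an exhaustion that starts with `K 0 = ∅`, so that truncated subtraction in `K (n - 1)` is
  -- harmless
  let K : CompactExhaustion M := CompactExhaustion.shiftr default
  let W : ℕ → Set M := fun n => G.saturation (interior (K n))
  have hW : ∀ n, IsOpen (W n) := fun n => isOpen_saturation isOpen_interior
  have hW0 : W 0 = ∅ := by
    change G.src '' (G.tgt ⁻¹' interior ∅) = ∅
    simp
  have hKW : ∀ n, G.saturation (K (n - 1)) ⊆ W n := by
    rintro (_ | n)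
    · change G.src '' (G.tgt ⁻¹' ∅) ⊆ _
      simp
    · exact saturation_mono (K.subset_interior_succ n)
  have hex : ∀ x, ∃ n, x ∈ W n := fun x => by
    obtain ⟨n, hn⟩ := K.exists_mem x
    exact ⟨n + 1, hKW _ (subset_saturation _ hn)⟩
  -- `φ n` is positive on the part of `K (n + 1)` outside of the open invariant set `W n`, and
  -- vanishes on the saturation of `K (n - 1)`; hence the supports are locally finite
  choose φ h1 h2 h3 using fun n => exists_isEquivariant_pos_on hG hc
    ((K.isCompact (n + 1)).diff (hW n)) (isClosed_saturation hG.2 (K.isCompact (n - 1)))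
    (fun g => tgt_mem_saturation)
    (Set.disjoint_left.2 fun x hx hx' => hx.2 (hKW n hx'))
  have hlf : LocallyFinite fun n => Function.support (φ n) := by
    intro x
    obtain ⟨N, hN⟩ := hex x
    refine ⟨W N, (hW N).mem_nhds hN, (Set.finite_le_nat N).subset ?_⟩
    rintro n ⟨x', hx', hx'N⟩
    by_contra hn
    have hn : N < n := not_le.1 hn
    exact hx' (h3 n x' (saturation_mono (interior_subset.trans (K.subset (by omega))) hx'N))
  refine ⟨_, IsEquivariant.finsum h1 hlf, fun x => ?_⟩
  refine finsum_pos (fun n => (h1 n).nonneg x) ?_ (hlf.point_finite x)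
  classical
  -- `x` lies in `W (n + 1)` for a minimal `n`, so its orbit meets `K (n + 1)` outside of `W n`
  obtain ⟨n, hn⟩ : ∃ n, Nat.find (hex x) = n + 1 := Nat.exists_eq_succ_of_ne_zero fun h0 => by
    have := Nat.find_spec (hex x)
    rw [h0, hW0] at this
    exact this
  have hx := Nat.find_spec (hex x)
  have hx' := Nat.find_min (hex x) (m := n) (by omega)
  rw [hn] at hx
  obtain ⟨g, hg, rfl⟩ := hx
  exact ⟨n, (h1 n).src_pos (h2 n _ ⟨interior_subset hg, fun h => hx' (src_mem_saturation h)⟩)⟩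

variable (G)

/-- All cocycles of a proper groupoid are coboundaries: `c` is the coboundary of `log φ` for a
positive equivariant function `φ`. -/
theorem isUnimodular_of_isProper [SecondCountableTopology M] (hG : G.IsProper) :
    G.IsUnimodular := by
  obtain ⟨c, hc⟩ := Submodule.mkQ_surjective _ G.modularClass
  change G.modularClass = 0
  rw [← hc]
  obtain ⟨φ, h1, h2⟩ := exists_isEquivariant_forall_pos hG c.2
  refine (Submodule.Quotient.mk_eq_zero _).2 ?_
  refine ⟨fun x => Real.log (φ x), fun x => ?_, fun g => ?_⟩
  · exact ((Real.contDiffAt_log.2 (h2 x).ne').contMDiffAt).comp x h1.smooth.contMDiffAt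
  · change c.1 g = Real.log (φ (G.src g)) - Real.log (φ (G.tgt g))
    rw [h1.src_eq, Real.log_mul (Real.exp_pos _).ne' (h2 _).ne', Real.log_exp]
    ring

end LieGroupoid

end ProperGroupoids

theorem mainTheorem2
    {E : Type*} [NormedAddCommGroup E] [NormedSpace ℝ E] [FiniteDimensional ℝ E]
    {M : Type*} [TopologicalSpace M] [ChartedSpace E M] [IsManifold 𝓘(ℝ, E) ∞ M]
    [T2Space M] [SecondCountableTopology M]
    {F : Type*} [NormedAddCommGroup F] [NormedSpace ℝ F] [FiniteDimensional ℝ F]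
    {𝒢 : Type*} [TopologicalSpace 𝒢] [ChartedSpace F 𝒢] [IsManifold 𝓘(ℝ, F) ∞ 𝒢]
    (G : LieGroupoid E M F 𝒢) :
    -- the modular classes of `G` and of its Lie algebroid and the Van Est map are well defined
    (G.IsModularClass G.modularClass ∧
      G.lieAlgebroid.IsModularClass G.lieAlgebroid.modularClass ∧
      G.IsVanEst G.vanEst) ∧
    -- the Van Est map sends the modular class of `G` to the one of its Lie algebroid
    G.vanEst G.modularClass = G.lieAlgebroid.modularClass ∧
    -- if `G` is unimodular, the modular class of every Lie algebroid integrated by `G` vanishes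
    (G.IsUnimodular →
      ∀ {F' : Type*} [NormedAddCommGroup F'] [NormedSpace ℝ F'] [FiniteDimensional ℝ F']
        {A : M → Type*} [TopologicalSpace (Bundle.TotalSpace F' A)]
        [∀ x, TopologicalSpace (A x)] [∀ x, AddCommGroup (A x)] [∀ x, Module ℝ (A x)]
        [FiberBundle F' A] [VectorBundle ℝ F' A] [ContMDiffVectorBundle ∞ F' A 𝓘(ℝ, E)]
        (L : LieAlgebroid E M F' A), G.Integrates L.toData →
        L.toData.IsModularClass L.toData.modularClass ∧ L.toData.modularClass = 0) ∧
    -- proper Lie groupoids are unimodular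
    (G.IsProper → G.IsUnimodular) := by
  refine ⟨⟨G.isModularClass_modularClass, ?_, G.isVanEst_vanEst⟩, G.vanEst_modularClass, ?_, ?_⟩
  · exact G.lieAlgebroid_isModularClass.isModularClass_modularClass
  · intro hG F' _ _ _ A _ _ _ _ _ _ _ L hL
    exact LieGroupoid.IsUnimodular.modularClass_eq_zero G hG L.finrank_fiber hL
  · exact G.isUnimodular_of_isProper
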